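/- Let $k$ be an algebraically closed field of characteristic zero and let $S$ be a commutative monoid in the category of schemes over $k$, with unit $\epsilon$ and multiplication $\mu$, such that $S$ is locally of finite type over $k$ and $\mu$ is of finite type. **Conventions.** Let $G$ be an affine group scheme over $k$ and $B$ a $k$-scheme with $G$-action. $K_0^G(\mathrm{Var}/B)$ is the abelian group generated by isomorphism classes of $G$-equivariant morphisms of finite type $X\to B$, where $X$ is a reduced separated $k$-scheme with a good $G$-action (every point has a $G$-invariant affine open neighbourhood), modulo $[X\to B]=[Z\to B]+[X\setminus Z\to B]$ for $G$-invariant closed reduced subschemes $Z\subset X$. A *$\lambda$-ring* is a commutative ring $R$ with maps $\sigma^n:R\to R$ ($n\ge 0$) such that $\sigma_a(t)=\sum_n\sigma^n(a)t^n$ satisfies $\sigma_a(t)\equiv 1+at \bmod t^2$, $\sigma_0(t)=1$ and $\sigma_{a+b}(t)=\sigma_a(t)\sigma_b(t)$; homomorphisms are ring homomorphisms commuting with all $\sigma^n$. A *$\lambda$-ideal* is an ideal $I$ with $\sigma^n(I)\subset I$ for all $n\ge 1$. For $d\ge 0$ let $\mathbb G_m$ act on $\mathbb A^1_S=S\times_k\mathbb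 A^1_k$ by $g\cdot(u,z)=(u,g^dz)$, and trivially on $S$. $\mathbb A^1_S$ is a monoid by $\mu$ and addition. Write $K_0^{\mathbb G_m,d}(\mathrm{Var}/\mathbb A^1_S)$ for its group of equivariant motives and $K_0^{\mathbb G_m,d}(\mathrm{Var}/\mathrm{Gl}_S(1))$ for that of the complement $S\times_k\mathbb G_m$ of the zero section. Let $\mathfrak I_d$ be the image of the pullback $$K_0^{\mathbb G_m}(\mathrm{Var}/S)\to K_0^{\mathbb G_m,d}(\mathrm{Var}/\mathbb A^1_S),\qquad [Y\to S]\mapsto[Y\times_k\mathbb A^1_k\to S\times_k\mathbb A^1_k],$$ with $g\cdot(y,z)=(g\cdot y,g^dz)$. **Statement.** 1. For every $d\ge 0$ there is exactly one $\lambda$-ring structure on $K_0^{\mathbb G_m,d}(\mathrm{Var}/\mathbb A^1_S)$ with unit $[\mathrm{Spec}\,k\xrightarrow{(\epsilon,0)}\mathbb A^1_S]$, with the convolution product $[X]\cdot[Y]=[X\times_kY\to\mathbb A^1_S\times_k\mathbb A^1_S\to\mathbb A^1_S]$, and with $\sigma^n[X]=[\mathrm{Sym}^nX\to\mathbb A^1_S]$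 whenever the quotient $\mathrm{Sym}^nX=X^n/S_n$ exists as a scheme with affine quotient map and is an equivariant variety over $\mathbb A^1_S$ as above. 2. For every $d\ge0$ the pullback is injective, so that $\mathfrak I_d\cong K_0^{\mathbb G_m}(\mathrm{Var}/S)$, and $\mathfrak I_d$ is a $\lambda$-ideal. 3. For every $d\ge 0$ the push-forward $K_0^{\mathbb G_m,d}(\mathrm{Var}/\mathrm{Gl}_S(1))\to K_0^{\mathbb G_m,d}(\mathrm{Var}/\mathbb A^1_S)$ is injective and its image is a complement of $\mathfrak I_d$. There is exactly one $\lambda$-ring structure on $K_0^{\mathbb G_m,d}(\mathrm{Var}/\mathrm{Gl}_S(1))$ for which the projection $\mathrm{pr}_d$ along $\mathfrak I_d$ is a homomorphism of $\lambda$-rings. 4. For every $d\ge1$, taking the (reduced) fibre over the unit section defines a unique isomorphism of groups $\varphi_d:K_0^{\mathbb G_m,d}(\mathrm{Var}/\mathrm{Gl}_S(1))\to K_0^{\mu_d}(\mathrm{Var}/S)$, where $\mu_d$ acts trivially on $S$. The map $\rho_d=-\varphi_d\circ\mathrm{pr}_d$ is given by $\rho_d[X\xrightarrow{f}\mathbb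 A^1_S]=[f^{-1}(0)\to S]-[f^{-1}(1)\to S]$, where $f^{-1}(0)$ and $f^{-1}(1)$ are the reduced preimages of the sections $0$ and $1$; it is surjective with kernel $\mathfrak I_d$, and there is exactly one $\lambda$-ring structure on $K_0^{\mu_d}(\mathrm{Var}/S)$ for which $\rho_d$ is a homomorphism of $\lambda$-rings. 5. For $d\mid d'$, replacing the action of $g$ by that of $g^{d'/d}$ is a homomorphism of $\lambda$-rings $K_0^{\mathbb G_m,d}(\mathrm{Var}/\mathbb A^1_S)\to K_0^{\mathbb G_m,d'}(\mathrm{Var}/\mathbb A^1_S)$, compatible with the pullbacks from $K_0^{\mathbb G_m}(\mathrm{Var}/S)$ (on which the action is replaced in the same way). For $d\ge1$ and $d'\ge 1$ it is compatible, through $\rho_d$ and $\rho_{d'}$, with the map $K_0^{\mu_d}(\mathrm{Var}/S)\to K_0^{\mu_{d'}}(\mathrm{Var}/S)$ induced by $\mu_{d'}\to\mu_d$, $\zeta\mapsto\zeta^{d'/d}$, and the latter is a homomorphism for the $\lambda$-ring structures of 4. 6. On $K_0^{\hat\mu}(\mathrm{Var}/S)=\varinjlim_{d}K_0^{\mu_d}(\mathrm{Var}/S)$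 (over $d\ge 1$ ordered by divisibility) there is exactly one $\lambda$-ring structure for which all the maps $K_0^{\mu_d}(\mathrm{Var}/S)\to K_0^{\hat\mu}(\mathrm{Var}/S)$ are homomorphisms of $\lambda$-rings, where $K_0^{\mu_d}(\mathrm{Var}/S)$ carries the structure of 4. -/

import Mathlib

open CategoryTheory AlgebraicGeometry MonoidalCategory CartesianMonoidalCategory Limits MonObj
open scoped TensorProduct

namespace EquivariantMotives
universe u
noncomputable section

lemma isReduced_tensor (k A B : Type*) [Field k] [IsAlgClosed k] [CommRing A] [CommRing B]
    [Algebra k A] [Algebra k B] [Algebra.FiniteType k A] [_root_.IsReduced A] [_root_.IsReduced B] :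
    _root_.IsReduced (A ⊗[k] B) := by
  classical
  have hJ : IsJacobsonRing A := isJacobsonRing_of_finiteType (A := k)
  refine ⟨fun x hx => ?_⟩
  let b := Module.Basis.ofVectorSpace k B
  apply (TensorProduct.equivFinsuppOfBasisRight (M := A) b).injective
  rw [map_zero]
  ext i
  rw [Finsupp.zero_apply]
  have h0 : (⊥ : Ideal A).jacobson = ⊥ :=
    IsJacobsonRing.out hJ (Ideal.isRadical_bot_iff.2 inferInstance)
  rw [← Ideal.mem_bot, ← h0, Ideal.jacobson, Ideal.mem_sInf]
  rintro m ⟨-, hm⟩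
  let _ := Ideal.Quotient.field m
  have := finite_of_finite_type_of_isJacobsonRing k (A ⧸ m)
  let e : k ≃ₐ[k] (A ⧸ m) :=
    AlgEquiv.ofBijective (Algebra.ofId _ _) IsAlgClosed.algebraMap_bijective_of_isIntegral
  let φ : A →ₐ[k] k := e.symm.toAlgHom.comp (Ideal.Quotient.mkₐ k m)
  let ψ : A ⊗[k] B →ₐ[k] B := Algebra.TensorProduct.lift ((Algebra.ofId k B).comp φ) (AlgHom.id k B)
    (fun _ _ => Commute.all _ _)
  have key : ∀ x, φ (TensorProduct.equivFinsuppOfBasisRight b x i) = b.repr (ψ x) i := by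
    intro x
    induction x with
    | zero => simp
    | add x y hx hy => simp [hx, hy]
    | tmul x y =>
      rw [Algebra.TensorProduct.lift_tmul]
      simp only [AlgHom.comp_apply, Algebra.ofId_apply, AlgHom.id_apply, ← Algebra.smul_def]
      simp [mul_comm]
  have h1 : ψ x = 0 := (hx.map ψ).eq_zero
  have h2 := key x
  rw [h1] at h2
  have h3 : Ideal.Quotient.mkₐ k m (TensorProduct.equivFinsuppOfBasisRight b x i) = 0 := by
    apply e.symm.injective
    simpa [φ] using h2
  exact Ideal.Quotient.eq_zero_iff_mem.1 h3

lemma isReduced_pullback_Spec {k : Type u} [Field k] [IsAlgClosed k] {R S : CommRingCat.{u}}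
    (f : Spec R ⟶ Spec (.of k)) (g : Spec S ⟶ Spec (.of k)) [LocallyOfFiniteType f]
    [IsReduced (Spec R)] [IsReduced (Spec S)] : IsReduced (pullback f g) := by
  obtain ⟨φ, rfl⟩ := Spec.map_surjective f
  obtain ⟨ψ, rfl⟩ := Spec.map_surjective g
  have hφ : φ.hom.FiniteType := (HasRingHomProperty.Spec_iff (P := @LocallyOfFiniteType)).1 ‹_›
  algebraize [φ.hom, ψ.hom]
  have := (affine_isReduced_iff R).1 inferInstance
  have := (affine_isReduced_iff S).1 inferInstance
  have := isReduced_tensor k R S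
  have h : IsReduced (Spec (.of (R ⊗[k] S))) := inferInstance
  exact isReduced_of_isOpenImmersion (pullbackSpecIso k R S).hom

lemma isReduced_pullback {k : Type u} [Field k] [IsAlgClosed k] {X Y : Scheme.{u}}
    (f : X ⟶ Spec (.of k)) (g : Y ⟶ Spec (.of k)) [LocallyOfFiniteType f]
    [IsReduced X] [IsReduced Y] : IsReduced (pullback f g) := by
  have h : ∀ ij, IsReduced ((Scheme.Pullback.openCoverOfLeftRight X.affineOpenCover.openCover
      Y.affineOpenCover.openCover f g).X ij) := by
    rintro ⟨i, j⟩
    have hX : IsReduced (X.affineOpenCover.openCover.X i) :=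
      isReduced_of_isOpenImmersion (X.affineOpenCover.openCover.f i)
    have hY : IsReduced (Y.affineOpenCover.openCover.X j) :=
      isReduced_of_isOpenImmersion (Y.affineOpenCover.openCover.f j)
    have hf : LocallyOfFiniteType (X.affineOpenCover.openCover.f i ≫ f) :=
      have : LocallyOfFiniteType (X.affineOpenCover.openCover.f i) := inferInstance
      inferInstance
    exact @isReduced_pullback_Spec k _ _ (R := X.affineOpenCover.X i) (S := Y.affineOpenCover.X j)
      (X.affineOpenCover.openCover.f i ≫ f) (Y.affineOpenCover.openCover.f j ≫ g) hf hX hY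
  exact IsReduced.of_openCover _ (Scheme.Pullback.openCoverOfLeftRight X.affineOpenCover.openCover
      Y.affineOpenCover.openCover f g)
section pts
variable {C : Type*} [Category C] [CartesianMonoidalCategory C] {G : C} [MonObj G]

/-- An action of a monoid object `G` on `X`, given by a morphism `a : G ⊗ X ⟶ X` that is an action
on generalized points. -/
abbrev modOfPoints {X : C} (a : G ⊗ X ⟶ X)
    (h1 : ∀ (T : C) (x : T ⟶ X), lift 1 x ≫ a = x)
    (h2 : ∀ (T : C) (g h : T ⟶ G) (x : T ⟶ X), lift (g * h) x ≫ a = lift g (lift h x ≫ a) ≫ a) :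
    ModObj G X where
  smul := a
  one_smul := by
    have h := h1 _ (snd (𝟙_ C) X)
    have e : lift 1 (snd (𝟙_ C) X) = η[G] ▷ X := by
      ext <;> simp [Hom.one_def, toUnit_unique (fst (𝟙_ C) X) (toUnit _)]
    rw [e] at h
    simpa [leftUnitor_hom] using h
  mul_smul := by
    have h := h2 ((G ⊗ G) ⊗ X) (fst _ _ ≫ fst _ _) (fst _ _ ≫ snd _ _) (snd _ _)
    have e : lift ((fst (G ⊗ G) X ≫ fst _ _) * (fst (G ⊗ G) X ≫ snd _ _)) (snd _ _) = μ[G] ▷ X := by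
      ext
      · simp [Hom.mul_def, ← comp_lift]
      · simp
    have e' : lift (fst (G ⊗ G) X ≫ fst _ _) (lift (fst (G ⊗ G) X ≫ snd _ _) (snd _ _) ≫ a) =
      (α_ G G X).hom ≫ G ◁ a := by
      ext
      · simp
      · simp only [lift_snd, Category.assoc, whiskerLeft_snd]
        rw [← Category.assoc]
        congr 1
        ext <;> simp
    rw [e, e'] at h
    simpa using h

lemma isModHom_of_points {X Y : C} [ModObj G X] [ModObj G Y] (f : X ⟶ Y)
    (h : ∀ (T : C) (g : T ⟶ G) (x : T ⟶ X), (g • x) ≫ f = g • (x ≫ f)) : IsModHom G f where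
  smul_hom := by
    have := h _ (fst _ _) (snd _ _)
    simp only [Hom.smul_def, lift_fst_snd, Category.id_comp] at this
    refine this.trans ?_
    congr 1
    ext <;> simp

/-- The diagonal action of `G` on a product. -/
abbrev prodModObj (X Y : C) [ModObj G X] [ModObj G Y] : ModObj G (X ⊗ Y) := modOfPoints
    (lift ((fst G (X ⊗ Y)) • (snd G (X ⊗ Y) ≫ fst X Y))
      ((fst G (X ⊗ Y)) • (snd G (X ⊗ Y) ≫ snd X Y)))
    (by intro T x; ext <;> simp [ModObj.comp_smul])
    (by intro T g h x; ext <;> simp [ModObj.comp_smul, mul_smul])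

/-- The product of two objects with `G`-action, with the diagonal action. -/
def prodMod (X Y : CategoryTheory.Mod C G) : CategoryTheory.Mod C G :=
  letI := prodModObj (G := G) X.X Y.X
  ⟨X.X ⊗ Y.X⟩

lemma prodModObj_smul (X Y : C) [ModObj G X] [ModObj G Y] {T : C} (g : T ⟶ G) (x : T ⟶ X ⊗ Y) :
    letI := prodModObj (G := G) X Y
    g • x = lift (g • (x ≫ fst X Y)) (g • (x ≫ snd X Y)) := by
  change lift g x ≫ lift _ _ = _
  ext <;> simp [ModObj.comp_smul]

lemma prodMod_smul_fst {X Y : CategoryTheory.Mod C G} {T : C} (g : T ⟶ G)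
    (x : T ⟶ (prodMod X Y).X) :
    (g • x) ≫ fst X.X Y.X = g • (x ≫ fst X.X Y.X) :=
  (congrArg (· ≫ fst X.X Y.X) (prodModObj_smul X.X Y.X g x)).trans (lift_fst _ _)

lemma prodMod_smul_snd {X Y : CategoryTheory.Mod C G} {T : C} (g : T ⟶ G)
    (x : T ⟶ (prodMod X Y).X) :
    (g • x) ≫ snd X.X Y.X = g • (x ≫ snd X.X Y.X) :=
  (congrArg (· ≫ snd X.X Y.X) (prodModObj_smul X.X Y.X g x)).trans (lift_snd _ _)

/-- An object with the trivial `G`-action. -/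
def trivMod (X : C) : CategoryTheory.Mod C G :=
  letI := ModObj.trivialAction G X
  ⟨X⟩
lemma trivMod_smul {X : C} {T : C} (g : T ⟶ G) (x : T ⟶ (trivMod (G := G) X).X) :
    g • x = x := by
  rw [Hom.smul_def]
  exact lift_snd _ _
lemma comap_smul {H : C} [MonObj H] (φ : H ⟶ G) [IsMonHom φ] (X : CategoryTheory.Mod C G) {T : C} (h : T ⟶ H)
   (x : T ⟶ X.X) :
    h • (show T ⟶ ((CategoryTheory.Mod.comap φ).obj X).X from x) = (h ≫ φ) • x := by
  rw [Hom.smul_def, Hom.smul_def]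
  exact (Category.assoc _ _ _).symm.trans (congrArg (· ≫ _) (lift_whiskerRight _ _ _))
end pts
variable (k : Type u) [Field k]

/-- Schemes over `k`. -/
abbrev Sch := Over (Spec (.of k))

/-- The affine line over `k`. -/
def A1 : Sch k := Over.mk (𝔸(PUnit.{u+1}; Spec (.of k)) ↘ Spec (.of k))

variable {k}
/-- Pullback of global functions. -/
def fnPull {T T' : Sch k} (g : T' ⟶ T) : Γ(T.left, ⊤) →+* Γ(T'.left, ⊤) := g.left.appTop.hom

lemma fnPull_comp {T T' T'' : Sch k} (h : T'' ⟶ T') (g : T' ⟶ T) (a : Γ(T.left, ⊤)) :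
    fnPull (h ≫ g) a = fnPull h (fnPull g a) := by
  exact congrArg (fun t => t.hom a) (Scheme.Hom.comp_appTop h.left g.left)

namespace A1
/-- The function defined by a morphism to the affine line. -/
def coord {T : Sch k} (f : T ⟶ A1 k) : Γ(T.left, ⊤) :=
  fnPull f (AffineSpace.coord (Spec (.of k)) PUnit.unit : Γ((A1 k).left, ⊤))
/-- The morphism to the affine line defined by a function. -/
def mk {T : Sch k} (a : Γ(T.left, ⊤)) : T ⟶ A1 k :=
  Over.homMk (AffineSpace.homOfVector T.hom fun _ => a) (AffineSpace.homOfVector_over _ _)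
@[simp] lemma coord_mk {T : Sch k} (a : Γ(T.left, ⊤)) : coord (mk a) = a :=
  AffineSpace.homOfVector_appTop_coord _ _ _
lemma ext {T : Sch k} {f g : T ⟶ A1 k} (h : coord f = coord g) : f = g := by
  apply Over.OverMorphism.ext
  apply AffineSpace.hom_ext
  · exact (Over.w f).trans (Over.w g).symm
  · rintro ⟨⟩; exact h
lemma coord_comp {T T' : Sch k} (g : T' ⟶ T) (f : T ⟶ A1 k) :
    coord (g ≫ f) = fnPull g (coord f) := fnPull_comp _ _ _

/-- The affine line is a monoid under addition. -/
instance : MonObj (A1 k) where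
  one := mk 0
  mul := mk (coord (fst _ _) + coord (snd _ _))
  one_mul := by
    apply ext
    rw [coord_comp, coord_mk, map_add, ← coord_comp, ← coord_comp, whiskerRight_fst,
      whiskerRight_snd, coord_comp, coord_mk, map_zero, zero_add, leftUnitor_hom]
  mul_one := by
    apply ext
    rw [coord_comp, coord_mk, map_add, ← coord_comp, ← coord_comp, whiskerLeft_fst,
      whiskerLeft_snd, coord_comp (snd _ _), coord_mk, map_zero, add_zero, rightUnitor_hom]
  mul_assoc := by
    apply ext
    rw [coord_comp, coord_comp, coord_comp (_ ◁ _), coord_mk]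
    simp only [map_add, ← coord_comp, whiskerRight_fst, whiskerRight_snd, whiskerLeft_fst,
      whiskerLeft_snd, coord_comp _ (mk _), coord_mk, add_assoc, associator_hom_fst,
      associator_hom_snd_fst, associator_hom_snd_snd]
instance : IsCommMonObj (A1 k) where
  mul_comm := by
    apply ext
    change coord (_ ≫ mk _) = coord (mk _)
    simp only [coord_comp _ (mk _), coord_mk, map_add, ← coord_comp, braiding_hom_fst,
      braiding_hom_snd, add_comm]
end A1

variable (k) in
/-- The diagonalizable group `Spec k[M]` with character group `M`. -/
def Diag (M : Type) [AddCommGroup M] : Sch k :=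
  (Spec (.of (AddMonoidAlgebra k M))).asOver (Spec (.of k))

variable (k) in
/-- The group structure of `Spec k[M]`. -/
@[reducible] def Diag.grpObj (M : Type) [AddCommGroup M] : GrpObj (Diag k M) :=
  inferInstanceAs (GrpObj ((Spec (.of (AddMonoidAlgebra k M))).asOver (Spec (.of k))))

instance (M : Type) [AddCommGroup M] : GrpObj (Diag k M) := Diag.grpObj k M

instance (M : Type) [AddCommGroup M] : IsCommMonObj (Diag k M) :=
  inferInstanceAs (IsCommMonObj ((Spec (.of (AddMonoidAlgebra k M))).asOver (Spec (.of k))))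

variable {M N : Type} [AddCommGroup M] [AddCommGroup N]

variable (k) in
/-- The homomorphism of diagonalizable groups defined by a homomorphism of character groups. -/
def Diag.map (f : M →+ N) : Diag k N ⟶ Diag k M :=
  (Spec.map (CommRingCat.ofHom
    (AddMonoidAlgebra.mapDomainBialgHom k f : _ →ₐ[k] _).toRingHom)).asOver (Spec (.of k))
instance (f : M →+ N) : IsMonHom (Diag.map k f) :=
   ((hopfSpec (.of k)).map
     (.op (CommHopfAlgCat.ofHom (AddMonoidAlgebra.mapDomainBialgHom k f)))).hom.isMonHom_hom

namespace Diag
/-- The character `m` as a function on the diagonalizable group `Spec k[M]`. -/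
def chi0 (m : M) : Γ((Diag k M).left, ⊤) :=
  (Scheme.ΓSpecIso (.of (AddMonoidAlgebra k M))).inv (AddMonoidAlgebra.single m 1)

/-- The character `m`, evaluated at a generalized point of `Spec k[M]`. -/
def chi (m : M) {T : Sch k} (g : T ⟶ Diag k M) : Γ(T.left, ⊤) := fnPull g (chi0 m)

lemma chi_comp (m : M) {T T' : Sch k} (h : T' ⟶ T) (g : T ⟶ Diag k M) :
    chi m (h ≫ g) = fnPull h (chi m g) := fnPull_comp _ _ _

lemma appTop_SpecMap {X : Scheme.{u}} {R S : CommRingCat.{u}} (e : X ⟶ Spec S) (φ : R ⟶ S) (a : R) :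
    (e ≫ Spec.map φ).appTop ((Scheme.ΓSpecIso R).inv a) =
      (e.appTop.hom.comp (Scheme.ΓSpecIso S).inv.hom) (φ a) := by
  rw [Scheme.Hom.comp_appTop]
  exact (congrArg (fun t => e.appTop (t.hom a)) (Scheme.ΓSpecIso_inv_naturality φ)).symm

lemma chi0_mul (m : M) : fnPull (μ[Diag k M]) (chi0 m) =
    fnPull (fst _ _) (chi0 m) * fnPull (snd _ _) (chi0 m) := by
  let e := (pullbackSpecIso k (AddMonoidAlgebra k M) (AddMonoidAlgebra k M)).hom
  have h1 : (fst (Diag k M) (Diag k M)).left =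
    e ≫ Spec.map (CommRingCat.ofHom Algebra.TensorProduct.includeLeftRingHom) :=
    (pullbackSpecIso_hom_fst ..).symm
  have h2 : (snd (Diag k M) (Diag k M)).left =
    e ≫ Spec.map (CommRingCat.ofHom
        (Algebra.TensorProduct.includeRight (R := k) (A := AddMonoidAlgebra k M)
          (B := AddMonoidAlgebra k M)).toRingHom) :=
    (pullbackSpecIso_hom_snd ..).symm
  have h3 : (μ[Diag k M]).left = e ≫ Spec.map (CommRingCat.ofHom
      (Bialgebra.comulAlgHom k (AddMonoidAlgebra k M)).toRingHom) :=
    mul_spec_asOver_spec_left (R := .of k) (A := .of (AddMonoidAlgebra k M))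
  have e1 := appTop_SpecMap e
    (CommRingCat.ofHom Algebra.TensorProduct.includeLeftRingHom) (AddMonoidAlgebra.single m 1)
  have e2 := appTop_SpecMap e (CommRingCat.ofHom
        (Algebra.TensorProduct.includeRight (R := k) (A := AddMonoidAlgebra k M)
          (B := AddMonoidAlgebra k M)).toRingHom) (AddMonoidAlgebra.single m 1)
  have e3 := appTop_SpecMap e (CommRingCat.ofHom
      (Bialgebra.comulAlgHom k (AddMonoidAlgebra k M)).toRingHom) (AddMonoidAlgebra.single m 1)
  rw [← h1] at e1
  rw [← h2] at e2
  rw [← h3] at e3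
  refine e3.trans (Eq.trans ?_ (congrArg₂ (· * ·) e1 e2).symm)
  refine (congrArg _ ?_).trans (map_mul (e.appTop.hom.comp (Scheme.ΓSpecIso _).inv.hom) _ _)
  simp

lemma chi_mul (m : M) {T : Sch k} (g h : T ⟶ Diag k M) : chi m (g * h) = chi m g * chi m h := by
  rw [Hom.mul_def, chi_comp, chi, chi0_mul, map_mul, ← fnPull_comp, ← fnPull_comp, lift_fst,
    lift_snd]; rfl

lemma chi_one (m : M) {T : Sch k} : chi m (1 : T ⟶ Diag k M) = 1 := by
  have h := appTop_SpecMap (𝟙 _)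
    (CommRingCat.ofHom (Bialgebra.counitAlgHom k (AddMonoidAlgebra k M)).toRingHom)
    (AddMonoidAlgebra.single m 1)
  rw [Category.id_comp] at h
  have h' : fnPull η[Diag k M] (chi0 m) = 1 := by
    refine h.trans ?_
    simp
  rw [Hom.one_def, chi_comp, chi, h', map_one]

lemma chi_map (f : M →+ N) (m : M) {T : Sch k} (g : T ⟶ Diag k N) :
    chi m (g ≫ map k f) = chi (f m) g := by
  rw [chi_comp, chi, chi]
  congr 1
  have h := appTop_SpecMap (𝟙 _) (CommRingCat.ofHom
    (AddMonoidAlgebra.mapDomainBialgHom k f :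
      AddMonoidAlgebra k M →ₐ[k] AddMonoidAlgebra k N).toRingHom)
    (AddMonoidAlgebra.single m (1 : k))
  rw [Category.id_comp] at h
  refine h.trans ?_
  simp [chi0]

lemma chi_pow (m : M) (n : ℕ) {T : Sch k} (g : T ⟶ Diag k M) : chi m (g ^ n) = chi m g ^ n := by
  induction n with
  | zero => simp [chi_one]
  | succ n ih => rw [pow_succ, chi_mul, ih, pow_succ]

lemma chi_nsmul (m : M) (n : ℕ) {T : Sch k} (g : T ⟶ Diag k M) : chi (n • m) g = chi m g ^ n := by
  have h : (AddMonoidAlgebra.single (n • m) 1 : AddMonoidAlgebra k M) =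
    AddMonoidAlgebra.single m 1 ^ n := by simp [AddMonoidAlgebra.single_pow]
  have h' : (chi0 (n • m) : Γ((Diag k M).left, ⊤)) = chi0 m ^ n :=
    (congrArg _ h).trans (map_pow (Scheme.ΓSpecIso (.of (AddMonoidAlgebra k M))).inv.hom _ _)
  exact (congrArg (fnPull g) h').trans (map_pow (fnPull g) _ _)
end Diag

section Cart
variable {C : Type*} [Category C] [CartesianMonoidalCategory C]
lemma isPullback_whiskerRight {X Y : C} (f : X ⟶ Y) (Z : C) :
    IsPullback (f ▷ Z) (fst X Z) (fst Y Z) f := by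
  refine ⟨⟨by simp⟩, ⟨PullbackCone.IsLimit.mk _ (fun s => lift s.snd (s.fst ≫ snd _ _)) ?_ ?_ ?_⟩⟩
  · intro s; ext <;> simp [s.condition]
  · intro s; simp
  · intro s m h1 h2; ext <;> simp [← h1, ← h2]
lemma isPullback_whiskerLeft {X Y : C} (f : X ⟶ Y) (Z : C) :
    IsPullback (Z ◁ f) (snd Z X) (snd Z Y) f := by
  refine ⟨⟨by simp⟩, ⟨PullbackCone.IsLimit.mk _ (fun s => lift (s.fst ≫ fst _ _) s.snd) ?_ ?_ ?_⟩⟩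
  · intro s; ext <;> simp [s.condition]
  · intro s; simp
  · intro s m h1 h2; ext <;> simp [← h1, ← h2]
end Cart

lemma tensorHom_left {P : MorphismProperty Scheme.{u}} [P.IsStableUnderBaseChange]
    [P.IsStableUnderComposition] {X X' Y Y' : Sch k} {f : X ⟶ Y} {g : X' ⟶ Y'}
    (hf : P f.left) (hg : P g.left) : P (f ⊗ₘ g).left := by
  rw [MonoidalCategory.tensorHom_def, Over.comp_left]
  exact P.comp_mem _ _
    (P.of_isPullback ((isPullback_whiskerRight f X').map (Over.forget _)).flip hf)
    (P.of_isPullback ((isPullback_whiskerLeft g Y).map (Over.forget _)).flip hg)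

/-- Schemes over `k` with an action of the group scheme `G`, and equivariant morphisms. -/
abbrev GSch (G : Sch k) [GrpObj G] := CategoryTheory.Mod (Sch k) G

section
variable {G : Sch k} [GrpObj G]

/-- The open subset `U` is invariant: `G × U` is mapped into `U` by the action. -/
def IsInvOpen (X : GSch G) (U : X.X.left.Opens) : Prop :=
  ∀ (T : Sch k) (g : T ⟶ G) (x : T ⟶ X.X), Set.range x.left ⊆ U →
    Set.range (g • x : T ⟶ X.X).left ⊆ U

/-- The action is good: every point has an invariant affine open neighbourhood. -/
def IsGood (X : GSch G) : Prop :=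
  ∀ p : X.X.left, ∃ U : X.X.left.Opens, p ∈ U ∧ IsAffineOpen U ∧ IsInvOpen X U

/-- A `G`-equivariant variety over `B`: a reduced and separated `k`-scheme with a good `G`-action,
together with an equivariant morphism of finite type to `B`. -/
structure GVar (B : GSch G) where
  X : GSch G
  str : X ⟶ B
  isReduced : IsReduced X.X.left
  isSeparated : IsSeparated X.X.hom
  locallyOfFiniteType : LocallyOfFiniteType str.hom.left
  quasiCompact : QuasiCompact str.hom.left
  isGood : IsGood X

/-- `Z` is an (equivariant, reduced) closed subscheme of `X` and `U` is its open complement. -/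
structure GVar.IsCut {B : GSch G} (X Z U : GVar B) (i : Z.X ⟶ X.X) (j : U.X ⟶ X.X) : Prop where
  closed_comp : i ≫ X.str = Z.str
  open_comp : j ≫ X.str = U.str
  isClosedImmersion : IsClosedImmersion i.hom.left
  isOpenImmersion : IsOpenImmersion j.hom.left
  range_eq : Set.range j.hom.left = (Set.range i.hom.left)ᶜ

/-- The subgroup generated by the scissor relations. (The relation for `Z = X` and `U = ∅` shows
that isomorphic objects have the same class.) -/
def scissors (B : GSch G) : AddSubgroup (FreeAbelianGroup (GVar B)) :=
  AddSubgroup.closure {r | ∃ (X Z U : GVar B) (i : Z.X ⟶ X.X) (j : U.X ⟶ X.X),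
    X.IsCut Z U i j ∧
      r = FreeAbelianGroup.of X - (FreeAbelianGroup.of Z + FreeAbelianGroup.of U)}

/-- The group `K₀^G(Var/B)` of `G`-equivariant motives over `B`. -/
def K0 (B : GSch G) : Type (u + 1) := FreeAbelianGroup (GVar B) ⧸ scissors B

instance (B : GSch G) : AddCommGroup (K0 B) :=
  inferInstanceAs (AddCommGroup (FreeAbelianGroup (GVar B) ⧸ scissors B))

/-- The class of an equivariant variety over `B`. -/
def K0.mk {B : GSch G} (X : GVar B) : K0 B :=
  QuotientAddGroup.mk (FreeAbelianGroup.of X)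

/-- An additive invariant of equivariant varieties over `B` induces a homomorphism on `K₀`. -/
def K0.lift {B : GSch G} {A : Type*} [AddCommGroup A] (f : GVar B → A)
    (hf : ∀ (X Z U : GVar B) (i : Z.X ⟶ X.X) (j : U.X ⟶ X.X), X.IsCut Z U i j → f X = f Z + f U) :
    K0 B →+ A :=
  QuotientAddGroup.lift (scissors B) (FreeAbelianGroup.lift f) <| by
    rw [scissors, AddSubgroup.closure_le]
    rintro _ ⟨X, Z, U, i, j, h, rfl⟩
    change FreeAbelianGroup.lift f _ = 0
    simp [hf X Z U i j h]

@[simp] lemma K0.lift_mk {B : GSch G} {A : Type*} [AddCommGroup A] (f : GVar B → A) (hf)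
    (X : GVar B) : K0.lift f hf (K0.mk X) = f X :=
  FreeAbelianGroup.lift_apply_of _ _

lemma K0.mk_eq {B : GSch G} {X Z U : GVar B} {i : Z.X ⟶ X.X} {j : U.X ⟶ X.X}
    (h : X.IsCut Z U i j) : K0.mk X = K0.mk Z + K0.mk U := by
  rw [← sub_eq_zero]
  exact (QuotientAddGroup.eq_zero_iff _).2
    (AddSubgroup.subset_closure ⟨X, Z, U, i, j, h, rfl⟩)

/-- Morphisms of finite type. -/
class IsFT {X Y : Sch k} (f : X ⟶ Y) : Prop where
  locallyOfFiniteType : LocallyOfFiniteType f.left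
  quasiCompact : QuasiCompact f.left

/-- Composition with a morphism of finite type. -/
def GVar.push {B B' : GSch G} (f : B ⟶ B') [hf : IsFT f.hom] (X : GVar B) : GVar B' where
  X := X.X
  str := X.str ≫ f
  isReduced := X.isReduced
  isSeparated := X.isSeparated
  locallyOfFiniteType :=
    MorphismProperty.comp_mem _ _ _ X.locallyOfFiniteType hf.locallyOfFiniteType
  quasiCompact := MorphismProperty.comp_mem _ _ _ X.quasiCompact hf.quasiCompact
  isGood := X.isGood

/-- The push-forward along an equivariant morphism of finite type. -/
def K0.push {B B' : GSch G} (f : B ⟶ B') [IsFT f.hom] : K0 B →+ K0 B' :=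
  K0.lift (fun X => K0.mk (X.push f)) fun X _ _ i j h => K0.mk_eq (i := i) (j := j)
    { closed_comp := (Category.assoc i X.str f).symm.trans (congrArg (· ≫ f) h.closed_comp)
      open_comp := (Category.assoc j X.str f).symm.trans (congrArg (· ≫ f) h.open_comp)
      isClosedImmersion := h.isClosedImmersion
      isOpenImmersion := h.isOpenImmersion
      range_eq := h.range_eq }

/-- Restriction of the acting group along a homomorphism `φ : H ⟶ G`. -/
def GVar.res {H : Sch k} [GrpObj H] (φ : H ⟶ G) [IsMonHom φ] {B : GSch G} (X : GVar B) :
    GVar ((CategoryTheory.Mod.comap φ).obj B) where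
  X := (CategoryTheory.Mod.comap φ).obj X.X
  str := (CategoryTheory.Mod.comap φ).map X.str
  isReduced := X.isReduced
  isSeparated := X.isSeparated
  locallyOfFiniteType := X.locallyOfFiniteType
  quasiCompact := X.quasiCompact
  isGood p := by
    obtain ⟨U, hp, hU, h⟩ := X.isGood p
    refine ⟨U, hp, hU, fun T g x hx => ?_⟩
    have := h T (g ≫ φ) x hx
    rw [← comap_smul φ X.X g x] at this
    exact this

/-- Restriction of the acting group along a homomorphism `φ : H ⟶ G`. -/
def K0.res {H : Sch k} [GrpObj H] (φ : H ⟶ G) [IsMonHom φ] (B : GSch G) :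
    K0 B →+ K0 ((CategoryTheory.Mod.comap φ).obj B) :=
  K0.lift (fun X => K0.mk (X.res φ)) fun X Z U i j h => K0.mk_eq
    (X := X.res φ) (Z := Z.res φ) (U := U.res φ)
    (i := (CategoryTheory.Mod.comap φ).map i) (j := (CategoryTheory.Mod.comap φ).map j)
    { closed_comp := ((CategoryTheory.Mod.comap φ).map_comp i X.str).symm.trans
        (congrArg (CategoryTheory.Mod.comap φ).map h.closed_comp)
      open_comp := ((CategoryTheory.Mod.comap φ).map_comp j X.str).symm.trans
        (congrArg (CategoryTheory.Mod.comap φ).map h.open_comp)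
      isClosedImmersion := h.isClosedImmersion
      isOpenImmersion := h.isOpenImmersion
      range_eq := h.range_eq }

/-- The product of two equivariant morphisms. -/
def prodMap {X X' Y Y' : GSch G} (f : X ⟶ X') (g : Y ⟶ Y') : prodMod X Y ⟶ prodMod X' Y' :=
  letI : IsModHom G (show (prodMod X Y).X ⟶ (prodMod X' Y').X from f.hom ⊗ₘ g.hom) :=
    isModHom_of_points _ (by
      intro T a x
      apply CartesianMonoidalCategory.hom_ext
      · refine Eq.trans ?_ (prodMod_smul_fst a (x ≫ (f.hom ⊗ₘ g.hom))).symm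
        have h1 : (a • x) ≫ fst X.X Y.X ≫ f.hom = a • (x ≫ fst X.X Y.X ≫ f.hom) := by
          refine (Category.assoc _ _ _).symm.trans ?_
          refine (congrArg (· ≫ f.hom) (prodMod_smul_fst a x)).trans ?_
          refine (IsModHom.map_smul f.hom a _).trans ?_
          exact congrArg (a • ·) (Category.assoc _ _ _)
        refine (Category.assoc _ _ _).trans ?_
        refine (congrArg ((a • x) ≫ ·) (tensorHom_fst f.hom g.hom)).trans ?_
        refine h1.trans (congrArg (a • ·) ?_)
        exact (congrArg (x ≫ ·) (tensorHom_fst f.hom g.hom).symm).trans (Category.assoc _ _ _).symm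
      · refine Eq.trans ?_ (prodMod_smul_snd a (x ≫ (f.hom ⊗ₘ g.hom))).symm
        have h1 : (a • x) ≫ snd X.X Y.X ≫ g.hom = a • (x ≫ snd X.X Y.X ≫ g.hom) := by
          refine (Category.assoc _ _ _).symm.trans ?_
          refine (congrArg (· ≫ g.hom) (prodMod_smul_snd a x)).trans ?_
          refine (IsModHom.map_smul g.hom a _).trans ?_
          exact congrArg (a • ·) (Category.assoc _ _ _)
        refine (Category.assoc _ _ _).trans ?_
        refine (congrArg ((a • x) ≫ ·) (tensorHom_snd f.hom g.hom)).trans ?_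
        refine h1.trans (congrArg (a • ·) ?_)
        exact (congrArg (x ≫ ·) (tensorHom_snd f.hom g.hom).symm).trans (Category.assoc _ _ _).symm)
  ⟨f.hom ⊗ₘ g.hom⟩

lemma isAffineOpen_inf {X Y S : Scheme.{u}} (f : X ⟶ S) (g : Y ⟶ S) [IsAffine S]
    {U : X.Opens} {V : Y.Opens} (hU : IsAffineOpen U) (hV : IsAffineOpen V) :
    IsAffineOpen (pullback.fst f g ⁻¹ᵁ U ⊓ pullback.snd f g ⁻¹ᵁ V) := by
  have : IsAffine U := hU
  have : IsAffine V := hV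
  let p := pullback.map (U.ι ≫ f) (V.ι ≫ g) f g U.ι V.ι (𝟙 _) (by simp) (by simp)
  have h := isAffineOpen_opensRange p
  convert h using 1
  ext1
  simp [p, Scheme.Pullback.range_map]

lemma isGood_prodMod {X Y : GSch G} (hX : IsGood X) (hY : IsGood Y) : IsGood (prodMod X Y) := by
  intro p
  let p1 : pullback X.X.hom Y.X.hom ⟶ X.X.left := pullback.fst X.X.hom Y.X.hom
  let p2 : pullback X.X.hom Y.X.hom ⟶ Y.X.left := pullback.snd X.X.hom Y.X.hom
  obtain ⟨U, hp, hU, h⟩ := hX (p1 p)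
  obtain ⟨V, hq, hV, h'⟩ := hY (p2 p)
  let W : (pullback X.X.hom Y.X.hom).Opens := p1 ⁻¹ᵁ U ⊓ p2 ⁻¹ᵁ V
  have hW : IsAffineOpen W := isAffineOpen_inf _ _ hU hV
  refine ⟨W, ⟨hp, hq⟩, hW, fun T g x hx => ?_⟩
  have h1 := h T g (x ≫ fst X.X Y.X) (by
    rintro _ ⟨s, rfl⟩
    exact (hx ⟨s, rfl⟩).1)
  have h2 := h' T g (x ≫ snd X.X Y.X) (by
    rintro _ ⟨s, rfl⟩
    exact (hx ⟨s, rfl⟩).2)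
  rw [← prodMod_smul_fst] at h1
  rw [← prodMod_smul_snd] at h2
  rintro _ ⟨t, rfl⟩
  exact ⟨h1 ⟨t, rfl⟩, h2 ⟨t, rfl⟩⟩

variable [IsAlgClosed k]
/-- The product `X × Y ⟶ B × B'` of two equivariant varieties, with the diagonal action. -/
def GVar.prod {B B' : GSch G} [LocallyOfFiniteType B.X.hom] (X : GVar B) (Y : GVar B') :
    GVar (prodMod B B') where
  X := prodMod X.X Y.X
  str := prodMap X.str Y.str
  isReduced := by
    have := X.isReduced
    have := Y.isReduced
    have : LocallyOfFiniteType X.X.X.hom := by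
      have := X.locallyOfFiniteType
      rw [← Over.w X.str.hom]
      infer_instance
    exact isReduced_pullback X.X.X.hom Y.X.X.hom
  isSeparated := by
    have := X.isSeparated
    have := Y.isSeparated
    exact (inferInstance : IsSeparated (pullback.fst X.X.X.hom Y.X.X.hom ≫ X.X.X.hom))
  locallyOfFiniteType :=
    tensorHom_left (P := @LocallyOfFiniteType) X.locallyOfFiniteType Y.locallyOfFiniteType
  quasiCompact := tensorHom_left (P := @QuasiCompact) X.quasiCompact Y.quasiCompact
  isGood := isGood_prodMod X.isGood Y.isGood
end

variable (k) in
/-- The multiplicative group. -/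
abbrev Gm : Sch k := Diag k ℤ
variable (k) in
/-- The group of `d`-th roots of unity (for `d > 0`). -/
abbrev Mu (d : ℕ) : Sch k := Diag k (ZMod d)

/-- The affine line with `𝔾ₘ` acting with weight `d`: `g • z = g ^ d * z`. -/
def A1w (d : ℕ) : GSch (Gm k) :=
  letI : ModObj (Gm k) (A1 k) := modOfPoints
    (A1.mk (Diag.chi 1 (fst (Gm k) (A1 k)) ^ d * A1.coord (snd (Gm k) (A1 k))))
    (by
      intro T x
      apply A1.ext
      rw [A1.coord_comp, A1.coord_mk, map_mul, map_pow, ← Diag.chi_comp, ← A1.coord_comp, lift_fst,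
        lift_snd, Diag.chi_one, one_pow, _root_.one_mul])
    (by
      intro T g h x
      apply A1.ext
      simp only [A1.coord_comp _ (A1.mk _), A1.coord_mk, map_mul, map_pow, ← Diag.chi_comp,
        ← A1.coord_comp, lift_fst, lift_snd, Diag.chi_mul]
      ring)
  ⟨A1 k⟩

lemma A1w_smul {d : ℕ} {T : Sch k} (g : T ⟶ Gm k) (x : T ⟶ (A1w (k := k) d).X) :
    A1.coord (g • x) = Diag.chi 1 g ^ d * A1.coord x := by
  let x' : T ⟶ A1 k := x
  change A1.coord (lift g x' ≫ A1.mk _) = Diag.chi 1 g ^ d * A1.coord x'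
  rw [A1.coord_comp, A1.coord_mk, map_mul, map_pow, ← Diag.chi_comp, ← A1.coord_comp, lift_fst,
        lift_snd]

/-- The group `𝔾ₘ` with `𝔾ₘ` acting with weight `d`: `g • z = g ^ d * z`. -/
def GmW (d : ℕ) : GSch (Gm k) :=
  letI : ModObj (Gm k) (Gm k) := modOfPoints
    (fst (Gm k) (Gm k) ^ d * snd (Gm k) (Gm k))
    (by
      intro T x
      rw [MonObj.comp_mul, MonObj.comp_pow, lift_fst, lift_snd, one_pow, _root_.one_mul])
    (by
      intro T g h x
      simp only [MonObj.comp_mul, MonObj.comp_pow, lift_fst, lift_snd, mul_pow, _root_.mul_assoc])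
  ⟨Gm k⟩

lemma GmW_smul {d : ℕ} {T : Sch k} (g : T ⟶ Gm k) (x : T ⟶ (GmW (k := k) d).X) :
    g • x = (g ^ d * (show T ⟶ Gm k from x) : T ⟶ Gm k) := by
  let x' : T ⟶ Gm k := x
  change lift g x' ≫ (fst (Gm k) (Gm k) ^ d * snd (Gm k) (Gm k)) = g ^ d * x'
  rw [MonObj.comp_mul, MonObj.comp_pow, lift_fst, lift_snd]

lemma coord_gm {T : Sch k} (y : T ⟶ Gm k) :
    A1.coord (y ≫ A1.mk (Diag.chi 1 (𝟙 (Gm k)))) = Diag.chi 1 y := by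
  rw [A1.coord_comp, A1.coord_mk, ← Diag.chi_comp, Category.comp_id]

/-- The inclusion of the complement of the origin of the affine line. -/
def gmToA1 (d : ℕ) : GmW (k := k) d ⟶ A1w d :=
  letI : IsModHom (Gm k) (show (GmW (k := k) d).X ⟶ (A1w (k := k) d).X from
      A1.mk (Diag.chi 1 (𝟙 (Gm k)))) := isModHom_of_points _ (by
    intro T g x
    apply A1.ext
    refine Eq.trans ?_ (A1w_smul _ _).symm
    rw [GmW_smul]
    refine (coord_gm _).trans ?_
    rw [Diag.chi_mul, Diag.chi_pow]
    exact congrArg (_ * ·) (coord_gm _).symm)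
  ⟨A1.mk (Diag.chi 1 (𝟙 (Gm k)))⟩

section
variable {G : Sch k} [GrpObj G]

/-- `B` is a commutative monoid, locally of finite type over `k` and with multiplication of finite
type, on which `G` acts by endomorphisms of the monoid. -/
class IsGMonoid (B : GSch G) [MonObj B.X] : Prop where
  smul_one : ∀ (T : Sch k) (g : T ⟶ G), g • (1 : T ⟶ B.X) = 1
  smul_mul : ∀ (T : Sch k) (g : T ⟶ G) (x y : T ⟶ B.X), g • (x * y) = (g • x) * (g • y)
  comm : IsCommMonObj B.X
  lft : LocallyOfFiniteType B.X.hom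
  qc : QuasiCompact μ[B.X].left

instance (S : Sch k) [h : MonObj S] : MonObj (trivMod (G := G) S).X := h

instance (S : Sch k) [MonObj S] [h : IsCommMonObj S] [LocallyOfFiniteType S.hom]
    [QuasiCompact μ[S].left] : IsGMonoid (trivMod (G := G) S) where
  smul_one T g := trivMod_smul _ _
  smul_mul T g x y := (trivMod_smul _ _).trans
    (congrArg₂ _ (trivMod_smul _ _).symm (trivMod_smul _ _).symm)
  comm := h
  lft := ‹_›
  qc := ‹_›

instance (d : ℕ) : MonObj (A1w (k := k) d).X := inferInstanceAs (MonObj (A1 k))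

lemma A1.coord_add {T : Sch k} (x y : T ⟶ A1 k) : coord (x * y) = coord x + coord y := by
  rw [Hom.mul_def]
  change coord (_ ≫ mk _) = _
  rw [coord_comp, coord_mk, map_add, ← coord_comp, ← coord_comp, lift_fst, lift_snd]

lemma A1.coord_zero {T : Sch k} : coord (1 : T ⟶ A1 k) = 0 := by
  rw [Hom.one_def]
  change coord (_ ≫ mk _) = _
  rw [coord_comp, coord_mk, map_zero]

instance : IsAffineHom (A1 k).hom := inferInstanceAs (IsAffineHom (𝔸(_; _) ↘ _))
instance : LocallyOfFiniteType (A1 k).hom :=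
  inferInstanceAs (LocallyOfFiniteType (𝔸(_; _) ↘ _))

instance (d : ℕ) : IsGMonoid (A1w (k := k) d) where
  smul_one T g := by
    apply A1.ext
    refine (A1w_smul g (1 : T ⟶ (A1w (k := k) d).X)).trans ?_
    refine (congrArg (_ * ·) A1.coord_zero).trans ((mul_zero _).trans A1.coord_zero.symm)
  smul_mul T g x y := by
    apply A1.ext
    refine (A1w_smul g (x * y)).trans ?_
    refine (congrArg (_ * ·) (A1.coord_add x y)).trans ((mul_add _ _ _).trans ?_)
    refine Eq.trans ?_ (A1.coord_add (g • x : T ⟶ (A1w (k := k) d).X) (g • y)).symm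
    exact congrArg₂ (· + ·) (A1w_smul g x).symm (A1w_smul g y).symm
  comm := inferInstanceAs (IsCommMonObj (A1 k))
  lft := inferInstanceAs (LocallyOfFiniteType (A1 k).hom)
  qc := by
    have : QuasiCompact (μ[A1 k].left ≫ (A1 k).hom) := by
      rw [Over.w]
      exact (inferInstance : QuasiCompact (pullback.fst (A1 k).hom (A1 k).hom ≫ (A1 k).hom))
    exact (.of_comp μ[A1 k].left (A1 k).hom : QuasiCompact μ[A1 k].left)

instance (B B' : GSch G) [MonObj B.X] [MonObj B'.X] : MonObj (prodMod B B').X :=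
  inferInstanceAs (MonObj (B.X ⊗ B'.X))

lemma prodMod_one_fst (B B' : GSch G) [MonObj B.X] [MonObj B'.X] (T : Sch k) :
    (1 : T ⟶ B.X ⊗ B'.X) ≫ fst B.X B'.X = 1 := MonObj.one_comp _
lemma prodMod_one_snd (B B' : GSch G) [MonObj B.X] [MonObj B'.X] (T : Sch k) :
    (1 : T ⟶ B.X ⊗ B'.X) ≫ snd B.X B'.X = 1 := MonObj.one_comp _
lemma prodMod_mul_fst (B B' : GSch G) [MonObj B.X] [MonObj B'.X] {T : Sch k}
   (x y : T ⟶ B.X ⊗ B'.X) :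
    (x * y) ≫ fst B.X B'.X = x ≫ fst _ _ * y ≫ fst _ _ := MonObj.mul_comp _ _ _
lemma prodMod_mul_snd (B B' : GSch G) [MonObj B.X] [MonObj B'.X] {T : Sch k}
   (x y : T ⟶ B.X ⊗ B'.X) :
    (x * y) ≫ snd B.X B'.X = x ≫ snd _ _ * y ≫ snd _ _ := MonObj.mul_comp _ _ _

instance (B B' : GSch G) [MonObj B.X] [MonObj B'.X] [h : IsGMonoid B] [h' : IsGMonoid B'] :
    IsGMonoid (prodMod B B') where
  smul_one T g := by
    apply CartesianMonoidalCategory.hom_ext (X := B.X) (Y := B'.X)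
    · refine (prodMod_smul_fst g (1 : T ⟶ (prodMod B B').X)).trans ?_
      refine (congrArg (g • ·) (prodMod_one_fst B B' T)).trans ((h.smul_one T g).trans ?_)
      exact (prodMod_one_fst B B' T).symm
    · refine (prodMod_smul_snd g (1 : T ⟶ (prodMod B B').X)).trans ?_
      refine (congrArg (g • ·) (prodMod_one_snd B B' T)).trans ((h'.smul_one T g).trans ?_)
      exact (prodMod_one_snd B B' T).symm
  smul_mul T g x y := by
    apply CartesianMonoidalCategory.hom_ext (X := B.X) (Y := B'.X)
    · refine (prodMod_smul_fst g (x * y)).trans ?_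
      refine (congrArg (g • ·) (prodMod_mul_fst B B' x y)).trans ((h.smul_mul T g _ _).trans ?_)
      refine Eq.trans ?_ (prodMod_mul_fst B B' (g • x) (g • y)).symm
      exact congrArg₂ (· * ·) (prodMod_smul_fst g x).symm (prodMod_smul_fst g y).symm
    · refine (prodMod_smul_snd g (x * y)).trans ?_
      refine (congrArg (g • ·) (prodMod_mul_snd B B' x y)).trans ((h'.smul_mul T g _ _).trans ?_)
      refine Eq.trans ?_ (prodMod_mul_snd B B' (g • x) (g • y)).symm
      exact congrArg₂ (· * ·) (prodMod_smul_snd g x).symm (prodMod_smul_snd g y).symm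
  comm := by
    have := h.comm
    have := h'.comm
    exact inferInstanceAs (IsCommMonObj (B.X ⊗ B'.X))
  lft := by
    have := h.lft
    have := h'.lft
    exact (inferInstance :
      LocallyOfFiniteType (pullback.fst B.X.hom B'.X.hom ≫ B.X.hom))
  qc := by
    have h1 := tensorHom_left (P := @QuasiCompact) h.qc h'.qc
    have h2 : QuasiCompact ((tensorμ B.X B'.X B.X B'.X) ≫ (μ[B.X] ⊗ₘ μ[B'.X])).left := by
      rw [Over.comp_left]
      have h3 : IsIso (tensorμ B.X B'.X B.X B'.X) :=
        ⟨tensorδ B.X B'.X B.X B'.X, tensorμ_tensorδ .., tensorδ_tensorμ ..⟩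
      have h4 : IsIso (tensorμ B.X B'.X B.X B'.X).left :=
        inferInstanceAs (IsIso ((Over.forget _).map (tensorμ B.X B'.X B.X B'.X)))
      exact MorphismProperty.comp_mem @QuasiCompact _ _ inferInstance h1
    exact h2

/-- The multiplication of `B` as an equivariant morphism. -/
def mulHom (B : GSch G) [MonObj B.X] [h : IsGMonoid B] : prodMod B B ⟶ B :=
  letI : IsModHom G (show (prodMod B B).X ⟶ B.X from μ[B.X]) := isModHom_of_points _ (by
    intro T g x
    have e (y : T ⟶ (prodMod B B).X) : (y ≫ μ[B.X] : T ⟶ B.X) =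
        (y ≫ fst B.X B.X) * (y ≫ snd B.X B.X) := by
      rw [Hom.mul_def]
      refine congrArg (· ≫ μ[B.X]) ?_
      apply CartesianMonoidalCategory.hom_ext
      · exact (lift_fst _ _).symm
      · exact (lift_snd _ _).symm
    refine (e _).trans (Eq.trans ?_ (congrArg (g • ·) (e x).symm))
    refine Eq.trans ?_ (h.smul_mul T g _ _).symm
    exact congrArg₂ (· * ·) (prodMod_smul_fst g x) (prodMod_smul_snd g x))
  ⟨μ[B.X]⟩

lemma lft_left {X Y : Sch k} (f : X ⟶ Y) (h : LocallyOfFiniteType X.hom) :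
    LocallyOfFiniteType f.left := by
  have : LocallyOfFiniteType (f.left ≫ Y.hom) := by rwa [Over.w]
  exact locallyOfFiniteType_of_comp f.left Y.hom

instance (B : GSch G) [MonObj B.X] [h : IsGMonoid B] : IsFT (mulHom B).hom where
  locallyOfFiniteType := lft_left _ (by
    have := h.lft
    exact (inferInstance :
      LocallyOfFiniteType (pullback.fst B.X.hom B.X.hom ≫ B.X.hom)))
  quasiCompact := h.qc

/-- The convolution `X × Y ⟶ B × B ⟶ B`. -/
def GVar.conv [IsAlgClosed k] {B : GSch G} [MonObj B.X] [h : IsGMonoid B] (X Y : GVar B) :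
    GVar B :=
  haveI := h.lft
  (X.prod Y).push (mulHom B)

/-- The unit of `B` as an equivariant morphism. -/
def oneHom (B : GSch G) [MonObj B.X] [h : IsGMonoid B] : trivMod (𝟙_ (Sch k)) ⟶ B :=
  letI : IsModHom G (show (trivMod (G := G) (𝟙_ (Sch k))).X ⟶ B.X from η[B.X]) :=
    isModHom_of_points _ (by
    intro T g x
    have e (y : T ⟶ (trivMod (G := G) (𝟙_ (Sch k))).X) : (y ≫ η[B.X] : T ⟶ B.X) = 1 :=
      (congrArg (· ≫ η[B.X]) (toUnit_unique _ _)).trans (Hom.one_def (X := T) (M := B.X)).symm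
    exact (e _).trans ((h.smul_one T g).symm.trans (congrArg (g • ·) (e x).symm)))
  ⟨η[B.X]⟩

variable (G) in
lemma isGood_trivMod (X : Sch k) : IsGood (trivMod (G := G) X) := by
  intro p
  obtain ⟨U, hU, hp, -⟩ := exists_isAffineOpen_mem_and_subset (x := p) (U := ⊤) trivial
  refine ⟨U, hp, hU, fun T g x hx => ?_⟩
  rwa [trivMod_smul]

/-- The unit `Spec k ⟶ B`. -/
def GVar.one {B : GSch G} [MonObj B.X] [h : IsGMonoid B] : GVar B where
  X := trivMod (𝟙_ (Sch k))
  str := oneHom B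
  isReduced := (inferInstance : IsReduced (Spec (.of k)))
  isSeparated := (inferInstance : IsSeparated (𝟙 (Spec (.of k))))
  locallyOfFiniteType := lft_left _ (inferInstance : LocallyOfFiniteType (𝟙 (Spec (.of k))))
  quasiCompact := by
    have := h.lft
    have : IsLocallyNoetherian B.X.left := LocallyOfFiniteType.isLocallyNoetherian B.X.hom
    exact quasiCompact_of_compactSpace (X := Spec (.of k)) (Y := B.X.left) _
  isGood := isGood_trivMod G _
end

section
variable {G : Sch k} [GrpObj G]

lemma range_whiskerRight {X X' : Sch k} (f : X ⟶ X') (Y : Sch k) :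
    Set.range (f ⊗ₘ 𝟙 Y).left = (fst X' Y).left ⁻¹' Set.range f.left := by
  have h := Scheme.Pullback.range_map X.hom Y.hom X'.hom Y.hom f.left (𝟙 Y.left) (𝟙 _)
    (by simp) (by simp)
  refine Eq.trans ?_ (h.trans ?_)
  · rfl
  · simp

instance : MorphismProperty.IsStableUnderComposition (C := Scheme.{u}) @IsClosedImmersion :=
  ⟨fun f g _ _ => IsClosedImmersion.comp f g⟩

lemma GVar.IsCut.prod [IsAlgClosed k] {B B' : GSch G} [LocallyOfFiniteType B.X.hom]
    {X Z U : GVar B} {i : Z.X ⟶ X.X} {j : U.X ⟶ X.X} (h : X.IsCut Z U i j) (Y : GVar B') :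
    (X.prod Y).IsCut (Z.prod Y) (U.prod Y) (prodMap i (𝟙 Y.X)) (prodMap j (𝟙 Y.X)) where
  closed_comp := by
    apply Mod.Hom.ext
    refine (tensorHom_comp_tensorHom i.hom (𝟙 Y.X.X) X.str.hom Y.str.hom).trans ?_
    exact congrArg₂ (· ⊗ₘ ·) (congrArg Mod.Hom.hom h.closed_comp) (Category.id_comp _)
  open_comp := by
    apply Mod.Hom.ext
    refine (tensorHom_comp_tensorHom j.hom (𝟙 Y.X.X) X.str.hom Y.str.hom).trans ?_
    exact congrArg₂ (· ⊗ₘ ·) (congrArg Mod.Hom.hom h.open_comp) (Category.id_comp _)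
  isClosedImmersion := tensorHom_left (P := @IsClosedImmersion) h.isClosedImmersion
    (inferInstance : IsClosedImmersion (𝟙 Y.X.X.left))
  isOpenImmersion := tensorHom_left (P := @IsOpenImmersion) h.isOpenImmersion
    (inferInstance : IsOpenImmersion (𝟙 Y.X.X.left))
  range_eq := by
    refine (range_whiskerRight j.hom Y.X.X).trans (Eq.trans ?_
      (congrArg (·ᶜ) (range_whiskerRight i.hom Y.X.X)).symm)
    rw [h.range_eq]
    rfl

/-- The homomorphism `[X] ↦ [X × Y]`. -/
def K0.prodRight [IsAlgClosed k] {B B' : GSch G} [LocallyOfFiniteType B.X.hom] (Y : GVar B') :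
    K0 B →+ K0 (prodMod B B') :=
  K0.lift (fun X => K0.mk (X.prod Y)) fun _ _ _ _ _ h => K0.mk_eq (h.prod Y)

/-- Restricting a trivial action gives the trivial action (the underlying morphism is the
identity). -/
def trivRes {H : Sch k} [GrpObj H] (φ : H ⟶ G) [IsMonHom φ] (S : Sch k) :
    (CategoryTheory.Mod.comap φ).obj (trivMod (G := G) S) ⟶ trivMod (G := H) S :=
  letI : IsModHom H (show ((CategoryTheory.Mod.comap φ).obj (trivMod (G := G) S)).X ⟶
      (trivMod (G := H) S).X from 𝟙 S) := isModHom_of_points _ (by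
    intro T g x
    have e : (x ≫ 𝟙 S : T ⟶ (trivMod (G := H) S).X) = x := Category.comp_id (X := T) (Y := S) x
    refine (Category.comp_id (X := T) (Y := S) _).trans ?_
    refine (comap_smul φ (trivMod S) g x).trans ((trivMod_smul _ _).trans ?_)
    exact Eq.trans (trivMod_smul g (show T ⟶ (trivMod (G := H) S).X from x)).symm
      (congrArg (g • ·) e.symm))
  ⟨𝟙 S⟩

instance {X : Sch k} : IsFT (𝟙 X) where
  locallyOfFiniteType := (inferInstance : LocallyOfFiniteType (𝟙 X.left))
  quasiCompact := (inferInstance : QuasiCompact (𝟙 X.left))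

instance {H : Sch k} [GrpObj H] (φ : H ⟶ G) [IsMonHom φ] (S : Sch k) :
    IsFT (trivRes φ S).hom := inferInstanceAs (IsFT (𝟙 S))

/-- Restriction of the acting group along `φ : H ⟶ G`, over a base with trivial action. -/
def K0.resTriv {H : Sch k} [GrpObj H] (φ : H ⟶ G) [IsMonHom φ] (S : Sch k) :
    K0 (trivMod (G := G) S) →+ K0 (trivMod (G := H) S) :=
  (K0.push (trivRes φ S)).comp (K0.res φ _)

/-- `Z` is the (reduced) fibre of `X` over the section `s : S ⟶ B`, as a variety over `S` with the
action of `H` that is induced by `φ : H ⟶ G`. -/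
def IsFiber {H : Sch k} [GrpObj H] (φ : H ⟶ G) [IsMonHom φ] {B : GSch G} {S : Sch k}
    (s : S ⟶ B.X) (X : GVar B) (Z : GVar (trivMod (G := H) S)) : Prop :=
  ∃ i : Z.X ⟶ (X.res φ).X, IsClosedImmersion i.hom.left ∧
    (show Z.X.X ⟶ X.X.X from i.hom) ≫ X.str.hom = (show Z.X.X ⟶ S from Z.str.hom) ≫ s ∧
    Set.range i.hom.left = X.str.hom.left ⁻¹' Set.range s.left

/-- The permutation of the factors of `X ^ n` that is given by `e`. -/
abbrev powPerm (X : Sch k) {n : ℕ} (e : Equiv.Perm (Fin n)) :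
    (∏ᶜ fun _ : Fin n => X) ⟶ ∏ᶜ fun _ : Fin n => X :=
  Pi.lift fun i => Pi.π _ (e i)

/-- `q : X ^ n ⟶ Q` exhibits `Q` as the symmetric power `Sym^n X`, that is, as the quotient of
`X ^ n` by the permutations of the factors: `q` is affine and invariant, the functions on `Q` are the
invariant functions on `X ^ n`, the action of `G` on `Q` is induced by the diagonal one on `X ^ n`,
and the morphism `Q ⟶ B` is induced by `X ^ n ⟶ B ^ n ⟶ B`. -/
structure IsSymPower {B : GSch G} [MonObj B.X] [h : IsGMonoid B] (n : ℕ) (X Q : GVar B)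
    (q : (∏ᶜ fun _ : Fin n => X.X.X) ⟶ Q.X.X) : Prop where
  perm_comp : ∀ e : Equiv.Perm (Fin n), powPerm X.X.X e ≫ q = q
  isAffineHom : IsAffineHom q.left
  existsUnique_app : ∀ (V : Q.X.X.left.Opens) (f : Γ((∏ᶜ fun _ : Fin n => X.X.X).left, q.left ⁻¹ᵁ V)),
    (∀ (e : Equiv.Perm (Fin n)) (hV : q.left ⁻¹ᵁ V ≤ (powPerm X.X.X e).left ⁻¹ᵁ (q.left ⁻¹ᵁ V)),
      (powPerm X.X.X e).left.appLE (q.left ⁻¹ᵁ V) (q.left ⁻¹ᵁ V) hV f = f) →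
    ∃! g : Γ(Q.X.X.left, V), q.left.app V g = f
  equivariant : ∀ (T : Sch k) (g : T ⟶ G) (x y : T ⟶ ∏ᶜ fun _ : Fin n => X.X.X),
    (∀ i, y ≫ Pi.π _ i = g • (x ≫ Pi.π _ i)) → y ≫ q = g • (x ≫ q)
  comp_str : haveI := h.comm
    q ≫ Q.str.hom = ∏ i, (Pi.π (fun _ : Fin n => X.X.X) i ≫ X.str.hom)

/-- The structure of a commutative ring on the abelian group `A` with operations `σ n` such that
`σ_a(t) = ∑ σ n a * t ^ n` satisfies `σ_a(t) = 1 + a * t` modulo `t ^ 2`, `σ_0(t) = 1` and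
`σ_{a + b}(t) = σ_a(t) * σ_b(t)`. -/
structure LambdaRingStr (A : Type*) [AddCommGroup A] where
  one : A
  mul : A →+ A →+ A
  σ : ℕ → A → A
  mul_comm : ∀ a b, mul a b = mul b a
  mul_assoc : ∀ a b c, mul (mul a b) c = mul a (mul b c)
  one_mul : ∀ a, mul one a = a
  σ_zero : ∀ a, σ 0 a = one
  σ_one : ∀ a, σ 1 a = a
  σ_map_zero : ∀ n, σ (n + 1) 0 = 0
  σ_add : ∀ n a b, σ n (a + b) = ∑ p ∈ Finset.HasAntidiagonal.antidiagonal n, mul (σ p.1 a) (σ p.2 b)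

namespace LambdaRingStr
variable {A A' : Type*} [AddCommGroup A] [AddCommGroup A']

/-- Homomorphisms of `λ`-rings. -/
structure IsHom (L : LambdaRingStr A) (L' : LambdaRingStr A') (f : A →+ A') : Prop where
  map_one : f L.one = L'.one
  map_mul : ∀ a b, f (L.mul a b) = L'.mul (f a) (f b)
  map_σ : ∀ n a, f (L.σ n a) = L'.σ n (f a)

/-- An ideal that is preserved by `σ n` for all `n > 0`. -/
structure IsLambdaIdeal (L : LambdaRingStr A) (I : AddSubgroup A) : Prop where
  mul_mem : ∀ a, ∀ b ∈ I, L.mul a b ∈ I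
  σ_mem : ∀ n, 0 < n → ∀ b ∈ I, L.σ n b ∈ I

/-- The product is the convolution, and `σ n` is given by the symmetric powers of varieties. -/
structure IsConvSym [IsAlgClosed k] {B : GSch G} [MonObj B.X] [IsGMonoid B]
    (L : LambdaRingStr (K0 B)) : Prop where
  one_eq : L.one = K0.mk GVar.one
  mul_mk : ∀ X Y : GVar B, L.mul (K0.mk X) (K0.mk Y) = K0.mk (X.conv Y)
  σ_mk : ∀ (n : ℕ) (X Q : GVar B) (q : (∏ᶜ fun _ : Fin n => X.X.X) ⟶ Q.X.X),
    IsSymPower n X Q q → L.σ n (K0.mk X) = K0.mk Q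

end LambdaRingStr
end

section
variable (S : Sch k)

/-- The monoid `S × 𝔸¹` with `g • (u, z) = (u, g ^ d * z)`. -/
abbrev A1S (d : ℕ) : GSch (Gm k) := prodMod (trivMod S) (A1w d)
/-- The complement `S × 𝔾ₘ` of the zero section in `S × 𝔸¹`. -/
abbrev GlS (d : ℕ) : GSch (Gm k) := prodMod (trivMod S) (GmW d)

instance (X : Sch k) [LocallyOfFiniteType X.hom] : LocallyOfFiniteType (trivMod (G := Gm k) X).X.hom :=
  ‹_›

lemma isGood_A1w (d : ℕ) : IsGood (A1w (k := k) d) := by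
  intro p
  have h : IsAffine (A1 k).left := isAffine_of_isAffineHom (A1 k).hom
  exact ⟨⊤, trivial, isAffineOpen_top (A1 k).left, fun T g x hx => by simp⟩

/-- The affine line with the action of weight `d`, as a variety over itself. -/
def a1Var [IsAlgClosed k] (d : ℕ) : GVar (A1w (k := k) d) where
  X := A1w d
  str := 𝟙 _
  isReduced := (inferInstance : IsReduced 𝔸(PUnit.{u + 1}; Spec (.of k)))
  isSeparated := (inferInstance : IsSeparated (A1 k).hom)
  locallyOfFiniteType := (inferInstance : LocallyOfFiniteType (𝟙 (A1 k).left))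
  quasiCompact := (inferInstance : QuasiCompact (𝟙 (A1 k).left))
  isGood := isGood_A1w d

/-- The pullback `[Y ⟶ S] ↦ [Y × 𝔸¹ ⟶ S × 𝔸¹]`, with `g • (y, z) = (g • y, g ^ d * z)`. -/
def pullA1 [IsAlgClosed k] [LocallyOfFiniteType S.hom] (d : ℕ) :
    K0 (trivMod (G := Gm k) S) →+ K0 (A1S S d) :=
  K0.prodRight (a1Var d)

/-- The inclusion `S × 𝔾ₘ ⟶ S × 𝔸¹`. -/
def glToA1 (d : ℕ) : GlS S d ⟶ A1S S d := prodMap (𝟙 _) (gmToA1 d)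

instance : QuasiCompact (Gm k).hom := inferInstanceAs (QuasiCompact (Spec.map _))
instance : LocallyOfFiniteType (Gm k).hom := by
  change LocallyOfFiniteType (Spec.map (CommRingCat.ofHom (algebraMap k (AddMonoidAlgebra k ℤ))))
  rw [HasRingHomProperty.Spec_iff (P := @LocallyOfFiniteType)]
  exact RingHom.finiteType_algebraMap.2 inferInstance

instance (d : ℕ) : IsFT (gmToA1 (k := k) d).hom where
  locallyOfFiniteType := lft_left (X := Gm k) (Y := A1 k) _ inferInstance
  quasiCompact := by
    have : QuasiCompact ((A1.mk (Diag.chi 1 (𝟙 (Gm k)))).left ≫ (A1 k).hom) := by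
      rw [Over.w]
      infer_instance
    exact (.of_comp (A1.mk (Diag.chi 1 (𝟙 (Gm k)))).left (A1 k).hom :
      QuasiCompact (A1.mk (Diag.chi 1 (𝟙 (Gm k)))).left)

instance (d : ℕ) : IsFT (glToA1 S d).hom where
  locallyOfFiniteType := tensorHom_left (P := @LocallyOfFiniteType)
    (inferInstance : LocallyOfFiniteType (𝟙 S.left))
    (inferInstance : IsFT (gmToA1 (k := k) d).hom).locallyOfFiniteType
  quasiCompact := tensorHom_left (P := @QuasiCompact)
    (inferInstance : QuasiCompact (𝟙 S.left))
    (inferInstance : IsFT (gmToA1 (k := k) d).hom).quasiCompact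

/-- The push-forward along `S × 𝔾ₘ ⟶ S × 𝔸¹`. -/
def inclGl (d : ℕ) : K0 (GlS S d) →+ K0 (A1S S d) := K0.push (glToA1 S d)

/-- The homomorphism `g ↦ g ^ m` of `𝔾ₘ`. -/
abbrev gmPow (k : Type u) [Field k] (m : ℕ) : Gm k ⟶ Gm k := Diag.map k (m • AddMonoidHom.id ℤ)

/-- The inclusion of `μ_d` into `𝔾ₘ`. -/
abbrev muToGm (k : Type u) [Field k] (d : ℕ) : Mu k d ⟶ Gm k := Diag.map k (Int.castAddHom (ZMod d))

/-- The homomorphism of character groups that is dual to `muPow`, given by `1 ↦ d' / d`. -/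
def zmodMul {d d' : ℕ} (h : d ∣ d') : ZMod d →+ ZMod d' :=
  ZMod.lift d ⟨(d' / d) • Int.castAddHom (ZMod d'), by
    have : ((d' / d * d : ℕ) : ZMod d') = 0 := by rw [Nat.div_mul_cancel h]; simp
    simpa using this⟩

/-- The homomorphism `μ_{d'} ⟶ μ_d`, `ζ ↦ ζ ^ (d' / d)`. -/
abbrev muPow (k : Type u) [Field k] {d d' : ℕ} (h : d ∣ d') : Mu k d' ⟶ Mu k d :=
  Diag.map k (zmodMul h)

/-- The zero section `u ↦ (u, 0)`. -/
def zeroSec (d : ℕ) : S ⟶ (A1S S d).X := lift (𝟙 S) (A1.mk 0)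
/-- The section `u ↦ (u, 1)` of `S × 𝔸¹`. -/
def oneSec (d : ℕ) : S ⟶ (A1S S d).X := lift (𝟙 S) (A1.mk 1)
/-- The unit section `u ↦ (u, 1)` of `S × 𝔾ₘ`. -/
def unitSec (d : ℕ) : S ⟶ (GlS S d).X := lift (𝟙 S) (1 : S ⟶ Gm k)

/-- The affine line with weight `d`, acted on through `g ↦ g ^ (d' / d)`, is the affine line with
weight `d'` (the underlying morphism is the identity). -/
def a1wRes {d d' : ℕ} (h : d ∣ d') :
    (CategoryTheory.Mod.comap (gmPow k (d' / d))).obj (A1w d) ⟶ A1w d' :=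
  letI : IsModHom (Gm k) (show ((CategoryTheory.Mod.comap (gmPow k (d' / d))).obj (A1w d)).X ⟶
      (A1w d').X from 𝟙 (A1 k)) := isModHom_of_points _ (by
    intro T g x
    have e : (x ≫ 𝟙 (A1 k) : T ⟶ (A1w (k := k) d').X) = x :=
      Category.comp_id (X := T) (Y := A1 k) x
    refine (Category.comp_id (X := T) (Y := A1 k) _).trans ?_
    refine (comap_smul _ (A1w d) g x).trans (Eq.trans ?_ (congrArg (g • ·) e.symm))
    apply A1.ext
    refine (A1w_smul _ _).trans (Eq.trans ?_ (A1w_smul _ _).symm)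
    refine congrArg (· * _) ?_
    rw [Diag.chi_map]
    have e2 : ((d' / d) • AddMonoidHom.id ℤ) 1 = (d' / d) • (1 : ℤ) := rfl
    rw [e2, Diag.chi_nsmul, ← pow_mul, Nat.div_mul_cancel h])
  ⟨𝟙 (A1 k)⟩

/-- Restriction of the group is compatible with products (the underlying morphism is the identity). -/
def comapProd {G H : Sch k} [GrpObj G] [GrpObj H] (φ : H ⟶ G) [IsMonHom φ] (X Y : GSch G) :
    (CategoryTheory.Mod.comap φ).obj (prodMod X Y) ⟶
      prodMod ((CategoryTheory.Mod.comap φ).obj X) ((CategoryTheory.Mod.comap φ).obj Y) :=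
  letI : IsModHom H (show ((CategoryTheory.Mod.comap φ).obj (prodMod X Y)).X ⟶
      (prodMod ((CategoryTheory.Mod.comap φ).obj X) ((CategoryTheory.Mod.comap φ).obj Y)).X
      from 𝟙 (X.X ⊗ Y.X)) := isModHom_of_points _ (by
    intro T g x
    have e : (x ≫ 𝟙 (X.X ⊗ Y.X) : T ⟶ X.X ⊗ Y.X) = x := Category.comp_id _
    refine (Category.comp_id (X := T) (Y := X.X ⊗ Y.X) _).trans ?_
    refine (comap_smul φ (prodMod X Y) g x).trans (Eq.trans ?_ (congrArg (fun y : T ⟶ (prodMod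
      ((CategoryTheory.Mod.comap φ).obj X) ((CategoryTheory.Mod.comap φ).obj Y)).X => g • y)
      e.symm))
    apply CartesianMonoidalCategory.hom_ext (X := X.X) (Y := Y.X)
    · refine (prodMod_smul_fst (X := X) (Y := Y) (g ≫ φ) x).trans ?_
      refine Eq.trans ?_ (prodMod_smul_fst (X := (CategoryTheory.Mod.comap φ).obj X)
        (Y := (CategoryTheory.Mod.comap φ).obj Y) g x).symm
      exact (comap_smul φ X g _).symm
    · refine (prodMod_smul_snd (X := X) (Y := Y) (g ≫ φ) x).trans ?_
      refine Eq.trans ?_ (prodMod_smul_snd (X := (CategoryTheory.Mod.comap φ).obj X)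
        (Y := (CategoryTheory.Mod.comap φ).obj Y) g x).symm
      exact (comap_smul φ Y g _).symm)
  ⟨𝟙 (X.X ⊗ Y.X)⟩

/-- `S × 𝔸¹` with weight `d`, acted on through `g ↦ g ^ (d' / d)`, is `S × 𝔸¹` with weight `d'` (the
underlying morphism is the identity). -/
def a1Res {d d' : ℕ} (h : d ∣ d') :
    (CategoryTheory.Mod.comap (gmPow k (d' / d))).obj (A1S S d) ⟶ A1S S d' :=
  comapProd _ _ _ ≫ prodMap (trivRes _ S) (a1wRes h)

instance {X Y Z : Sch k} (f : X ⟶ Y) (g : Y ⟶ Z) [hf : IsFT f] [hg : IsFT g] : IsFT (f ≫ g) where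
  locallyOfFiniteType :=
    MorphismProperty.comp_mem _ _ _ hf.locallyOfFiniteType hg.locallyOfFiniteType
  quasiCompact := MorphismProperty.comp_mem _ _ _ hf.quasiCompact hg.quasiCompact

instance {X Y X' Y' : Sch k} (f : X ⟶ Y) (g : X' ⟶ Y') [hf : IsFT f] [hg : IsFT g] :
    IsFT (f ⊗ₘ g) where
  locallyOfFiniteType := tensorHom_left (P := @LocallyOfFiniteType) hf.1 hg.1
  quasiCompact := tensorHom_left (P := @QuasiCompact) hf.2 hg.2

instance {d d' : ℕ} (h : d ∣ d') : IsFT (a1Res S h).hom :=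
  inferInstanceAs (IsFT (𝟙 (S ⊗ A1 k) ≫ (𝟙 S ⊗ₘ 𝟙 (A1 k))))

/-- For `d ∣ d'`, the map that replaces the action of `g` by the action of `g ^ (d' / d)`. -/
def transA1 {d d' : ℕ} (h : d ∣ d') : K0 (A1S S d) →+ K0 (A1S S d') :=
  (K0.push (a1Res S h)).comp (K0.res (gmPow k (d' / d)) _)

/-- The group `K₀^{μ_d}(Var/S)`, for the trivial action of `μ_d` on `S`. -/
abbrev KMu (d : ℕ) : Type (u + 1) := K0 (trivMod (G := Mu k d) S)
/-- For `d ∣ d'`, the map that lets `μ_{d'}` act through `ζ ↦ ζ ^ (d' / d)`. -/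
abbrev transMu {d d' : ℕ} (h : d ∣ d') : KMu S d →+ KMu S d' := K0.resTriv (muPow k h) S

end

/-- The positive integers, ordered by divisibility. -/
def DivPos : Type := {d : ℕ // 0 < d}
instance : CoeOut DivPos ℕ := ⟨Subtype.val⟩
instance : DecidableEq DivPos := inferInstanceAs (DecidableEq {d : ℕ // 0 < d})
instance : Preorder DivPos where
  le d d' := (d : ℕ) ∣ d'
  le_refl d := dvd_refl (d : ℕ)
  le_trans _ _ _ h h' := Nat.dvd_trans h h'

/-- The direct limit of the groups `K₀^{μ_d}(Var/S)` over all `d > 0`. -/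
abbrev KMuHat (S : Sch k) : Type (u + 1) :=
  AddCommGroup.DirectLimit (fun d : DivPos => KMu S d) fun _ _ h => transMu S h

/-- The canonical map to the direct limit. -/
def KMuHat.of (S : Sch k) (d : DivPos) : KMu S d →+ KMuHat S :=
  AddCommGroup.DirectLimit.of (fun d : DivPos => KMu S d) (fun _ _ h => transMu S h) d

end

end EquivariantMotives

open EquivariantMotives

open CategoryTheory.Category
namespace EquivariantMotives
universe u
noncomputable section
set_option linter.unusedSectionVars false
variable {k : Type u} [Field k] [IsAlgClosed k] [CharZero k]

section
notation:max "triv(" K ")" => trivMod (G := K)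
notation "LFT" => LocallyOfFiniteType
lemma bijective_of_eq {α : Type*} {f : α → α} (h : ∀ x, f x = x) : Function.Bijective f :=
  funext h ▸ Function.bijective_id

lemma assoc' {C : Type*} [Category C] {W X Y Z : C} {f : W ⟶ X} {g : X ⟶ Y} {h : Y ⟶ Z} :
    (f ≫ g) ≫ h = f ≫ g ≫ h :=
  assoc _ _ _

/-! ### Points over an algebraically closed field -/

section LiftImmersion

lemma exists_lift_of_isImmersion {X Z T : Scheme.{u}} (j : Z ⟶ X) [IsImmersion j] (f : T ⟶ X)
    [IsReduced T] (h : Set.range f ⊆ Set.range j) : ∃ f' : T ⟶ Z, f' ≫ j = f := by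
  have hs : Function.Surjective (pullback.snd j f) := by
    intro t
    obtain ⟨z, hz⟩ := h ⟨t, rfl⟩
    obtain ⟨p, -, hp⟩ := Scheme.Pullback.exists_preimage_pullback z t hz
    exact ⟨p, hp⟩
  have : Surjective (pullback.snd j f) := ⟨hs⟩
  have : IsClosedImmersion (pullback.snd j f) :=
    .of_isPreimmersion _ (by rw [hs.range_eq]; exact isClosed_univ)
  have := isIso_of_isClosedImmersion_of_surjective (pullback.snd j f)
  exact ⟨inv (pullback.snd j f) ≫ pullback.fst j f, by
    rw [assoc, pullback.condition, IsIso.inv_hom_id_assoc]⟩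

lemma eq_univ_of_closedPoints_subset {X : Type*} [TopologicalSpace X] [JacobsonSpace X] {s : Set X}
    (hs : IsLocallyClosed s) (h : closedPoints X ⊆ s) : s = Set.univ := by
  by_contra hne
  have h1 : closure s = Set.univ := by
    rw [Set.eq_univ_iff_forall]
    intro x
    have := JacobsonSpace.closure_inter_closedPoints_eq_closure (X := X)
      isClosed_univ.isLocallyClosed
    rw [Set.univ_inter, closure_univ] at this
    exact closure_mono h (this ▸ Set.mem_univ x)
  have ho : IsOpen s := by
    have := hs.isOpen_coborder
    rwa [coborder_eq_union_closure_compl, h1, Set.compl_univ, Set.union_empty] at this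
  have hne' : (sᶜ).Nonempty := by rwa [Set.nonempty_compl]
  have h2 := JacobsonSpace.closure_inter_closedPoints_eq_closure (ho.isClosed_compl.isLocallyClosed)
  have h3 : sᶜ ∩ closedPoints X = ∅ := by
    ext x
    simp only [Set.mem_inter_iff, Set.mem_compl_iff, Set.mem_empty_iff_false, iff_false, not_and]
    exact fun hx hc => hx (h hc)
  rw [h3, closure_empty] at h2
  exact (hne'.mono subset_closure).ne_empty h2.symm

end LiftImmersion

/-- The `k`-points of a `k`-scheme. -/
abbrev Pt (X : Sch k) : Type u := 𝟙_ (Sch k) ⟶ X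

def pt0 : (𝟙_ (Sch k)).left := (IsLocalRing.closedPoint k : Spec (.of k))

/-- The point underlying a `k`-point. -/
def Pt.val {X : Sch k} (x : Pt X) : X.left := x.left pt0

lemma Pt.val_comp {X Y : Sch k} (x : Pt X) (f : X ⟶ Y) : Pt.val (x ≫ f) = f.left x.val := rfl

instance : Subsingleton (𝟙_ (Sch k)).left := inferInstanceAs (Subsingleton (Spec (.of k)))

lemma Pt.range_left {X : Sch k} (x : Pt X) : Set.range x.left = {x.val} := by
  ext y
  constructor
  · rintro ⟨p, rfl⟩
    rw [Subsingleton.elim p pt0]; rfl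
  · rintro rfl
    exact ⟨pt0, rfl⟩

section pts

lemma exists_pt_of_isClosed {X : Sch k} [LFT X.hom] {x : X.left}
    (hx : IsClosed {x}) : ∃ y : Pt X, y.val = x :=
  ⟨Over.homMk (pointOfClosedPoint X.hom x hx) (pointOfClosedPoint_comp X.hom x hx),
    pointOfClosedPoint_apply X.hom x hx _⟩

lemma Pt.ext_val {X : Sch k} [LFT X.hom] {x y : Pt X} (h : x.val = y.val) : x = y :=
  Over.OverMorphism.ext (ext_of_apply_closedPoint_eq X.hom (Over.w x) (Over.w y) h)

lemma eq_univ_of_forall_pt {X : Sch k} [LFT X.hom] {s : Set X.left}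
    (hs : IsLocallyClosed s) (h : ∀ x : Pt X, x.val ∈ s) : s = Set.univ := by
  have : JacobsonSpace X.left := LocallyOfFiniteType.jacobsonSpace X.hom
  refine eq_univ_of_closedPoints_subset hs fun x hx => ?_
  obtain ⟨y, rfl⟩ := exists_pt_of_isClosed hx
  exact h y

lemma subset_of_forall_pt {X : Sch k} [LFT X.hom] {s t : Set X.left}
    (hs : IsLocallyClosed s) (ht : IsClosed t) (h : ∀ x : Pt X, x.val ∈ s → x.val ∈ t) :
    s ⊆ t := by
  have : JacobsonSpace X.left := LocallyOfFiniteType.jacobsonSpace X.hom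
  have h2 := JacobsonSpace.closure_inter_closedPoints_eq_closure hs
  refine subset_closure.trans (h2 ▸ closure_minimal ?_ ht)
  rintro x ⟨hx, hc⟩
  obtain ⟨y, rfl⟩ := exists_pt_of_isClosed hc
  exact h y hx

lemma exists_pt_mem {X : Sch k} [LFT X.hom] {s : Set X.left}
    (hs : IsLocallyClosed s) (h : s.Nonempty) : ∃ x : Pt X, x.val ∈ s := by
  by_contra! hc
  have := subset_of_forall_pt hs isClosed_empty fun x hx => (hc x hx).elim
  exact h.ne_empty (Set.subset_empty_iff.1 this)

lemma subset_of_forall_pt' {X : Sch k} [LFT X.hom] {s t : Set X.left}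
    (hs : IsLocallyClosed s) (ht : IsOpen t) (h : ∀ x : Pt X, x.val ∈ s → x.val ∈ t) :
    s ⊆ t := by
  by_contra hc
  rw [← Set.sdiff_eq_empty.not, ← Ne, ← Set.nonempty_iff_ne_empty] at hc
  obtain ⟨x, hx, hx'⟩ := exists_pt_mem (hs.inter ht.isClosed_compl.isLocallyClosed) hc
  exact hx' (h x hx)

lemma hom_ext_pt {X Y : Sch k} [LFT X.hom] [IsReduced X.left] {f g : X ⟶ Y}
    (h : ∀ x : Pt X, x ≫ f = x ≫ g) : f = g := by
  apply Over.OverMorphism.ext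
  let e := equalizer.ι f.left g.left
  have hr : Set.range e = Set.univ := by
    refine eq_univ_of_forall_pt (Scheme.Hom.isLocallyClosed_range e) fun x => ?_
    have hx := congrArg (fun t => t.left) (h x)
    simp only [Over.comp_left] at hx
    exact ⟨(equalizer.lift x.left hx) pt0, by rw [← Scheme.Hom.comp_apply, equalizer.lift_ι]; rfl⟩
  obtain ⟨f', hf'⟩ := exists_lift_of_isImmersion e (𝟙 X.left) (by rw [hr]; exact Set.subset_univ _)
  rw [← id_comp f.left, ← id_comp g.left, ← hf', assoc, assoc, equalizer.condition]

lemma exists_lift_pt {X Z T : Sch k} [LFT T.hom] [IsReduced T.left] (j : Z ⟶ X)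
    [IsImmersion j.left] (f : T ⟶ X) (h : ∀ t : Pt T, ∃ z : Pt Z, z ≫ j = t ≫ f) :
    ∃ f' : T ⟶ Z, f' ≫ j = f := by
  have hr : f.left ⁻¹' Set.range j.left = Set.univ := by
    refine eq_univ_of_forall_pt
      ((Scheme.Hom.isLocallyClosed_range j.left).preimage f.left.continuous) fun x => ?_
    obtain ⟨z, hz⟩ := h x
    exact ⟨z.val, by rw [← Pt.val_comp, hz]; rfl⟩
  obtain ⟨f', hf'⟩ := exists_lift_of_isImmersion j.left f.left (by
    rintro _ ⟨t, rfl⟩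
    have : t ∈ f.left ⁻¹' Set.range j.left := hr ▸ Set.mem_univ t
    exact this)
  refine ⟨Over.homMk f' ?_, Over.OverMorphism.ext hf'⟩
  have h1 := Over.w f
  have h2 := Over.w j
  rw [← hf', assoc] at h1
  rw [← h1, h2]

lemma mono_of_left {X Z : Sch k} (j : Z ⟶ X) [Mono j.left] : Mono j :=
  (Over.forget (Spec (.of k))).mono_of_mono_map ‹_›

lemma exists_pt_lift {X Z : Sch k} (j : Z ⟶ X) [IsImmersion j.left] (x : Pt X)
    (h : x.val ∈ Set.range j.left) : ∃ z : Pt Z, z ≫ j = x := by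
  have : IsReduced (𝟙_ (Sch k)).left := (inferInstance : IsReduced (Spec (.of k)))
  obtain ⟨f', hf'⟩ := exists_lift_of_isImmersion j.left x.left
    (by rw [Pt.range_left]; simpa using h)
  refine ⟨Over.homMk f' ?_, Over.OverMorphism.ext hf'⟩
  have h1 := Over.w x
  have h2 := Over.w j
  rw [← hf', assoc] at h1
  rw [← h1, h2]

lemma mem_range_iff_pt {X Z : Sch k} (j : Z ⟶ X) [IsImmersion j.left] (x : Pt X) :
    x.val ∈ Set.range j.left ↔ ∃ z : Pt Z, z ≫ j = x :=
  ⟨exists_pt_lift j x, by rintro ⟨z, rfl⟩; exact ⟨z.val, rfl⟩⟩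

lemma surjective_of_pt {X Y : Sch k} [LFT X.hom] [LFT Y.hom]
    (f : X ⟶ Y) [IsImmersion f.left] (h : ∀ y : Pt Y, ∃ x : Pt X, x ≫ f = y) :
    Function.Surjective f.left := by
  rw [← Set.range_eq_univ]
  exact eq_univ_of_forall_pt (Scheme.Hom.isLocallyClosed_range f.left)
    fun y => (mem_range_iff_pt f y).2 (h y)

end pts

/-! ### Values of functions at points -/

lemma preimage_basicOpen_fnPull {X Y : Sch k} (f : X ⟶ Y) (a : Γ(Y.left, ⊤)) :
    f.left ⁻¹ᵁ Y.left.basicOpen a = X.left.basicOpen (fnPull f a) :=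
  Scheme.preimage_basicOpen_top f.left a

lemma mem_basicOpen_iff_fnPull {X : Sch k} (x : Pt X) (a : Γ(X.left, ⊤)) :
    x.val ∈ X.left.basicOpen a ↔ fnPull x a ≠ 0 := by
  have h : x.val ∈ X.left.basicOpen a ↔ pt0 ∈ (𝟙_ (Sch k)).left.basicOpen (fnPull x a) := by
    rw [← preimage_basicOpen_fnPull]; rfl
  rw [h]
  have hr : IsReduced (𝟙_ (Sch k)).left := (inferInstance : IsReduced (Spec (.of k)))
  rw [← not_iff_not, not_not, ← basicOpen_eq_bot_iff]
  constructor
  · intro h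
    ext p
    rw [Subsingleton.elim p pt0]
    exact iff_of_false h (by simp)
  · intro h
    rw [h]; simp

lemma fn_ext_pt {X : Sch k} [LFT X.hom] [IsReduced X.left] {a b : Γ(X.left, ⊤)}
    (h : ∀ x : Pt X, fnPull x a = fnPull x b) : a = b := by
  rw [← A1.coord_mk a, ← A1.coord_mk b]
  congr 1
  apply hom_ext_pt
  intro x
  apply A1.ext
  rw [A1.coord_comp, A1.coord_comp, A1.coord_mk, A1.coord_mk, h]
end

section
/-! ### Bijections on points are generically isomorphisms -/

lemma surjective_algebraMap_of_unique_hom {K D : Type u} [Field K] [CharZero K] [CommRing D]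
    [_root_.IsReduced D] [Algebra K D] (H : ∀ (F : Type u) [Field F] (f g : D →+* F),
      f.comp (algebraMap K D) = g.comp (algebraMap K D) → f = g) :
    Function.Surjective (algebraMap K D) := fun c => by
  cases subsingleton_or_nontrivial D
  · exact ⟨0, Subsingleton.elim _ _⟩
  obtain ⟨P, hP⟩ := Ideal.exists_maximal D
  let _ := Ideal.Quotient.field P
  have : Nonempty (D ⧸ P →+* AlgebraicClosure (D ⧸ P)) := ⟨algebraMap _ _⟩
  have : IsPurelyInseparable K (D ⧸ P) :=
    IsPurelyInseparable.of_injective_comp_algebraMap K _ (AlgebraicClosure (D ⧸ P))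
      fun f g h => Ideal.Quotient.ringHom_ext (H _ (f.comp (Ideal.Quotient.mk P)) (g.comp _) h)
  let i := RingEquiv.ofBijective (algebraMap K (D ⧸ P)) ⟨(algebraMap K (D ⧸ P)).injective,
    IsPurelyInseparable.surjective_algebraMap_of_isSeparable K _⟩
  let e : D →+* K := (i.symm : D ⧸ P →+* K).comp (Ideal.Quotient.mk P)
  refine ⟨e c, (sub_eq_zero.1 (IsNilpotent.eq_zero (nilpotent_iff_mem_prime.2 fun Q hQ => ?_))).symm⟩
  let ψ : D →+* FractionRing (D ⧸ Q) := (algebraMap (D ⧸ Q) _).comp (Ideal.Quotient.mk Q)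
  have h := H _ ψ ((ψ.comp (algebraMap K D)).comp e)
    (RingHom.ext fun x => congrArg (fun y => ψ (algebraMap K D y)) (i.symm_apply_apply x).symm)
  rw [← Ideal.Quotient.eq_zero_iff_mem, ← (IsFractionRing.injective (D ⧸ Q)
    (FractionRing (D ⧸ Q))).eq_iff, map_zero, map_sub, map_sub, sub_eq_zero]
  exact congrArg (fun f => f c) h

lemma exists_mul_mem_range_of_unique_hom {A C : Type u} [CommRing A] [IsDomain A] [CommRing C]
    [_root_.IsReduced C] [CharZero A] [Algebra A C] (H : ∀ (F : Type u) [Field F] (f g : C →+* F),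
      f.comp (algebraMap A C) = g.comp (algebraMap A C) → f = g) (c : C) :
    ∃ a b : A, a ≠ 0 ∧ algebraMap A C a * c = algebraMap A C b := by
  let N := (nonZeroDivisors A).map (algebraMap A C)
  let D := Localization N
  let g : FractionRing A →+* D := IsLocalization.map D (algebraMap A C) (nonZeroDivisors A).le_comap_map
  have hg (a : A) : g (algebraMap A _ a) = algebraMap C D (algebraMap A C a) := IsLocalization.map_eq _ a
  have : _root_.IsReduced D := isReduced_localizationPreserves N D ‹_›
  have : CharZero (FractionRing A) := charZero_of_injective_algebraMap (IsFractionRing.injective A _)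
  let _ := g.toAlgebra
  obtain ⟨x, hx⟩ := surjective_algebraMap_of_unique_hom (K := FractionRing A) (D := D)
    (fun F _ f f' h => IsLocalization.ringHom_ext N (H F _ _ (RingHom.ext fun a => by
      have := congrArg (fun t => t (algebraMap A _ a)) h
      rwa [RingHom.comp_apply, RingHom.comp_apply, RingHom.algebraMap_toAlgebra, hg] at this))) (algebraMap C D c)
  obtain ⟨b, a, ha, rfl⟩ := IsFractionRing.div_surjective (A := A) x
  have h : algebraMap C D (algebraMap A C a * c) = algebraMap C D (algebraMap A C b) := by
    rw [map_mul, ← hx, ← hg, ← hg]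
    refine (map_mul g _ _).symm.trans (congrArg g (mul_div_cancel₀ _ ?_))
    simpa using nonZeroDivisors.ne_zero ha
  obtain ⟨⟨_, s, hs, rfl⟩, h⟩ := (IsLocalization.eq_iff_exists N D).1 h
  refine ⟨s * a, s * b, mul_ne_zero (nonZeroDivisors.ne_zero hs) (nonZeroDivisors.ne_zero ha), ?_⟩
  rw [map_mul, map_mul, _root_.mul_assoc]
  exact h

lemma exists_isLocalization_away_of_unique_hom {A C : Type u} [CommRing A] [IsDomain A] [CommRing C]
    [_root_.IsReduced C] [CharZero A] [Algebra A C] [Algebra.FiniteType A C]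
    (hinj : Function.Injective (algebraMap A C))
    (H : ∀ (F : Type u) [Field F] (f g : C →+* F),
      f.comp (algebraMap A C) = g.comp (algebraMap A C) → f = g) :
    ∃ a : A, a ≠ 0 ∧ IsLocalization.Away a (Localization.Away (algebraMap A C a)) := by
  classical
  obtain ⟨s, hs⟩ := (inferInstance : Algebra.FiniteType A C).out
  choose a b ha hab using exists_mul_mem_range_of_unique_hom H
  let d : A := ∏ c ∈ s, a c
  have hd : d ≠ 0 := Finset.prod_ne_zero_iff.2 fun c _ => ha c
  have key : ∀ c : C, ∃ (n : ℕ) (b : A), algebraMap A C d ^ n * c = algebraMap A C b := by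
    intro c
    have hc : c ∈ Algebra.adjoin A (s : Set C) := hs ▸ Algebra.mem_top
    induction hc using Algebra.adjoin_induction with
    | mem c hc =>
      refine ⟨1, (∏ c ∈ s.erase c, a c) * b c, ?_⟩
      have : d = (∏ c ∈ s.erase c, a c) * a c := (Finset.prod_erase_mul _ _ hc).symm
      rw [pow_one, this, map_mul, map_mul, _root_.mul_assoc, hab]
    | algebraMap r => exact ⟨0, r, by simp⟩
    | add x y _ _ hx hy =>
      obtain ⟨n, b1, h1⟩ := hx
      obtain ⟨m, b2, h2⟩ := hy
      refine ⟨n + m, d ^ m * b1 + d ^ n * b2, ?_⟩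
      simp only [map_add, map_mul, map_pow]
      rw [← h1, ← h2]
      ring
    | mul x y _ _ hx hy =>
      obtain ⟨n, b1, h1⟩ := hx
      obtain ⟨m, b2, h2⟩ := hy
      refine ⟨n + m, b1 * b2, ?_⟩
      rw [map_mul, ← h1, ← h2]
      ring
  refine ⟨d, hd, ?_⟩
  let e := algebraMap A C d
  let R := Localization.Away e
  have hmap : ∀ x, algebraMap A R x = algebraMap C R (algebraMap A C x) := fun x =>
    IsScalarTower.algebraMap_apply A C R x
  refine ⟨?_, ?_, ?_⟩
  · rintro ⟨_, n, rfl⟩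
    rw [map_pow]
    refine IsUnit.pow n ?_
    change IsUnit (algebraMap A R d)
    rw [hmap]
    exact IsLocalization.Away.algebraMap_isUnit e
  · intro z
    obtain ⟨⟨c, ⟨_, n, rfl⟩⟩, hz⟩ := IsLocalization.surj (Submonoid.powers e) z
    obtain ⟨m, b', hb⟩ := key c
    refine ⟨(b', ⟨d ^ (m + n), m + n, rfl⟩), ?_⟩
    change z * algebraMap A R (d ^ (m + n)) = algebraMap A R b'
    replace hz : z * algebraMap C R (e ^ n) = algebraMap C R c := hz
    rw [hmap, hmap, ← hb, map_mul (algebraMap C R), ← hz, map_pow (algebraMap A C)]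
    simp only [map_pow]
    change z * _ ^ (m + n) = _ ^ m * _
    ring
  · intro x y hxy
    rw [hmap, hmap] at hxy
    obtain ⟨⟨_, n, rfl⟩, h⟩ := (IsLocalization.eq_iff_exists (Submonoid.powers e) R).1 hxy
    refine ⟨⟨d ^ n, n, rfl⟩, hinj ?_⟩
    simpa [e] using h

lemma universallyInjective_of_pt {X Y : Sch k} [LFT X.hom]
    (f : X ⟶ Y) (h : ∀ x y : Pt X, x ≫ f = y ≫ f → x = y) : UniversallyInjective f.left := by
  rw [UniversallyInjective.iff_diagonal]
  let P : Sch k := Over.mk (pullback.fst f.left f.left ≫ X.hom)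
  let d : X ⟶ P := Over.homMk (pullback.diagonal f.left) (by simp [P])
  have : LFT f.left := lft_left f ‹_›
  have : LFT P.hom := (inferInstance : LFT (pullback.fst f.left f.left ≫ X.hom))
  have : IsImmersion d.left := (inferInstance : IsImmersion (pullback.diagonal f.left))
  let p1 : P ⟶ X := Over.homMk (pullback.fst f.left f.left) rfl
  let p2 : P ⟶ X := Over.homMk (pullback.snd f.left f.left) (by
    change pullback.snd f.left f.left ≫ X.hom = pullback.fst f.left f.left ≫ X.hom
    rw [← Over.w f, pullback.condition_assoc])
  refine ⟨surjective_of_pt d fun y => ⟨y ≫ p1, ?_⟩⟩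
  have e : y ≫ p1 = y ≫ p2 := h _ _ (assoc'.trans
    ((y ≫= Over.OverMorphism.ext pullback.condition).trans (assoc y p2 f).symm))
  refine Over.OverMorphism.ext (pullback.hom_ext (assoc'.trans ?_) (assoc'.trans ?_))
  · exact ((y ≫ p1).left ≫= pullback.diagonal_fst f.left).trans (comp_id _)
  · exact ((y ≫ p1).left ≫= pullback.diagonal_snd f.left).trans
      ((comp_id _).trans (congrArg (fun t => t.left) e))

lemma exists_irreducible_isAffineOpen (Y : Scheme.{u}) [IsLocallyNoetherian Y] [Nonempty Y] :
    ∃ V : Y.Opens, IsAffineOpen V ∧ IsIrreducible (V : Set Y) := by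
  obtain ⟨y⟩ := (inferInstance : Nonempty Y)
  obtain ⟨U, hU, hy, -⟩ := exists_isAffineOpen_mem_and_subset (x := y) (U := ⊤) trivial
  have hUr : IsNoetherianRing Γ(Y, U) := IsLocallyNoetherian.component_noetherian ⟨U, hU⟩
  have hUn : TopologicalSpace.NoetherianSpace (U : Set Y) := noetherianSpace_of_isAffineOpen U hU
  obtain ⟨o, ho, hne, hsub⟩ :=
    TopologicalSpace.NoetherianSpace.exists_isOpen_nonempty_subset_irreducibleComponent
      _ (irreducibleComponent_mem_irreducibleComponents (⟨y, hy⟩ : (U : Set Y)))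
  have hirr : IsIrreducible o :=
    ⟨hne, isIrreducible_irreducibleComponent.isPreirreducible.open_subset ho hsub⟩
  let o' : Y.Opens := ⟨Subtype.val '' o, U.2.isOpenMap_subtype_val o ho⟩
  have ho' : IsIrreducible (o' : Set Y) := hirr.image _ continuous_subtype_val.continuousOn
  obtain ⟨z, hz⟩ := ho'.nonempty
  obtain ⟨V, hV, hzV, hVo⟩ := exists_isAffineOpen_mem_and_subset (x := z) (U := o') hz
  exact ⟨V, hV, ⟨z, hzV⟩, ho'.isPreirreducible.open_subset V.2 hVo⟩

lemma exists_isIso_morphismRestrict {X Y : Sch k} [LFT X.hom]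
    [LFT Y.hom] [IsReduced X.left] [IsReduced Y.left] (f : X ⟶ Y)
    [QuasiCompact f.left] (hf : Function.Bijective fun x : Pt X => x ≫ f) [Nonempty Y.left] :
    ∃ V : Y.left.Opens, (V : Set Y.left).Nonempty ∧ IsIso (f.left ∣_ V) := by
  have : IsLocallyNoetherian Y.left := LocallyOfFiniteType.isLocallyNoetherian Y.hom
  obtain ⟨V, hV, hVi⟩ := exists_irreducible_isAffineOpen Y.left
  have hui : UniversallyInjective f.left := universallyInjective_of_pt f fun x y h => hf.1 h
  have hft : LFT f.left := lft_left f ‹_›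
  obtain ⟨s, hsf, hs⟩ := isCompact_iff_finite_and_eq_biUnion_affineOpens.1
    (show IsCompact ((f.left ⁻¹ᵁ V : X.left.Opens) : Set X.left) from
      f.left.isCompact_preimage (U := V) hV.isCompact)
  let c (W : X.left.affineOpens) : Set Y.left := closure (f.left '' (W : X.left.Opens))
  have hcl : (V : Set Y.left) ⊆ ⋃₀ (c '' s) := by
    have hc : IsClosed (⋃₀ (c '' s)) := by
      rw [Set.sUnion_image]
      exact hsf.isClosed_biUnion fun _ _ => isClosed_closure
    refine subset_of_forall_pt V.2.isLocallyClosed hc fun y hy => ?_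
    obtain ⟨x, rfl⟩ := hf.2 y
    have hx : x.val ∈ f.left ⁻¹ᵁ V := hy
    rw [hs] at hx
    obtain ⟨W, hW, hxW⟩ := by simpa only [TopologicalSpace.Opens.mem_iSup] using hx
    exact ⟨_, ⟨W, hW, rfl⟩, subset_closure ⟨x.val, hxW, rfl⟩⟩
  obtain ⟨_, hWs', hVW⟩ := isIrreducible_iff_sUnion_isClosed.1 hVi
    (hsf.image c).toFinset (fun z hz => by
      obtain ⟨W, -, rfl⟩ := (Set.Finite.mem_toFinset _).1 hz
      exact isClosed_closure) (by rwa [Set.Finite.coe_toFinset])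
  obtain ⟨W, hWs, rfl⟩ := (Set.Finite.mem_toFinset _).1 hWs'
  have hWV : (W : X.left.Opens) ≤ f.left ⁻¹ᵁ V := by
    rw [hs]
    exact le_iSup₂_of_le W hWs le_rfl
  have hWaff : IsAffineOpen (W : X.left.Opens) := W.2
  let φ := f.left.appLE V W hWV
  have hφ : φ.hom.FiniteType := HasRingHomProperty.appLE @LocallyOfFiniteType f.left inferInstance ⟨V, hV⟩ ⟨W, hWaff⟩ hWV
  have hint : IsDomain Γ(Y.left, V) := by
    have : IrreducibleSpace V := isIrreducible_iff_irreducibleSpace.mp hVi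
    have : AlgebraicGeometry.IsIntegral (V : Scheme) := isIntegral_of_irreducibleSpace_of_isReduced _
    have : Nonempty V := hVi.nonempty.to_subtype
    let e := (Scheme.Opens.topIso V).symm.commRingCatIsoToRingEquiv
    exact e.injective.isDomain e.toRingHom
  have hchar : CharZero Γ(Y.left, V) := by
    have i : k →+* Γ(Y.left, V) :=
      ((Y.left.presheaf.map (homOfLE le_top : V ⟶ ⊤).op).hom.comp Y.hom.appTop.hom).comp
        (Scheme.ΓSpecIso (.of k)).inv.hom
    exact charZero_of_injective_ringHom i.injective
  have hinj : Function.Injective φ.hom := by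
    rw [injective_iff_map_eq_zero]
    intro a ha
    have h1 : f.left ⁻¹ᵁ (Y.left.basicOpen a) ⊓ W = ⊥ := by
      rw [inf_comm, ← Scheme.basicOpen_appLE f.left W V hWV a]
      exact (basicOpen_eq_bot_iff _).2 ha
    rw [← basicOpen_eq_bot_iff]
    by_contra hne
    obtain ⟨y, hy⟩ := Set.nonempty_iff_ne_empty.2 fun h => hne (TopologicalSpace.Opens.ext h)
    obtain ⟨_, hy2, x, hx, rfl⟩ := mem_closure_iff.1 (hVW (Y.left.basicOpen_le a hy)) _
      (Y.left.basicOpen a).2 hy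
    exact h1.le ⟨hy2, hx⟩
  algebraize [φ.hom]
  obtain ⟨a, ha, hloc⟩ := exists_isLocalization_away_of_unique_hom (A := Γ(Y.left, V))
    (C := Γ(X.left, W)) hinj (by
      intro F _ p q hpq
      have h2 : Function.Injective (fun g : Spec (.of F) ⟶ X.left ↦ g ≫ f.left) :=
        (((tfae_universallyInjective f.left).out 0 1).1 hui :) F
      have h3 : Spec.map (CommRingCat.ofHom p) ≫ hWaff.fromSpec =
          Spec.map (CommRingCat.ofHom q) ≫ hWaff.fromSpec := by
        apply h2
        change (_ ≫ _) ≫ _ = (_ ≫ _) ≫ _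
        rw [assoc, assoc, ← IsAffineOpen.SpecMap_appLE_fromSpec f.left hV hWaff hWV,
          ← assoc, ← assoc, ← Spec.map_comp, ← Spec.map_comp]
        congr 2
        exact CommRingCat.hom_ext hpq
      rw [cancel_mono] at h3
      exact congrArg CommRingCat.Hom.hom (Spec.map_injective h3))
  let R := Localization.Away (algebraMap Γ(Y.left, V) Γ(X.left, W) a)
  let j : Spec (.of R) ⟶ X.left :=
    Spec.map (CommRingCat.ofHom (algebraMap Γ(X.left, W) R)) ≫ hWaff.fromSpec
  have hj1 : IsOpenImmersion (Spec.map (CommRingCat.ofHom (algebraMap Γ(X.left, W) R))) :=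
    .of_isLocalization (algebraMap Γ(Y.left, V) Γ(X.left, W) a)
  have hjf : j ≫ f.left =
      Spec.map (CommRingCat.ofHom (algebraMap Γ(Y.left, V) R)) ≫ hV.fromSpec := by
    rw [assoc, ← IsAffineOpen.SpecMap_appLE_fromSpec f.left hV hWaff hWV, ← assoc, ← Spec.map_comp]
    rfl
  have hj2 : IsOpenImmersion (Spec.map (CommRingCat.ofHom (algebraMap Γ(Y.left, V) R))) :=
    IsOpenImmersion.of_isLocalization a
  have hjf' : IsOpenImmersion (j ≫ f.left) := by rw [hjf]; infer_instance
  let V' : Y.left.Opens := (j ≫ f.left).opensRange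
  have hpre : f.left ⁻¹ᵁ V' = j.opensRange := by
    ext x
    exact ⟨fun ⟨y, hy⟩ => ⟨y, Scheme.Hom.injective f.left hy⟩, fun ⟨y, hy⟩ => ⟨y, congrArg f.left hy⟩⟩
  refine ⟨V', ?_, ?_⟩
  · have : Nontrivial R := (IsLocalization.injective (M := Submonoid.powers a) R
      (powers_le_nonZeroDivisors_of_noZeroDivisors ha) :
        Function.Injective (algebraMap Γ(Y.left, V) R)).nontrivial
    exact ⟨_, ⟨(inferInstance : Nonempty (Spec (.of R))).some, rfl⟩⟩
  · have hs : Surjective (f.left ∣_ V') := ⟨by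
      rintro ⟨_, x, rfl⟩
      exact ⟨⟨j x, ⟨x, rfl⟩⟩, Subtype.ext (morphismRestrict_base_coe _ _ _)⟩⟩
    have ho : IsOpenImmersion (f.left ∣_ V') := by
      have h1 : IsOpenImmersion ((f.left ∣_ V') ≫ V'.ι) := by
        rw [morphismRestrict_ι]
        let l : (f.left ⁻¹ᵁ V' : X.left.Opens).toScheme ⟶ Spec (.of R) :=
          IsOpenImmersion.lift j (f.left ⁻¹ᵁ V').ι (by rw [Scheme.Opens.range_ι, hpre]; rfl)
        have hl : l ≫ j = (f.left ⁻¹ᵁ V').ι := IsOpenImmersion.lift_fac _ _ _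
        have hl' : IsOpenImmersion l := by
          have : IsOpenImmersion (l ≫ j) := by rw [hl]; infer_instance
          exact IsOpenImmersion.of_comp l j
        rw [← hl, assoc]
        infer_instance
      exact IsOpenImmersion.of_comp _ V'.ι
    exact (isIso_iff_isOpenImmersion_and_surjective _).2 ⟨ho, hs⟩
end

section
/-! ### Actions on points -/

section

instance lft_tensorObj (X Y : Sch k) [LFT X.hom] [LFT Y.hom] : LFT (X ⊗ Y).hom :=
  (inferInstance : LFT (pullback.fst X.hom Y.hom ≫ X.hom))

instance isReduced_tensorObj (X Y : Sch k) [LFT X.hom]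
    [IsReduced X.left] [IsReduced Y.left] : IsReduced (X ⊗ Y).left :=
  isReduced_pullback X.hom Y.hom

variable (k) in
abbrev PtRing : Type u := Γ((𝟙_ (Sch k)).left, ⊤)

/-- Affine reduced group schemes of finite type whose functions are spanned by characters. -/
class GoodGrp (G : Sch k) [GrpObj G] : Prop where
  lft : LFT G.hom
  isReduced : IsReduced G.left
  exists_chars : ∃ (M : Type) (χ : M → Γ(G.left, ⊤)),
    (∀ (s : Finset M) (c : M → PtRing k),
      (∀ g : Pt G, ∑ m ∈ s, fnPull g (χ m) * c m = 0) → ∀ m ∈ s, c m = 0) ∧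
    (∀ m (g h : Pt G), fnPull (g * h) (χ m) = fnPull g (χ m) * fnPull h (χ m)) ∧
    (∀ m, fnPull (1 : Pt G) (χ m) = 1) ∧
    ∀ (X : Sch k) [IsAffine X.left] (F : Γ((G ⊗ X).left, ⊤)),
      ∃ (s : Finset M) (b : M → Γ(X.left, ⊤)),
        F = ∑ m ∈ s, fnPull (fst G X) (χ m) * fnPull (snd G X) (b m)

attribute [instance] GoodGrp.lft GoodGrp.isReduced

variable {G : Sch k} [GrpObj G]

section
variable {B : GSch G} (X : GVar B)
instance : IsReduced X.X.X.left := X.isReduced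
instance : IsSeparated X.X.X.hom := X.isSeparated
instance : LFT X.str.hom.left := X.locallyOfFiniteType
instance : QuasiCompact X.str.hom.left := X.quasiCompact
instance [LFT B.X.hom] : LFT X.X.X.hom := by
  rw [← Over.w X.str.hom]
  infer_instance
end

lemma lift_pt {X Y : Sch k} (p : Pt (X ⊗ Y)) : lift (p ≫ fst X Y) (p ≫ snd X Y) = p := by
  ext <;> simp

/-- A morphism that defines an action on `k`-points defines an action. -/
abbrev modObjOfPt {Z : Sch k} [LFT G.hom] [IsReduced G.left]
    [LFT Z.hom] [IsReduced Z.left]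
    (a : G ⊗ Z ⟶ Z) (h1 : ∀ z : Pt Z, lift 1 z ≫ a = z)
    (h2 : ∀ (g h : Pt G) (z : Pt Z), lift (g * h) z ≫ a = lift g (lift h z ≫ a) ≫ a) :
    ModObj G Z := modOfPoints a
  (by
    have h : lift 1 (𝟙 Z) ≫ a = 𝟙 Z := hom_ext_pt fun z => by
      rw [comp_lift_assoc, MonObj.comp_one, comp_id]
      exact h1 z
    intro T x
    have := x ≫= h
    rwa [comp_lift_assoc, MonObj.comp_one, comp_id] at this)
  (by
    have h : lift (fst G (G ⊗ Z) * (snd G (G ⊗ Z) ≫ fst G Z)) (snd G (G ⊗ Z) ≫ snd G Z) ≫ a =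
        lift (fst G (G ⊗ Z)) (snd G (G ⊗ Z) ≫ a) ≫ a := hom_ext_pt fun z => by
      rw [comp_lift_assoc, comp_lift_assoc, MonObj.comp_mul]
      have := h2 (z ≫ fst _ _) (z ≫ snd _ _ ≫ fst _ _) (z ≫ snd _ _ ≫ snd _ _)
      rw [this]
      congr 2
      rw [← assoc, ← assoc, lift_pt, assoc]
    intro T g g' x
    have := lift g (lift g' x) ≫= h
    simp only [comp_lift_assoc, MonObj.comp_mul, lift_fst, lift_snd, lift_snd_assoc] at this
    exact this)

lemma isModHom_of_pt {X Y : Sch k} [ModObj G X] [ModObj G Y] [LFT G.hom]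
    [IsReduced G.left] [LFT X.hom] [IsReduced X.left] (f : X ⟶ Y)
    (h : ∀ (g : Pt G) (x : Pt X), (g • x) ≫ f = g • (x ≫ f)) : IsModHom G f :=
  isModHom_of_points f (by
    have e : (fst G X • snd G X) ≫ f = fst G X • (snd G X ≫ f) := hom_ext_pt fun z => by
      rw [← assoc, ModObj.comp_smul, ModObj.comp_smul, h, assoc]
    intro T g x
    have := lift g x ≫= e
    simp only [← assoc, ModObj.comp_smul, lift_fst, lift_snd] at this
    exact this)

/-- Construct an equivariant morphism from its values on `k`-points. -/
def GSch.homMk {X Y : GSch G} [LFT G.hom]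
    [IsReduced G.left] [LFT X.X.hom] [IsReduced X.X.left] (f : X.X ⟶ Y.X)
    (h : ∀ (g : Pt G) (x : Pt X.X), (g • x) ≫ f = g • (x ≫ f)) : X ⟶ Y :=
  letI : IsModHom G f := isModHom_of_pt f h
  ⟨f⟩

lemma GSch.smul_comp {X Y : GSch G} (f : X ⟶ Y) {T : Sch k} (g : T ⟶ G) (x : T ⟶ X.X) :
    (g • x) ≫ f.hom = g • (x ≫ f.hom) := IsModHom.map_smul f.hom g x

/-- The automorphism defined by a `k`-point of the group. -/
def GSch.act (X : GSch G) (g : Pt G) : X.X ⟶ X.X := (toUnit X.X ≫ g) • 𝟙 X.X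

lemma GSch.comp_act (X : GSch G) (g : Pt G) (x : Pt X.X) : x ≫ X.act g = g • x := by
  rw [GSch.act, ModObj.comp_smul, comp_id, ← assoc]
  congr 1
  rw [toUnit_unique (x ≫ toUnit X.X) (𝟙 _), id_comp]

lemma GSch.act_val (X : GSch G) (g : Pt G) (x : Pt X.X) :
    (g • x : Pt X.X).val = (X.act g).left x.val := by
  rw [← X.comp_act]; rfl

lemma GSch.act_comp (X : GSch G) (g h : Pt G) : X.act h ≫ X.act g = X.act (g * h) := by
  rw [GSch.act, GSch.act, ModObj.comp_smul, comp_id, ← assoc, smul_smul]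
  congr 1
  rw [toUnit_unique ((_ • _) ≫ toUnit X.X) (toUnit X.X), MonObj.comp_mul]

lemma GSch.act_one (X : GSch G) : X.act 1 = 𝟙 _ := by rw [GSch.act, MonObj.comp_one, one_smul]

instance (X : GSch G) (g : Pt G) : IsIso (X.act g) :=
  ⟨X.act g⁻¹, by rw [X.act_comp, inv_mul_cancel, X.act_one],
    by rw [X.act_comp, mul_inv_cancel, X.act_one]⟩

/-- The set `s` is invariant under the `k`-points of `G`. -/
def InvSet (X : GSch G) (s : Set X.X.left) : Prop :=
  ∀ (g : Pt G) (x : Pt X.X), x.val ∈ s → (g • x : Pt X.X).val ∈ s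

namespace InvSet
variable {X : GSch G} {s t : Set X.X.left}
lemma iff (hs : InvSet X s) (g : Pt G) (x : Pt X.X) : (g • x : Pt X.X).val ∈ s ↔ x.val ∈ s :=
  ⟨fun h => by simpa using hs g⁻¹ _ h, hs g x⟩
lemma compl (hs : InvSet X s) : InvSet X sᶜ := fun g x hx h => hx ((hs.iff g x).1 h)
lemma inter (hs : InvSet X s) (ht : InvSet X t) : InvSet X (s ∩ t) :=
  fun g x hx => ⟨hs g x hx.1, ht g x hx.2⟩
lemma univ : InvSet X Set.univ := fun _ _ _ => trivial
lemma preimage {Y : GSch G} {t : Set Y.X.left} (ht : InvSet Y t) (f : X ⟶ Y) :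
    InvSet X (f.hom.left ⁻¹' t) := fun g x hx => by
  have h := ht g (x ≫ f.hom) hx
  rw [← GSch.smul_comp] at h
  exact h
lemma closure (hs : InvSet X s) (h : IsLocallyClosed s) [LFT X.X.hom] : InvSet X (closure s) := by
  intro g x hx
  rw [GSch.act_val]
  have h1 : IsClosed ((X.act g).left ⁻¹' (_root_.closure s)) :=
    isClosed_closure.preimage (X.act g).left.continuous
  have h2 : s ⊆ (X.act g).left ⁻¹' (_root_.closure s) := subset_of_forall_pt h h1 fun y hy => by
      have := hs g y hy
      rw [GSch.act_val] at this
      exact subset_closure this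
  exact closure_minimal h2 h1 hx
end InvSet

lemma IsInvOpen.invSet {X : GSch G} {U : X.X.left.Opens} (h : IsInvOpen X U) :
    InvSet X (U : Set X.X.left) := fun g x hx => by
  have := h _ g x (by rw [Pt.range_left]; simpa using hx)
  exact this ⟨pt0, rfl⟩

lemma isInvOpen_of_invSet {X : GSch G} [LFT G.hom] [LFT X.X.hom]
    {U : X.X.left.Opens} (h : InvSet X (U : Set X.X.left)) : IsInvOpen X U := by
  have h1 : (snd G X.X).left ⁻¹' U ⊆ (fst G X.X • snd G X.X : G ⊗ X.X ⟶ X.X).left ⁻¹' U := by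
    refine subset_of_forall_pt' (X := G ⊗ X.X)
      (U.2.preimage (snd G X.X).left.continuous).isLocallyClosed
      (U.2.preimage (fst G X.X • snd G X.X : G ⊗ X.X ⟶ X.X).left.continuous) fun z hz => ?_
    have h2 := h (z ≫ fst G X.X) (z ≫ snd G X.X) hz
    rw [← ModObj.comp_smul] at h2
    exact h2
  intro T g x hx
  rintro _ ⟨t, rfl⟩
  have h3 : (lift g x).left t ∈ (snd G X.X).left ⁻¹' U := by
    change ((lift g x) ≫ snd G X.X).left t ∈ U
    rw [lift_snd]
    exact hx ⟨t, rfl⟩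
  have h4 := h1 h3
  have h5 : g • x = lift g x ≫ (fst G X.X • snd G X.X) := by
    rw [ModObj.comp_smul, lift_fst, lift_snd]
  rw [h5]
  exact h4

/-! ### Subschemes with an action -/

section subMod
variable [LFT G.hom] [IsReduced G.left]
variable (X : GSch G) {Z : Sch k} [LFT Z.hom] [IsReduced Z.left]
  (j : Z ⟶ X.X) [IsImmersion j.left]
  (h : ∀ (g : Pt G) (z : Pt Z), ∃ z' : Pt Z, z' ≫ j = g • (z ≫ j))

include h in
lemma exists_subModAct : ∃ a : G ⊗ Z ⟶ Z, a ≫ j = fst G Z • (snd G Z ≫ j) :=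
  exists_lift_pt j _ fun t => by
    obtain ⟨z, hz⟩ := h (t ≫ fst _ _) (t ≫ snd _ _)
    exact ⟨z, by rw [hz, ModObj.comp_smul, assoc]⟩

include h in
lemma exists_subMod : ∃ _ : ModObj G Z, IsModHom G j := by
  obtain ⟨a, ha⟩ := exists_subModAct X j h
  have hm := mono_of_left j
  have hg : ∀ (g : Pt G) (z : Pt Z), lift g z ≫ a ≫ j = g • (z ≫ j) := fun g z => by
    rw [ha, ModObj.comp_smul, lift_fst, lift_snd_assoc]
  let m : ModObj G Z := modObjOfPt a (fun z => by
      rw [← cancel_mono j, assoc, hg, one_smul]) (fun g h z => by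
      rw [← cancel_mono j, assoc, hg, assoc, hg, assoc, hg, smul_smul])
  refine ⟨m, isModHom_of_pt j fun g z => ?_⟩
  rw [Hom.smul_def, assoc]
  exact hg g z

/-- An invariant reduced subscheme, with the induced action. -/
def subMod : GSch G :=
  letI := (exists_subMod X j h).choose
  ⟨Z⟩

def subModι : subMod X j h ⟶ X :=
  { hom := (j : Z ⟶ X.X)
    isModHom := (exists_subMod X j h).choose_spec }

end subMod

end

/-! ### Locally closed subsets as reduced subschemes -/

lemma isReduced_subscheme_vanishingIdeal {X : Scheme.{u}} (Z : TopologicalSpace.Closeds X) :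
    IsReduced (Scheme.IdealSheafData.vanishingIdeal Z).subscheme := by
  refine @IsReduced.of_openCover _
    (Scheme.IdealSheafData.subschemeCover (.vanishingIdeal Z)).openCover fun (U : X.affineOpens) => ?_
  have h : ((Scheme.IdealSheafData.vanishingIdeal Z).ideal U).IsRadical := by
    rw [Scheme.IdealSheafData.vanishingIdeal_ideal]
    exact PrimeSpectrum.isRadical_vanishingIdeal _
  have : _root_.IsReduced (Γ(X, U.1) ⧸ (Scheme.IdealSheafData.vanishingIdeal Z).ideal U) :=
    (Ideal.isRadical_iff_quotient_reduced _).1 h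
  exact (inferInstance : IsReduced
    (Spec (.of (Γ(X, U.1) ⧸ (Scheme.IdealSheafData.vanishingIdeal Z).ideal U))))

lemma exists_redSub (X : Scheme.{u}) {s : Set X} (hs : IsLocallyClosed s) :
    ∃ (Z : Scheme.{u}) (j : Z ⟶ X), IsReduced Z ∧ IsImmersion j ∧ Set.range j = s := by
  let C : TopologicalSpace.Closeds X := ⟨closure s, isClosed_closure⟩
  have hr := isReduced_subscheme_vanishingIdeal C
  generalize hi : (Scheme.IdealSheafData.vanishingIdeal C).subschemeι = i at hr
  have h : Set.range i = closure s := by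
    rw [← hi, Scheme.IdealSheafData.range_subschemeι,
      Scheme.IdealSheafData.coe_support_vanishingIdeal]
    rfl
  have hi' : IsImmersion i := by rw [← hi]; infer_instance
  clear hi
  generalize (Scheme.IdealSheafData.vanishingIdeal C).subscheme = Y at i hr h hi'
  let O : X.Opens := ⟨coborder s, hs.isOpen_coborder⟩
  refine ⟨(i ⁻¹ᵁ O : Y.Opens), (i ⁻¹ᵁ O).ι ≫ i, isReduced_of_isOpenImmersion (i ⁻¹ᵁ O).ι,
    inferInstance, ?_⟩
  have e : Set.range ((i ⁻¹ᵁ O).ι ≫ i) = i '' Set.range (i ⁻¹ᵁ O).ι := by rw [← Set.range_comp]; rfl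
  rw [e, Scheme.Opens.range_ι]
  change _ '' (_ ⁻¹' coborder s) = s
  rw [Set.image_preimage_eq_inter_range, h, coborder_inter_closure]

/-- The reduced subscheme structure on a locally closed subset. -/
def redSub (X : Scheme.{u}) {s : Set X} (hs : IsLocallyClosed s) : Scheme.{u} :=
  (exists_redSub X hs).choose

def redSubι (X : Scheme.{u}) {s : Set X} (hs : IsLocallyClosed s) : redSub X hs ⟶ X :=
  (exists_redSub X hs).choose_spec.choose

instance (X : Scheme.{u}) {s : Set X} (hs : IsLocallyClosed s) : IsReduced (redSub X hs) :=
  (exists_redSub X hs).choose_spec.choose_spec.1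

instance (X : Scheme.{u}) {s : Set X} (hs : IsLocallyClosed s) : IsImmersion (redSubι X hs) :=
  (exists_redSub X hs).choose_spec.choose_spec.2.1

lemma range_redSubι (X : Scheme.{u}) {s : Set X} (hs : IsLocallyClosed s) :
    Set.range (redSubι X hs) = s :=
  (exists_redSub X hs).choose_spec.choose_spec.2.2

lemma isOpenImmersion_of_isImmersion {X Z : Scheme.{u}} (j : Z ⟶ X) [IsImmersion j] [IsReduced X]
    (h : IsOpen (Set.range j)) : IsOpenImmersion j := by
  let U : X.Opens := ⟨Set.range j, h⟩
  have hU : IsReduced (U : Scheme) := isReduced_of_isOpenImmersion U.ι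
  obtain ⟨f, hf⟩ := exists_lift_of_isImmersion j U.ι (by rw [Scheme.Opens.range_ι]; rfl)
  let g : Z ⟶ U := IsOpenImmersion.lift U.ι j (by rw [Scheme.Opens.range_ι]; rfl)
  have hg : g ≫ U.ι = j := IsOpenImmersion.lift_fac _ _ _
  have : IsIso g := ⟨f, by rw [← cancel_mono j, assoc, hf, hg, id_comp],
    by rw [← cancel_mono U.ι, assoc, hg, hf, id_comp]⟩
  rw [← hg]
  infer_instance

lemma isClosedImmersion_of_isImmersion {X Z : Scheme.{u}} (j : Z ⟶ X) [IsImmersion j]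
    (h : IsClosed (Set.range j)) : IsClosedImmersion j := .of_isPreimmersion _ h
end

section
section

def fnC (T : Sch k) : k →+* Γ(T.left, ⊤) := T.hom.appTop.hom.comp (Scheme.ΓSpecIso (.of k)).inv.hom

lemma fnPull_fnC {T T' : Sch k} (g : T' ⟶ T) (a : k) : fnPull g (fnC T a) = fnC T' a := by
  have h : (g.left ≫ T.hom).appTop = T'.hom.appTop := by rw [Over.w]
  exact congrArg (fun t => t.hom ((Scheme.ΓSpecIso (.of k)).inv a))
    ((Scheme.Hom.comp_appTop g.left T.hom).symm.trans h)

variable (k) in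
lemma fnC_unit_bijective : Function.Bijective (fnC (𝟙_ (Sch k))) := by
  have h : fnC (𝟙_ (Sch k)) = (Scheme.ΓSpecIso (.of k)).inv.hom := by
    have : (𝟙_ (Sch k)).hom.appTop = 𝟙 _ := Scheme.Hom.id_appTop (X := Spec (.of k))
    ext a
    exact congrArg (fun t => t.hom ((Scheme.ΓSpecIso (.of k)).inv a)) this
  rw [h]
  exact (Scheme.ΓSpecIso (.of k)).symm.commRingCatIsoToRingEquiv.bijective

instance : IsDomain (PtRing k) :=
  (RingEquiv.ofBijective _ (fnC_unit_bijective k)).symm.injective.isDomain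
    (RingEquiv.ofBijective _ (fnC_unit_bijective k)).symm.toRingHom

section Diag
variable {M : Type} [AddCommGroup M]

/-- The functions on `Spec k[M]`. -/
def Diag.fn : AddMonoidAlgebra k M →+* Γ((Diag k M).left, ⊤) :=
  (Scheme.ΓSpecIso (.of (AddMonoidAlgebra k M))).inv.hom

lemma Diag.fn_algebraMap (a : k) : Diag.fn (algebraMap k (AddMonoidAlgebra k M) a) = fnC _ a :=
  congrArg (fun t => t.hom a) (Scheme.ΓSpecIso_inv_naturality
    (CommRingCat.ofHom (algebraMap k (AddMonoidAlgebra k M))))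

lemma Diag.fn_single (m : M) (a : k) : Diag.fn (AddMonoidAlgebra.single m a) = chi0 m * fnC _ a := by
  have h : (AddMonoidAlgebra.single m a : AddMonoidAlgebra k M) =
      AddMonoidAlgebra.single m 1 * algebraMap k _ a := by
    rw [AddMonoidAlgebra.coe_algebraMap]
    simp [AddMonoidAlgebra.single_mul_single]
  rw [h, map_mul, Diag.fn_algebraMap]
  rfl

lemma Diag.fn_injective : Function.Injective (Diag.fn (k := k) (M := M)) :=
  (Scheme.ΓSpecIso (.of (AddMonoidAlgebra k M))).symm.commRingCatIsoToRingEquiv.injective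

lemma Diag.exists_isotypic_spec (R : CommRingCat.{u}) (φ : CommRingCat.of k ⟶ R)
    (F : Γ((Diag k M ⊗ Over.mk (Spec.map φ)).left, ⊤)) :
    ∃ (s : Finset M) (b : M → Γ((Over.mk (Spec.map φ)).left, ⊤)),
      F = ∑ m ∈ s, fnPull (fst (Diag k M) (Over.mk (Spec.map φ))) (Diag.chi0 m) *
        fnPull (snd (Diag k M) (Over.mk (Spec.map φ))) (b m) := by
  classical
  algebraize [φ.hom]
  let X : Sch k := Over.mk (Spec.map φ)
  let e : (Diag k M ⊗ X).left ≅ Spec (.of (AddMonoidAlgebra k M ⊗[k] R)) :=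
    pullbackSpecIso k (AddMonoidAlgebra k M) R
  have h1 : (fst (Diag k M) X).left =
      e.hom ≫ Spec.map (CommRingCat.ofHom Algebra.TensorProduct.includeLeftRingHom) :=
    (pullbackSpecIso_hom_fst ..).symm
  have h2 : (snd (Diag k M) X).left =
      e.hom ≫ Spec.map (CommRingCat.ofHom
        (Algebra.TensorProduct.includeRight (R := k) (A := AddMonoidAlgebra k M)
          (B := R)).toRingHom) :=
    (pullbackSpecIso_hom_snd ..).symm
  let Φ : AddMonoidAlgebra k M ⊗[k] R →+* Γ((Diag k M ⊗ X).left, ⊤) :=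
    e.hom.appTop.hom.comp (Scheme.ΓSpecIso (.of (AddMonoidAlgebra k M ⊗[k] R))).inv.hom
  let ψ : R →+* Γ(X.left, ⊤) := (Scheme.ΓSpecIso R).inv.hom
  have hΦ1 (a : AddMonoidAlgebra k M) : Φ (a ⊗ₜ 1) = fnPull (fst (Diag k M) X) (Diag.fn a) := by
    have := Diag.appTop_SpecMap e.hom
      (CommRingCat.ofHom (Algebra.TensorProduct.includeLeftRingHom (R := k)
        (A := AddMonoidAlgebra k M) (B := R))) a
    rw [← h1] at this
    exact this.symm
  have hΦ2 (r : R) : Φ (1 ⊗ₜ r) = fnPull (snd (Diag k M) X) (ψ r) := by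
    have := Diag.appTop_SpecMap e.hom
      (CommRingCat.ofHom (Algebra.TensorProduct.includeRight (R := k) (A := AddMonoidAlgebra k M)
          (B := R)).toRingHom) r
    rw [← h2] at this
    exact this.symm
  have key : ∀ t : AddMonoidAlgebra k M ⊗[k] R, ∃ b : M →₀ Γ(X.left, ⊤),
      Φ t = b.sum fun m r => fnPull (fst (Diag k M) X) (Diag.chi0 m) *
        fnPull (snd (Diag k M) X) r := by
    intro t
    have hadd : ∀ b b' : M →₀ Γ(X.left, ⊤), ((b + b').sum fun m r =>
        fnPull (fst (Diag k M) X) (Diag.chi0 m) * fnPull (snd (Diag k M) X) r) =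
        (b.sum fun m r => fnPull (fst (Diag k M) X) (Diag.chi0 m) * fnPull (snd (Diag k M) X) r) +
        (b'.sum fun m r => fnPull (fst (Diag k M) X) (Diag.chi0 m) * fnPull (snd (Diag k M) X) r) :=
      fun b b' => Finsupp.sum_add_index' (fun m => by rw [map_zero, mul_zero])
        (fun m r r' => by rw [map_add, mul_add])
    induction t with
    | zero => exact ⟨0, by rw [map_zero, Finsupp.sum_zero_index]⟩
    | add x y hx hy =>
      obtain ⟨b, hb⟩ := hx
      obtain ⟨b', hb'⟩ := hy
      exact ⟨b + b', by rw [map_add, hb, hb', hadd]⟩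
    | tmul a r =>
      induction a using AddMonoidAlgebra.induction_linear with
      | zero => exact ⟨0, by rw [TensorProduct.zero_tmul, map_zero, Finsupp.sum_zero_index]⟩
      | add x y hx hy =>
        obtain ⟨b, hb⟩ := hx
        obtain ⟨b', hb'⟩ := hy
        exact ⟨b + b', by rw [TensorProduct.add_tmul, map_add, hb, hb', hadd]⟩
      | single m a =>
        refine ⟨Finsupp.single m (fnC X a * ψ r), ?_⟩
        rw [Finsupp.sum_single_index (by rw [map_zero, mul_zero])]
        have : (AddMonoidAlgebra.single m a : AddMonoidAlgebra k M) ⊗ₜ[k] r =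
          (AddMonoidAlgebra.single m a ⊗ₜ 1) * (1 ⊗ₜ r) := by simp
        rw [this, map_mul, hΦ1, hΦ2, Diag.fn_single, map_mul, map_mul, fnPull_fnC, fnPull_fnC,
          _root_.mul_assoc]
  obtain ⟨t, ht⟩ : ∃ t, Φ t = F := by
    refine ⟨(Scheme.ΓSpecIso (.of (AddMonoidAlgebra k M ⊗[k] R))).hom (e.inv.appTop F), ?_⟩
    have h3 : e.inv.appTop ≫ e.hom.appTop = 𝟙 _ := by
      rw [← Scheme.Hom.comp_appTop, e.hom_inv_id, Scheme.Hom.id_appTop]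
    change e.hom.appTop ((Scheme.ΓSpecIso _).inv ((Scheme.ΓSpecIso _).hom _)) = F
    rw [← CommRingCat.comp_apply (Scheme.ΓSpecIso _).hom, Iso.hom_inv_id, CommRingCat.id_apply]
    exact congrArg (fun t => t.hom F) h3
  obtain ⟨b, hb⟩ := key t
  exact ⟨b.support, b, by rw [← ht, hb]; rfl⟩

lemma Diag.exists_isotypic (X : Sch k) [IsAffine X.left] (F : Γ((Diag k M ⊗ X).left, ⊤)) :
    ∃ (s : Finset M) (b : M → Γ(X.left, ⊤)),
      F = ∑ m ∈ s, fnPull (fst (Diag k M) X) (Diag.chi0 m) * fnPull (snd (Diag k M) X) (b m) := by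
  let φ : CommRingCat.of k ⟶ Γ(X.left, ⊤) := CommRingCat.ofHom (fnC X)
  have hw : X.left.isoSpec.hom ≫ Spec.map φ = X.hom := by
    have h1 : φ = (Scheme.ΓSpecIso (.of k)).inv ≫ X.hom.appTop := rfl
    have h2 := Scheme.isoSpec_hom_naturality X.hom
    rw [h1, Spec.map_comp, ← assoc, h2, assoc]
    refine (X.hom ≫= ?_).trans (comp_id _)
    rw [Scheme.isoSpec_Spec_hom, ← Spec.map_comp, Iso.inv_hom_id, Spec.map_id]
  let Y : Sch k := Over.mk (Spec.map φ)
  let e : X ≅ Y := Over.isoMk X.left.isoSpec hw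
  obtain ⟨s, b, hb⟩ := Diag.exists_isotypic_spec _ φ (fnPull (Diag k M ◁ e.inv) F)
  refine ⟨s, fun m => fnPull e.hom (b m), ?_⟩
  have h2 := congrArg (fnPull (Diag k M ◁ e.hom)) hb
  rw [← fnPull_comp, ← MonoidalCategory.whiskerLeft_comp, e.hom_inv_id,
    MonoidalCategory.whiskerLeft_id] at h2
  have h3 : fnPull (𝟙 (Diag k M ⊗ X)) F = F :=
    congrArg (fun t => t.hom F) (Scheme.Hom.id_appTop (X := (Diag k M ⊗ X).left))
  rw [h3] at h2
  rw [h2, map_sum]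
  refine Finset.sum_congr rfl fun m _ => ?_
  rw [map_mul, ← fnPull_comp, ← fnPull_comp, ← fnPull_comp, whiskerLeft_fst, whiskerLeft_snd]

instance [h1 : IsReduced (Diag k M).left] [h2 : LFT (Diag k M).hom] : GoodGrp (Diag k M) where
  lft := h2
  isReduced := h1
  exists_chars := by
    classical
    refine ⟨M, Diag.chi0, fun s c hc => ?_, fun m g h => Diag.chi_mul m g h,
      fun m => Diag.chi_one m, fun X _ F => Diag.exists_isotypic X F⟩
    choose c' hc' using fun m => (fnC_unit_bijective k).2 (c m)
    let t : AddMonoidAlgebra k M := ∑ m ∈ s, AddMonoidAlgebra.single m (c' m)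
    have ht : Diag.fn t = 0 := by
      apply fn_ext_pt
      intro g
      rw [map_zero, ← hc g, map_sum, map_sum]
      refine Finset.sum_congr rfl fun m _ => ?_
      rw [Diag.fn_single, map_mul, fnPull_fnC, hc']
    have ht' : t = 0 := Diag.fn_injective (ht.trans (map_zero _).symm)
    intro m hm
    have h3 : t.coeff m = 0 := by rw [ht']; rfl
    rw [AddMonoidAlgebra.coeff_sum, Finsupp.finsetSum_apply, Finset.sum_eq_single m,
      AddMonoidAlgebra.coeff_single, Finsupp.single_eq_same] at h3
    · rw [← hc', h3, map_zero]
    · intro b _ hb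
      rw [AddMonoidAlgebra.coeff_single, Finsupp.single_eq_of_ne]
      exact hb.symm
    · exact fun h => (h hm).elim

lemma Diag.isReduced_of_ring [_root_.IsReduced (AddMonoidAlgebra k M)] :
    IsReduced (Diag k M).left := inferInstanceAs (IsReduced (Spec (.of (AddMonoidAlgebra k M))))

lemma Diag.lft_of_finite [Algebra.FiniteType k (AddMonoidAlgebra k M)] : LFT (Diag k M).hom := by
  change LFT (Spec.map (CommRingCat.ofHom (algebraMap k (AddMonoidAlgebra k M))))
  rw [HasRingHomProperty.Spec_iff (P := @LocallyOfFiniteType)]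
  exact RingHom.finiteType_algebraMap.2 inferInstance

instance : IsReduced (Gm k).left := Diag.isReduced_of_ring

lemma isReduced_addMonoidAlgebra [Finite M] : _root_.IsReduced (AddMonoidAlgebra k M) := by
  classical
  have := Fintype.ofFinite M
  let b : Module.Basis M k (AddMonoidAlgebra k M) := .ofRepr (AddMonoidAlgebra.coeffLinearEquiv k)
  have hf : Module.Finite k (AddMonoidAlgebra k M) := .of_basis b
  have htr (x : AddMonoidAlgebra k M) : Algebra.trace k _ x = Fintype.card M • x.coeff 0 := by
    rw [Algebra.trace_eq_matrix_trace b, Matrix.trace]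
    rw [Finset.sum_congr rfl (g := fun _ => x.coeff 0), Finset.sum_const, Finset.card_univ]
    intro m _
    rw [Matrix.diag_apply, Algebra.leftMulMatrix_eq_repr_mul]
    change (x * AddMonoidAlgebra.single m 1 : AddMonoidAlgebra k M).coeff m = _
    rw [AddMonoidAlgebra.coeff_mul_single_apply]
    simp
  refine ⟨fun x hx => ?_⟩
  ext m
  have h1 : IsNilpotent (x * AddMonoidAlgebra.single (-m) 1) :=
    (Commute.all _ _).isNilpotent_mul_right hx
  have h2 : Algebra.trace k _ (x * AddMonoidAlgebra.single (-m) 1) = 0 :=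
    (LinearMap.isNilpotent_trace_of_isNilpotent (h1.map (Algebra.lmul k _))).eq_zero
  rw [htr, smul_eq_zero] at h2
  have h3 := h2.resolve_left Fintype.card_ne_zero
  rw [AddMonoidAlgebra.coeff_mul_single_apply] at h3
  simpa using h3

instance (d : ℕ) [NeZero d] : IsReduced (Mu k d).left :=
  have := isReduced_addMonoidAlgebra (k := k) (M := ZMod d)
  Diag.isReduced_of_ring

instance (d : ℕ) [NeZero d] : LFT (Mu k d).hom :=
  have : Module.Finite k (AddMonoidAlgebra k (ZMod d)) :=
    .of_basis (Module.Basis.ofRepr (AddMonoidAlgebra.coeffLinearEquiv k))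
  Diag.lft_of_finite

end Diag
end
end

section
section
variable {G : Sch k} [GrpObj G]

/-! ### Invariant affine neighbourhoods -/

lemma GSch.comp_hom {X Y Z : GSch G} (f : X ⟶ Y) (g : Y ⟶ Z) {T : Sch k} (p : T ⟶ X.X) :
    p ≫ (f ≫ g).hom = (p ≫ f.hom) ≫ g.hom := assoc'.symm

lemma GSch.comp_eq {X Y Z : GSch G} {f : X ⟶ Y} {g : Y ⟶ Z} {h : X ⟶ Z} (e : f ≫ g = h) {T : Sch k}
    (p : T ⟶ X.X) : (p ≫ f.hom) ≫ g.hom = p ≫ h.hom :=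
  (GSch.comp_hom f g p).symm.trans (congrArg (fun t : X ⟶ Z => p ≫ t.hom) e)

protected lemma GSch.hom_ext_pt {X Y : GSch G} [LFT X.X.hom] [IsReduced X.X.left] {f g : X ⟶ Y}
    (h : ∀ p : Pt X.X, p ≫ f.hom = p ≫ g.hom) : f = g :=
  Mod.Hom.ext (hom_ext_pt h)

lemma GSch.ext_of_comp {X Y Z : GSch G} [LFT X.X.hom] [IsReduced X.X.left]
    {f : X ⟶ Y} {g : Y ⟶ Z} {h : X ⟶ Z} (e : ∀ p : Pt X.X, (p ≫ f.hom) ≫ g.hom = p ≫ h.hom) :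
    f ≫ g = h := GSch.hom_ext_pt fun p => (GSch.comp_hom f g p).trans (e p)

lemma exists_mem_basicOpen_of_sum {X : Scheme.{u}} {I : Type*} (s : Finset I) (b : I → Γ(X, ⊤)) (p : X)
    (h : p ∈ X.basicOpen (∑ i ∈ s, b i)) : ∃ i ∈ s, p ∈ X.basicOpen (b i) := by
  classical
  induction s using Finset.induction_on with
  | empty => simp at h
  | insert i s hi ih =>
    rw [Finset.sum_insert hi] at h
    rcases X.basicOpen_add_le _ _ h with h | h
    · exact ⟨i, by simp, h⟩
    · obtain ⟨j, hj, h⟩ := ih h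
      exact ⟨j, by simp [hj], h⟩

lemma exists_invSet_basicOpen [GoodGrp G] (X : GSch G) [IsAffine X.X.left]
    [LFT X.X.hom] [IsReduced X.X.left] (O : X.X.left.Opens)
    (hO : InvSet X (O : Set X.X.left)) (p : X.X.left) (hp : p ∈ O) :
    ∃ a : Γ(X.X.left, ⊤), p ∈ X.X.left.basicOpen a ∧ X.X.left.basicOpen a ≤ O ∧
      InvSet X (X.X.left.basicOpen a : Set X.X.left) := by
  obtain ⟨f, hfO, hpf⟩ := (isAffineOpen_top X.X.left).exists_basicOpen_le (V := O) ⟨p, hp⟩ trivial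
  obtain ⟨M, χ, hli, hmul, hone, hiso⟩ := GoodGrp.exists_chars (G := G)
  obtain ⟨s, b, hb⟩ := hiso X.X (fnPull (fst G X.X • snd G X.X : G ⊗ X.X ⟶ X.X) f)
  have hgf (g : Pt G) (x : Pt X.X) :
      fnPull (g • x) f = ∑ m ∈ s, fnPull g (χ m) * fnPull x (b m) := by
    have h1 : g • x = lift g x ≫ (fst G X.X • snd G X.X : G ⊗ X.X ⟶ X.X) := by
      rw [ModObj.comp_smul, lift_fst, lift_snd]
    rw [h1, fnPull_comp, hb, map_sum]
    refine Finset.sum_congr rfl fun m _ => ?_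
    rw [map_mul, ← fnPull_comp, ← fnPull_comp, lift_fst, lift_snd]
  have hw (g : Pt G) (x : Pt X.X) (m : M) (hm : m ∈ s) :
      fnPull (g • x) (b m) = fnPull g (χ m) * fnPull x (b m) := by
    rw [← sub_eq_zero]
    refine hli s (fun m => fnPull (g • x) (b m) - fnPull g (χ m) * fnPull x (b m)) (fun h => ?_) m hm
    have h1 := hgf h (g • x)
    have h2 := hgf (h * g) x
    rw [mul_smul, h1] at h2
    simp only [mul_sub, Finset.sum_sub_distrib]
    rw [h2, sub_eq_zero]
    refine Finset.sum_congr rfl fun m _ => ?_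
    rw [hmul, _root_.mul_assoc]
  have hfs : f = ∑ m ∈ s, b m := by
    apply fn_ext_pt
    intro x
    have := hgf 1 x
    rw [one_smul] at this
    rw [this, map_sum]
    exact Finset.sum_congr rfl fun m _ => by rw [hone, _root_.one_mul]
  obtain ⟨m, hm, hpm⟩ := exists_mem_basicOpen_of_sum s b p (hfs ▸ hpf)
  refine ⟨b m, hpm, ?_, fun g x hx => ?_⟩
  · refine subset_of_forall_pt' (X.X.left.basicOpen (b m)).2.isLocallyClosed O.2 fun x hx => ?_
    by_contra hxO
    have hx' := (mem_basicOpen_iff_fnPull x (b m)).1 hx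
    refine hx' (hli s (fun m => fnPull x (b m)) (fun g => ?_) m hm)
    rw [← hgf]
    by_contra hne
    exact hO.compl g x hxO (hfO ((mem_basicOpen_iff_fnPull (g • x) f).2 hne))
  · refine (mem_basicOpen_iff_fnPull (g • x) (b m)).2 ?_
    rw [hw g x m hm]
    have h1 : fnPull g (χ m) * fnPull g⁻¹ (χ m) = 1 := by rw [← hmul, mul_inv_cancel, hone]
    exact mul_ne_zero (left_ne_zero_of_mul_eq_one h1) ((mem_basicOpen_iff_fnPull x (b m)).1 hx)

/-- The open subscheme defined by an open subset. -/
def openObj (X : Sch k) (U : X.left.Opens) : Sch k := Over.mk (U.ι ≫ X.hom)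
def openObjι (X : Sch k) (U : X.left.Opens) : openObj X U ⟶ X := Over.homMk U.ι rfl
instance (X : Sch k) (U : X.left.Opens) : IsOpenImmersion (openObjι X U).left :=
  inferInstanceAs (IsOpenImmersion U.ι)
instance (X : Sch k) (U : X.left.Opens) [LFT X.hom] :
    LFT (openObj X U).hom := inferInstanceAs (LFT (U.ι ≫ X.hom))
instance (X : Sch k) (U : X.left.Opens) [IsReduced X.left] :
    IsReduced (openObj X U).left := isReduced_of_isOpenImmersion (openObjι X U).left

lemma range_openObjι (X : Sch k) (U : X.left.Opens) : Set.range (openObjι X U).left = U :=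
  Scheme.Opens.range_ι U

lemma stable_of_range {X : GSch G} {Z : Sch k} (j : Z ⟶ X.X) [IsImmersion j.left]
    (h : InvSet X (Set.range j.left)) (g : Pt G) (z : Pt Z) :
    ∃ z' : Pt Z, z' ≫ j = g • (z ≫ j) :=
  exists_pt_lift j _ (h g (z ≫ j) ⟨z.val, rfl⟩)

lemma invSet_range {X Y : GSch G} (f : Y ⟶ X) [IsImmersion f.hom.left] :
    InvSet X (Set.range f.hom.left) := fun g x hx => by
  obtain ⟨y, rfl⟩ := exists_pt_lift f.hom x hx
  rw [← GSch.smul_comp]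
  exact ⟨(g • y : Pt Y.X).val, rfl⟩

variable [GoodGrp G]

lemma IsGood.exists_isAffineOpen {X : GSch G} (hX : IsGood X)
    [LFT X.X.hom] [IsReduced X.X.left] (O : X.X.left.Opens)
    (hO : InvSet X (O : Set X.X.left)) (p : X.X.left) (hp : p ∈ O) :
    ∃ V : X.X.left.Opens, p ∈ V ∧ V ≤ O ∧ IsAffineOpen V ∧ InvSet X (V : Set X.X.left) := by
  obtain ⟨U, hpU, hU, hUi⟩ := hX p
  have hst := stable_of_range (openObjι X.X U) (by rw [range_openObjι]; exact hUi.invSet)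
  let Y : GSch G := subMod X (openObjι X.X U) hst
  let i : Y ⟶ X := subModι X (openObjι X.X U) hst
  have h1 : IsAffine Y.X.left := hU
  have h2 : LFT Y.X.hom := inferInstanceAs (LFT (openObj X.X U).hom)
  have h3 : IsReduced Y.X.left := inferInstanceAs (IsReduced (openObj X.X U).left)
  have h4 : IsOpenImmersion i.hom.left := inferInstanceAs (IsOpenImmersion (openObjι X.X U).left)
  obtain ⟨q, hq⟩ : p ∈ Set.range i.hom.left := by
    have : Set.range i.hom.left = U := range_openObjι X.X U
    rw [this]; exact hpU
  obtain ⟨a, ha1, ha2, ha3⟩ := exists_invSet_basicOpen Y (i.hom.left ⁻¹ᵁ O) (hO.preimage i) q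
    (by change i.hom.left q ∈ O; rwa [hq])
  refine ⟨i.hom.left ''ᵁ Y.X.left.basicOpen a, ⟨q, ha1, hq⟩, ?_, ?_, ?_⟩
  · rintro _ ⟨y, hy, rfl⟩
    exact ha2 hy
  · exact ((isAffineOpen_top Y.X.left).basicOpen a).image_of_isOpenImmersion i.hom.left
  · rintro g x ⟨y, hy, hyx⟩
    obtain ⟨z, rfl⟩ := exists_pt_lift i.hom x ⟨y, hyx⟩
    have : y = z.val := i.hom.left.isOpenEmbedding.injective hyx
    subst this
    rw [← GSch.smul_comp]
    exact ⟨_, ha3 g z hy, rfl⟩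

lemma isGood_of_isImmersion {X Y : GSch G} (hX : IsGood X) [LFT X.X.hom]
    [IsReduced X.X.left] [LFT Y.X.hom] (f : Y ⟶ X) [IsImmersion f.hom.left] :
    IsGood Y := by
  intro p
  have hr := invSet_range f
  have hl := Scheme.Hom.isLocallyClosed_range f.hom.left
  let O := f.hom.left.coborderRange
  have hO : InvSet X (O : Set X.X.left) := by
    have : (O : Set X.X.left) = (closure (Set.range f.hom.left) ∩ (Set.range f.hom.left)ᶜ)ᶜ := by
      change coborder _ = _
      rw [coborder, Set.sdiff_eq]
    rw [this]
    exact ((hr.closure hl).inter hr.compl).compl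
  obtain ⟨V, hpV, hVO, hV, hVi⟩ := hX.exists_isAffineOpen O hO (f.hom.left p)
    (subset_coborder ⟨p, rfl⟩)
  refine ⟨f.hom.left ⁻¹ᵁ V, hpV, ?_, isInvOpen_of_invSet (hVi.preimage f)⟩
  have e : f.hom.left ⁻¹ᵁ V = f.hom.left.liftCoborder ⁻¹ᵁ (O.ι ⁻¹ᵁ V) := by
    rw [← Scheme.Hom.comp_preimage, Scheme.Hom.liftCoborder_ι]
  rw [e]
  refine IsAffineOpen.preimage ?_ f.hom.left.liftCoborder
  exact hV.preimage_of_isOpenImmersion O.ι (by rwa [Scheme.Opens.opensRange_ι])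

lemma quasiCompact_of_isImmersion {X Z : Scheme.{u}} (j : Z ⟶ X) [IsImmersion j]
    [IsLocallyNoetherian X] : QuasiCompact j := by
  rw [quasiCompact_iff_forall_isAffineOpen]
  intro U hU
  have : IsNoetherianRing Γ(X, U) := IsLocallyNoetherian.component_noetherian ⟨U, hU⟩
  have hUn : TopologicalSpace.NoetherianSpace (U : Set X) := noetherianSpace_of_isAffineOpen U hU
  rw [j.isEmbedding.isInducing.isCompact_iff]
  change IsCompact (j '' (j ⁻¹' U))
  rw [Set.image_preimage_eq_inter_range]
  have h := (TopologicalSpace.NoetherianSpace.isCompact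
    ((Subtype.val : {x // x ∈ (U : Set X)} → X) ⁻¹' Set.range j)).image continuous_subtype_val
  rwa [Set.image_preimage_eq_inter_range, Subtype.range_coe, Set.inter_comm] at h

/-! ### Equivariant varieties from subsets -/

variable {B : GSch G} [LFT B.X.hom]

/-- An equivariant variety that is immersed into another one. -/
def GVar.ofImmersion {X : GSch G} (hX : IsGood X) [LFT X.X.hom]
    [IsReduced X.X.left] [IsSeparated X.X.hom] (Y : GSch G) [IsReduced Y.X.left]
    [LFT Y.X.hom] (f : Y ⟶ X) [IsImmersion f.hom.left] (str : Y ⟶ B)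
    (hq : QuasiCompact str.hom.left) : GVar B where
  X := Y
  str := str
  isReduced := ‹_›
  isSeparated := by rw [← Over.w f.hom]; infer_instance
  locallyOfFiniteType := lft_left _ ‹_›
  quasiCompact := hq
  isGood := isGood_of_isImmersion hX f

/-- The reduced subscheme defined by a locally closed subset, over `k`. -/
def subObj (X : Sch k) {s : Set X.left} (hs : IsLocallyClosed s) : Sch k :=
  Over.mk (redSubι X.left hs ≫ X.hom)
def subObjι (X : Sch k) {s : Set X.left} (hs : IsLocallyClosed s) : subObj X hs ⟶ X :=
  Over.homMk (redSubι X.left hs) rfl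
instance (X : Sch k) {s : Set X.left} (hs : IsLocallyClosed s) :
    IsImmersion (subObjι X hs).left := inferInstanceAs (IsImmersion (redSubι X.left hs))
instance (X : Sch k) {s : Set X.left} (hs : IsLocallyClosed s) : IsReduced (subObj X hs).left :=
  inferInstanceAs (IsReduced (redSub X.left hs))
lemma range_subObjι (X : Sch k) {s : Set X.left} (hs : IsLocallyClosed s) :
    Set.range (subObjι X hs).left = s := range_redSubι _ hs

lemma lft_of_isImmersion {X Z : Sch k} (j : Z ⟶ X) [IsImmersion j.left]
    [LFT X.hom] : LFT Z.hom := by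
  have : IsLocallyNoetherian X.left := LocallyOfFiniteType.isLocallyNoetherian X.hom
  obtain ⟨W, g₁, g₂, h1, h2, h3⟩ := (IsImmersion.isImmersion_iff_exists (f := j.left)).1 inferInstance
  have : LFT j.left := by
    rw [← h3]
    infer_instance
  rw [← Over.w j]
  infer_instance

instance (X : Sch k) {s : Set X.left} (hs : IsLocallyClosed s) [LFT X.hom] :
    LFT (subObj X hs).hom := lft_of_isImmersion (subObjι X hs)

/-- The subset `s` is locally closed and invariant. -/
structure InvLC (X : GSch G) (s : Set X.X.left) : Prop where
  lc : IsLocallyClosed s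
  inv : InvSet X s

lemma InvSet.lc {X : GSch G} {s : Set X.X.left} (hi : InvSet X s) (hs : IsClosed s) : InvLC X s :=
  ⟨hs.isLocallyClosed, hi⟩

lemma InvSet.lc_compl {X : GSch G} {s : Set X.X.left} (hi : InvSet X s) (hs : IsClosed s) :
    InvLC X sᶜ :=
  ⟨hs.isOpen_compl.isLocallyClosed, hi.compl⟩

section sub
variable (X : GVar B) {s : Set X.X.X.left} (hs : InvLC X.X s)

/-- The variety defined by an invariant locally closed subset. -/
def GVar.sub : GVar B :=
  have h := stable_of_range (subObjι X.X.X hs.lc) (by simpa only [range_subObjι] using hs.inv)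
  haveI : IsReduced (subMod X.X (subObjι X.X.X hs.lc) h).X.left :=
    inferInstanceAs (IsReduced (subObj X.X.X hs.lc).left)
  haveI : LFT (subMod X.X (subObjι X.X.X hs.lc) h).X.hom :=
    inferInstanceAs (LFT (subObj X.X.X hs.lc).hom)
  haveI : IsImmersion (subModι X.X (subObjι X.X.X hs.lc) h).hom.left :=
    inferInstanceAs (IsImmersion (subObjι X.X.X hs.lc).left)
  .ofImmersion X.isGood (subMod X.X (subObjι X.X.X hs.lc) h) (subModι X.X (subObjι X.X.X hs.lc) h)
    (subModι X.X (subObjι X.X.X hs.lc) h ≫ X.str) (by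
      have : IsLocallyNoetherian X.X.X.left := LocallyOfFiniteType.isLocallyNoetherian X.X.X.hom
      have := quasiCompact_of_isImmersion (subObjι X.X.X hs.lc).left
      exact MorphismProperty.comp_mem @QuasiCompact (subObjι X.X.X hs.lc).left X.str.hom.left this
        inferInstance)

def GVar.subι : (X.sub hs).X ⟶ X.X :=
  subModι X.X (subObjι X.X.X hs.lc) (stable_of_range _ (by simpa only [range_subObjι] using hs.inv))

instance : IsImmersion (X.subι hs).hom.left := inferInstanceAs (IsImmersion (subObjι X.X.X hs.lc).left)

lemma GVar.range_subι : Set.range (X.subι hs).hom.left = s := range_subObjι _ hs.lc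

lemma GVar.subι_str : X.subι hs ≫ X.str = (X.sub hs).str := rfl

lemma GVar.exists_subι_iff (x : Pt X.X.X) :
    (∃ y : Pt (X.sub hs).X.X, y ≫ (X.subι hs).hom = x) ↔ x.val ∈ s := by
  rw [← mem_range_iff_pt, X.range_subι]

lemma GVar.subι_injective {T : Sch k} {y y' : T ⟶ (X.sub hs).X.X}
    (h : y ≫ (X.subι hs).hom = y' ≫ (X.subι hs).hom) : y = y' := by
  have := mono_of_left (X.subι hs).hom
  exact (cancel_mono _).1 h

end sub

/-! ### Invariance of classes -/

instance (X : GVar B) : IsLocallyNoetherian X.X.X.left :=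
  LocallyOfFiniteType.isLocallyNoetherian X.X.X.hom

lemma GVar.mk_eq_of_immersions {X Z U : GVar B} (i : Z.X ⟶ X.X) (j : U.X ⟶ X.X)
    (hi : i ≫ X.str = Z.str) (hj : j ≫ X.str = U.str) [IsImmersion i.hom.left]
    [IsImmersion j.hom.left] (hc : IsClosed (Set.range i.hom.left))
    (hr : Set.range j.hom.left = (Set.range i.hom.left)ᶜ) : K0.mk X = K0.mk Z + K0.mk U :=
  K0.mk_eq (i := i) (j := j) ⟨hi, hj, isClosedImmersion_of_isImmersion _ hc,
    isOpenImmersion_of_isImmersion _ (hr ▸ hc.isOpen_compl), hr⟩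

lemma K0.mk_of_isEmpty (X : GVar B) [IsEmpty X.X.X.left] : K0.mk X = 0 := by
  have h1 : IsImmersion (𝟙 X.X : X.X ⟶ X.X).hom.left := inferInstanceAs (IsImmersion (𝟙 X.X.X.left))
  have h2 : Set.range (𝟙 X.X : X.X ⟶ X.X).hom.left = ∅ := Set.range_eq_empty _
  have := GVar.mk_eq_of_immersions (X := X) (Z := X) (U := X) (𝟙 _) (𝟙 _) (id_comp _)
    (id_comp _) (by rw [h2]; exact isClosed_empty)
    (by ext x; exact (IsEmpty.false x).elim)
  simpa using this

lemma GVar.mk_eq_sub_add_sub (X : GVar B) {s : Set X.X.X.left} (hs : IsClosed s)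
    (hi : InvSet X.X s) : K0.mk X = K0.mk (X.sub (hi.lc hs)) + K0.mk (X.sub (hi.lc_compl hs)) :=
  GVar.mk_eq_of_immersions (X.subι _) (X.subι _) rfl rfl (by rwa [X.range_subι])
    (by rw [X.range_subι, X.range_subι])

lemma K0.mk_eq_of_immersion_surjective {X Y : GVar B} (f : Y.X ⟶ X.X) (hf : f ≫ X.str = Y.str)
    [IsImmersion f.hom.left] (hs : ∀ x : Pt X.X.X, ∃ y : Pt Y.X.X, y ≫ f.hom = x) :
    K0.mk Y = K0.mk X := by
  have hr : Set.range f.hom.left = Set.univ := (surjective_of_pt f.hom hs).range_eq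
  have h : InvLC X.X (∅ : Set X.X.X.left) := ⟨isClosed_empty.isLocallyClosed, fun _ _ h => h.elim⟩
  have hE := X.range_subι h
  have : IsEmpty (X.sub h).X.X.left := Set.range_eq_empty_iff.1 hE
  rw [GVar.mk_eq_of_immersions (X := X) f (X.subι h) hf rfl (by rw [hr]; exact isClosed_univ)
    (by rw [hr, hE, Set.compl_univ]), K0.mk_of_isEmpty (X.sub h), add_zero]

end
end

section
/-! ### Disjoint unions -/

section

section sigmaObj
variable {I : Type u} (X : I → Sch k)

def sigmaObj : Sch k := Over.mk (Sigma.desc fun i => (X i).hom)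

def sigmaIn (i : I) : X i ⟶ sigmaObj X :=
  Over.homMk (Sigma.ι (fun i => (X i).left) i) (Sigma.ι_desc _ _)

instance (i : I) : IsOpenImmersion (sigmaIn X i).left :=
  (inferInstance : IsOpenImmersion (Sigma.ι (fun i => (X i).left) i))

variable {X} in
def sigmaTo {T : Sch k} (f : ∀ i, X i ⟶ T) : sigmaObj X ⟶ T :=
  Over.homMk (Sigma.desc fun i => (f i).left) (by
    refine Sigma.hom_ext _ _ fun i => ?_
    have h : Sigma.ι (fun i => (X i).left) i ≫ (sigmaObj X).hom = (X i).hom := Sigma.ι_desc _ _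
    rw [h]
    exact (Sigma.ι_desc_assoc _ _ _).trans (Over.w (f i)))

variable {X} in
lemma sigmaIn_sigmaTo {T : Sch k} (f : ∀ i, X i ⟶ T) (i : I) : sigmaIn X i ≫ sigmaTo f = f i :=
  Over.OverMorphism.ext (Sigma.ι_desc _ _)

lemma exists_sigmaIn_val (p : (sigmaObj X).left) : ∃ (i : I) (q : (X i).left), (sigmaIn X i).left q = p := by
  obtain ⟨i, q, hq⟩ := (sigmaOpenCover (fun i => (X i).left)).exists_eq p
  exact ⟨i, q, hq⟩

lemma exists_sigmaIn_pt (p : Pt (sigmaObj X)) : ∃ (i : I) (q : Pt (X i)), q ≫ sigmaIn X i = p := by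
  obtain ⟨i, q, hq⟩ := exists_sigmaIn_val X p.val
  obtain ⟨z, hz⟩ := exists_pt_lift (sigmaIn X i) p ⟨q, hq⟩
  exact ⟨i, z, hz⟩

lemma sigmaIn_val_ne {i j : I} (h : i ≠ j) (p : (X i).left) (q : (X j).left) :
    (sigmaIn X i).left p ≠ (sigmaIn X j).left q := by
  intro e
  have := (sigmaι_eq_iff (fun i => (X i).left) i j p q).1 e
  exact h (congrArg Sigma.fst this)

lemma sigmaIn_pt_injective {i j : I} {p : Pt (X i)} {q : Pt (X j)}
    (h : p ≫ sigmaIn X i = q ≫ sigmaIn X j) : (⟨i, p⟩ : Σ i, Pt (X i)) = ⟨j, q⟩ := by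
  have hij : i = j := by
    by_contra hne
    exact sigmaIn_val_ne X hne p.val q.val (congrArg Pt.val h)
  subst hij
  have := mono_of_left (sigmaIn X i)
  rw [(cancel_mono _).1 h]

instance [∀ i, LFT (X i).hom] : LFT (sigmaObj X).hom :=
  have : IsZariskiLocalAtSource @LocallyOfFiniteType := HasRingHomProperty.instIsZariskiLocalAtSource
  IsZariskiLocalAtSource.sigmaDesc (P := @LocallyOfFiniteType) fun _ => inferInstance

instance [∀ i, IsReduced (X i).left] : IsReduced (sigmaObj X).left :=
  @IsReduced.of_openCover _ (sigmaOpenCover (fun i => (X i).left))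
    fun i : I => (inferInstance : IsReduced (X i).left)

lemma isOpenImmersion_sigmaTo {T : Sch k} (f : ∀ i, X i ⟶ T) (hf : ∀ i, IsOpenImmersion (f i).left)
    (hd : ∀ i j, i ≠ j → Disjoint (Set.range (f i).left) (Set.range (f j).left)) :
    IsOpenImmersion (sigmaTo f).left :=
  have := hf
  isOpenImmersion_sigmaDesc _ (fun i => (f i).left) fun i j h => hd i j h

instance sigmaObj_isSeparated [∀ i, IsSeparated (X i).hom] : IsSeparated (sigmaObj X).hom := by
  let Y := sigmaObj X
  let δ : Y ⟶ Y ⊗ Y := lift (𝟙 Y) (𝟙 Y)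
  let δ' (i : I) : X i ⟶ X i ⊗ X i := lift (𝟙 (X i)) (𝟙 (X i))
  let m (i : I) : X i ⊗ X i ⟶ Y ⊗ Y := sigmaIn X i ⊗ₘ sigmaIn X i
  have hm (i : I) : IsOpenImmersion (m i).left :=
    tensorHom_left (P := @IsOpenImmersion) inferInstance inferInstance
  have hδ' (i : I) : IsClosedImmersion (δ' i).left :=
    (inferInstance : IsClosedImmersion (pullback.diagonal (X i).hom))
  have hdm (i : I) : sigmaIn X i ≫ δ = δ' i ≫ m i := by
    apply CartesianMonoidalCategory.hom_ext <;> simp [δ, δ', m] <;>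
      exact comp_id _
  have e1 (x : Y.left) : (fst Y Y).left (δ.left x) = x :=
    congrArg (fun t : Y ⟶ Y => t.left x) (lift_fst _ _)
  have e2 (x : Y.left) : (snd Y Y).left (δ.left x) = x :=
    congrArg (fun t : Y ⟶ Y => t.left x) (lift_snd _ _)
  have hr (i : I) : IsOpen (Set.range (sigmaIn X i).left) := (sigmaIn X i).left.isOpenEmbedding.isOpen_range
  have hop : IsOpen (Set.range δ.left)ᶜ := isOpen_iff_forall_mem_open.2 fun p hp => by
    obtain ⟨i, a, ha⟩ := exists_sigmaIn_val X ((fst Y Y).left p)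
    obtain ⟨j, b, hb⟩ := exists_sigmaIn_val X ((snd Y Y).left p)
    by_cases hij : i = j
    · subst hij
      have hc := (comp_id (X i).hom).trans (Over.w (sigmaIn X i)).symm
      obtain ⟨q, rfl⟩ : p ∈ Set.range (m i).left := (Scheme.Pullback.range_map (X i).hom (X i).hom
        Y.hom Y.hom (sigmaIn X i).left (sigmaIn X i).left (𝟙 _) hc hc).ge ⟨⟨a, ha⟩, ⟨b, hb⟩⟩
      have hd (y : (X i).left) : δ.left ((sigmaIn X i).left y) = (m i).left ((δ' i).left y) :=
        congrArg (fun t : X i ⟶ Y ⊗ Y => t.left y) (hdm i)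
      refine ⟨(m i).left '' (Set.range (δ' i).left)ᶜ, ?_, (m i).left.isOpenEmbedding.isOpenMap _
        (hδ' i).isClosedEmbedding.isClosed_range.isOpen_compl,
        ⟨q, fun ⟨y, h⟩ => hp ⟨_, (hd y).trans (congrArg _ h)⟩, rfl⟩⟩
      rintro _ ⟨q', hq', rfl⟩ ⟨x, hx⟩
      have hy : (sigmaIn X i).left ((fst (X i) (X i)).left q') = x :=
        (congrArg (fun t : X i ⊗ X i ⟶ Y => t.left q') (tensorHom_fst _ _)).symm.trans
          ((congrArg (fst Y Y).left hx.symm).trans (e1 x))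
      exact hq' ⟨_, (m i).left.isOpenEmbedding.injective
        ((hd _).symm.trans ((congrArg δ.left hy).trans hx))⟩
    · refine ⟨(fst Y Y).left ⁻¹' Set.range (sigmaIn X i).left ∩
        (snd Y Y).left ⁻¹' Set.range (sigmaIn X j).left, ?_, ((hr i).preimage
        (fst Y Y).left.continuous).inter ((hr j).preimage (snd Y Y).left.continuous), ⟨a, ha⟩, ⟨b, hb⟩⟩
      rintro _ ⟨⟨a', ha'⟩, ⟨b', hb'⟩⟩ ⟨x, rfl⟩
      exact sigmaIn_val_ne X hij a' b' (ha'.trans ((e1 x).trans ((e2 x).symm.trans hb'.symm)))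
  constructor
  have : IsImmersion (pullback.diagonal Y.hom) := inferInstance
  exact isClosedImmersion_of_isImmersion _ (isOpen_compl_iff.1 hop)

end sigmaObj

variable {G : Sch k} [GrpObj G] [GoodGrp G]

section sigmaAct
variable {I : Type u} (X : I → GSch G) [∀ i, LFT (X i).X.hom] [∀ i, IsReduced (X i).X.left]

/-- The comparison `⊔ G × X_i ⟶ G × ⊔ X_i`. -/
def sigmaTensor : sigmaObj (fun i => G ⊗ (X i).X) ⟶ G ⊗ sigmaObj (fun i => (X i).X) :=
  sigmaTo fun i => G ◁ sigmaIn (fun i => (X i).X) i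

instance : IsIso (sigmaTensor X) := by
  have h1 : IsOpenImmersion (sigmaTensor X).left := by
    refine isOpenImmersion_sigmaTo _ _ (fun i => ?_) fun i j hij => ?_
    · exact MorphismProperty.of_isPullback (P := @IsOpenImmersion)
        ((isPullback_whiskerLeft (sigmaIn (fun i => (X i).X) i) G).map (Over.forget _)).flip
        (inferInstance : IsOpenImmersion (sigmaIn (fun i => (X i).X) i).left)
    · rw [Set.disjoint_iff]
      rintro _ ⟨⟨a, rfl⟩, ⟨b, hb⟩⟩
      have e1 := congrArg (fun t : G ⊗ (X i).X ⟶ _ => t.left a)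
        (whiskerLeft_snd G (sigmaIn (fun i => (X i).X) i))
      have e2 := congrArg (fun t : G ⊗ (X j).X ⟶ _ => t.left b)
        (whiskerLeft_snd G (sigmaIn (fun i => (X i).X) j))
      refine sigmaIn_val_ne (fun i => (X i).X) hij.symm _ _ (e2.symm.trans (Eq.trans ?_ e1))
      exact congrArg (snd G (sigmaObj fun i => (X i).X)).left hb
  have h2 : Surjective (sigmaTensor X).left := by
    refine ⟨surjective_of_pt (sigmaTensor X) fun y => ?_⟩
    obtain ⟨i, q, hq⟩ := exists_sigmaIn_pt _ (y ≫ snd _ _)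
    refine ⟨lift (y ≫ fst _ _) q ≫ sigmaIn (fun i => G ⊗ (X i).X) i, ?_⟩
    rw [assoc, sigmaTensor, sigmaIn_sigmaTo]
    apply CartesianMonoidalCategory.hom_ext
    · simp
    · simp only [assoc, whiskerLeft_snd, lift_snd_assoc]
      exact hq
  have h3 : IsIso (sigmaTensor X).left := (isIso_iff_isOpenImmersion_and_surjective _).2 ⟨h1, h2⟩
  have h4 : IsIso ((Over.forget (Spec (.of k))).map (sigmaTensor X)) := h3
  exact isIso_of_reflects_iso (sigmaTensor X) (Over.forget _)

def sigmaAct : G ⊗ sigmaObj (fun i => (X i).X) ⟶ sigmaObj (fun i => (X i).X) :=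
  inv (sigmaTensor X) ≫ sigmaTo fun i =>
    (fst G (X i).X • snd G (X i).X) ≫ sigmaIn (fun i => (X i).X) i

lemma lift_sigmaAct {T : Sch k} (i : I) (g : T ⟶ G) (x : T ⟶ (X i).X) :
    lift g (x ≫ sigmaIn (fun i => (X i).X) i) ≫ sigmaAct X =
      (g • x) ≫ sigmaIn (fun i => (X i).X) i := by
  have h : lift g (x ≫ sigmaIn (fun i => (X i).X) i) =
      (lift g x ≫ sigmaIn (fun i => G ⊗ (X i).X) i) ≫ sigmaTensor X := by
    rw [assoc, sigmaTensor, sigmaIn_sigmaTo]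
    ext <;> simp
  rw [h, sigmaAct, assoc, IsIso.hom_inv_id_assoc, assoc, sigmaIn_sigmaTo,
    ← assoc, ModObj.comp_smul, lift_fst, lift_snd]

def sigmaMod : GSch G :=
  letI : ModObj G (sigmaObj (fun i => (X i).X)) := modObjOfPt (sigmaAct X) (fun z => by
      obtain ⟨i, q, rfl⟩ := exists_sigmaIn_pt _ z
      rw [lift_sigmaAct, one_smul])
    (fun g h z => by
      obtain ⟨i, q, rfl⟩ := exists_sigmaIn_pt _ z
      rw [lift_sigmaAct, lift_sigmaAct, lift_sigmaAct, mul_smul])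
  ⟨sigmaObj (fun i => (X i).X)⟩

instance : LFT (sigmaMod X).X.hom := inferInstanceAs (LFT (sigmaObj (fun i => (X i).X)).hom)
instance : IsReduced (sigmaMod X).X.left :=
  inferInstanceAs (IsReduced (sigmaObj (fun i => (X i).X)).left)

def sigmaModIn (i : I) : X i ⟶ sigmaMod X :=
  GSch.homMk (show (X i).X ⟶ (sigmaMod X).X from sigmaIn (fun i => (X i).X) i)
    (fun g x => (lift_sigmaAct X i g x).symm)

variable {X} in
def sigmaModTo {T : GSch G} (f : ∀ i, X i ⟶ T) : sigmaMod X ⟶ T :=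
  GSch.homMk (show (sigmaMod X).X ⟶ T.X from sigmaTo fun i => (f i).hom) (fun g x => by
    obtain ⟨i, q, rfl⟩ := exists_sigmaIn_pt _ x
    have h1 := GSch.smul_comp (sigmaModIn X i) g q
    have h2 (y : Pt (X i).X) : (y ≫ sigmaIn (fun i => (X i).X) i) ≫ sigmaTo (fun i => (f i).hom) =
        y ≫ (f i).hom := by rw [assoc, sigmaIn_sigmaTo]
    refine (h1.symm =≫ sigmaTo (fun i => (f i).hom)).trans ?_
    refine (h2 _).trans ((GSch.smul_comp (f i) g q).trans (congrArg (g • ·) (h2 q).symm)))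

end sigmaAct

variable {B : GSch G} [LFT B.X.hom]

variable {I : Type u} (X : I → GVar B)

/-- Only finitely many members of the family meet the preimage of a quasi-compact open subset. -/
def LocFin : Prop :=
  ∀ K : B.X.left.Opens, IsCompact (K : Set B.X.left) →
    {i | ((X i).str.hom.left ⁻¹' (K : Set B.X.left)).Nonempty}.Finite

variable (h : LocFin X)

/-- The disjoint union of a locally finite family. -/
def GVar.sigma : GVar B where
  X := sigmaMod fun i => (X i).X
  str := sigmaModTo fun i => (X i).str
  isReduced := inferInstance
  isSeparated := inferInstanceAs (IsSeparated (sigmaObj fun i => (X i).X.X).hom)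
  locallyOfFiniteType := lft_left _ inferInstance
  quasiCompact := by
    rw [quasiCompact_iff_forall_isAffineOpen]
    intro K hK
    have hf := h K hK.isCompact
    let m (i : I) := (sigmaIn (fun i => (X i).X.X) i).left
    have hc (i : I) (q : (X i).X.X.left) : (sigmaModTo fun i => (X i).str).hom.left (m i q) =
        (X i).str.hom.left q :=
      congrArg (fun t : (X i).X.X ⟶ B.X => t.left q) (sigmaIn_sigmaTo (fun i => (X i).str.hom) i)
    have e : (((sigmaModTo fun i => (X i).str).hom.left ⁻¹ᵁ K : (sigmaMod fun i => (X i).X).X.left.Opens) :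
        Set (sigmaMod fun i => (X i).X).X.left) =
        ⋃ i ∈ {i | ((X i).str.hom.left ⁻¹' (K : Set B.X.left)).Nonempty},
          m i '' ((X i).str.hom.left ⁻¹' K) := by
      ext p
      constructor
      · intro hp
        obtain ⟨i, q, rfl⟩ := exists_sigmaIn_val (fun i => (X i).X.X) p
        have hq : (X i).str.hom.left q ∈ K := by rw [← hc]; exact hp
        exact Set.mem_biUnion (show i ∈ _ from ⟨q, hq⟩) ⟨q, hq, rfl⟩
      · intro hp
        obtain ⟨i, -, q, hq, rfl⟩ := Set.mem_iUnion₂.1 hp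
        change (sigmaModTo fun i => (X i).str).hom.left (m i q) ∈ K
        rw [hc]
        exact hq
    rw [e]
    exact hf.isCompact_biUnion fun i _ =>
      ((X i).str.hom.left.isCompact_preimage hK.isCompact).image (m i).continuous
  isGood := by
    intro p
    obtain ⟨i, q, rfl⟩ := exists_sigmaIn_val (fun i => (X i).X.X) p
    obtain ⟨U, hqU, hU, hUi⟩ := (X i).isGood q
    let j := sigmaIn (fun i => (X i).X.X) i
    have ho : IsOpenImmersion j.left := inferInstance
    refine ⟨j.left ''ᵁ U, ⟨q, hqU, rfl⟩, hU.image_of_isOpenImmersion j.left, isInvOpen_of_invSet ?_⟩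
    rintro g x ⟨y, hy, hyx⟩
    obtain ⟨z, rfl⟩ := exists_pt_lift j x ⟨y, hyx⟩
    obtain rfl : y = z.val := j.left.isOpenEmbedding.injective hyx
    exact (congrArg (fun t : Pt (sigmaMod fun i => (X i).X).X => t.val ∈ (j.left ''ᵁ U :))
      (GSch.smul_comp (sigmaModIn (fun i => (X i).X) i) g z).symm).mpr ⟨_, hUi.invSet g z hy, rfl⟩

protected def GVar.sigmaIn (i : I) :
    (X i).X ⟶ (GVar.sigma X h).X := sigmaModIn (fun i => (X i).X) i

instance (i : I) :
    IsOpenImmersion (GVar.sigmaIn X h i).hom.left :=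
  inferInstanceAs (IsOpenImmersion (sigmaIn (fun i => (X i).X.X) i).left)

lemma GVar.sigmaIn_str (i : I) :
    GVar.sigmaIn X h i ≫ (GVar.sigma X h).str = (X i).str :=
  Mod.Hom.ext (sigmaIn_sigmaTo (fun i => (X i).str.hom) i)

def GVar.sigmaTo {T : GSch G} (f : ∀ i, (X i).X ⟶ T) :
    (GVar.sigma X h).X ⟶ T := sigmaModTo f

protected lemma GVar.sigmaIn_sigmaTo {T : GSch G}
    (f : ∀ i, (X i).X ⟶ T) (i : I) : GVar.sigmaIn X h i ≫ GVar.sigmaTo X h f = f i :=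
  Mod.Hom.ext (sigmaIn_sigmaTo (fun i => (f i).hom) i)

protected lemma GVar.exists_sigmaIn_pt {I : Type u} (X : I → GVar B) (h : LocFin X)
    (p : Pt (GVar.sigma X h).X.X) : ∃ (i : I) (q : Pt (X i).X.X), q ≫ (GVar.sigmaIn X h i).hom = p :=
  exists_sigmaIn_pt _ p

protected lemma GVar.sigmaIn_pt_injective {i j : I}
    {p : Pt (X i).X.X} {q : Pt (X j).X.X}
    (e : p ≫ (GVar.sigmaIn X h i).hom = q ≫ (GVar.sigmaIn X h j).hom) :
    (⟨i, p⟩ : Σ i, Pt (X i).X.X) = ⟨j, q⟩ :=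
  sigmaIn_pt_injective _ e

lemma GVar.mk_sigma_eq (W : GVar B)
    (f : ∀ i, (X i).X ⟶ W.X) (hf : ∀ i, f i ≫ W.str = (X i).str) [∀ i, IsImmersion (f i).hom.left]
    (ho : ∀ i, IsOpen (Set.range (f i).hom.left))
    (hd : ∀ i j (x : Pt (X i).X.X) (y : Pt (X j).X.X), x ≫ (f i).hom = y ≫ (f j).hom → i = j)
    (hs : ∀ w : Pt W.X.X, ∃ (i : I) (x : Pt (X i).X.X), x ≫ (f i).hom = w) :
    K0.mk (GVar.sigma X h) = K0.mk W := by
  have h1 : IsOpenImmersion (GVar.sigmaTo X h f).hom.left := by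
    refine isOpenImmersion_sigmaTo _ _ (fun i => isOpenImmersion_of_isImmersion _ (ho i))
      fun i j hij => ?_
    rw [Set.disjoint_iff_inter_eq_empty]
    by_contra hne
    obtain ⟨w, ⟨hw1, hw2⟩⟩ := exists_pt_mem (X := W.X.X) ((ho i).inter (ho j)).isLocallyClosed
      (Set.nonempty_iff_ne_empty.2 hne)
    obtain ⟨x, rfl⟩ := exists_pt_lift _ _ hw1
    obtain ⟨y, hy⟩ := exists_pt_lift _ _ hw2
    exact hij (hd i j x y hy.symm)
  have e1 (i : I) (q : Pt (X i).X.X) : (q ≫ (GVar.sigmaIn X h i).hom) ≫ (GVar.sigmaTo X h f).hom =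
      q ≫ (f i).hom := GSch.comp_eq (GVar.sigmaIn_sigmaTo X h f i) q
  refine K0.mk_eq_of_immersion_surjective (GVar.sigmaTo X h f) (GSch.ext_of_comp fun x => ?_)
    fun w => ?_
  · obtain ⟨i, q, rfl⟩ := GVar.exists_sigmaIn_pt X h x
    exact (e1 i q =≫ W.str.hom).trans
      ((GSch.comp_eq (hf i) q).trans (GSch.comp_eq (GVar.sigmaIn_str X h i) q).symm)
  · obtain ⟨i, x, rfl⟩ := hs w
    exact ⟨_, e1 i x⟩

end
end

section
section
variable {G : Sch k} [GrpObj G] [GoodGrp G]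
variable {B : GSch G} [LFT B.X.hom]

/-! ### Lifts to subvarieties and decompositions -/

lemma GVar.exists_lift (X : GVar B) {s : Set X.X.X.left} (hs : InvLC X.X s) {Y : GVar B}
    (f : Y.X ⟶ X.X) (hf : f ≫ X.str = Y.str) (h : ∀ y : Pt Y.X.X, Pt.val (y ≫ f.hom) ∈ s) :
    ∃ f' : Y.X ⟶ (X.sub hs).X, f' ≫ X.subι hs = f ∧ f' ≫ (X.sub hs).str = Y.str := by
  obtain ⟨f', hf'⟩ := exists_lift_pt (X.subι hs).hom f.hom fun t => (X.exists_subι_iff hs _).2 (h t)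
  let F : Y.X ⟶ (X.sub hs).X := GSch.homMk f' (fun g x => by
    apply X.subι_injective hs
    rw [GSch.smul_comp (X.subι hs) g (x ≫ f'), assoc, assoc, hf']
    exact GSch.smul_comp f g x)
  have hF : F ≫ X.subι hs = f := Mod.Hom.ext hf'
  exact ⟨F, hF, by rw [← X.subι_str, ← assoc, hF, hf]⟩

lemma GVar.subι_mem (X : GVar B) {s : Set X.X.X.left} (hs : InvLC X.X s) (p : (X.sub hs).X.X.left) :
    (X.subι hs).hom.left p ∈ s :=
  (X.range_subι hs).subset ⟨p, rfl⟩

lemma isImmersion_of_comp {X Y Z : GSch G} {f : X ⟶ Y} {g : Y ⟶ Z} {h : X ⟶ Z} (e : f ≫ g = h)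
    [hh : IsImmersion h.hom.left] : IsImmersion f.hom.left := by
  subst e
  have : IsImmersion (f.hom.left ≫ g.hom.left) := hh
  exact IsImmersion.of_comp _ g.hom.left

instance isImmersion_comp_hom {X Y Z : GSch G} (f : X ⟶ Y) (g : Y ⟶ Z) [IsImmersion f.hom.left]
    [IsImmersion g.hom.left] : IsImmersion (f ≫ g).hom.left :=
  (inferInstance : IsImmersion (f.hom.left ≫ g.hom.left))

lemma GVar.exists_subMap (X : GVar B) {s t : Set X.X.X.left} (hs : InvLC X.X s) (ht : InvLC X.X t)
    (h : s ⊆ t) : ∃ f : (X.sub hs).X ⟶ (X.sub ht).X, f ≫ X.subι ht = X.subι hs ∧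
      f ≫ (X.sub ht).str = (X.sub hs).str ∧ IsImmersion f.hom.left := by
  obtain ⟨f, h1, h2⟩ := X.exists_lift ht (X.subι hs) (X.subι_str hs)
    fun y => h ((X.exists_subι_iff hs _).1 ⟨y, rfl⟩)
  exact ⟨f, h1, h2, isImmersion_of_comp h1⟩

lemma GVar.mk_sigma_eq_sub {I : Type u} (W : GVar B) {s : Set W.X.X.left} (hs : InvLC W.X s)
    (Y : I → GVar B) (hY : LocFin Y) (e : ∀ i, (Y i).X ⟶ W.X)
    (he : ∀ i, e i ≫ W.str = (Y i).str) [∀ i, IsImmersion (e i).hom.left]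
    (hO : ∀ i, ∃ O : Set W.X.X.left, IsOpen O ∧ Set.range (e i).hom.left = s ∩ O)
    (hd : ∀ i j (x : Pt (Y i).X.X) (y : Pt (Y j).X.X), x ≫ (e i).hom = y ≫ (e j).hom → i = j)
    (hc : ∀ w : Pt W.X.X, w.val ∈ s → ∃ (i : I) (x : Pt (Y i).X.X), x ≫ (e i).hom = w) :
    K0.mk (GVar.sigma Y hY) = K0.mk (W.sub hs) := by
  have hr (i : I) : Set.range (e i).hom.left ⊆ s := by
    obtain ⟨O, -, h⟩ := hO i
    rw [h]; exact Set.inter_subset_left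
  choose f hf1 hf2 using fun i => W.exists_lift hs (e i) (he i) fun y => hr i ⟨y.val, rfl⟩
  have him (i : I) : IsImmersion (f i).hom.left := isImmersion_of_comp (hf1 i)
  have hp (i : I) (x : Pt (Y i).X.X) : (x ≫ (f i).hom) ≫ (W.subι hs).hom = x ≫ (e i).hom :=
    assoc'.trans (congrArg (fun t : (Y i).X ⟶ W.X => x ≫ t.hom) (hf1 i))
  refine GVar.mk_sigma_eq Y hY _ f hf2 (fun i => ?_) (fun i j x y h => ?_) fun w => ?_
  · obtain ⟨O, hOo, hOe⟩ := hO i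
    have hcomp (q) : (W.subι hs).hom.left ((f i).hom.left q) = (e i).hom.left q :=
      congrArg (fun t : (Y i).X ⟶ W.X => t.hom.left q) (hf1 i)
    convert hOo.preimage (W.subι hs).hom.left.continuous
    ext p
    constructor
    · rintro ⟨q, rfl⟩
      rw [Set.mem_preimage, hcomp]
      exact (hOe.subset ⟨q, rfl⟩).2
    · intro hp
      obtain ⟨q, hq⟩ := hOe.ge ⟨W.subι_mem hs p, hp⟩
      exact ⟨q, (W.subι hs).hom.left.isEmbedding.injective ((hcomp q).trans hq)⟩
  · exact hd i j x y (by rw [← hp, h, hp])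
  · obtain ⟨i, x, hx⟩ := hc (w ≫ (W.subι hs).hom) ((W.exists_subι_iff hs _).1 ⟨w, rfl⟩)
    exact ⟨i, x, W.subι_injective hs (by rw [hp, hx])⟩

lemma GVar.range_subMap (X : GVar B) {s t : Set X.X.X.left} (hs : InvLC X.X s) (ht : InvLC X.X t)
    (f : (X.sub hs).X ⟶ (X.sub ht).X) (hf : f ≫ X.subι ht = X.subι hs) :
    Set.range f.hom.left = (X.subι ht).hom.left ⁻¹' s := by
  have hc (p) : (X.subι ht).hom.left (f.hom.left p) = (X.subι hs).hom.left p :=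
    congrArg (fun t : (X.sub hs).X ⟶ X.X => t.hom.left p) hf
  ext p
  constructor
  · rintro ⟨q, rfl⟩
    exact (congrArg (· ∈ s) (hc q)).mpr (X.subι_mem hs q)
  · intro hp
    obtain ⟨q, hq⟩ := (X.range_subι hs).ge hp
    exact ⟨q, (X.subι ht).hom.left.isEmbedding.injective ((hc q).trans hq)⟩

/-! ### Disjoint unions of decompositions -/

section
variable {I : Type u} (A A' R : I → GVar B) (hA : LocFin A) (hA' : LocFin A') (hR : LocFin R)

lemma GVar.sigmaIn_injective (i : I) : Function.Injective (GVar.sigmaIn A hA i).hom.left :=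
  (GVar.sigmaIn A hA i).hom.left.isOpenEmbedding.injective

lemma GVar.sigmaIn_eq {i j : I} {p q} (h : (GVar.sigmaIn A hA i).hom.left p =
    (GVar.sigmaIn A hA j).hom.left q) : i = j := by
  by_contra hne
  exact sigmaIn_val_ne (fun i => (A i).X.X) hne p q h

lemma GVar.exists_sigmaIn (w : (GVar.sigma A hA).X.X.left) :
    ∃ i q, (GVar.sigmaIn A hA i).hom.left q = w :=
  exists_sigmaIn_val (fun i => (A i).X.X) w

lemma GVar.isOpen_range_sigmaIn (i : I) : IsOpen (Set.range (GVar.sigmaIn A hA i).hom.left) :=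
  (GVar.sigmaIn A hA i).hom.left.isOpenEmbedding.isOpen_range

/-- The subset of a disjoint union with given components. -/
def GVar.sigmaSet (t : ∀ i, Set (A i).X.X.left) : Set (GVar.sigma A hA).X.X.left :=
  {w | ∃ i q, (GVar.sigmaIn A hA i).hom.left q = w ∧ q ∈ t i}

lemma GVar.mem_sigmaSet (t : ∀ i, Set (A i).X.X.left) (i : I) (q) :
    (GVar.sigmaIn A hA i).hom.left q ∈ GVar.sigmaSet A hA t ↔ q ∈ t i := by
  refine ⟨?_, fun h => ⟨i, q, rfl, h⟩⟩
  rintro ⟨j, q', h, h'⟩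
  obtain rfl := GVar.sigmaIn_eq A hA h
  rwa [← GVar.sigmaIn_injective A hA _ h]

lemma GVar.sigmaSet_compl (t : ∀ i, Set (A i).X.X.left) :
    (GVar.sigmaSet A hA t)ᶜ = GVar.sigmaSet A hA fun i => (t i)ᶜ := by
  ext w
  obtain ⟨i, q, rfl⟩ := GVar.exists_sigmaIn A hA w
  rw [Set.mem_compl_iff, GVar.mem_sigmaSet, GVar.mem_sigmaSet, Set.mem_compl_iff]

lemma GVar.isOpen_sigmaSet {t : ∀ i, Set (A i).X.X.left} (ht : ∀ i, IsOpen (t i)) :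
    IsOpen (GVar.sigmaSet A hA t) := by
  have e : GVar.sigmaSet A hA t = ⋃ i, (GVar.sigmaIn A hA i).hom.left '' t i := by
    ext w
    rw [Set.mem_iUnion]
    exact ⟨fun ⟨i, q, h, h'⟩ => ⟨i, q, h', h⟩, fun ⟨i, q, h', h⟩ => ⟨i, q, h, h'⟩⟩
  rw [e]
  exact isOpen_iUnion fun i => (GVar.sigmaIn A hA i).hom.left.isOpenEmbedding.isOpenMap _ (ht i)

lemma GVar.isClosed_sigmaSet {t : ∀ i, Set (A i).X.X.left} (ht : ∀ i, IsClosed (t i)) :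
    IsClosed (GVar.sigmaSet A hA t) := by
  rw [← isOpen_compl_iff, GVar.sigmaSet_compl]
  exact GVar.isOpen_sigmaSet A hA fun i => (ht i).isOpen_compl

lemma GVar.invSet_sigmaSet {t : ∀ i, Set (A i).X.X.left} (ht : ∀ i, InvSet (A i).X (t i)) :
    InvSet (GVar.sigma A hA).X (GVar.sigmaSet A hA t) := by
  intro g w hw
  obtain ⟨i, q, rfl⟩ := GVar.exists_sigmaIn_pt A hA w
  rw [← GSch.smul_comp]
  exact (GVar.mem_sigmaSet A hA t i _).2 (ht i g q ((GVar.mem_sigmaSet A hA t i q.val).1 hw))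

lemma GVar.mk_sigma_eq_sigmaSet (t : ∀ i, Set (A i).X.X.left)
    (hs : InvLC (GVar.sigma A hA).X (GVar.sigmaSet A hA t)) (a : ∀ i, (A' i).X ⟶ (A i).X)
    (ha : ∀ i, a i ≫ (A i).str = (A' i).str) [him : ∀ i, IsImmersion (a i).hom.left]
    (hr : ∀ i, Set.range (a i).hom.left = t i) :
    K0.mk (GVar.sigma A' hA') = K0.mk ((GVar.sigma A hA).sub hs) := by
  have heA (i : I) : Set.range (a i ≫ GVar.sigmaIn A hA i).hom.left =
      GVar.sigmaSet A hA t ∩ Set.range (GVar.sigmaIn A hA i).hom.left := by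
    ext w
    constructor
    · rintro ⟨p, rfl⟩
      exact ⟨(GVar.mem_sigmaSet A hA t i ((a i).hom.left p)).2 ((hr i).subset ⟨p, rfl⟩), _, rfl⟩
    · rintro ⟨hw, q, rfl⟩
      obtain ⟨p, rfl⟩ := (hr i).ge ((GVar.mem_sigmaSet A hA t i q).1 hw)
      exact ⟨p, rfl⟩
  have (i : I) : IsImmersion (a i ≫ GVar.sigmaIn A hA i).hom.left := inferInstance
  refine GVar.mk_sigma_eq_sub (GVar.sigma A hA) hs A' hA' (fun i => a i ≫ GVar.sigmaIn A hA i)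
      (fun i => ?_) (fun i => ⟨_, GVar.isOpen_range_sigmaIn A hA i, heA i⟩)
      (fun i j x y h => GVar.sigmaIn_eq A hA (congrArg Pt.val h :)) fun w hw => ?_
  · rw [assoc, GVar.sigmaIn_str, ha]
  · obtain ⟨i, q, rfl⟩ := GVar.exists_sigmaIn_pt A hA w
    exact ⟨i, exists_pt_lift (a i ≫ GVar.sigmaIn A hA i).hom _ ((heA i).ge ⟨hw, q.val, rfl⟩)⟩

lemma GVar.mk_sigma_eq_add (a : ∀ i, (A' i).X ⟶ (A i).X) (ha : ∀ i, a i ≫ (A i).str = (A' i).str)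
    [∀ i, IsImmersion (a i).hom.left] (b : ∀ i, (R i).X ⟶ (A i).X)
    (hb : ∀ i, b i ≫ (A i).str = (R i).str) [∀ i, IsImmersion (b i).hom.left]
    (hc : ∀ i, IsClosed (Set.range (a i).hom.left))
    (hab : ∀ i, Set.range (b i).hom.left = (Set.range (a i).hom.left)ᶜ) :
    K0.mk (GVar.sigma A hA) = K0.mk (GVar.sigma A' hA') + K0.mk (GVar.sigma R hR) := by
  have hs := GVar.isClosed_sigmaSet A hA hc
  have hs' := GVar.isOpen_sigmaSet A hA fun i => (hc i).isOpen_compl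
  have hi := GVar.invSet_sigmaSet A hA fun i => invSet_range (a i)
  have hi' := GVar.invSet_sigmaSet A hA fun i => (invSet_range (a i)).compl
  rw [(GVar.sigma A hA).mk_eq_sub_add_sub hs hi,
    GVar.mk_sigma_eq_sigmaSet A A' hA hA' _ (hi.lc hs) a ha fun _ => rfl,
    GVar.mk_sigma_eq_sigmaSet A R hA hR _ ⟨hs'.isLocallyClosed, hi'⟩ b hb hab]
  congr 2
  congr 1
  exact GVar.sigmaSet_compl A hA _
end

lemma GVar.mk_sigma_succ (A : ULift.{u} ℕ → GVar B) (hA : LocFin A)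
    (hA' : LocFin fun n : ULift.{u} ℕ => A ⟨n.down + 1⟩) :
    K0.mk (GVar.sigma A hA) = K0.mk (A ⟨0⟩) +
      K0.mk (GVar.sigma (fun n : ULift.{u} ℕ => A ⟨n.down + 1⟩) hA') := by
  let W := GVar.sigma A hA
  let t : Set W.X.X.left := Set.range (GVar.sigmaIn A hA ⟨0⟩).hom.left
  have h0 {n : ℕ} {p q} (h : (GVar.sigmaIn A hA ⟨n + 1⟩).hom.left p =
      (GVar.sigmaIn A hA ⟨0⟩).hom.left q) : False :=
    Nat.succ_ne_zero n (congrArg ULift.down (GVar.sigmaIn_eq A hA h))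
  have htc : IsClosed t := by
    have e : tᶜ = ⋃ n : ℕ, Set.range (GVar.sigmaIn A hA ⟨n + 1⟩).hom.left := by
      ext w
      obtain ⟨⟨n⟩, q, rfl⟩ := GVar.exists_sigmaIn A hA w
      rw [Set.mem_iUnion]
      constructor
      · intro h
        cases n with
        | zero => exact (h ⟨q, rfl⟩).elim
        | succ n => exact ⟨n, q, rfl⟩
      · rintro ⟨m, q', h'⟩ ⟨q'', h''⟩
        exact h0 (h'.trans h''.symm)
    rw [← isOpen_compl_iff, e]
    exact isOpen_iUnion fun n => GVar.isOpen_range_sigmaIn A hA _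
  have hti : InvSet W.X t := invSet_range (GVar.sigmaIn A hA ⟨0⟩)
  have ht := hti.lc htc
  rw [W.mk_eq_sub_add_sub htc hti]
  congr 1
  · obtain ⟨f, hf1, hf2⟩ := W.exists_lift ht (GVar.sigmaIn A hA ⟨0⟩) (GVar.sigmaIn_str A hA ⟨0⟩)
      fun y => ⟨y.val, rfl⟩
    have := isImmersion_of_comp hf1
    refine (K0.mk_eq_of_immersion_surjective f hf2 fun w => ?_).symm
    obtain ⟨x, hx⟩ := exists_pt_lift (GVar.sigmaIn A hA ⟨0⟩).hom (w ≫ (W.subι ht).hom)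
      ((W.exists_subι_iff ht _).1 ⟨w, rfl⟩)
    refine ⟨x, W.subι_injective ht ?_⟩
    rw [← hx, assoc]
    exact congrArg (fun t : (A ⟨0⟩).X ⟶ W.X => x ≫ t.hom) hf1
  · refine (GVar.mk_sigma_eq_sub W (hti.lc_compl htc) _ hA' (fun n => GVar.sigmaIn A hA ⟨n.down + 1⟩)
      (fun n => GVar.sigmaIn_str A hA ⟨n.down + 1⟩)
      (fun n => ⟨_, GVar.isOpen_range_sigmaIn A hA ⟨n.down + 1⟩, ?_⟩)
      (fun n m x y h => ?_) fun w hw => ?_).symm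
    · refine (Set.inter_eq_right.2 ?_).symm
      rintro _ ⟨p, rfl⟩ ⟨q, hq⟩
      exact h0 hq.symm
    · have := GVar.sigmaIn_eq A hA (congrArg Pt.val h :)
      exact ULift.down_injective (Nat.succ_injective (congrArg ULift.down this))
    · obtain ⟨⟨n⟩, q, rfl⟩ := GVar.exists_sigmaIn_pt A hA w
      cases n with
      | zero => exact (hw ⟨q.val, rfl⟩).elim
      | succ n => exact ⟨⟨n⟩, q, rfl⟩

/-! ### Stratifications -/

/-- A descending sequence of closed invariant subsets, locally eventually empty. -/
structure Strat (X : GVar B) where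
  C : ℕ → Set X.X.X.left
  closed : ∀ n, IsClosed (C n)
  inv : ∀ n, InvSet X.X (C n)
  zero : C 0 = Set.univ
  succ : ∀ n, C (n + 1) ⊆ C n
  fin : ∀ K : B.X.left.Opens, IsCompact (K : Set B.X.left) →
    ∃ n, C n ∩ X.str.hom.left ⁻¹' (K : Set B.X.left) = ∅

namespace Strat
variable {X : GVar B} (S : Strat X)

lemma anti : Antitone S.C := antitone_nat_of_succ_le S.succ

lemma diff (n : ℕ) : InvLC X.X (S.C n \ S.C (n + 1)) :=
  ⟨(S.closed n).isLocallyClosed.inter (S.closed (n + 1)).isOpen_compl.isLocallyClosed,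
    (S.inv n).inter (S.inv (n + 1)).compl⟩

lemma exists_mem_diff (x : X.X.X.left) : ∃ n, x ∈ S.C n \ S.C (n + 1) := by
  obtain ⟨K, hK, hxK, -⟩ := exists_isAffineOpen_mem_and_subset (x := X.str.hom.left x) (U := ⊤) trivial
  obtain ⟨n, hn⟩ := S.fin K hK.isCompact
  by_contra! h
  have h' (n) : x ∈ S.C n := by
    induction n with
    | zero => rw [S.zero]; trivial
    | succ n ih => exact not_not.1 fun hx => h n ⟨ih, hx⟩
  exact hn.subset ⟨h' n, hxK⟩

lemma eq_of_mem_diff {m n : ℕ} {x : X.X.X.left} (hm : x ∈ S.C m \ S.C (m + 1))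
    (hn : x ∈ S.C n \ S.C (n + 1)) : m = n := by
  rcases lt_trichotomy m n with h | h | h
  · exact (hm.2 (S.anti h hn.1)).elim
  · exact h
  · exact (hn.2 (S.anti h hm.1)).elim

lemma locFin {s : ULift.{u} ℕ → Set X.X.X.left} (hs : ∀ n, InvLC X.X (s n))
    (h : ∀ n, s n ⊆ S.C n.down) : LocFin fun n => X.sub (hs n) := by
  intro K hK
  obtain ⟨m, hm⟩ := S.fin K hK
  refine ((Set.finite_lt_nat m).preimage (ULift.down_injective.injOn)).subset ?_
  rintro n ⟨p, hp⟩
  by_contra hnm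
  exact hm.subset ⟨S.anti (not_lt.1 hnm) (h n (X.subι_mem (hs n) p)), hp⟩

def strata (n : ULift.{u} ℕ) : GVar B := X.sub (S.diff n.down)

lemma locFin_strata : LocFin S.strata := S.locFin (fun n => S.diff n.down) fun _ => Set.sdiff_subset

lemma mk_eq : K0.mk X = K0.mk (GVar.sigma S.strata S.locFin_strata) := by
  have c (n) := (S.inv n).lc (S.closed n)
  have hA : LocFin fun n : ULift.{u} ℕ => X.sub (c n.down) := S.locFin _ fun _ => le_rfl
  have hA' : LocFin fun n : ULift.{u} ℕ => X.sub (c (n.down + 1)) := S.locFin _ fun n => S.succ n.down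
  choose a ha1 ha2 ha3 using fun n : ULift.{u} ℕ =>
    X.exists_subMap (c (n.down + 1)) (c n.down) (S.succ n.down)
  choose b hb1 hb2 hb3 using fun n : ULift.{u} ℕ =>
    X.exists_subMap (S.diff n.down) (c n.down) Set.sdiff_subset
  have h1 := GVar.mk_sigma_eq_add (fun n : ULift.{u} ℕ => X.sub (c n.down))
    (fun n => X.sub (c (n.down + 1))) (fun n => X.sub (S.diff n.down)) hA hA' S.locFin_strata
    a ha2 b hb2
    (fun n => by
      rw [X.range_subMap _ _ (a n) (ha1 n)]
      exact (S.closed _).preimage (X.subι (c n.down)).hom.left.continuous)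
    (fun n => by
      rw [X.range_subMap _ _ (a n) (ha1 n), X.range_subMap _ _ (b n) (hb1 n)]
      ext p
      exact ⟨fun h => h.2, fun h => ⟨X.subι_mem (c n.down) p, h⟩⟩)
  have h2 := GVar.mk_sigma_succ (fun n : ULift.{u} ℕ => X.sub (c n.down)) hA hA'
  have h3 : K0.mk (X.sub (c 0)) = K0.mk X :=
    K0.mk_eq_of_immersion_surjective (X := X) (Y := X.sub (c 0)) (X.subι (c 0)) rfl fun x => by
      rw [X.exists_subι_iff, S.zero]; trivial
  have := h1.symm.trans h2
  rw [add_comm] at this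
  exact ((add_right_cancel this).trans h3).symm

end Strat

lemma exists_strat (X : GVar B) (P : Set X.X.X.left → Prop)
    (h : ∀ C : Set X.X.X.left, IsClosed C → InvSet X.X C → ∃ C' ⊆ C, IsClosed C' ∧ InvSet X.X C' ∧
      P (C \ C') ∧ ∀ O : Set X.X.X.left, IsOpen O → (O ∩ C).Nonempty → (O ∩ (C \ C')).Nonempty) :
    ∃ S : Strat X, ∀ n, P (S.C n \ S.C (n + 1)) := by
  choose! D hD1 hD2 hD3 hD4 hD5 using h
  let C (n : ℕ) : Set X.X.X.left := D^[n] Set.univ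
  have hs (n : ℕ) : C (n + 1) = D (C n) := Function.iterate_succ_apply' D n _
  have hC (n : ℕ) : IsClosed (C n) ∧ InvSet X.X (C n) := by
    induction n with
    | zero => exact ⟨isClosed_univ, InvSet.univ⟩
    | succ n ih => rw [hs]; exact ⟨hD2 _ ih.1 ih.2, hD3 _ ih.1 ih.2⟩
  have hsucc (n : ℕ) : C (n + 1) ⊆ C n := by rw [hs]; exact hD1 _ (hC n).1 (hC n).2
  refine ⟨⟨C, fun n => (hC n).1, fun n => (hC n).2, rfl, hsucc, fun K hK => ?_⟩, fun n => ?_⟩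
  · let U : X.X.X.left.Opens := X.str.hom.left ⁻¹ᵁ K
    have hU : IsCompact (U : Set X.X.X.left) := X.str.hom.left.isCompact_preimage hK
    have : CompactSpace U := isCompact_iff_compactSpace.1 hU
    have : IsLocallyNoetherian (U : Scheme) := isLocallyNoetherian_of_isOpenImmersion U.ι
    have : IsNoetherian (U : Scheme) := {}
    have hN : TopologicalSpace.NoetherianSpace (U : Scheme) := inferInstance
    let F (n : ℕ) : TopologicalSpace.Closeds (U : Scheme) :=
      ⟨U.ι ⁻¹' C n, (hC n).1.preimage U.ι.continuous⟩
    have hwf := (TopologicalSpace.noetherianSpace_TFAE (U : Scheme)).out 0 1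
    have hwf' : WellFoundedLT (TopologicalSpace.Closeds (U : Scheme)) := hwf.1 hN
    obtain ⟨_, ⟨n, rfl⟩, hn⟩ := hwf'.wf.has_min (Set.range F) (Set.range_nonempty F)
    refine ⟨n, ?_⟩
    by_contra hne
    obtain ⟨x, hx1, hx2⟩ := Set.nonempty_iff_ne_empty.2 hne
    obtain ⟨y, hy1, hy2⟩ := hD5 (C n) (hC n).1 (hC n).2 (U : Set X.X.X.left) U.2 ⟨x, hx2, hx1⟩
    refine hn (F (n + 1)) ⟨n + 1, rfl⟩ ⟨fun z hz => hsucc n hz, fun hle => ?_⟩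
    have := hle (show (⟨y, hy1⟩ : U) ∈ F n from hy2.1)
    have h2 : y ∈ C (n + 1) := this
    rw [hs] at h2
    exact hy2.2 h2
  · change P (C n \ C (n + 1))
    rw [hs]
    exact hD4 _ (hC n).1 (hC n).2

lemma exists_strat_of_dense (X : GVar B) (P : Set X.X.X.left → Prop)
    (h : ∀ C (hC : IsClosed C) (hi : InvSet X.X C), ∃ W, IsOpen W ∧
      InvSet (X.sub (hi.lc hC)).X W ∧ Dense W ∧ P ((X.subι (hi.lc hC)).hom.left '' W)) :
    ∃ S : Strat X, ∀ n, P (S.C n \ S.C (n + 1)) := by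
  refine exists_strat X P fun C hC hi => ?_
  obtain ⟨W, hWo, hWi, hWd, hP⟩ := h C hC hi
  let j := X.subι (hi.lc hC)
  have hr : Set.range j.hom.left = C := X.range_subι (hi.lc hC)
  have hci : IsClosedImmersion j.hom.left := isClosedImmersion_of_isImmersion _ (by rwa [hr])
  have hinj : Function.Injective j.hom.left := j.hom.left.isEmbedding.injective
  have hdiff : C \ (j.hom.left '' Wᶜ) = j.hom.left '' W := by
    rw [Set.image_compl_eq_range_sdiff_image hinj, hr, sdiff_sdiff_right_self]
    exact Set.inter_eq_right.2 ((Set.image_subset_range _ _).trans hr.le)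
  refine ⟨j.hom.left '' Wᶜ, (Set.image_subset_range _ _).trans hr.le,
    hci.isClosedEmbedding.isClosedMap _ hWo.isClosed_compl, fun g y hy => ?_, hdiff ▸ hP, ?_⟩
  · obtain ⟨t, rfl⟩ := exists_pt_lift j.hom y (Set.image_subset_range _ _ hy)
    obtain ⟨t', ht', h⟩ := hy
    obtain rfl : t' = t.val := hinj h
    exact ⟨Pt.val (g • t), hWi.compl g t ht', congrArg Pt.val (GSch.smul_comp j g t)⟩
  · rintro O hO ⟨y, hyO, hyC⟩
    obtain ⟨t, rfl⟩ := hr.ge hyC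
    obtain ⟨t', h3, h4⟩ := hWd.inter_open_nonempty _ (hO.preimage j.hom.left.continuous) ⟨t, hyO⟩
    exact hdiff ▸ ⟨j.hom.left t', h3, t', h4, rfl⟩

end
end

section
/-! ### The locus where a morphism is an isomorphism -/

lemma isIso_morphismRestrict_morphismRestrict_iff {X Y : Scheme.{u}} (f : X ⟶ Y) (W : Y.Opens)
    (V : (W : Scheme).Opens) : IsIso (f ∣_ W ∣_ V) ↔ IsIso (f ∣_ W.ι ''ᵁ V) :=
  MorphismProperty.arrow_mk_iso_iff (.isomorphisms Scheme.{u}) (morphismRestrictRestrict f W V)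

/-- The largest open subset of the target over which a morphism is an isomorphism. -/
def isoLocus {X Y : Scheme.{u}} (f : X ⟶ Y) : Y.Opens := sSup {V | IsIso (f ∣_ V)}

lemma le_isoLocus {X Y : Scheme.{u}} (f : X ⟶ Y) (V : Y.Opens) [h : IsIso (f ∣_ V)] :
    V ≤ isoLocus f := le_sSup h

instance {X Y : Scheme.{u}} (f : X ⟶ Y) : IsIso (f ∣_ isoLocus f) := by
  let I := {V : Y.Opens // IsIso (f ∣_ V)}
  let U : I → (isoLocus f : Scheme).Opens := fun V => (isoLocus f).ι ⁻¹ᵁ V.1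
  have hU : iSup U = ⊤ := by
    rw [eq_top_iff]
    rintro ⟨x, hx⟩ -
    obtain ⟨V, hV, hxV⟩ := TopologicalSpace.Opens.mem_sSup.1 hx
    exact TopologicalSpace.Opens.mem_iSup.2 ⟨⟨V, hV⟩, hxV⟩
  refine (IsZariskiLocalAtTarget.iff_of_iSup_eq_top (P := .isomorphisms Scheme.{u}) U hU).2
    fun V => ?_
  have h1 : (isoLocus f).ι ''ᵁ (U V) = V.1 := by
    have : V.1 ≤ isoLocus f := le_sSup V.2
    exact ((isoLocus f).ι.image_preimage_eq_opensRange_inf V.1).trans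
      ((congrArg (· ⊓ V.1) (isoLocus f).opensRange_ι).trans (inf_eq_right.2 this))
  refine (isIso_morphismRestrict_morphismRestrict_iff f _ (U V)).2 ?_
  rw [h1]
  exact V.2

lemma exists_section_isoLocus {X Y : Scheme.{u}} (f : X ⟶ Y) :
    ∃ s : (isoLocus f : Scheme) ⟶ X, s ≫ f = (isoLocus f).ι :=
  ⟨inv (f ∣_ isoLocus f) ≫ (f ⁻¹ᵁ isoLocus f).ι, by
    rw [assoc, ← morphismRestrict_ι, IsIso.inv_hom_id_assoc]⟩

lemma preimage_isoLocus_le {X Y : Scheme.{u}} (f : X ⟶ Y) (a : Y ⟶ Y) (b : X ⟶ X) [IsIso a] [IsIso b]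
    (h : b ≫ f = f ≫ a) : a ⁻¹ᵁ isoLocus f ≤ isoLocus f := by
  have h1 : IsIso ((b ≫ f) ∣_ isoLocus f) := by
    rw [morphismRestrict_comp]
    have : IsIso (b ∣_ f ⁻¹ᵁ isoLocus f) := inferInstance
    exact IsIso.comp_isIso' this inferInstance
  have h2 : IsIso ((f ≫ a) ∣_ isoLocus f) := by rwa [← h]
  rw [morphismRestrict_comp] at h2
  have h3 : IsIso (f ∣_ a ⁻¹ᵁ isoLocus f) :=
    @IsIso.of_isIso_comp_right _ _ _ _ _ _ (a ∣_ isoLocus f) inferInstance h2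
  exact le_isoLocus f _

lemma bijective_of_comm {X Y Z T : Sch k} {f : X ⟶ Y} {φ : Z ⟶ T} {j : Z ⟶ X} {i : T ⟶ Y}
    (e : φ ≫ i = j ≫ f) [LFT X.hom] [IsImmersion i.left] [IsImmersion j.left]
    (hf : Function.Bijective fun x : Pt X => x ≫ f)
    (h : ∀ x : Pt X, Pt.val (x ≫ f) ∈ Set.range i.left → x.val ∈ Set.range j.left) :
    Function.Bijective fun x : Pt Z => x ≫ φ := by
  have hx (x : Pt Z) : (x ≫ φ) ≫ i = (x ≫ j) ≫ f := by rw [assoc, e, assoc]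
  have m1 := mono_of_left i
  have m2 := mono_of_left j
  refine ⟨fun x x' h => ?_, fun y => ?_⟩
  · rw [← cancel_mono j]
    exact hf.1 ((hx x).symm.trans ((h =≫ i).trans (hx x')))
  · obtain ⟨x, hxy : x ≫ f = y ≫ i⟩ := hf.2 (y ≫ i)
    obtain ⟨x', rfl⟩ := exists_pt_lift j x (h x (by rw [hxy]; exact ⟨Pt.val y, rfl⟩))
    exact ⟨x', (cancel_mono i).1 ((hx x').trans hxy)⟩

lemma inter_isoLocus_nonempty {X Y : Sch k} [LFT X.hom] [LFT Y.hom] [IsReduced X.left]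
    [IsReduced Y.left] (f : X ⟶ Y) [QuasiCompact f.left]
    (hf : Function.Bijective fun x : Pt X => x ≫ f) (O : Y.left.Opens)
    (hO : (O : Set Y.left).Nonempty) :
    ((O : Set Y.left) ∩ (isoLocus f.left : Y.left.Opens)).Nonempty := by
  let f' : openObj X (f.left ⁻¹ᵁ O) ⟶ openObj Y O := Over.homMk (f.left ∣_ O) (by
    change _ ≫ O.ι ≫ Y.hom = (f.left ⁻¹ᵁ O).ι ≫ X.hom
    rw [morphismRestrict_ι_assoc, Over.w])
  have hf' : f' ≫ openObjι Y O = openObjι X (f.left ⁻¹ᵁ O) ≫ f :=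
    Over.OverMorphism.ext (morphismRestrict_ι f.left O)
  have hq : QuasiCompact f'.left := (inferInstance : QuasiCompact (f.left ∣_ O))
  have : Nonempty (openObj Y O).left := hO.to_subtype
  obtain ⟨V, ⟨v, hv⟩, hV⟩ := exists_isIso_morphismRestrict f' (bijective_of_comm hf' hf fun x hx =>
    (range_openObjι X _).ge ((range_openObjι Y O).le hx))
  have h3 : IsIso (f.left ∣_ O.ι ''ᵁ V) := (isIso_morphismRestrict_morphismRestrict_iff f.left O V).1 hV
  exact ⟨O.ι v, (Scheme.Opens.range_ι O).subset ⟨v, rfl⟩,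
    le_isoLocus f.left (O.ι ''ᵁ V) ⟨v, hv, rfl⟩⟩

variable {G : Sch k} [GrpObj G] [GoodGrp G] {B : GSch G} [LFT B.X.hom]

/-! ### Morphisms that are bijective on points -/

lemma GVar.quasiCompact_hom {X Y : GVar B} (f : X.X ⟶ Y.X) (hf : f ≫ Y.str = X.str) :
    QuasiCompact f.hom.left := by
  have h1 : QuasiCompact (f.hom.left ≫ Y.str.hom.left) := by
    have := X.quasiCompact
    rw [← hf] at this
    exact this
  exact .of_comp f.hom.left Y.str.hom.left

/-- The stratification by the preimages of strata. -/
def Strat.preimage {X Y : GVar B} (f : X.X ⟶ Y.X) (hf : f ≫ Y.str = X.str) (S : Strat Y) :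
    Strat X where
  C n := f.hom.left ⁻¹' S.C n
  closed n := (S.closed n).preimage f.hom.left.continuous
  inv n := (S.inv n).preimage f
  zero := by rw [S.zero]; rfl
  succ n := Set.preimage_mono (S.succ n)
  fin K hK := by
    obtain ⟨n, hn⟩ := S.fin K hK
    refine ⟨n, ?_⟩
    have e : X.str.hom.left ⁻¹' (K : Set B.X.left) =
        f.hom.left ⁻¹' (Y.str.hom.left ⁻¹' (K : Set B.X.left)) :=
      congrArg (fun t : X.X ⟶ B => t.hom.left ⁻¹' (K : Set B.X.left)) hf.symm
    rw [e, ← Set.preimage_inter, hn, Set.preimage_empty]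

lemma GVar.mk_sigma_congr {I : Type u} (A A' : I → GVar B) (hA : LocFin A) (hA' : LocFin A')
    (a : ∀ i, (A' i).X ⟶ (A i).X) (ha : ∀ i, a i ≫ (A i).str = (A' i).str)
    [him : ∀ i, IsImmersion (a i).hom.left]
    (hs : ∀ i (x : Pt (A i).X.X), ∃ y : Pt (A' i).X.X, y ≫ (a i).hom = x) :
    K0.mk (GVar.sigma A' hA') = K0.mk (GVar.sigma A hA) := by
  have hr (i : I) : Set.range (a i ≫ GVar.sigmaIn A hA i).hom.left =
      Set.range (GVar.sigmaIn A hA i).hom.left :=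
    (surjective_of_pt (a i).hom (hs i)).range_comp (GVar.sigmaIn A hA i).hom.left
  have (i : I) : IsImmersion (a i ≫ GVar.sigmaIn A hA i).hom.left := inferInstance
  refine GVar.mk_sigma_eq A' hA' _ (fun i => a i ≫ GVar.sigmaIn A hA i) (fun i => ?_) (fun i => ?_)
    (fun i j x y h => GVar.sigmaIn_eq A hA (congrArg Pt.val h :)) fun w => ?_
  · rw [assoc, GVar.sigmaIn_str, ha]
  · rw [hr]; exact GVar.isOpen_range_sigmaIn A hA i
  · obtain ⟨i, q, rfl⟩ := GVar.exists_sigmaIn_pt A hA w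
    obtain ⟨y, rfl⟩ := hs i q
    exact ⟨i, y, assoc'.symm⟩

lemma GVar.exists_dense_section {X Y : GVar B} (f : X.X ⟶ Y.X) (hf : f ≫ Y.str = X.str)
    (hb : Function.Bijective fun x : Pt X.X.X => x ≫ f.hom) (C : Set Y.X.X.left) (hC : IsClosed C)
    (hi : InvSet Y.X C) : ∃ W, IsOpen W ∧ InvSet (Y.sub (hi.lc hC)).X W ∧ Dense W ∧
      ∃ (Z : Sch k) (j : Z ⟶ X.X.X), IsImmersion (j ≫ f.hom).left ∧
        Set.range (j ≫ f.hom).left = (Y.subι (hi.lc hC)).hom.left '' W := by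
  have hT := hi.lc hC
  have hZ := (hi.preimage f).lc (hC.preimage f.hom.left.continuous)
  let T := Y.sub hT
  let Z := X.sub hZ
  let i : T.X ⟶ Y.X := Y.subι hT
  let j : Z.X ⟶ X.X := X.subι hZ
  obtain ⟨φ, h1, h2⟩ := Y.exists_lift hT (Y := Z) (j ≫ f) (assoc'.trans (j ≫= hf))
    fun y => X.subι_mem hZ y.val
  have hφ : φ.hom ≫ i.hom = j.hom ≫ f.hom := congrArg Mod.Hom.hom h1
  have hφb := bijective_of_comm hφ hb fun x hx => (X.range_subι hZ).ge ((Y.range_subι hT).le hx)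
  have hq : QuasiCompact φ.hom.left := GVar.quasiCompact_hom φ h2
  let W := isoLocus φ.hom.left
  have hWi : InvSet T.X (W : Set T.X.X.left) := by
    intro g x hx
    have i1 : IsIso (T.X.act g⁻¹).left := inferInstanceAs (IsIso ((Over.forget _).map (T.X.act g⁻¹)))
    have i2 : IsIso (Z.X.act g⁻¹).left := inferInstanceAs (IsIso ((Over.forget _).map (Z.X.act g⁻¹)))
    have h3 := preimage_isoLocus_le φ.hom.left (T.X.act g⁻¹).left (Z.X.act g⁻¹).left (by
      refine congrArg (fun t : Z.X.X ⟶ T.X.X => t.left) (hom_ext_pt fun z => ?_ :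
        Z.X.act g⁻¹ ≫ φ.hom = φ.hom ≫ T.X.act g⁻¹)
      rw [← assoc, ← assoc, GSch.comp_act, GSch.comp_act, GSch.smul_comp])
    refine h3 ?_
    have h4 := GSch.act_val T.X g⁻¹ (g • x)
    rw [inv_smul_smul] at h4
    exact (congrArg (· ∈ W) h4).mp hx
  obtain ⟨s, hs⟩ := exists_section_isoLocus φ.hom.left
  let s' : openObj T.X.X W ⟶ Z.X.X := Over.homMk s (by
    change s ≫ Z.X.X.hom = W.ι ≫ T.X.X.hom
    rw [← hs, assoc, Over.w])
  have hs' : s' ≫ φ.hom = openObjι T.X.X W := Over.OverMorphism.ext hs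
  have hsf : (s' ≫ j.hom) ≫ f.hom = openObjι T.X.X W ≫ i.hom := by rw [assoc, ← hφ, ← assoc, hs']
  refine ⟨W, W.2, hWi, dense_iff_inter_open.2 fun O hO hne =>
    inter_isoLocus_nonempty φ.hom hφb ⟨O, hO⟩ hne, openObj T.X.X W, s' ≫ j.hom, ?_, ?_⟩
  · rw [hsf]
    exact (inferInstance : IsImmersion ((openObjι T.X.X W).left ≫ i.hom.left))
  · rw [hsf]
    exact (Set.range_comp i.hom.left (openObjι T.X.X W).left).trans
      (congrArg _ (range_openObjι T.X.X W))

theorem K0.mk_eq_of_bijective {X Y : GVar B} (f : X.X ⟶ Y.X) (hf : f ≫ Y.str = X.str)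
    (hb : Function.Bijective fun x : Pt X.X.X => x ≫ f.hom) : K0.mk X = K0.mk Y := by
  obtain ⟨S, hS⟩ := exists_strat_of_dense Y (fun V => ∃ (Z : Sch k) (j : Z ⟶ X.X.X),
    IsImmersion (j ≫ f.hom).left ∧ Set.range (j ≫ f.hom).left = V) (GVar.exists_dense_section f hf hb)
  let S' := S.preimage f hf
  rw [S'.mk_eq, S.mk_eq]
  choose Z j hj1 hj2 using hS
  have hx (n : ULift.{u} ℕ) (x : Pt X.X.X) : x.val ∈ S'.C n.down \ S'.C (n.down + 1) ↔
      Pt.val (x ≫ f.hom) ∈ S.C n.down \ S.C (n.down + 1) := Iff.rfl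
  have key (n : ULift.{u} ℕ) : ∃ e : (S.strata n).X ⟶ (S'.strata n).X,
      e ≫ (S'.strata n).str = (S.strata n).str ∧ IsImmersion e.hom.left ∧
        ∀ x : Pt (S'.strata n).X.X, ∃ y : Pt (S.strata n).X.X, y ≫ e.hom = x := by
    have d := S.diff n.down
    have d' := S'.diff n.down
    let i := Y.subι d
    let i' := X.subι d'
    have hi (y : Pt (S.strata n).X.X) : Pt.val (y ≫ i.hom) ∈ S.C n.down \ S.C (n.down + 1) :=
      Y.subι_mem d y.val
    obtain ⟨t, ht⟩ := exists_lift_pt (T := (S.strata n).X.X) (j n.down ≫ f.hom) i.hom fun y =>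
      exists_pt_lift _ _ (by rw [hj2]; exact hi y)
    let s : (S.strata n).X.X ⟶ X.X.X := t ≫ j n.down
    have hs : s ≫ f.hom = i.hom := assoc'.trans ht
    have hsp (y : Pt (S.strata n).X.X) : (y ≫ s) ≫ f.hom = y ≫ i.hom := by rw [assoc, hs]
    let s' : (S.strata n).X ⟶ X.X := GSch.homMk s fun g y => by
      apply hb.1
      change ((g • y) ≫ s) ≫ f.hom = (g • (y ≫ s)) ≫ f.hom
      rw [hsp, GSch.smul_comp f, hsp]
      exact GSch.smul_comp i g y
    have hs' : s' ≫ f = i := Mod.Hom.ext hs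
    have hsI : IsImmersion s'.hom.left := isImmersion_of_comp
      (hh := (inferInstance : IsImmersion (Y.subι d).hom.left)) hs'
    obtain ⟨e, he1, he2⟩ := X.exists_lift (Y := S.strata n) d' s' (by rw [← hf, ← assoc, hs']; rfl)
      fun y => (hx n _).2 ((congrArg (fun t : Pt _ => t.val ∈ _) (hsp y)).mpr (hi y))
    refine ⟨e, he2, isImmersion_of_comp he1, fun x => ?_⟩
    have hxm : Pt.val ((x ≫ i'.hom) ≫ f.hom) ∈ S.C n.down \ S.C (n.down + 1) :=
      X.subι_mem d' x.val
    obtain ⟨y, hy⟩ := (Y.exists_subι_iff d _).2 hxm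
    refine ⟨y, X.subι_injective d' (hb.1 ?_)⟩
    have h6 : (y ≫ e.hom) ≫ i'.hom = y ≫ s := (assoc y e.hom i'.hom).trans
      (congrArg (fun t : (S.strata n).X ⟶ X.X => y ≫ t.hom) he1)
    exact (congrArg (fun t : Pt X.X.X => t ≫ f.hom) h6).trans ((hsp y).trans hy)
  choose e he1 he2 he3 using key
  exact (GVar.mk_sigma_congr _ _ S'.locFin_strata S.locFin_strata e he1 he3).symm
end

section
variable {G : Sch k} [GrpObj G] [GoodGrp G] {B : GSch G} [LFT B.X.hom]

/-! ### Finite decompositions -/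

lemma GVar.mk_sub_union (X : GVar B) {s t r : Set X.X.X.left} (hs : IsClosed s)
    (hi : InvSet X.X s) (ht : InvLC X.X t) (hr : InvLC X.X r) (hst : Disjoint s t) (h : s ∪ t = r) :
    K0.mk (X.sub hr) = K0.mk (X.sub (hi.lc hs)) + K0.mk (X.sub ht) := by
  obtain ⟨i, hi1, hi2, hi3⟩ := X.exists_subMap (hi.lc hs) hr (h ▸ Set.subset_union_left)
  obtain ⟨j, hj1, hj2, hj3⟩ := X.exists_subMap ht hr (h ▸ Set.subset_union_right)
  have ri := X.range_subMap _ hr i hi1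
  refine GVar.mk_eq_of_immersions i j hi2 hj2 ?_ ?_
  · rw [ri]
    exact hs.preimage (X.subι hr).hom.left.continuous
  · rw [ri, X.range_subMap ht hr j hj1]
    ext p
    have hp := h.ge (X.subι_mem hr p)
    exact ⟨fun h3 h4 => Set.disjoint_left.1 hst h4 h3, fun h3 => hp.resolve_left h3⟩

lemma K0.mk_sub_eq_of_immersion {W Y : GVar B} (f : Y.X ⟶ W.X) (hf : f ≫ W.str = Y.str)
    [IsImmersion f.hom.left] {s : Set W.X.X.left} (hs : InvLC W.X s)
    (h : Set.range f.hom.left = s) : K0.mk (W.sub hs) = K0.mk Y := by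
  obtain ⟨e, he1, he2⟩ := W.exists_lift hs f hf fun y => h.subset ⟨Pt.val y, rfl⟩
  have := isImmersion_of_comp he1
  refine (K0.mk_eq_of_immersion_surjective e he2 fun w => ?_).symm
  obtain ⟨x, hx⟩ := exists_pt_lift f.hom (w ≫ (W.subι hs).hom) (h.ge (W.subι_mem hs (Pt.val w)))
  refine ⟨x, W.subι_injective hs ?_⟩
  rw [← hx, assoc]
  exact congrArg (fun t : Y.X ⟶ W.X => x ≫ t.hom) he1

section
variable {I : Type u} (X : I → GVar B)

lemma locFin_of_finite [Finite I] : LocFin X :=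
  fun _ _ => Set.toFinite _

variable (hX : LocFin X)

lemma GVar.mk_sigma_eq_sum [Fintype I] :
    K0.mk (GVar.sigma X hX) = ∑ i, K0.mk (X i) := by
  classical
  let t (s : Finset I) (i : I) : Set (X i).X.X.left := {_x | i ∈ s}
  have hc (s : Finset I) : IsClosed (GVar.sigmaSet X hX (t s)) :=
    GVar.isClosed_sigmaSet X hX fun i => isClosed_const
  have hi (s : Finset I) : InvSet (GVar.sigma X hX).X (GVar.sigmaSet X hX (t s)) :=
    GVar.invSet_sigmaSet X hX fun i g x h => h
  have hl (s) := (hi s).lc (hc s)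
  have key (s : Finset I) : K0.mk ((GVar.sigma X hX).sub (hl s)) =
      ∑ i ∈ s, K0.mk (X i) := by
    induction s using Finset.induction_on with
    | empty =>
      rw [Finset.sum_empty]
      have : IsEmpty ((GVar.sigma X hX).sub (hl ∅)).X.X.left := ⟨fun p => by
        obtain ⟨i, q, -, h⟩ := (GVar.sigma X hX).subι_mem (hl ∅) p
        exact Finset.notMem_empty _ h⟩
      exact K0.mk_of_isEmpty _
    | insert a s ha ih =>
      rw [Finset.sum_insert ha, ← ih]
      have hr : IsClosed (Set.range (GVar.sigmaIn X hX a).hom.left) := by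
        have e : Set.range (GVar.sigmaIn X hX a).hom.left = GVar.sigmaSet X hX (t {a}) := by
          ext w
          constructor
          · rintro ⟨q, rfl⟩
            exact (GVar.mem_sigmaSet X hX _ a q).2 (Finset.mem_singleton_self a)
          · rintro ⟨i, q, rfl, h⟩
            obtain rfl := Finset.mem_singleton.1 h
            exact ⟨q, rfl⟩
        rw [e]; exact hc _
      have hri := invSet_range (GVar.sigmaIn X hX a)
      rw [(GVar.sigma X hX).mk_sub_union hr hri (hl s) (hl (insert a s)) ?_ ?_,
        K0.mk_sub_eq_of_immersion (GVar.sigmaIn X hX a) (GVar.sigmaIn_str X hX a) _ rfl]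
      · rw [Set.disjoint_left]
        rintro _ ⟨q, rfl⟩ h
        exact ha ((GVar.mem_sigmaSet X hX _ a q).1 h)
      · ext w
        obtain ⟨i, q, rfl⟩ := GVar.exists_sigmaIn X hX w
        rw [Set.mem_union, GVar.mem_sigmaSet, GVar.mem_sigmaSet]
        change _ ∨ i ∈ s ↔ i ∈ insert a s
        rw [Finset.mem_insert]
        refine or_congr_left ⟨?_, ?_⟩
        · rintro ⟨q', h⟩
          exact (GVar.sigmaIn_eq X hX h).symm
        · rintro rfl; exact ⟨q, rfl⟩
  rw [← key]
  have h1 : IsImmersion (𝟙 (GVar.sigma X hX).X : (GVar.sigma X hX).X ⟶ _).hom.left :=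
    (inferInstance : IsImmersion (𝟙 (GVar.sigma X hX).X.X.left))
  refine (K0.mk_sub_eq_of_immersion (Y := GVar.sigma X hX) (𝟙 _) (id_comp _) _ ?_).symm
  refine Set.range_id.trans (Set.eq_univ_iff_forall.2 fun w => ?_).symm
  obtain ⟨i, q, rfl⟩ := GVar.exists_sigmaIn X hX w
  exact (GVar.mem_sigmaSet X hX _ i q).2 (Finset.mem_univ i)

/-- The family of morphisms is jointly bijective on points. -/
def JointBij {I : Type*} (X : I → GSch G) {W : GSch G} (f : ∀ i, X i ⟶ W) : Prop :=
  Function.Bijective fun p : Σ i, Pt (X i).X => p.2 ≫ (f p.1).hom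

lemma GVar.sigmaTo_bijective {W : GSch G}
    (f : ∀ i, (X i).X ⟶ W) (hb : JointBij _ f) :
    Function.Bijective fun x : Pt (GVar.sigma X hX).X.X => x ≫ (GVar.sigmaTo X hX f).hom := by
  have h1 (i : I) (q : Pt (X i).X.X) :
      (q ≫ (GVar.sigmaIn X hX i).hom) ≫ (GVar.sigmaTo X hX f).hom = q ≫ (f i).hom :=
    assoc'.trans (congrArg (fun t : (X i).X ⟶ W => q ≫ t.hom) (GVar.sigmaIn_sigmaTo X hX f i))
  refine ⟨fun x y h => ?_, fun w => ?_⟩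
  · obtain ⟨i, q, rfl⟩ := GVar.exists_sigmaIn_pt X hX x
    obtain ⟨j, r, rfl⟩ := GVar.exists_sigmaIn_pt X hX y
    have h2 : q ≫ (f i).hom = r ≫ (f j).hom := (h1 i q).symm.trans (Eq.trans h (h1 j r))
    obtain h3 : (⟨i, q⟩ : Σ i, Pt (X i).X.X) = ⟨j, r⟩ := hb.1 h2
    cases h3
    rfl
  · obtain ⟨⟨i, q⟩, rfl⟩ := hb.2 w
    exact ⟨q ≫ (GVar.sigmaIn X hX i).hom, h1 i q⟩

lemma GVar.sigmaTo_str (W : GVar B)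
    (f : ∀ i, (X i).X ⟶ W.X) (hf : ∀ i, f i ≫ W.str = (X i).str) :
    GVar.sigmaTo X hX f ≫ W.str = (GVar.sigma X hX).str := by
  refine GSch.ext_of_comp fun x => ?_
  obtain ⟨i, q, rfl⟩ := GVar.exists_sigmaIn_pt X hX x
  refine (GSch.comp_eq (GVar.sigmaIn_sigmaTo X hX f i) q =≫ W.str.hom).trans ?_
  exact (GSch.comp_eq (hf i) q).trans (GSch.comp_eq (GVar.sigmaIn_str X hX i) q).symm

end

lemma K0.mk_eq_sum_of_jointBij {I : Type*} [Fintype I] (X : I → GVar B) (W : GVar B)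
    (f : ∀ i, (X i).X ⟶ W.X) (hf : ∀ i, f i ≫ W.str = (X i).str) (hb : JointBij _ f) :
    K0.mk W = ∑ i, K0.mk (X i) := by
  let J := ULift.{u} (Fin (Fintype.card I))
  let e : J ≃ I := Equiv.ulift.trans (Fintype.equivFin I).symm
  let X' (j : J) := X (e j)
  have hX' : LocFin X' := locFin_of_finite X'
  have hb' : JointBij _ fun j => f (e j) :=
    hb.comp (Equiv.sigmaCongrLeft (β := fun i => Pt (X i).X.X) e).bijective
  rw [← K0.mk_eq_of_bijective (GVar.sigmaTo X' hX' fun j => f (e j))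
    (GVar.sigmaTo_str X' hX' W _ fun j => hf (e j)) (GVar.sigmaTo_bijective X' hX' _ hb'),
    GVar.mk_sigma_eq_sum]
  exact e.sum_comp fun i => K0.mk (X i)

/-- The images of the points under two morphisms form a decomposition. -/
structure Decomp {X Z U : GSch G} (z : Z ⟶ X) (v : U ⟶ X) : Prop where
  inj_left : ∀ p q : Pt Z.X, p ≫ z.hom = q ≫ z.hom → p = q
  inj_right : ∀ p q : Pt U.X, p ≫ v.hom = q ≫ v.hom → p = q
  disj : ∀ (p : Pt Z.X) (q : Pt U.X), p ≫ z.hom ≠ q ≫ v.hom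
  surj : ∀ x : Pt X.X, (∃ p : Pt Z.X, p ≫ z.hom = x) ∨ ∃ q : Pt U.X, q ≫ v.hom = x

lemma K0.mk_eq_add_of_decomp {X Z U : GVar B} (z : Z.X ⟶ X.X) (v : U.X ⟶ X.X)
    (hz : z ≫ X.str = Z.str) (hv : v ≫ X.str = U.str) (h : Decomp z v) :
    K0.mk X = K0.mk Z + K0.mk U := by
  have h1 := K0.mk_eq_sum_of_jointBij (I := Bool) (fun b => cond b Z U) X
    (fun b => match b with | true => z | false => v)
    (fun b => match b with | true => hz | false => hv) ?_
  · rw [h1, Fintype.sum_bool]; rfl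
  · refine ⟨?_, fun x => ?_⟩
    · rintro ⟨b, p⟩ ⟨c, q⟩ hpq
      match b, c with
      | true, true => exact congrArg (Sigma.mk true) (h.inj_left p q hpq)
      | false, false => exact congrArg (Sigma.mk false) (h.inj_right p q hpq)
      | true, false => exact (h.disj p q hpq).elim
      | false, true => exact (h.disj q p hpq.symm).elim
    · obtain ⟨p, hp⟩ | ⟨p, hp⟩ := h.surj x
      · exact ⟨⟨true, p⟩, hp⟩
      · exact ⟨⟨false, p⟩, hp⟩

/-! ### Nice varieties -/

/-- There is a partition into invariant affine open subsets. -/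
def IsNice (X : GSch G) : Prop :=
  ∃ (I : Type u) (U : I → X.X.left.Opens), (∀ i, IsAffineOpen (U i) ∧ InvSet X (U i : Set X.X.left)) ∧
    (∀ i j, i ≠ j → Disjoint (U i : Set X.X.left) (U j)) ∧ ∀ x, ∃ i, x ∈ U i

lemma IsNice.of_isOpenImmersion {X Y : GSch G} (f : Y ⟶ X) [IsOpenImmersion f.hom.left] {I : Type u}
    (U : I → X.X.left.Opens) (hU : ∀ i, IsAffineOpen (U i) ∧ InvSet X (U i : Set X.X.left))
    (hd : ∀ i j, i ≠ j → Disjoint (U i : Set X.X.left) (U j))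
    (hr : Set.range f.hom.left = ⋃ i, (U i : Set X.X.left)) : IsNice Y := by
  refine ⟨I, fun i => f.hom.left ⁻¹ᵁ U i, fun i => ⟨?_, (hU i).2.preimage f⟩,
    fun i j h => (hd i j h).preimage _, fun y => ?_⟩
  · refine (hU i).1.preimage_of_isOpenImmersion f.hom.left fun x hx => ?_
    change x ∈ Set.range f.hom.left
    rw [hr]
    exact Set.mem_iUnion.2 ⟨i, hx⟩
  · obtain ⟨i, hi⟩ := Set.mem_iUnion.1 (hr.subset ⟨y, rfl⟩)
    exact ⟨i, hi⟩

lemma GVar.isNice_sigma {I : Type u} (X : I → GVar B) (hX : LocFin X) (h : ∀ i, IsNice (X i).X) :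
    IsNice (GVar.sigma X hX).X := by
  choose J U hU hd hc using h
  refine ⟨Σ i, J i, fun p => (GVar.sigmaIn X hX p.1).hom.left ''ᵁ U p.1 p.2, fun p => ⟨?_, ?_⟩,
    fun p q hpq => ?_, fun w => ?_⟩
  · exact (hU p.1 p.2).1.image_of_isOpenImmersion (GVar.sigmaIn X hX p.1).hom.left
  · intro g x hx
    obtain ⟨y, hy, h⟩ := hx
    obtain ⟨x', rfl⟩ := exists_pt_lift (GVar.sigmaIn X hX p.1).hom x ⟨y, h⟩
    obtain rfl : y = x'.val := GVar.sigmaIn_injective X hX p.1 h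
    exact ⟨(g • x' : Pt (X p.1).X.X).val, (hU p.1 p.2).2 g x' hy,
      congrArg Pt.val (GSch.smul_comp (GVar.sigmaIn X hX p.1) g x')⟩
  · rw [Set.disjoint_left]
    rintro _ ⟨x, hx, rfl⟩ ⟨y, hy, h⟩
    obtain ⟨i, a⟩ := p
    obtain ⟨j, b⟩ := q
    obtain rfl := GVar.sigmaIn_eq X hX h
    obtain rfl := GVar.sigmaIn_injective X hX j h
    exact Set.disjoint_left.1 (hd j a b fun h => hpq (h ▸ rfl)) hx hy
  · obtain ⟨i, q, rfl⟩ := GVar.exists_sigmaIn X hX w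
    obtain ⟨a, ha⟩ := hc i q
    exact ⟨⟨i, a⟩, q, ha, rfl⟩

lemma GVar.exists_dense_nice (X : GVar B) : ∃ (I : Type u) (U : I → X.X.X.left.Opens),
    (∀ i, IsAffineOpen (U i) ∧ InvSet X.X (U i : Set X.X.X.left)) ∧
    (∀ i j, i ≠ j → Disjoint (U i : Set X.X.X.left) (U j)) ∧
    Dense (⋃ i, (U i : Set X.X.X.left)) := by
  let P : Set (Set X.X.X.left.Opens) := {s | (∀ U ∈ s, IsAffineOpen U ∧
    InvSet X.X (U : Set X.X.X.left)) ∧ s.PairwiseDisjoint fun U => (U : Set X.X.X.left)}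
  obtain ⟨s, hs⟩ := zorn_subset P fun c hc hch => ⟨⋃₀ c, ⟨fun U hU => by
    obtain ⟨t, ht, hUt⟩ := hU
    exact (hc ht).1 U hUt, (Set.pairwiseDisjoint_sUnion hch.directedOn).2 fun t ht => (hc ht).2⟩,
      fun t ht => Set.subset_sUnion_of_mem ht⟩
  refine ⟨s, fun U => U.1, fun U => hs.prop.1 U.1 U.2, fun U V h => hs.prop.2 U.2 V.2
    fun h' => h (Subtype.ext h'), ?_⟩
  set W : Set X.X.X.left := ⋃ U : s, (U.1 : Set X.X.X.left) with hW
  have hWo : IsOpen W := isOpen_iUnion fun U => U.1.2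
  have hWi : InvSet X.X W := by
    intro g x hx
    obtain ⟨U, hU⟩ := Set.mem_iUnion.1 hx
    exact Set.mem_iUnion.2 ⟨U, (hs.prop.1 U.1 U.2).2 g x hU⟩
  by_contra hd
  rw [dense_iff_closure_eq, ← Ne, Set.ne_univ_iff_exists_notMem] at hd
  obtain ⟨p, hp⟩ := hd
  obtain ⟨V, hpV, hVW, hVa, hVi⟩ := X.isGood.exists_isAffineOpen
    ⟨(closure W)ᶜ, isClosed_closure.isOpen_compl⟩ (hWi.closure hWo.isLocallyClosed).compl p hp
  have hVd (U : X.X.X.left.Opens) (hU : U ∈ s) :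
      Disjoint (V : Set X.X.X.left) (U : Set X.X.X.left) := by
    rw [Set.disjoint_left]
    intro x hx hx'
    exact hVW hx (subset_closure (Set.mem_iUnion.2 ⟨⟨U, hU⟩, hx'⟩))
  have h1 : insert V s ∈ P := by
    refine ⟨fun U hU => ?_, ?_⟩
    · obtain rfl | hU := hU
      · exact ⟨hVa, hVi⟩
      · exact hs.prop.1 U hU
    · exact hs.prop.2.insert fun U hU _ => hVd U hU
  have h2 : V ∈ s := hs.le_of_ge h1 (Set.subset_insert V s) (Set.mem_insert V s)
  exact Set.disjoint_left.1 (hVd V h2) hpV hpV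

lemma GVar.exists_nice (X : GVar B) : ∃ (Y : GVar B) (f : Y.X ⟶ X.X), IsNice Y.X ∧
    f ≫ X.str = Y.str ∧ Function.Bijective fun y : Pt Y.X.X => y ≫ f.hom := by
  obtain ⟨S, hS⟩ := exists_strat_of_dense X (fun V => ∀ h : InvLC X.X V, IsNice (X.sub h).X) (by
    intro C hC hi
    obtain ⟨I, U, hU, hd, hD⟩ := (X.sub (hi.lc hC)).exists_dense_nice
    refine ⟨_, isOpen_iUnion fun i => (U i).2, fun g x hx => ?_, hD, fun h => ?_⟩
    · obtain ⟨i, hU'⟩ := Set.mem_iUnion.1 hx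
      exact Set.mem_iUnion.2 ⟨i, (hU i).2 g x hU'⟩
    · obtain ⟨e, he1, he2, he3⟩ := X.exists_subMap h (hi.lc hC)
        ((Set.image_subset_range _ _).trans (X.range_subι _).le)
      have hr := (X.range_subMap h (hi.lc hC) e he1).trans
        ((X.subι (hi.lc hC)).hom.left.isEmbedding.injective.preimage_image _)
      have : IsOpenImmersion e.hom.left := isOpenImmersion_of_isImmersion _ (by
        rw [hr]; exact isOpen_iUnion fun i => (U i).2)
      exact IsNice.of_isOpenImmersion e U hU hd hr)
  refine ⟨GVar.sigma S.strata S.locFin_strata, GVar.sigmaTo _ _ fun n => X.subι (S.diff n.down),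
    GVar.isNice_sigma _ _ fun n => hS n.down _, GVar.sigmaTo_str _ _ _ _ fun n => rfl,
    GVar.sigmaTo_bijective _ _ _ ⟨?_, fun x => ?_⟩⟩
  · rintro ⟨n, p⟩ ⟨m, q⟩ h
    have h : p ≫ (X.subι (S.diff n.down)).hom = q ≫ (X.subι (S.diff m.down)).hom := h
    have h' : (X.subι (S.diff n.down)).hom.left (Pt.val p) =
      (X.subι (S.diff m.down)).hom.left (Pt.val q) := congrArg Pt.val h
    obtain rfl : n = m := ULift.down_injective (S.eq_of_mem_diff (X.subι_mem (S.diff n.down) p.val)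
      (h' ▸ X.subι_mem (S.diff m.down) q.val))
    exact congrArg (Sigma.mk n) (X.subι_injective _ h)
  · obtain ⟨n, hn⟩ := S.exists_mem_diff (Pt.val x)
    obtain ⟨y, hy⟩ := (X.exists_subι_iff (S.diff n) x).2 hn
    exact ⟨⟨⟨n⟩, y⟩, hy⟩
end

section
/-! ### Fibre products -/

instance isClosedImmersion_diag (X : Sch k) [IsSeparated X.hom] :
    IsClosedImmersion (lift (𝟙 X) (𝟙 X)).left :=
  (inferInstance : IsClosedImmersion (pullback.diagonal X.hom))

/-- The closed subset where two morphisms agree. -/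
def eqLocus {X Y : Sch k} (f g : X ⟶ Y) : Set X.left :=
  (lift f g).left ⁻¹' Set.range (lift (𝟙 Y) (𝟙 Y)).left

lemma isClosed_eqLocus {X Y : Sch k} (f g : X ⟶ Y) [IsSeparated Y.hom] : IsClosed (eqLocus f g) :=
  (lift (𝟙 Y) (𝟙 Y)).left.isClosedEmbedding.isClosed_range.preimage (lift f g).left.continuous

lemma mem_eqLocus_iff {X Y : Sch k} (f g : X ⟶ Y) [IsSeparated Y.hom] (x : Pt X) :
    x.val ∈ eqLocus f g ↔ x ≫ f = x ≫ g := by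
  have h1 : x.val ∈ eqLocus f g ↔ Pt.val (x ≫ lift f g) ∈ Set.range (lift (𝟙 Y) (𝟙 Y)).left := Iff.rfl
  rw [h1, mem_range_iff_pt]
  refine ⟨fun ⟨y, hy⟩ => ?_, fun h => ⟨x ≫ f, CartesianMonoidalCategory.hom_ext _ _ ?_ ?_⟩⟩
  · have h2 := hy =≫ fst Y Y
    have h3 := hy =≫ snd Y Y
    simp only [assoc, lift_fst, lift_snd] at h2 h3
    exact h2.symm.trans h3
  all_goals simp only [assoc, lift_fst, lift_snd, ← h]
  all_goals exact x ≫= comp_id f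

variable {G : Sch k} [GrpObj G]

def prodFst [GoodGrp G] (X Y : GSch G) [LFT (prodMod X Y).X.hom]
    [IsReduced (prodMod X Y).X.left] : prodMod X Y ⟶ X :=
  GSch.homMk (show (prodMod X Y).X ⟶ X.X from fst X.X Y.X) fun g x => prodMod_smul_fst g x

def prodSnd [GoodGrp G] (X Y : GSch G) [LFT (prodMod X Y).X.hom]
    [IsReduced (prodMod X Y).X.left] : prodMod X Y ⟶ Y :=
  GSch.homMk (show (prodMod X Y).X ⟶ Y.X from snd X.X Y.X) fun g x => prodMod_smul_snd g x

section
variable [GoodGrp G] {W X Y : GSch G}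

lemma prod_hom_ext {T : Sch k} {x x' : T ⟶ (prodMod X Y).X}
    (h : x ≫ fst X.X Y.X = x' ≫ fst X.X Y.X) (h' : x ≫ snd X.X Y.X = x' ≫ snd X.X Y.X) : x = x' :=
  CartesianMonoidalCategory.hom_ext (X := X.X) (Y := Y.X) _ _ h h'

def prodLift [LFT W.X.hom] [IsReduced W.X.left] (f : W ⟶ X) (g : W ⟶ Y) : W ⟶ prodMod X Y :=
  GSch.homMk (lift f.hom g.hom) fun a x => by
    refine prod_hom_ext ?_ ?_
    · refine assoc'.trans (((a • x) ≫= lift_fst _ _).trans ?_)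
      refine (GSch.smul_comp f a x).trans (Eq.trans ?_ (prodMod_smul_fst a _).symm)
      exact congrArg (a • ·) ((x ≫= lift_fst f.hom g.hom).symm.trans assoc'.symm)
    · refine assoc'.trans (((a • x) ≫= lift_snd _ _).trans ?_)
      refine (GSch.smul_comp g a x).trans (Eq.trans ?_ (prodMod_smul_snd a _).symm)
      exact congrArg (a • ·) ((x ≫= lift_snd f.hom g.hom).symm.trans assoc'.symm)

lemma comp_prodLift_fst [LFT W.X.hom] [IsReduced W.X.left] (f : W ⟶ X) (g : W ⟶ Y) {T : Sch k} (x : T ⟶ W.X) :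
    (x ≫ (prodLift f g).hom : T ⟶ (prodMod X Y).X) ≫ fst X.X Y.X = x ≫ f.hom :=
  assoc'.trans (x ≫= lift_fst _ _)

lemma comp_prodLift_snd [LFT W.X.hom] [IsReduced W.X.left] (f : W ⟶ X) (g : W ⟶ Y) {T : Sch k} (x : T ⟶ W.X) :
    (x ≫ (prodLift f g).hom : T ⟶ (prodMod X Y).X) ≫ snd X.X Y.X = x ≫ g.hom :=
  assoc'.trans (x ≫= lift_snd _ _)

lemma comp_prodMap_fst {X' Y' : GSch G} (f : X ⟶ X') (g : Y ⟶ Y') {T : Sch k}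
    (x : T ⟶ (prodMod X Y).X) :
    (x ≫ (prodMap f g).hom : T ⟶ (prodMod X' Y').X) ≫ fst X'.X Y'.X =
      (x ≫ fst X.X Y.X) ≫ f.hom :=
  assoc'.trans ((x ≫= tensorHom_fst f.hom g.hom).trans assoc'.symm)

lemma comp_prodMap_snd {X' Y' : GSch G} (f : X ⟶ X') (g : Y ⟶ Y') {T : Sch k}
    (x : T ⟶ (prodMod X Y).X) :
    (x ≫ (prodMap f g).hom : T ⟶ (prodMod X' Y').X) ≫ snd X'.X Y'.X =
      (x ≫ snd X.X Y.X) ≫ g.hom :=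
  assoc'.trans ((x ≫= tensorHom_snd f.hom g.hom).trans assoc'.symm)
end

variable [GoodGrp G] {B B' : GSch G} [LFT B.X.hom] [LFT B'.X.hom]

instance (X : GVar B) (Y : GVar B') : IsReduced (prodMod X.X Y.X).X.left := (X.prod Y).isReduced
instance (X : GVar B) (Y : GVar B') : LFT (prodMod X.X Y.X).X.hom :=
  inferInstanceAs (LFT (X.X.X ⊗ Y.X.X).hom)

def GVar.over (W : GVar B') (str : W.X ⟶ B) (hq : QuasiCompact str.hom.left) : GVar B where
  X := W.X
  str := str
  isReduced := W.isReduced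
  isSeparated := W.isSeparated
  locallyOfFiniteType := lft_left _ inferInstance
  quasiCompact := hq
  isGood := W.isGood

instance : LFT (prodMod B B').X.hom := inferInstanceAs (LFT (B.X ⊗ B'.X).hom)

lemma quasiCompact_of_isImmersion_pullback {P X Y T : Sch k} [LFT X.hom]
    [LFT Y.hom] (f : X ⟶ T) (g : Y ⟶ T) [QuasiCompact g.left] (p : P ⟶ X) (q : P ⟶ Y)
    (h : p ≫ f = q ≫ g) [him : IsImmersion (lift p q).left] : QuasiCompact p.left := by
  let Pb : Sch k := Over.mk (pullback.fst f.left g.left ≫ X.hom)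
  let a : Pb ⟶ X := Over.homMk (pullback.fst f.left g.left) rfl
  let b : Pb ⟶ Y := Over.homMk (pullback.snd f.left g.left) (by
    change pullback.snd f.left g.left ≫ Y.hom = pullback.fst f.left g.left ≫ X.hom
    rw [← Over.w f, ← Over.w g, pullback.condition_assoc])
  let e : P ⟶ Pb := Over.homMk (pullback.lift p.left q.left (congrArg (fun t : P ⟶ T => t.left) h)) (by
    change pullback.lift _ _ _ ≫ pullback.fst f.left g.left ≫ X.hom = P.hom
    rw [pullback.lift_fst_assoc, Over.w])
  have hea : e ≫ a = p := Over.OverMorphism.ext (pullback.lift_fst _ _ _)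
  have heb : e ≫ b = q := Over.OverMorphism.ext (pullback.lift_snd _ _ _)
  have he : IsImmersion e.left := by
    have h1 : e ≫ lift a b = lift p q := by rw [comp_lift, hea, heb]
    have : IsImmersion (e.left ≫ (lift a b).left) := by
      rw [← h1] at him
      exact him
    exact IsImmersion.of_comp e.left (lift a b).left
  have h1 : LFT g.left := lft_left _ inferInstance
  have h2 : LFT (pullback.fst f.left g.left ≫ X.hom) := inferInstance
  have h3 : IsLocallyNoetherian Pb.left := LocallyOfFiniteType.isLocallyNoetherian
    (pullback.fst f.left g.left ≫ X.hom)
  have h4 : QuasiCompact e.left := quasiCompact_of_isImmersion e.left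
  rw [← hea]
  exact (inferInstance : QuasiCompact (e.left ≫ pullback.fst f.left g.left))

lemma GVar.exists_pullback (X : GVar B) (Y : GVar B') {T : GSch G} [IsSeparated T.X.hom]
    [LFT T.X.hom] (f : X.X ⟶ T) (g : Y.X ⟶ T) [QuasiCompact g.hom.left] :
    ∃ (P : GVar B) (p : P.X ⟶ X.X) (q : P.X ⟶ Y.X), p ≫ X.str = P.str ∧ p ≫ f = q ≫ g ∧
      (∀ t t' : Pt P.X.X, t ≫ p.hom = t' ≫ p.hom → t ≫ q.hom = t' ≫ q.hom → t = t') ∧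
      ∀ (x : Pt X.X.X) (y : Pt Y.X.X), x ≫ f.hom = y ≫ g.hom →
        ∃ t : Pt P.X.X, t ≫ p.hom = x ∧ t ≫ q.hom = y := by
  let W := X.prod Y
  let a : W.X ⟶ X.X := prodFst X.X Y.X
  let b : W.X ⟶ Y.X := prodSnd X.X Y.X
  have hs : IsClosed (eqLocus (a ≫ f).hom (b ≫ g).hom) := isClosed_eqLocus _ _
  have hms (x : Pt W.X.X) : x.val ∈ eqLocus (a ≫ f).hom (b ≫ g).hom ↔
    x ≫ (a ≫ f).hom = x ≫ (b ≫ g).hom := mem_eqLocus_iff _ _ x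
  have hi : InvSet W.X (eqLocus (a ≫ f).hom (b ≫ g).hom) := by
    intro c x hx
    rw [hms] at hx ⊢
    rw [GSch.smul_comp, GSch.smul_comp, hx]
  have hl := hi.lc hs
  let j := W.subι hl
  have hjs (x : Pt W.X.X) : (∃ y : Pt (W.sub hl).X.X, y ≫ j.hom = x) ↔
      x ≫ (a ≫ f).hom = x ≫ (b ≫ g).hom := (W.exists_subι_iff hl x).trans (hms x)
  have hc : (j ≫ a) ≫ f = (j ≫ b) ≫ g := (assoc j a f).trans
    (GSch.ext_of_comp fun x => ((hjs (x ≫ j.hom)).1 ⟨x, rfl⟩).trans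
      ((x ≫= assoc j.hom b.hom g.hom).trans assoc'.symm).symm)
  have hlift : lift (j ≫ a).hom (j ≫ b).hom = j.hom :=
    CartesianMonoidalCategory.hom_ext _ _ (lift_fst _ _) (lift_snd _ _)
  have him : IsImmersion (lift (j ≫ a).hom (j ≫ b).hom).left :=
    hlift ▸ (inferInstance : IsImmersion (W.subι hl).hom.left)
  have h6 : QuasiCompact (j ≫ a).hom.left := quasiCompact_of_isImmersion_pullback f.hom g.hom
    (j ≫ a).hom (j ≫ b).hom (congrArg Mod.Hom.hom hc)
  have hq : QuasiCompact ((j ≫ a) ≫ X.str).hom.left :=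
    (inferInstance : QuasiCompact ((j ≫ a).hom.left ≫ X.str.hom.left))
  refine ⟨(W.sub hl).over ((j ≫ a) ≫ X.str) hq, j ≫ a, j ≫ b, rfl, hc,
    fun t t' h1 h2 => W.subι_injective hl (CartesianMonoidalCategory.hom_ext _ _ h1 h2),
    fun x y h => ?_⟩
  obtain ⟨t, ht⟩ := (hjs (lift x y)).2 (by
    have e3 : lift x y ≫ (a ≫ f).hom = x ≫ f.hom := assoc'.symm.trans (lift_fst x y =≫ f.hom)
    have e4 : lift x y ≫ (b ≫ g).hom = y ≫ g.hom := assoc'.symm.trans (lift_snd x y =≫ g.hom)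
    exact e3.trans (h.trans e4.symm))
  exact ⟨t, (congrArg (fun r : Pt W.X.X => r ≫ a.hom) ht).trans (lift_fst x y),
    (congrArg (fun r : Pt W.X.X => r ≫ b.hom) ht).trans (lift_snd x y)⟩

/-! ### The universal property for nice varieties -/

lemma GVar.exists_nice_pullback (X : GVar B) (Y : GVar B') {T : GSch G} [IsSeparated T.X.hom]
    [LFT T.X.hom] (f : X.X ⟶ T) (g : Y.X ⟶ T) [QuasiCompact g.hom.left] :
    ∃ (P : GVar B) (p : P.X ⟶ X.X) (q : P.X ⟶ Y.X), IsNice P.X ∧ p ≫ X.str = P.str ∧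
      p ≫ f = q ≫ g ∧
      (∀ t t' : Pt P.X.X, t ≫ p.hom = t' ≫ p.hom → t ≫ q.hom = t' ≫ q.hom → t = t') ∧
      ∀ (x : Pt X.X.X) (y : Pt Y.X.X), x ≫ f.hom = y ≫ g.hom →
        ∃ t : Pt P.X.X, t ≫ p.hom = x ∧ t ≫ q.hom = y := by
  obtain ⟨P, p, q, h1, h2, h3, h4⟩ := X.exists_pullback Y f g
  obtain ⟨N, r, hN, hr1, hr2⟩ := P.exists_nice
  have hp (t : Pt N.X.X) : t ≫ (r ≫ p).hom = (t ≫ r.hom) ≫ p.hom := assoc'.symm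
  have hq (t : Pt N.X.X) : t ≫ (r ≫ q).hom = (t ≫ r.hom) ≫ q.hom := assoc'.symm
  refine ⟨N, r ≫ p, r ≫ q, hN, by rw [assoc, h1, hr1], by
    rw [assoc, h2, assoc], fun t t' e1 e2 => hr2.1 (h3 _ _ ?_ ?_), fun x y h => ?_⟩
  · rw [hp, hp] at e1; exact e1
  · rw [hq, hq] at e2; exact e2
  · obtain ⟨t, ht1, ht2⟩ := h4 x y h
    obtain ⟨t', rfl⟩ := hr2.2 t
    exact ⟨t', (hp t').trans ht1, (hq t').trans ht2⟩

section
variable {A : Type*} [AddCommGroup A] (F : GVar B → A)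

/-- An invariant of nice varieties that is additive for decompositions. -/
def IsAdditiveOnNice : Prop :=
  ∀ (X Z U : GVar B) (z : Z.X ⟶ X.X) (v : U.X ⟶ X.X), IsNice X.X → IsNice Z.X → IsNice U.X →
    z ≫ X.str = Z.str → v ≫ X.str = U.str → Decomp z v → F X = F Z + F U

variable (B) in
lemma GVar.exists_empty : ∃ E : GVar B, IsEmpty E.X.X.left ∧
    ∀ X : GVar B, ∃ e : E.X ⟶ X.X, e ≫ X.str = E.str := by
  let E : PEmpty.{u + 1} → GVar B := fun i => i.elim
  have h : LocFin E := fun K _ => Set.toFinite _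
  refine ⟨GVar.sigma E h, ⟨fun w => ?_⟩, fun X => ⟨GVar.sigmaTo E h fun i => i.elim,
    GVar.sigmaTo_str E h X (fun i => i.elim) fun i => i.elim⟩⟩
  obtain ⟨i, -⟩ := GVar.exists_sigmaIn E h w
  exact i.elim

variable {F}

lemma IsAdditiveOnNice.eq_of_bijective (hF : IsAdditiveOnNice F) {X Z : GVar B} (hX : IsNice X.X)
    (hZ : IsNice Z.X) (z : Z.X ⟶ X.X) (hz : z ≫ X.str = Z.str)
    (h : Function.Bijective fun t : Pt Z.X.X => t ≫ z.hom) : F X = F Z := by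
  obtain ⟨E, hE, hE'⟩ := GVar.exists_empty B
  have hno (p : Pt E.X.X) : False := hE.false p.val
  have hEn : IsNice E.X := ⟨PEmpty, PEmpty.elim, fun i => i.elim, fun i => i.elim,
    fun x => (hE.false x).elim⟩
  obtain ⟨e, he⟩ := hE' X
  obtain ⟨e', he'⟩ := hE' E
  have h1 := hF E E E e' e' hEn hEn hEn he' he' ⟨fun p => (hno p).elim, fun p => (hno p).elim,
    fun p => (hno p).elim, fun p => (hno (p ≫ 𝟙 _)).elim⟩
  have h2 : F E = 0 := left_eq_add.1 h1
  have h3 := hF X Z E z e hX hZ hEn hz he ⟨fun p q e => h.1 e, fun p => (hno p).elim,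
    fun _ p => (hno p).elim, fun x => Or.inl (h.2 x)⟩
  rw [h3, h2, add_zero]

lemma IsAdditiveOnNice.eq_add (hF : IsAdditiveOnNice F) {X X' Z U : GVar B} (x : X'.X ⟶ X.X)
    (z : Z.X ⟶ X.X) (v : U.X ⟶ X.X) (hX : IsNice X'.X) (hZ : IsNice Z.X) (hU : IsNice U.X)
    (hx : x ≫ X.str = X'.str) (hz : z ≫ X.str = Z.str) (hv : v ≫ X.str = U.str)
    (hb : Function.Bijective fun t : Pt X'.X.X => t ≫ x.hom) (h : Decomp z v) :
    F X' = F Z + F U := by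
  have key {Z : GVar B} (z : Z.X ⟶ X.X) (hZ : IsNice Z.X) (hz : z ≫ X.str = Z.str) :
      ∃ (P : GVar B) (p : P.X ⟶ X'.X) (q : P.X ⟶ Z.X), IsNice P.X ∧ p ≫ X'.str = P.str ∧
        (∀ t : Pt P.X.X, (t ≫ p.hom) ≫ x.hom = (t ≫ q.hom) ≫ z.hom) ∧
        (∀ t t' : Pt P.X.X, t ≫ p.hom = t' ≫ p.hom → t ≫ q.hom = t' ≫ q.hom → t = t') ∧
        (∀ y a, a ≫ z.hom = y ≫ x.hom → ∃ t : Pt P.X.X, t ≫ p.hom = y) ∧ F Z = F P := by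
    have := GVar.quasiCompact_hom z hz
    obtain ⟨P, p, q, hP, hp, hpq, hi, hs⟩ := X'.exists_nice_pullback Z x z
    have hpq' (t : Pt P.X.X) : (t ≫ p.hom) ≫ x.hom = (t ≫ q.hom) ≫ z.hom := by
      rw [assoc, assoc]
      exact congrArg (fun f : P.X ⟶ X.X => t ≫ f.hom) hpq
    refine ⟨P, p, q, hP, hp, hpq', hi, fun y a h => (hs y a h.symm).imp fun t h => h.1,
      hF.eq_of_bijective hZ hP q ?_ ⟨fun t t' e => hi t t' (hb.1 ?_) e, fun y => ?_⟩⟩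
    · rw [← hz, ← assoc, ← hpq, assoc, hx, hp]
    · exact (hpq' t).trans ((e =≫ z.hom).trans (hpq' t').symm)
    · obtain ⟨a, ha⟩ := hb.2 (y ≫ z.hom)
      exact (hs a y ha).imp fun t h => h.2
  obtain ⟨P, p, q, hP, hp, hpq, hi, hs, e1⟩ := key z hZ hz
  obtain ⟨R, r, w, hR, hr, hrw, hi', hs', e2⟩ := key v hU hv
  rw [e1, e2]
  refine hF X' P R p r hX hP hR hp hr ⟨fun t t' e => hi t t' e (h.inj_left _ _ ?_),
    fun t t' e => hi' t t' e (h.inj_right _ _ ?_), fun t t' e => h.disj (t ≫ q.hom) (t' ≫ w.hom) ?_,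
    fun y => ?_⟩
  · rw [← hpq, ← hpq, e]
  · rw [← hrw, ← hrw, e]
  · rw [← hpq, ← hrw, e]
  · obtain ⟨a, ha⟩ | ⟨a, ha⟩ := h.surj (y ≫ x.hom)
    · exact Or.inl (hs y a ha)
    · exact Or.inr (hs' y a ha)

lemma GVar.IsCut.decomp {X Z U : GVar B} {i : Z.X ⟶ X.X} {j : U.X ⟶ X.X} (h : X.IsCut Z U i j) :
    Decomp i j := by
  have h1 := h.isClosedImmersion
  have h2 := h.isOpenImmersion
  have m1 := mono_of_left i.hom
  have m2 := mono_of_left j.hom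
  refine ⟨fun p q e => (cancel_mono i.hom).1 e, fun p q e => (cancel_mono j.hom).1 e,
    fun p q e => ?_, fun x => ?_⟩
  · have h3 : j.hom.left q.val ∈ (Set.range i.hom.left)ᶜ := h.range_eq.subset ⟨q.val, rfl⟩
    exact h3 ⟨p.val, congrArg Pt.val e⟩
  · by_cases hx : Pt.val x ∈ Set.range i.hom.left
    · exact Or.inl (exists_pt_lift i.hom x hx)
    · exact Or.inr (exists_pt_lift j.hom x (h.range_eq.ge hx))

lemma Decomp.comp {X Z U Z' U' : GSch G} {z : Z ⟶ X} {v : U ⟶ X} (h : Decomp z v) (z' : Z' ⟶ Z)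
    (v' : U' ⟶ U) (hz : Function.Bijective fun t : Pt Z'.X => t ≫ z'.hom)
    (hv : Function.Bijective fun t : Pt U'.X => t ≫ v'.hom) : Decomp (z' ≫ z) (v' ≫ v) := by
  have ez (t : Pt Z'.X) : t ≫ (z' ≫ z).hom = (t ≫ z'.hom) ≫ z.hom := assoc'.symm
  have ev (t : Pt U'.X) : t ≫ (v' ≫ v).hom = (t ≫ v'.hom) ≫ v.hom := assoc'.symm
  refine ⟨fun p q e => hz.1 (h.inj_left _ _ ?_), fun p q e => hv.1 (h.inj_right _ _ ?_),
    fun p q e => h.disj (p ≫ z'.hom) (q ≫ v'.hom) ?_, fun x => ?_⟩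
  · rw [ez, ez] at e; exact e
  · rw [ev, ev] at e; exact e
  · rw [ez, ev] at e; exact e
  · obtain ⟨t, rfl⟩ | ⟨t, rfl⟩ := h.surj x
    · obtain ⟨t', rfl⟩ := hz.2 t
      exact Or.inl ⟨t', ez t'⟩
    · obtain ⟨t', rfl⟩ := hv.2 t
      exact Or.inr ⟨t', ev t'⟩

theorem IsAdditiveOnNice.exists_hom (hF : IsAdditiveOnNice F) :
    ∃ Φ : K0 B →+ A, ∀ X : GVar B, IsNice X.X → Φ (K0.mk X) = F X := by
  choose N f hN hf hb using fun X : GVar B => X.exists_nice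
  refine ⟨K0.lift (fun X => F (N X)) fun X Z U i j h => ?_, fun X hX => ?_⟩
  · refine hF.eq_add (f X) (f Z ≫ i) (f U ≫ j) (hN X) (hN Z) (hN U) (hf X) ?_ ?_ (hb X)
      (h.decomp.comp _ _ (hb Z) (hb U))
    · rw [assoc, h.closed_comp, hf]
    · rw [assoc, h.open_comp, hf]
  · rw [K0.lift_mk]
    exact (hF.eq_of_bijective hX (hN X) (f X) (hf X) (hb X)).symm

end

lemma K0.induction {P : K0 B → Prop} (zero : P 0) (mk : ∀ X, P (K0.mk X))
    (add : ∀ a b, P a → P b → P (a + b)) (neg : ∀ a, P a → P (-a)) (a : K0 B) : P a := by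
  obtain ⟨a, rfl⟩ := QuotientAddGroup.mk_surjective a
  induction a using FreeAbelianGroup.induction_on with
  | zero => exact zero
  | of X => exact mk X
  | neg X _ => exact neg _ (mk X)
  | add x y hx hy => exact add _ _ hx hy

lemma K0.exists_nice_mk (X : GVar B) : ∃ Y : GVar B, IsNice Y.X ∧ K0.mk X = K0.mk Y := by
  obtain ⟨Y, f, hY, hf, hb⟩ := X.exists_nice
  exact ⟨Y, hY, (K0.mk_eq_of_bijective f hf hb).symm⟩

lemma K0.induction_nice {P : K0 B → Prop} (zero : P 0) (mk : ∀ X : GVar B, IsNice X.X → P (K0.mk X))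
    (add : ∀ a b, P a → P b → P (a + b)) (neg : ∀ a, P a → P (-a)) (a : K0 B) : P a := by
  refine K0.induction zero (fun X => ?_) add neg a
  obtain ⟨Y, hY, h⟩ := K0.exists_nice_mk X
  exact h ▸ mk Y hY

lemma K0.hom_ext {A : Type*} [AddCommGroup A] {f g : K0 B →+ A} (h : ∀ X, f (K0.mk X) = g (K0.mk X)) :
    f = g := by
  ext a
  induction a using K0.induction with
  | zero => rw [map_zero, map_zero]
  | mk X => exact h X
  | add a b ha hb => rw [map_add, map_add, ha, hb]
  | neg a ha => rw [map_neg, map_neg, ha]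
end

section
/-! ### Morphisms defined on points -/

lemma exists_hom_of_local {Y T : Sch k} [LFT Y.hom] [IsReduced Y.left]
    (θ : Pt Y → Pt T) (h : ∀ y : Pt Y, ∃ (V : Sch k) (v : V ⟶ Y) (g : V ⟶ T),
      IsOpenImmersion v.left ∧ (∃ z, z ≫ v = y) ∧ ∀ z : Pt V, z ≫ g = θ (z ≫ v)) :
    ∃ g : Y ⟶ T, ∀ y, y ≫ g = θ y := by
  have h' (y : Pt Y) : ∃ (U : Y.left.Opens) (g : openObj Y U ⟶ T), y.val ∈ U ∧
      ∀ z : Pt (openObj Y U), z ≫ g = θ (z ≫ openObjι Y U) := by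
    obtain ⟨V, v, g, hv, ⟨z, rfl⟩, hg⟩ := h y
    obtain ⟨e, he⟩ := exists_lift_pt (T := openObj Y v.left.opensRange) v (openObjι Y v.left.opensRange)
      fun t => exists_pt_lift v _ ((range_openObjι Y v.left.opensRange).subset ⟨Pt.val t, rfl⟩)
    refine ⟨v.left.opensRange, e ≫ g, ⟨Pt.val z, rfl⟩, fun t => ?_⟩
    rw [← assoc, hg, assoc, he]
  choose U g hU hg using h'
  have hcov : TopologicalSpace.IsOpenCover U := TopologicalSpace.Opens.ext
    (eq_univ_of_forall_pt (iSup U).2.isLocallyClosed fun y =>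
      TopologicalSpace.Opens.mem_iSup.2 ⟨y, hU y⟩)
  let 𝒰 := Y.left.openCoverOfIsOpenCover U hcov
  have hcomp (x y : Pt Y) : pullback.fst (U x).ι (U y).ι ≫ (g x).left =
      pullback.snd (U x).ι (U y).ι ≫ (g y).left := by
    let P : Sch k := Over.mk (pullback.fst (U x).ι (U y).ι ≫ (U x).ι ≫ Y.hom)
    let a : P ⟶ openObj Y (U x) := Over.homMk (pullback.fst (U x).ι (U y).ι) rfl
    let b : P ⟶ openObj Y (U y) := Over.homMk (pullback.snd (U x).ι (U y).ι)
      (pullback.condition_assoc (f := (U x).ι) (g := (U y).ι) Y.hom).symm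
    have hab : a ≫ openObjι Y (U x) = b ≫ openObjι Y (U y) :=
      Over.OverMorphism.ext (pullback.condition (f := (U x).ι) (g := (U y).ι))
    have i1 : LFT P.hom := inferInstanceAs (LFT (_ ≫ (U x).ι ≫ Y.hom))
    have i2 : IsReduced P.left := isReduced_of_isOpenImmersion
      (pullback.fst (U x).ι (U y).ι ≫ (U x).ι)
    have : a ≫ g x = b ≫ g y := by
      refine hom_ext_pt fun t => ?_
      rw [← assoc, ← assoc, hg, hg, assoc, assoc, hab]
    exact congrArg (fun t : P ⟶ T => t.left) this
  let f := 𝒰.glueMorphisms (fun y : Pt Y => (g y).left) hcomp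
  have hf (y : Pt Y) : (U y).ι ≫ f = (g y).left :=
    𝒰.ι_glueMorphisms (fun y : Pt Y => (g y).left) hcomp y
  have hw : f ≫ T.hom = Y.hom := by
    refine Scheme.Cover.hom_ext 𝒰 _ _ fun y : Pt Y => ?_
    change (U y).ι ≫ f ≫ T.hom = (U y).ι ≫ Y.hom
    exact assoc'.symm.trans ((hf y =≫ T.hom).trans (Over.w (g y)))
  refine ⟨Over.homMk f hw, fun y => ?_⟩
  obtain ⟨z, hz⟩ := exists_pt_lift (openObjι Y (U y)) y ((range_openObjι Y (U y)).ge (hU y))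
  have e : openObjι Y (U y) ≫ Over.homMk f hw = g y := Over.OverMorphism.ext (hf y)
  have h1 := hg y z
  rw [hz] at h1
  rw [← h1, ← e]
  exact (hz.symm =≫ Over.homMk f hw).trans assoc'

lemma fnPull_injective_of_surjective {X Y : Sch k} [LFT Y.hom] [IsReduced Y.left]
    (p : X ⟶ Y) (hp : ∀ y : Pt Y, ∃ x : Pt X, x ≫ p = y) : Function.Injective (fnPull p) := by
  intro a b h
  refine fn_ext_pt fun y => ?_
  obtain ⟨x, rfl⟩ := hp y
  rw [fnPull_comp, fnPull_comp, h]

lemma hom_ext_of_isAffine {X Y : Sch k} [IsAffine Y.left] {f g : X ⟶ Y}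
    (h : ∀ a, fnPull f a = fnPull g a) : f = g :=
  Over.OverMorphism.ext (ext_of_isAffine (CommRingCat.hom_ext (RingHom.ext h)))

lemma exists_hom_of_ringHom {Y Q : Sch k} [IsAffine Q.left] (ψ : Γ(Q.left, ⊤) →+* Γ(Y.left, ⊤))
    (hψ : ∀ a, ψ (fnC Q a) = fnC Y a) : ∃ g : Y ⟶ Q, fnPull g = ψ := by
  let f : Y.left ⟶ Q.left := Y.left.toSpecΓ ≫ Spec.map (CommRingCat.ofHom ψ) ≫ Q.left.isoSpec.inv
  have h1 : Q.left.isoSpec.inv.appTop ≫ (Scheme.ΓSpecIso Γ(Q.left, ⊤)).hom = 𝟙 _ := by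
    rw [← Scheme.toSpecΓ_appTop, ← Scheme.Hom.comp_appTop, Scheme.toSpecΓ_isoSpec_inv]
    exact Scheme.Hom.id_appTop
  have hf : f.appTop = CommRingCat.ofHom ψ := by
    rw [Scheme.Hom.comp_appTop, Scheme.Hom.comp_appTop, Scheme.toSpecΓ_appTop, assoc,
      Scheme.ΓSpecIso_naturality]
    exact assoc'.symm.trans ((h1 =≫ CommRingCat.ofHom ψ).trans (id_comp _))
  have hw : f ≫ Q.hom = Y.hom := by
    have : IsAffine (Spec (.of k)) := inferInstance
    apply ext_of_isAffine
    rw [Scheme.Hom.comp_appTop, hf]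
    refine CommRingCat.hom_ext (RingHom.ext fun a => ?_)
    have h2 := hψ ((Scheme.ΓSpecIso (.of k)).hom a)
    have h3 : (Scheme.ΓSpecIso (.of k)).inv ((Scheme.ΓSpecIso (.of k)).hom a) = a :=
      congrArg (fun t => t.hom a) (Scheme.ΓSpecIso (.of k)).hom_inv_id
    simp only [fnC, RingHom.comp_apply] at h2
    exact (congrArg (fun b => ψ (Q.hom.appTop.hom b)) h3.symm).trans
      (h2.trans (congrArg (fun b => Y.hom.appTop.hom b) h3))
  exact ⟨Over.homMk f hw, congrArg CommRingCat.Hom.hom hf⟩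

/-! ### Quotients by finite equivalence relations -/

/-- The functions on the affine scheme `Q` are the functions on `W` that are constant on the fibres
of `q`. -/
structure FnQuot {W Q : Sch k} (q : W ⟶ Q) : Prop where
  isAffine : IsAffine Q.left
  surj : ∀ y : Pt Q, ∃ x : Pt W, x ≫ q = y
  exists_fn : ∀ f : Γ(W.left, ⊤), (∀ x x' : Pt W, x ≫ q = x' ≫ q → fnPull x f = fnPull x' f) →
    ∃ g, fnPull q g = f

/-- A universally closed quotient with the expected functions, locally. -/
structure IsQuot {W Q : Sch k} (q : W ⟶ Q) : Prop where
  universallyClosed : UniversallyClosed q.left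
  surj : ∀ y : Pt Q, ∃ x : Pt W, x ≫ q = y
  exists_fnQuot : ∀ (y : Pt Q) (O : Q.left.Opens), y.val ∈ O →
    ∃ (D W' : Sch k) (d : D ⟶ Q) (w : W' ⟶ W) (q' : W' ⟶ D), IsOpenImmersion d.left ∧
      IsOpenImmersion w.left ∧ FnQuot q' ∧ q' ≫ d = w ≫ q ∧ (∃ y', y' ≫ d = y) ∧
      Set.range d.left ⊆ O

lemma isClosed_pt_val {X : Sch k} [LFT X.hom] (x : Pt X) : IsClosed {Pt.val x} :=
  (pointEquivClosedPoint X.hom ⟨x.left, Over.w x⟩).2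

lemma exists_factor {W Q T : Sch k} [LFT Q.hom] [IsReduced Q.left] (q : W ⟶ Q)
    (hq : ∀ y : Pt Q, ∃ x : Pt W, x ≫ q = y) [IsAffine T.left] (h : W ⟶ T)
    (key : ∀ a, ∃ b, fnPull q b = fnPull h a) : ∃ g : Q ⟶ T, q ≫ g = h := by
  have hi := fnPull_injective_of_surjective q hq
  choose ψ hψ using key
  obtain ⟨g, hg⟩ := exists_hom_of_ringHom (Y := Q) (Q := T)
    { toFun := ψ
      map_one' := hi (by rw [hψ, map_one, map_one])
      map_zero' := hi (by rw [hψ, map_zero, map_zero])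
      map_mul' := fun a b => hi (by rw [hψ, map_mul, map_mul, hψ, hψ])
      map_add' := fun a b => hi (by rw [hψ, map_add, map_add, hψ, hψ]) }
    (fun a => hi (by
      change fnPull q (ψ _) = _
      rw [hψ, fnPull_fnC, fnPull_fnC]))
  refine ⟨g, hom_ext_of_isAffine fun a => ?_⟩
  rw [fnPull_comp, hg]
  exact hψ a

lemma FnQuot.exists_hom {W Q : Sch k} [LFT Q.hom] [IsReduced Q.left] {q : W ⟶ Q}
    (hq : FnQuot q) {T : Sch k} [IsAffine T.left] (h : W ⟶ T)
    (hh : ∀ x x' : Pt W, x ≫ q = x' ≫ q → x ≫ h = x' ≫ h) : ∃ g : Q ⟶ T, q ≫ g = h :=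
  exists_factor q hq.surj h fun a => hq.exists_fn _ fun x x' e => by
    rw [← fnPull_comp, ← fnPull_comp, hh x x' e]

lemma IsQuot.exists_hom {W Q : Sch k} [LFT W.hom]
    [IsReduced W.left] [LFT Q.hom] [IsReduced Q.left] {q : W ⟶ Q} (hq : IsQuot q)
    {W' V T : Sch k} (w : W' ⟶ W) (v : V ⟶ Q) (q' : W' ⟶ V) [IsOpenImmersion w.left]
    [IsOpenImmersion v.left] (e : q' ≫ v = w ≫ q)
    (hc : ∀ (x : Pt W) (y : Pt V), x ≫ q = y ≫ v → ∃ x', x' ≫ w = x) (h : W' ⟶ T)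
    (hh : ∀ x x' : Pt W', x ≫ q' = x' ≫ q' → x ≫ h = x' ≫ h) : ∃ g : V ⟶ T, q' ≫ g = h := by
  have := hq.universallyClosed
  have := lft_of_isImmersion w
  have := lft_of_isImmersion v
  have : IsReduced W'.left := isReduced_of_isOpenImmersion w.left
  have : IsReduced V.left := isReduced_of_isOpenImmersion v.left
  have mv := mono_of_left v
  have hs (y : Pt V) : ∃ x : Pt W', x ≫ q' = y := by
    obtain ⟨x, hx⟩ := hq.surj (y ≫ v)
    obtain ⟨x', rfl⟩ := hc x y hx
    exact ⟨x', (cancel_mono v).1 (by rw [← hx, assoc, assoc, e])⟩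
  choose s hs using hs
  obtain ⟨g, hg⟩ := exists_hom_of_local (Y := V) (T := T) (fun y => s y ≫ h) fun y => by
    obtain ⟨T', hT', hyT, -⟩ := exists_isAffineOpen_mem_and_subset
      (x := Pt.val (s y ≫ h)) (U := (⊤ : T.left.Opens)) trivial
    let U : W.left.Opens := w.left ''ᵁ (h.left ⁻¹ᵁ T')
    have hcl : IsClosed (q.left '' (U : Set W.left)ᶜ) :=
      Scheme.Hom.isClosedMap q.left _ U.2.isClosed_compl
    let O : Q.left.Opens := ⟨(q.left '' (U : Set W.left)ᶜ)ᶜ, hcl.isOpen_compl⟩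
    have hO (x : Pt W) (hx : Pt.val (x ≫ q) ∈ O) : ∃ x' : Pt W', x' ≫ w = x ∧
        Pt.val (x' ≫ h) ∈ T' := by
      by_contra! hcon
      refine hx ⟨x.val, fun hxU => ?_, rfl⟩
      obtain ⟨p, hp, hpx⟩ := hxU
      obtain ⟨x', rfl⟩ := exists_pt_lift w x ⟨p, hpx⟩
      have : p = Pt.val x' := w.left.isOpenEmbedding.injective hpx
      subst this
      exact hcon x' rfl hp
    have hyO : Pt.val (y ≫ v) ∈ O := by
      rintro ⟨p, hp, hpy⟩
      have hfib := (isClosed_pt_val (y ≫ v)).preimage q.left.continuous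
      obtain ⟨x, hx1, hx2⟩ := exists_pt_mem
        (hfib.isLocallyClosed.inter U.2.isClosed_compl.isLocallyClosed) ⟨p, hpy, hp⟩
      have hxy : x ≫ q = y ≫ v := Pt.ext_val hx1
      obtain ⟨x', rfl⟩ := hc x y hxy
      have h1 : x' ≫ q' = y := (cancel_mono v).1 (by rw [← hxy, assoc, assoc, e])
      have h2 : x' ≫ h = s y ≫ h := hh _ _ (h1.trans (hs y).symm)
      exact hx2 ⟨Pt.val x', show Pt.val (x' ≫ h) ∈ T' by rwa [h2], rfl⟩
    obtain ⟨D, WD, d, wD, qD, hd, hwD, hqD, e1, ⟨y', hy'⟩, hDO⟩ := hq.exists_fnQuot (y ≫ v) O hyO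
    have := lft_of_isImmersion d
    have := lft_of_isImmersion wD
    have : IsReduced D.left := isReduced_of_isOpenImmersion d.left
    have : IsReduced WD.left := isReduced_of_isOpenImmersion wD.left
    have hWD (t : Pt WD) : ∃ x' : Pt W', x' ≫ w = t ≫ wD ∧ Pt.val (x' ≫ h) ∈ T' := by
      refine hO (t ≫ wD) (hDO ⟨Pt.val (t ≫ qD), ?_⟩)
      exact congrArg Pt.val (show (t ≫ qD) ≫ d = (t ≫ wD) ≫ q by rw [assoc, assoc, e1])
    obtain ⟨ww, hww⟩ := exists_lift_pt w wD fun t => (hWD t).imp fun _ => And.left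
    obtain ⟨dv, hdv⟩ := exists_lift_pt v d fun t => by
      obtain ⟨x, rfl⟩ := hqD.surj t
      obtain ⟨x', hx', -⟩ := hWD x
      exact ⟨x' ≫ q', by rw [assoc, e, ← assoc, hx', assoc, assoc, e1]⟩
    have hdv' : IsOpenImmersion dv.left := by
      have : IsOpenImmersion (dv.left ≫ v.left) := by rw [← Over.comp_left, hdv]; exact hd
      exact .of_comp dv.left v.left
    have mw := mono_of_left w
    obtain ⟨hT, hhT⟩ := exists_lift_pt (openObjι T T') (ww ≫ h) fun t => by
      obtain ⟨x', hx', hx''⟩ := hWD t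
      refine exists_pt_lift _ _ ((range_openObjι T T').ge ?_)
      have : t ≫ ww = x' := (cancel_mono w).1 (by rw [assoc, hww, hx'])
      rw [← assoc, this]
      exact hx''
    have hsq : ww ≫ q' = qD ≫ dv := (cancel_mono v).1 (by
      rw [assoc, assoc, e, hdv, e1, ← assoc, hww])
    have : IsAffine (openObj T T').left := hT'
    have mT := mono_of_left (openObjι T T')
    obtain ⟨g, hg⟩ := hqD.exists_hom hT fun x x' hxx => (cancel_mono (openObjι T T')).1 (by
      rw [assoc, assoc, hhT, ← assoc, ← assoc]
      exact hh _ _ (by rw [assoc, assoc, hsq, ← assoc, hxx, assoc]))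
    refine ⟨D, dv, g ≫ openObjι T T', hdv', ⟨y', (cancel_mono v).1 (by rw [assoc, hdv, hy'])⟩,
      fun z => ?_⟩
    obtain ⟨x, rfl⟩ := hqD.surj z
    have h1 : (x ≫ qD) ≫ g ≫ openObjι T T' = (x ≫ ww) ≫ h := by
      rw [assoc, ← assoc qD, hg, hhT, assoc]
    rw [h1]
    exact hh _ _ (by rw [hs, assoc, assoc, hsq])
  exact ⟨g, hom_ext_pt fun x => by rw [← assoc, hg]; exact hh _ _ (hs _)⟩
end

section
/-! ### Localization of affine quotients -/

lemma fnPull_openObjι {X : Sch k} (U : X.left.Opens) (c : Γ(X.left, ⊤)) :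
    fnPull (openObjι X U) c = U.topIso.inv (c |_ U) := by
  rw [TopCat.Presheaf.restrictOpenCommRingCat_apply]
  exact congrArg (fun t => t.hom c) ((Scheme.Opens.ι_appTop U).trans
    (X.left.presheaf.map_comp (homOfLE le_top : U ⟶ ⊤).op (eqToHom U.ι_image_top).op))

lemma exists_basicOpen_immersion (X : Sch k) [IsAffine X.left] (a : Γ(X.left, ⊤)) :
    ∃ (U : Sch k) (j : U ⟶ X), IsOpenImmersion j.left ∧
      Set.range j.left = X.left.basicOpen a ∧ IsAffine U.left ∧ IsUnit (fnPull j a) ∧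
      ∀ f, ∃ (n : ℕ) (b : Γ(X.left, ⊤)), fnPull j b = fnPull j a ^ n * f := by
  let U := X.left.basicOpen a
  refine ⟨openObj X U, openObjι X U, inferInstanceAs (IsOpenImmersion U.ι), range_openObjι _ _,
    (isAffineOpen_top X.left).basicOpen a, ?_, fun f => ?_⟩
  · rw [fnPull_openObjι]
    exact (X.left.toRingedSpace.isUnit_res_basicOpen a).map U.topIso.inv.hom
  · obtain ⟨n, b, hb⟩ := exists_eq_pow_mul_of_isAffineOpen X.left ⊤ (isAffineOpen_top X.left) a
      (U.topIso.hom f)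
    refine ⟨n, b, ?_⟩
    have h2 : U.topIso.inv (U.topIso.hom f) = f := congrArg (fun t => t.hom f) U.topIso.hom_inv_id
    rw [fnPull_openObjι, fnPull_openObjι]
    refine (congrArg U.topIso.inv hb).trans ?_
    rw [map_mul, map_pow, h2]
    rfl

lemma FnQuot.exists_fn_of_localization {W Q U V : Sch k} {q : W ⟶ Q} (hq : FnQuot q) (a : Γ(Q.left, ⊤))
    (w : U ⟶ W) (d : V ⟶ Q) [Mono d] (q' : U ⟶ V) (e : q' ≫ d = w ≫ q)
    (hw : ∀ x : Pt W, fnPull x (fnPull q a) ≠ 0 → ∃ x', x' ≫ w = x) (hu : IsUnit (fnPull d a))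
    (hF : ∀ f, ∃ (n : ℕ) (b : Γ(W.left, ⊤)), fnPull w b = fnPull w (fnPull q a) ^ n * f)
    (f : Γ(U.left, ⊤)) (hf : ∀ x x' : Pt U, x ≫ q' = x' ≫ q' → fnPull x f = fnPull x' f) :
    ∃ g, fnPull q' g = f := by
  obtain ⟨n, F, hF⟩ := hF f
  have hF' (x : Pt U) : fnPull (x ≫ w) F = fnPull (x ≫ w) (fnPull q a) ^ n * fnPull x f := by
    rw [fnPull_comp, fnPull_comp x w, ← map_pow, ← map_mul, hF]
  obtain ⟨g, hg⟩ := hq.exists_fn (fnPull q a * F) fun x x' e' => by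
    have e1 : fnPull x (fnPull q a) = fnPull x' (fnPull q a) := by
      rw [← fnPull_comp, ← fnPull_comp, e']
    rw [map_mul, map_mul, e1]
    by_cases h0 : fnPull x' (fnPull q a) = 0
    · rw [h0, zero_mul, zero_mul]
    · obtain ⟨z, rfl⟩ := hw x (e1 ▸ h0)
      obtain ⟨z', rfl⟩ := hw x' h0
      rw [hF', hF', e1, hf z z' ((cancel_mono d).1 (by rw [assoc, assoc, e, ← assoc, e', assoc]))]
  obtain ⟨u, hu⟩ := hu.exists_right_inv
  refine ⟨fnPull d g * u ^ (n + 1), ?_⟩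
  have h1 : fnPull q' (fnPull d a) * fnPull q' u = 1 := by rw [← map_mul, hu, map_one]
  have h2 (c : Γ(Q.left, ⊤)) : fnPull q' (fnPull d c) = fnPull w (fnPull q c) := by
    rw [← fnPull_comp, e, fnPull_comp]
  rw [map_mul, h2, hg, map_mul, map_pow, hF]
  rw [h2] at h1
  calc _ = (fnPull w (fnPull q a) * fnPull q' u) ^ (n + 1) * f := by ring
    _ = f := by rw [h1, one_pow, _root_.one_mul]

lemma FnQuot.isQuot {W Q : Sch k} [LFT W.hom] [IsReduced W.left]
    [LFT Q.hom] [IsAffine W.left] {q : W ⟶ Q} (hq : FnQuot q)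
    (hu : UniversallyClosed q.left) : IsQuot q where
  universallyClosed := hu
  surj := hq.surj
  exists_fnQuot y O hy := by
    have := hq.isAffine
    obtain ⟨a, haO, hya⟩ := (isAffineOpen_top Q.left).exists_basicOpen_le (V := O) ⟨y.val, hy⟩ trivial
    obtain ⟨V, d, hd, hdr, hV, hda, -⟩ := exists_basicOpen_immersion Q a
    obtain ⟨U, w, hw, hwr, hU, -, hF⟩ := exists_basicOpen_immersion W (fnPull q a)
    have mw : Mono w := mono_of_left w
    have md : Mono d := mono_of_left d
    have := lft_of_isImmersion w
    have : IsReduced U.left := isReduced_of_isOpenImmersion w.left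
    have hw1 (x : Pt W) (hx : fnPull x (fnPull q a) ≠ 0) : ∃ x' : Pt U, x' ≫ w = x :=
      exists_pt_lift w x (hwr.ge ((mem_basicOpen_iff_fnPull _ _).2 hx))
    have hd1 (x : Pt V) : fnPull (x ≫ d) a ≠ 0 :=
      (mem_basicOpen_iff_fnPull _ _).1 (hdr.subset ⟨Pt.val x, rfl⟩)
    have hw2 (x : Pt U) : fnPull (x ≫ w) (fnPull q a) ≠ 0 :=
      (mem_basicOpen_iff_fnPull _ _).1 (hwr.subset ⟨Pt.val x, rfl⟩)
    obtain ⟨q', hq'⟩ := exists_lift_pt d (w ≫ q) fun x => by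
      refine exists_pt_lift d _ (hdr.ge ((mem_basicOpen_iff_fnPull _ _).2 ?_))
      have := hw2 x
      rwa [← fnPull_comp, assoc] at this
    refine ⟨V, U, d, w, q', hd, hw, ⟨hV, fun t => ?_,
      hq.exists_fn_of_localization a w d q' hq' hw1 hda hF⟩, hq',
      exists_pt_lift d y (hdr.ge hya), hdr.subset.trans haO⟩
    obtain ⟨x, hx⟩ := hq.surj (t ≫ d)
    obtain ⟨x', rfl⟩ := hw1 x (by rw [← fnPull_comp, hx]; exact hd1 t)
    exact ⟨x', (cancel_mono d).1 (by rw [← hx, assoc, assoc, hq'])⟩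

/-! ### Actions of finite groups -/

/-- `ρ` is an action of the group `Γ` on `W`. -/
structure IsAct {Γ : Type*} [Group Γ] {W : Sch k} (ρ : Γ → (W ⟶ W)) : Prop where
  one : ρ 1 = 𝟙 W
  mul : ∀ a b, ρ (a * b) = ρ a ≫ ρ b

variable {Γ : Type*} [Group Γ] [Finite Γ] {W Q : Sch k} {ρ : Γ → (W ⟶ W)}

/-- The action on global functions. -/
abbrev IsAct.mulSemiringAction (hρ : IsAct ρ) : MulSemiringAction Γ Γ(W.left, ⊤) where
  smul := fun c f => fnPull (ρ c) f
  one_smul := fun f => by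
    change fnPull (ρ 1) f = f
    rw [hρ.one]
    exact congrArg (fun t => t.hom f) (Scheme.Hom.id_appTop (X := W.left))
  mul_smul := fun c d f => by
    change fnPull (ρ (c * d)) f = _
    rw [hρ.mul, fnPull_comp]
    rfl
  smul_zero := fun c => map_zero _
  smul_add := fun c => map_add _
  smul_one := fun c => map_one _
  smul_mul := fun c => map_mul _

lemma hom_affine_eq_of_ker [LFT W.hom] [IsAffine W.left] {x x' : Pt W}
    (h : ∀ a, fnPull x a = 0 → fnPull x' a = 0) : x = x' := by
  refine hom_ext_of_isAffine fun a => ?_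
  obtain ⟨c, hc⟩ := (fnC_unit_bijective k).2 (fnPull x a)
  have h1 := h (a - fnC W c) (by rw [map_sub, fnPull_fnC, hc, sub_self])
  rw [map_sub, fnPull_fnC, hc, sub_eq_zero] at h1
  exact h1.symm

lemma surjective_of_isIntegral {q : W ⟶ Q} [IsAffine W.left] [IsAffine Q.left]
    (h1 : (fnPull q).IsIntegral) (h2 : Function.Injective (fnPull q)) :
    IsIntegralHom q.left ∧ Function.Surjective q.left := by
  constructor
  · have : MorphismProperty.RespectsIso @IsIntegralHom :=
      MorphismProperty.IsStableUnderBaseChange.respectsIso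
    rw [MorphismProperty.arrow_mk_iso_iff @IsIntegralHom (arrowIsoSpecΓOfIsAffine q.left)]
    exact IsIntegralHom.SpecMap_iff.2 h1
  · have : Surjective q.left := by
      rw [MorphismProperty.arrow_mk_iso_iff @Surjective (arrowIsoSpecΓOfIsAffine q.left)]
      exact ⟨h1.comap_surjective h2⟩
    exact this.surj

lemma affine_quotient (hρ : IsAct ρ) [IsAffine W.left] [IsAffine Q.left] [LFT W.hom]
    [LFT Q.hom] (q : W ⟶ Q) (hq : ∀ c, ρ c ≫ q = q)
    (hi : Function.Injective (fnPull q))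
    (hf : ∀ f : Γ(W.left, ⊤), (∀ c, fnPull (ρ c) f = f) → ∃ g, fnPull q g = f) :
    IsIntegralHom q.left ∧ (∀ y : Pt Q, ∃ x : Pt W, x ≫ q = y) ∧
      ∀ x x' : Pt W, x ≫ q = x' ≫ q → ∃ c, x ≫ ρ c = x' := by
  let A := Γ(W.left, ⊤)
  let A0 := Γ(Q.left, ⊤)
  let _ := hρ.mulSemiringAction
  let _ : Algebra A0 A := (fnPull q).toAlgebra
  have hs (c : Γ) (f : A) : c • f = fnPull (ρ c) f := rfl
  have hfix (c : Γ) (a : A0) : fnPull (ρ c) (fnPull q a) = fnPull q a := by rw [← fnPull_comp, hq]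
  have : SMulCommClass Γ A0 A := ⟨fun c a f => by
    rw [Algebra.smul_def, Algebra.smul_def, hs, hs, map_mul]
    exact congrArg (· * _) (hfix c a)⟩
  have : Algebra.IsInvariant A0 A Γ := ⟨fun b hb => hf b hb⟩
  have hint : (fnPull q).IsIntegral := (Algebra.IsInvariant.isIntegral A0 A Γ).isIntegral
  obtain ⟨h1, h2⟩ := surjective_of_isIntegral hint hi
  refine ⟨h1, fun y => ?_, fun x x' e => ?_⟩
  · obtain ⟨p, hp⟩ := h2 y.val
    obtain ⟨x, hx⟩ := exists_pt_mem ((isClosed_pt_val y).preimage q.left.continuous).isLocallyClosed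
      ⟨p, hp⟩
    exact ⟨x, Pt.ext_val hx⟩
  · have i1 : (RingHom.ker (fnPull x)).IsPrime := RingHom.ker_isPrime _
    have i2 : (RingHom.ker (fnPull x')).IsPrime := RingHom.ker_isPrime _
    obtain ⟨c, hc⟩ := Algebra.IsInvariant.exists_smul_of_under_eq A0 A Γ
      (RingHom.ker (fnPull x)) (RingHom.ker (fnPull x')) (by
        ext a
        change fnPull x (fnPull q a) = 0 ↔ fnPull x' (fnPull q a) = 0
        rw [← fnPull_comp, ← fnPull_comp, e])
    refine ⟨c⁻¹, hom_affine_eq_of_ker fun a ha => ?_⟩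
    change a ∈ RingHom.ker (fnPull x')
    rw [hc, Ideal.mem_pointwise_smul_iff_inv_smul_mem]
    change fnPull x (fnPull (ρ c⁻¹) a) = 0
    rw [← fnPull_comp, ha]

/-- `q` is a quotient by the finite group that acts through `ρ`. -/
structure IsGrpQuot (ρ : Γ → (W ⟶ W)) (q : W ⟶ Q) : Prop extends IsQuot q where
  inv : ∀ c, ρ c ≫ q = q
  orbit : ∀ x x' : Pt W, x ≫ q = x' ≫ q → ∃ c, x ≫ ρ c = x'

lemma finiteType_fnC (W : Sch k) [IsAffine W.left] [h : LFT W.hom] : (fnC W).FiniteType := by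
  have h1 : W.hom.appTop.hom.FiniteType :=
    (HasRingHomProperty.iff_of_isAffine (P := @LocallyOfFiniteType)).1 h
  exact h1.comp (RingHom.FiniteType.of_surjective _
    (Scheme.ΓSpecIso (.of k)).symm.commRingCatIsoToRingEquiv.surjective)

lemma exists_affine_quotient (hρ : IsAct ρ) [IsAffine W.left] [LFT W.hom]
    [IsReduced W.left] : ∃ (Q : Sch k) (q : W ⟶ Q), IsAffine Q.left ∧ LFT Q.hom ∧
      IsReduced Q.left ∧ FnQuot q ∧ IsGrpQuot ρ q ∧
      ∀ f : Γ(W.left, ⊤), (∀ c, fnPull (ρ c) f = f) → ∃ g, fnPull q g = f := by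
  let _ : Algebra k Γ(W.left, ⊤) := (fnC W).toAlgebra
  let A0 : Subalgebra k Γ(W.left, ⊤) :=
    { carrier := {f | ∀ c, fnPull (ρ c) f = f}
      mul_mem' := fun ha hb c => by rw [map_mul, ha c, hb c]
      add_mem' := fun ha hb c => by rw [map_add, ha c, hb c]
      algebraMap_mem' := fun r c => fnPull_fnC _ _ }
  have hft : Algebra.FiniteType k Γ(W.left, ⊤) := finiteType_fnC W
  let _ := hρ.mulSemiringAction
  have : Algebra.IsInvariant A0 Γ(W.left, ⊤) Γ := ⟨fun b hb => ⟨⟨b, hb⟩, rfl⟩⟩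
  have hint : Algebra.IsIntegral A0 Γ(W.left, ⊤) := by
    have : SMulCommClass Γ A0 Γ(W.left, ⊤) := ⟨fun c a f => by
      change fnPull (ρ c) (a.1 * f) = a.1 * fnPull (ρ c) f
      rw [map_mul, a.2 c]⟩
    exact Algebra.IsInvariant.isIntegral A0 _ Γ
  have hft' : Algebra.FiniteType A0 Γ(W.left, ⊤) := .of_restrictScalars_finiteType k _ _
  have hfin : Module.Finite A0 Γ(W.left, ⊤) := Algebra.IsIntegral.finite
  have hA0 : Algebra.FiniteType k A0 :=
    ⟨fg_of_fg_of_fg k A0 Γ(W.left, ⊤) hft.1 hfin.1 Subtype.val_injective⟩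
  have hred : _root_.IsReduced A0 := by
    have : _root_.IsReduced Γ(W.left, ⊤) := inferInstance
    exact isReduced_of_injective A0.val Subtype.val_injective
  let Q : Sch k := Over.mk (Spec.map (CommRingCat.ofHom (algebraMap k A0)))
  let e : Γ(Q.left, ⊤) ≃+* A0 := (Scheme.ΓSpecIso (.of A0)).commRingCatIsoToRingEquiv
  have he (a : k) : e (fnC Q a) = algebraMap k A0 a := by
    rw [← RingEquiv.eq_symm_apply]
    exact (congrArg (fun t => t.hom a) (Scheme.ΓSpecIso_inv_naturality
      (CommRingCat.ofHom (algebraMap k A0)))).symm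
  have i1 : IsAffine Q.left := inferInstanceAs (IsAffine (Spec (.of A0)))
  have i2 : LFT Q.hom := by
    change LFT (Spec.map (CommRingCat.ofHom (algebraMap k A0)))
    rw [HasRingHomProperty.Spec_iff (P := @LocallyOfFiniteType)]
    exact RingHom.finiteType_algebraMap.2 hA0
  have i3 : IsReduced Q.left := inferInstanceAs (IsReduced (Spec (.of A0)))
  obtain ⟨q, hq⟩ := exists_hom_of_ringHom (Y := W) (Q := Q) (A0.val.toRingHom.comp e.toRingHom)
    fun a => congrArg Subtype.val (he a)
  have hq' (a : Γ(Q.left, ⊤)) : fnPull q a = (e a).1 := by rw [hq]; rfl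
  have hinv (c : Γ) : ρ c ≫ q = q := hom_ext_of_isAffine fun a => by
    rw [fnPull_comp, hq']
    exact (e a).2 c
  have hf (f : Γ(W.left, ⊤)) (h : ∀ c, fnPull (ρ c) f = f) : ∃ g, fnPull q g = f :=
    ⟨e.symm ⟨f, h⟩, by rw [hq', e.apply_symm_apply]⟩
  have hi : Function.Injective (fnPull q) := fun a b h => by
    rw [hq', hq'] at h
    exact e.injective (Subtype.val_injective h)
  obtain ⟨h1, h2, h3⟩ := affine_quotient hρ q hinv hi hf
  have hfq : FnQuot q := ⟨i1, h2, fun f h => hf f fun c => fn_ext_pt fun x => by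
    rw [← fnPull_comp]
    exact h _ _ (by rw [assoc, hinv])⟩
  exact ⟨Q, q, i1, i2, i3, hfq, ⟨hfq.isQuot inferInstance, hinv, h3⟩, hf⟩
end

section
/-! ### Quotients of equivariant varieties by finite groups -/

lemma of_cover (P : MorphismProperty Scheme.{u}) [IsZariskiLocalAtTarget P] {X Y : Scheme.{u}}
    (f : X ⟶ Y) {I : Type*} {U V : I → Scheme.{u}} (a : ∀ i, U i ⟶ X) (b : ∀ i, V i ⟶ Y)
    (c : ∀ i, U i ⟶ V i) [∀ i, IsOpenImmersion (a i)] [∀ i, IsOpenImmersion (b i)]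
    (h : ∀ i, a i ≫ f = c i ≫ b i) (hr : ∀ i, f ⁻¹ᵁ (b i).opensRange = (a i).opensRange)
    (hc : ∀ y : Y, ∃ i, y ∈ Set.range (b i)) (hP : ∀ i, P (c i)) : P f := by
  refine IsZariskiLocalAtTarget.of_iSup_eq_top (fun i => (b i).opensRange) ?_ fun i => ?_
  · ext y
    obtain ⟨i, hi⟩ := hc y
    exact ⟨fun _ => trivial, fun _ => TopologicalSpace.Opens.mem_iSup.2 ⟨i, hi⟩⟩
  · rw [P.arrow_mk_iso_iff (morphismRestrictOpensRange f (b i))]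
    have sq := (IsOpenImmersion.isPullback (c i) (a i) (b i) f (h i) (hr i)).flip
    rw [← sq.isoPullback_inv_snd, P.cancel_left_of_respectsIso]
    exact hP i

variable {G : Sch k} [GrpObj G] [GoodGrp G]
variable {B : GSch G} [LFT B.X.hom]
variable {Γ : Type*} [Group Γ] [Finite Γ]

instance {X : Sch k} : IsOpenImmersion (𝟙 X : X ⟶ X).left :=
  inferInstanceAs (IsOpenImmersion (𝟙 X.left))

lemma exists_quotient_action {W : GSch G} [LFT W.X.hom] [IsReduced W.X.left]
    [IsAffine W.X.left] (ρ : Γ → (W ⟶ W)) {Q : Sch k} [LFT Q.hom]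
    [IsReduced Q.left] [IsAffine Q.left] (q : W.X ⟶ Q) (hs : ∀ y : Pt Q, ∃ x : Pt W.X, x ≫ q = y)
    (hρ : IsAct fun c => (ρ c).hom) (hq : ∀ c, (ρ c).hom ≫ q = q)
    (hf : ∀ f : Γ(W.X.left, ⊤), (∀ c, fnPull (ρ c).hom f = f) → ∃ g, fnPull q g = f) :
    ∃ _ : ModObj G Q, ∀ (g : Pt G) (x : Pt W.X), (g • x) ≫ q = g • (x ≫ q) := by
  have := Fintype.ofFinite Γ
  let act : G ⊗ W.X ⟶ W.X := fst G W.X • snd G W.X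
  have hact (g : Pt G) (x : Pt W.X) : lift g x ≫ act = g • x := by
    rw [ModObj.comp_smul, lift_fst, lift_snd]
  obtain ⟨a, ha⟩ : ∃ a, (G ◁ q) ≫ a = act ≫ q := by
    refine exists_factor (G ◁ q) (fun y => ?_) _ fun f => ?_
    · obtain ⟨x, hx⟩ := hs (y ≫ snd _ _)
      refine ⟨lift (y ≫ fst _ _) x, ?_⟩
      rw [lift_whiskerLeft, hx, lift_pt]
    · obtain ⟨M, χ, -, -, -, hdec⟩ := GoodGrp.exists_chars (G := G)
      obtain ⟨s, b, hb⟩ := hdec W.X (fnPull (act ≫ q) f)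
      have hfix (c : Γ) : fnPull (G ◁ (ρ c).hom) (fnPull (act ≫ q) f) = fnPull (act ≫ q) f := by
        have h1 : (G ◁ (ρ c).hom) ≫ act = act ≫ (ρ c).hom := by
          refine hom_ext_pt fun t => ?_
          rw [← lift_pt t, ← assoc, ← assoc, lift_whiskerLeft, hact, hact]
          exact (GSch.smul_comp (ρ c) _ _).symm
        rw [← fnPull_comp, ← assoc, h1, assoc, hq]
      have hg (m : M) : ∃ g, fnPull q g = ∑ c, fnPull (ρ c).hom (b m) := by
        refine hf _ fun d => ?_
        rw [map_sum]
        have h2 (c : Γ) : fnPull (ρ d).hom (fnPull (ρ c).hom (b m)) =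
            fnPull (ρ (d * c)).hom (b m) := by
          rw [← fnPull_comp]
          exact congrArg (fnPull · (b m)) (hρ.mul d c).symm
        simp only [h2]
        exact Fintype.sum_equiv (Equiv.mulLeft d) _ _ fun _ => rfl
      choose g hg using hg
      refine ⟨fnC _ (Fintype.card Γ : k)⁻¹ *
        ∑ m ∈ s, fnPull (fst G Q) (χ m) * fnPull (snd G Q) (g m), ?_⟩
      have h3 : ∑ c : Γ, fnPull (G ◁ (ρ c).hom) (fnPull (act ≫ q) f) =
          fnC _ (Fintype.card Γ : k) * fnPull (act ≫ q) f := by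
        simp only [hfix]
        rw [Finset.sum_const, Finset.card_univ, nsmul_eq_mul, map_natCast]
      have h4 : fnPull (G ◁ q) (∑ m ∈ s, fnPull (fst G Q) (χ m) * fnPull (snd G Q) (g m)) =
          ∑ c : Γ, fnPull (G ◁ (ρ c).hom) (fnPull (act ≫ q) f) := by
        rw [hb, map_sum]
        simp only [map_sum, map_mul, ← fnPull_comp, whiskerLeft_fst, whiskerLeft_snd]
        rw [Finset.sum_comm]
        refine Finset.sum_congr rfl fun m _ => ?_
        rw [← Finset.mul_sum, fnPull_comp, hg, map_sum]
        simp only [fnPull_comp]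
      have hne : (Fintype.card Γ : k) ≠ 0 := Nat.cast_ne_zero.2 Fintype.card_ne_zero
      rw [map_mul, h4, h3, fnPull_fnC, ← _root_.mul_assoc, ← map_mul, inv_mul_cancel₀ hne, map_one,
        _root_.one_mul]
  have key (g : Pt G) (x : Pt W.X) : lift g (x ≫ q) ≫ a = (g • x) ≫ q := by
    rw [← hact, assoc, ← ha, ← assoc, lift_whiskerLeft]
  refine ⟨modObjOfPt a (fun z => ?_) fun g h z => ?_, fun g x => (key g x).symm⟩
  · obtain ⟨x, rfl⟩ := hs z
    rw [key, one_smul]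
  · obtain ⟨x, rfl⟩ := hs z
    rw [key, key, key, mul_smul]

protected lemma GVar.exists_affine_quotient (W : GVar B) [IsAffine W.X.X.left] (ρ : Γ → (W.X ⟶ W.X))
    (hρ : IsAct fun c => (ρ c).hom) (hs : ∀ c, ρ c ≫ W.str = W.str) :
    ∃ (Q : GVar B) (q : W.X ⟶ Q.X), q ≫ Q.str = W.str ∧ IsIntegralHom q.hom.left ∧
      IsGrpQuot (fun c => (ρ c).hom) q.hom := by
  obtain ⟨Q, q, i1, i2, i3, hfq, hq, hf⟩ := exists_affine_quotient hρ
  obtain ⟨mQ, hm⟩ := exists_quotient_action ρ q hq.surj hρ hq.inv hf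
  let Q' : GSch G := ⟨Q⟩
  have i2' : LFT Q'.X.hom := i2
  let q' : W.X ⟶ Q' := GSch.homMk q hm
  obtain ⟨s, hs'⟩ := hq.exists_hom (𝟙 _) (𝟙 _) q (by rw [comp_id, id_comp])
    (fun x y _ => ⟨x, comp_id _⟩) W.str.hom fun x x' e => by
      obtain ⟨c, rfl⟩ := hq.orbit x x' e
      rw [assoc]
      exact congrArg (fun t : W.X ⟶ B => x ≫ t.hom) (hs c).symm
  let str : Q' ⟶ B := GSch.homMk s fun g y => by
    obtain ⟨x, rfl⟩ := hq.surj y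
    rw [← hm, assoc, assoc, hs']
    exact GSch.smul_comp W.str g x
  have : IsLocallyNoetherian B.X.left := LocallyOfFiniteType.isLocallyNoetherian B.X.hom
  have : IsAffineHom Q.hom := inferInstance
  let Q'' : GVar B :=
    { X := Q'
      str := str
      isReduced := i3
      isSeparated := (inferInstance : IsSeparated Q.hom)
      locallyOfFiniteType := lft_left _ i2
      quasiCompact := quasiCompact_of_compactSpace (X := Q.left) (Y := B.X.left) _
      isGood := fun p => ⟨⊤, trivial, isAffineOpen_top Q.left, fun T g x hx => by simp⟩ }
  refine ⟨Q'', q', Mod.Hom.ext hs', ?_, hq⟩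
  exact (affine_quotient hρ q hq.inv (fnPull_injective_of_surjective q hq.surj) hf).1

/-- A partition into affine open subsets that are invariant under both actions. -/
def IsNiceFor (X : GSch G) (ρ : Γ → (X.X ⟶ X.X)) : Prop :=
  ∃ (I : Type u) (U : I → X.X.left.Opens), (∀ i, IsAffineOpen (U i) ∧ InvSet X (U i : Set X.X.left)) ∧
    (∀ i j (x : Pt X.X), x.val ∈ U i → x.val ∈ U j → i = j) ∧ (∀ x : Pt X.X, ∃ i, x.val ∈ U i) ∧
    ∀ i c (x : Pt X.X), x.val ∈ U i → Pt.val (x ≫ ρ c) ∈ U i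

theorem GVar.exists_quotient (W : GVar B) (ρ : Γ → (W.X ⟶ W.X))
    (hρ : IsAct fun c => (ρ c).hom) (hs : ∀ c, ρ c ≫ W.str = W.str)
    (hn : IsNiceFor W.X fun c => (ρ c).hom) :
    ∃ (Q : GVar B) (q : W.X ⟶ Q.X), q ≫ Q.str = W.str ∧ IsIntegralHom q.hom.left ∧
      IsGrpQuot (fun c => (ρ c).hom) q.hom := by
  obtain ⟨I, U, hU, hd, hc, hUρ⟩ := hn
  have hl (i : I) : InvLC W.X (U i : Set W.X.X.left) := ⟨(U i).2.isLocallyClosed, (hU i).2⟩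
  let Wi (i : I) : GVar B := W.sub (hl i)
  let j (i : I) : (Wi i).X ⟶ W.X := W.subι (hl i)
  have hjr (i : I) : Set.range (j i).hom.left = U i := W.range_subι _
  have hjm (i : I) (x : Pt (Wi i).X.X) : Pt.val (x ≫ (j i).hom) ∈ U i := (hjr i).subset ⟨x.val, rfl⟩
  have hj1 (i : I) : IsOpenImmersion (j i).hom.left :=
    isOpenImmersion_of_isImmersion _ (by rw [hjr]; exact (U i).2)
  have hj2 (i : I) : IsAffine (Wi i).X.X.left := by
    have h1 : (j i).hom.left.opensRange = U i := TopologicalSpace.Opens.ext (hjr i)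
    have : IsAffine (j i).hom.left.opensRange := by rw [h1]; exact (hU i).1
    exact IsAffine.of_isIso (IsOpenImmersion.isoOfRangeEq (j i).hom.left
      (j i).hom.left.opensRange.ι (by simp)).hom
  have hj3 (i : I) (x : Pt W.X.X) (hx : x.val ∈ U i) : ∃ y : Pt (Wi i).X.X, y ≫ (j i).hom = x :=
    (W.exists_subι_iff _ x).2 hx
  have hj4 (x : Pt W.X.X) : ∃ i, ∃ y : Pt (Wi i).X.X, y ≫ (j i).hom = x :=
    (hc x).imp fun i => hj3 i x
  have hρi (i : I) (c : Γ) : ∃ r : (Wi i).X ⟶ (Wi i).X, r ≫ j i = j i ≫ ρ c ∧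
      r ≫ (Wi i).str = (Wi i).str := by
    refine W.exists_lift (hl i) (j i ≫ ρ c) ?_ fun y => ?_
    · rw [assoc, hs]; rfl
    · have : y ≫ (j i ≫ ρ c).hom = (y ≫ (j i).hom) ≫ (ρ c).hom := assoc'.symm
      rw [this]
      exact hUρ i c _ (hjm i y)
  choose r hr hr' using hρi
  have mj (i : I) : Mono (j i).hom := mono_of_left _
  have hrh (i : I) (c : Γ) : (r i c).hom ≫ (j i).hom = (j i).hom ≫ (ρ c).hom :=
    congrArg Mod.Hom.hom (hr i c)
  have hact (i : I) : IsAct fun c => (r i c).hom := by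
    refine ⟨(cancel_mono (j i).hom).1 ?_, fun a b => (cancel_mono (j i).hom).1 ?_⟩
    · rw [hrh, hρ.one, comp_id, id_comp]
    · rw [hrh, hρ.mul, assoc, hrh, ← assoc, ← assoc, hrh]
  choose Qi qi hqs hqi hqg using fun i => (Wi i).exists_affine_quotient (r i) (hact i) (hr' i)
  have hfin : LocFin Qi := by
    intro K hK
    have hK' : IsCompact (W.str.hom.left ⁻¹' (K : Set B.X.left)) :=
      QuasiCompact.isCompact_preimage (f := W.str.hom.left) K K.2 hK
    obtain ⟨t, ht⟩ := hK'.elim_finite_subcover (fun i => (U i : Set W.X.X.left)) (fun i => (U i).2) (by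
      refine subset_of_forall_pt' (K.2.preimage W.str.hom.left.continuous).isLocallyClosed
        (isOpen_iUnion fun i => (U i).2) fun x _ => ?_
      obtain ⟨i, hi⟩ := hc x
      exact Set.mem_iUnion.2 ⟨i, hi⟩)
    refine t.finite_toSet.subset fun i hi => ?_
    obtain ⟨y, hy⟩ := exists_pt_mem (K.2.preimage (Qi i).str.hom.left.continuous).isLocallyClosed hi
    obtain ⟨x, rfl⟩ := (hqg i).surj y
    have h2 : (x ≫ (j i).hom) ≫ W.str.hom = (x ≫ (qi i).hom) ≫ (Qi i).str.hom := by
      rw [assoc, assoc]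
      exact congrArg (fun t : (Wi i).X ⟶ B => x ≫ t.hom) (hqs i).symm
    have h3 : W.str.hom.left (Pt.val (x ≫ (j i).hom)) =
      (Qi i).str.hom.left (Pt.val (x ≫ (qi i).hom)) := congrArg Pt.val h2
    obtain ⟨i', hi', hx⟩ := Set.mem_iUnion₂.1 (ht ((congrArg (· ∈ (K : Set B.X.left)) h3).mpr hy))
    exact hd i i' _ (hjm i x) hx ▸ hi'
  let Q := GVar.sigma Qi hfin
  let e (i : I) : (Qi i).X ⟶ Q.X := GVar.sigmaIn Qi hfin i
  have hθ (x : Pt W.X.X) : ∃ p : Pt Q.X.X, ∀ (i : I) (y : Pt (Wi i).X.X), y ≫ (j i).hom = x →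
      p = (y ≫ (qi i).hom) ≫ (e i).hom := by
    obtain ⟨i, y, rfl⟩ := hj4 x
    refine ⟨(y ≫ (qi i).hom) ≫ (e i).hom, fun i' y' h => ?_⟩
    obtain rfl : i = i' := hd i i' _ (hjm i y) (h ▸ hjm i' y')
    rw [(cancel_mono (j i).hom).1 h]
  choose θ hθ using hθ
  obtain ⟨q0, hq0⟩ := exists_hom_of_local θ fun x => by
    obtain ⟨i, y, rfl⟩ := hj4 x
    refine ⟨(Wi i).X.X, (j i).hom, (qi i).hom ≫ (e i).hom, hj1 i, ⟨y, rfl⟩, fun z => ?_⟩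
    rw [hθ _ i z rfl, assoc]
  have hq0' (i : I) (y : Pt (Wi i).X.X) : (y ≫ (j i).hom) ≫ q0 = (y ≫ (qi i).hom) ≫ (e i).hom :=
    (hq0 _).trans (hθ _ i y rfl)
  have hsq (i : I) : (j i).hom ≫ q0 = (qi i).hom ≫ (e i).hom := hom_ext_pt fun y => by
    rw [← assoc, hq0', assoc]
  let q : W.X ⟶ Q.X := GSch.homMk q0 fun g x => by
    obtain ⟨i, y, rfl⟩ := hj4 x
    rw [← GSch.smul_comp (j i) g y, hq0', hq0', GSch.smul_comp (qi i), GSch.smul_comp (e i)]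
  have hqq : q.hom = q0 := rfl
  have hpre (i : I) (x : Pt W.X.X) (hx : Pt.val (x ≫ q0) ∈ Set.range (e i).hom.left) :
      x.val ∈ U i := by
    obtain ⟨i', y, rfl⟩ := hj4 x
    obtain ⟨z, hz⟩ := exists_pt_lift (e i).hom _ hx
    rw [hq0'] at hz
    obtain rfl : i = i' := congrArg Sigma.fst (GVar.sigmaIn_pt_injective Qi hfin hz)
    exact hjm i y
  have hcov (y : Pt Q.X.X) : ∃ (i : I) (x : Pt (Wi i).X.X), (x ≫ (qi i).hom) ≫ (e i).hom = y := by
    obtain ⟨i, z, rfl⟩ := GVar.exists_sigmaIn_pt Qi hfin y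
    obtain ⟨x, rfl⟩ := (hqg i).surj z
    exact ⟨i, x, rfl⟩
  have hint : IsIntegralHom q0.left := by
    have := (HasAffineProperty.iff.1 IsIntegralHom.hasAffineProperty).1
    refine of_cover @IsIntegralHom q0.left (fun i => (j i).hom.left) (fun i => (e i).hom.left)
      (fun i => (qi i).hom.left) (fun i => congrArg (fun t : (Wi i).X.X ⟶ Q.X.X => t.left) (hsq i))
      (fun i => ?_) (fun y => ?_) hqi
    · refine TopologicalSpace.Opens.ext (Set.Subset.antisymm ?_ ?_)
      · refine (subset_of_forall_pt' ((e i).hom.left.opensRange.2.preimage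
          q0.left.continuous).isLocallyClosed (U i).2 fun x hx => hpre i x hx).trans (hjr i).ge
      · rintro _ ⟨x, rfl⟩
        exact ⟨(qi i).hom.left x, (congrArg (fun t : (Wi i).X.X ⟶ Q.X.X => t.left x) (hsq i)).symm⟩
    · obtain ⟨i, z, rfl⟩ := GVar.exists_sigmaIn Qi hfin y
      exact ⟨i, z, rfl⟩
  refine ⟨Q, q, GSch.hom_ext_pt fun x => ?_, hint, ⟨⟨?_, fun y => ?_, fun y O hy => ?_⟩,
    fun c => hom_ext_pt fun x => ?_, fun x x' h => ?_⟩⟩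
  · obtain ⟨i, hi⟩ := hc x
    obtain ⟨y, rfl⟩ := hj3 i x hi
    have h1 : (e i).hom ≫ Q.str.hom = (Qi i).str.hom :=
      congrArg Mod.Hom.hom (GVar.sigmaIn_str Qi hfin i)
    have h2 : (qi i).hom ≫ (Qi i).str.hom = (j i).hom ≫ W.str.hom := congrArg Mod.Hom.hom (hqs i)
    refine (assoc _ q0 Q.str.hom).symm.trans ?_
    rw [hq0', assoc, h1, assoc, h2, assoc]
  · exact (inferInstance : UniversallyClosed q0.left)
  · obtain ⟨i, x, rfl⟩ := hcov y
    exact ⟨x ≫ (j i).hom, hq0' i x⟩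
  · obtain ⟨i, z, rfl⟩ := GVar.exists_sigmaIn_pt Qi hfin y
    obtain ⟨D, W', d, w, q', hd', hw', hfq, hsq', ⟨y', hy'⟩, hO⟩ :=
      (hqg i).exists_fnQuot z ((e i).hom.left ⁻¹ᵁ O) hy
    refine ⟨D, W', d ≫ (e i).hom, w ≫ (j i).hom, q', ?_, ?_, hfq, ?_, ⟨y', ?_⟩, ?_⟩
    · exact (inferInstance : IsOpenImmersion (d.left ≫ (e i).hom.left))
    · exact (inferInstance : IsOpenImmersion (w.left ≫ (j i).hom.left))
    · rw [← assoc, hsq', assoc, assoc, hqq, hsq]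
    · rw [← assoc, hy']
    · rintro _ ⟨p, rfl⟩
      exact hO ⟨p, rfl⟩
  · obtain ⟨i, hi⟩ := hc x
    obtain ⟨y, rfl⟩ := hj3 i x hi
    have h1 : (y ≫ (j i).hom) ≫ (ρ c).hom = (y ≫ (r i c).hom) ≫ (j i).hom := by
      rw [assoc, assoc, hrh]
    have h2 : (y ≫ (r i c).hom) ≫ (qi i).hom = y ≫ (qi i).hom := assoc'.trans (y ≫= (hqg i).inv c)
    rw [hqq, ← assoc, h1, hq0', hq0', h2]
  · obtain ⟨i, hi⟩ := hc x
    obtain ⟨y, rfl⟩ := hj3 i x hi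
    obtain ⟨y', rfl⟩ := hj3 i x' (hpre i x' (by rw [← hqq, ← h, hqq, hq0']; exact ⟨_, rfl⟩))
    have me : Mono (e i).hom := mono_of_left _
    rw [hqq, hq0', hq0', cancel_mono] at h
    obtain ⟨c, rfl⟩ := (hqg i).orbit y y' h
    exact ⟨c, by rw [assoc, assoc, hrh]⟩
end

section
variable {G : Sch k} [GrpObj G] [GoodGrp G]

/-! ### Powers -/

section pow
variable {B : GSch G} [MonObj B.X] [h : IsGMonoid B]

instance lft_of_isGMonoid : LFT B.X.hom := h.lft
instance comm_of_isGMonoid : IsCommMonObj B.X := h.comm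

def GVar.pow (X : GVar B) : ℕ → GVar B
  | 0 => GVar.one
  | n + 1 => X.conv (X.pow n)

def GVar.powπ (X : GVar B) : ∀ n, Fin n → ((X.pow n).X ⟶ X.X)
  | 0 => fun i => i.elim0
  | n + 1 => Fin.cases (prodFst X.X (X.pow n).X) fun i => prodSnd X.X (X.pow n).X ≫ X.powπ n i

lemma GVar.pow_hom_ext (X : GVar B) {n : ℕ} {T : Sch k} {f g : T ⟶ (X.pow n).X.X}
    (h : ∀ i, f ≫ (X.powπ n i).hom = g ≫ (X.powπ n i).hom) : f = g := by
  induction n with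
  | zero => exact toUnit_unique (C := Sch k) _ _
  | succ n ih =>
    apply CartesianMonoidalCategory.hom_ext (X := X.X.X) (Y := (X.pow n).X.X)
    · exact h 0
    · exact ih fun i => assoc'.trans ((h i.succ).trans assoc'.symm)

lemma GVar.exists_powLift (X : GVar B) {n : ℕ} {T : Sch k} (f : Fin n → (T ⟶ X.X.X)) :
    ∃ g : T ⟶ (X.pow n).X.X, ∀ i, g ≫ (X.powπ n i).hom = f i := by
  induction n with
  | zero => exact ⟨toUnit (C := Sch k) T, fun i => i.elim0⟩
  | succ n ih =>
    obtain ⟨g, hg⟩ := ih fun i => f i.succ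
    refine ⟨lift (f 0) g, fun i => ?_⟩
    refine Fin.cases ?_ (fun i => ?_) i
    · exact lift_fst _ _
    · refine assoc'.symm.trans ?_
      exact (lift_snd (f 0) g =≫ (X.powπ n i).hom).trans (hg i)

lemma GVar.conv_str (X Y : GVar B) {T : Sch k} (g : T ⟶ (X.conv Y).X.X) :
    g ≫ (X.conv Y).str.hom = ((show T ⟶ X.X.X from g ≫ fst X.X.X Y.X.X) ≫ X.str.hom) *
      ((show T ⟶ Y.X.X from g ≫ snd X.X.X Y.X.X) ≫ Y.str.hom) := by
  rw [Hom.mul_def]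
  change g ≫ (X.str.hom ⊗ₘ Y.str.hom) ≫ μ[B.X] = _
  refine assoc'.symm.trans (?_ =≫ μ[B.X])
  apply CartesianMonoidalCategory.hom_ext
  · exact assoc'.trans ((g ≫= tensorHom_fst _ _).trans (assoc'.symm.trans (lift_fst _ _).symm))
  · exact assoc'.trans ((g ≫= tensorHom_snd _ _).trans (assoc'.symm.trans (lift_snd _ _).symm))

lemma GVar.one_str {T : Sch k} (g : T ⟶ (GVar.one (B := B)).X.X) :
    g ≫ (GVar.one (B := B)).str.hom = 1 :=
  (toUnit_unique (C := Sch k) g (toUnit T) =≫ η[B.X]).trans (Hom.one_def (X := T) (M := B.X)).symm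

lemma GVar.pow_str (X : GVar B) {n : ℕ} {T : Sch k} (g : T ⟶ (X.pow n).X.X) :
    g ≫ (X.pow n).str.hom = ∏ i, (g ≫ (X.powπ n i).hom) ≫ X.str.hom := by
  induction n with
  | zero => exact (GVar.one_str g).trans (by simp)
  | succ n ih =>
    refine (X.conv_str (X.pow n) g).trans ?_
    rw [Fin.prod_univ_succ]
    refine congrArg₂ (· * ·) rfl ((ih _).trans (Finset.prod_congr rfl fun i _ => ?_))
    exact assoc g _ _ =≫ X.str.hom

variable {W : GSch G} [LFT W.X.hom] [IsReduced W.X.left]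

def GVar.powLift (X : GVar B) {n : ℕ} (f : Fin n → (W ⟶ X.X)) : W ⟶ (X.pow n).X :=
  GSch.homMk (X.exists_powLift fun i => (f i).hom).choose fun g x => X.pow_hom_ext fun i => by
    have e := (X.exists_powLift fun i => (f i).hom).choose_spec
    refine assoc'.trans (((g • x) ≫= e i).trans ?_)
    refine (GSch.smul_comp (f i) g x).trans (Eq.trans ?_ (GSch.smul_comp _ g _).symm)
    exact congrArg (g • ·) ((x ≫= e i).symm.trans assoc'.symm)

lemma GVar.powLift_π (X : GVar B) {n : ℕ} (f : Fin n → (W ⟶ X.X)) (i : Fin n) :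
    (X.powLift f).hom ≫ (X.powπ n i).hom = (f i).hom :=
  (X.exists_powLift fun i => (f i).hom).choose_spec i

lemma GVar.comp_powLift_π (X : GVar B) {n : ℕ} (f : Fin n → (W ⟶ X.X)) (i : Fin n) {T : Sch k}
    (x : T ⟶ W.X) : (x ≫ (X.powLift f).hom) ≫ (X.powπ n i).hom = x ≫ (f i).hom :=
  assoc'.trans (x ≫= X.powLift_π f i)

/-- The permutations of the factors of a power. -/
protected def GVar.powPerm (X : GVar B) {n : ℕ} (e : Equiv.Perm (Fin n)) : (X.pow n).X ⟶ (X.pow n).X :=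
  X.powLift fun i => X.powπ n (e i)

lemma GVar.comp_powPerm_π (X : GVar B) {n : ℕ} (e : Equiv.Perm (Fin n)) (i : Fin n) {T : Sch k}
    (x : T ⟶ (X.pow n).X.X) :
    (x ≫ (X.powPerm e).hom) ≫ (X.powπ n i).hom = x ≫ (X.powπ n (e i)).hom :=
  X.comp_powLift_π _ i x

lemma GVar.isAct_powPerm (X : GVar B) (n : ℕ) :
    IsAct fun e : Equiv.Perm (Fin n) => (X.powPerm e).hom where
  one := X.pow_hom_ext fun i => X.powLift_π _ i
  mul a b := X.pow_hom_ext fun i => (X.powLift_π _ i).trans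
    ((X.comp_powPerm_π b i _).trans
      (X.powLift_π (fun j => X.powπ n (a j)) (b i))).symm

lemma GVar.powPerm_str (X : GVar B) {n : ℕ} (e : Equiv.Perm (Fin n)) :
    X.powPerm e ≫ (X.pow n).str = (X.pow n).str := by
  apply Mod.Hom.ext
  refine (X.pow_str _).trans (Eq.trans ?_ (((rfl : 𝟙 (X.pow n).X.X = _) =≫ (X.pow n).str.hom).symm.trans (id_comp _)))
  refine Eq.trans ?_ (X.pow_str _).symm
  have h1 : ∀ i, ((X.powPerm e).hom ≫ (X.powπ n i).hom) ≫ X.str.hom =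
      (𝟙 (X.pow n).X.X ≫ (X.powπ n (e i)).hom) ≫ X.str.hom := fun i =>
    (X.powLift_π _ i).trans (id_comp _).symm =≫ X.str.hom
  exact (Finset.prod_congr rfl fun i _ => h1 i).trans
    (Equiv.prod_comp e fun i => (𝟙 (X.pow n).X.X ≫ (X.powπ n i).hom) ≫ X.str.hom)

end pow

/-! ### Multisets -/

lemma map_univ_eq_iff {n : ℕ} {α : Type*} (f g : Fin n → α) :
    Finset.univ.val.map f = Finset.univ.val.map g ↔ ∃ e : Equiv.Perm (Fin n), f ∘ e = g := by
  classical
  constructor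
  · intro h
    have h1 : ∀ c, Nonempty ({a // g a = c} ≃ {a // f a = c}) := fun c => by
      have h2 := congrArg (Multiset.count c) h
      rw [Multiset.count_map, Multiset.count_map] at h2
      refine ⟨Fintype.equivOfCardEq ?_⟩
      rw [Fintype.card_subtype, Fintype.card_subtype]
      have h3 : ∀ f : Fin n → α, (Finset.univ.val.filter fun a => c = f a).card =
          (Finset.univ.filter fun a => f a = c).card := fun f =>
        congrArg Finset.card (Finset.filter_congr fun a _ => eq_comm :
          (Finset.univ.filter fun a => c = f a) = Finset.univ.filter fun a => f a = c)
      exact (h3 g).symm.trans (h2.symm.trans (h3 f))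
    refine ⟨Equiv.ofFiberEquiv fun c => (h1 c).some, funext fun a => ?_⟩
    exact Equiv.ofFiberEquiv_map (f := g) (g := f) (fun c => (h1 c).some) a
  · rintro ⟨e, rfl⟩
    have h1 : (Finset.univ.val : Multiset (Fin n)).map e = Finset.univ.val :=
      Multiset.map_univ_val_equiv e
    rw [← Multiset.map_map, h1]

lemma exists_map_univ_eq {n : ℕ} {α : Type*} (m : Multiset α) (h : m.card = n) :
    ∃ f : Fin n → α, Finset.univ.val.map f = m := by
  subst h
  induction m using Quotient.inductionOn with
  | h l =>
    exact ⟨l.get, (Fin.univ_val_map l.get).trans (congrArg Multiset.ofList (List.ofFn_get l))⟩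

section
variable {B : GSch G} [MonObj B.X] [h : IsGMonoid B]
/-- The multiset of the coordinates of a point of a power. -/
def GVar.toM (X : GVar B) {n : ℕ} (x : Pt (X.pow n).X.X) : Multiset (Pt X.X.X) :=
  Finset.univ.val.map fun i => x ≫ (X.powπ n i).hom

lemma GVar.card_toM (X : GVar B) {n : ℕ} (x : Pt (X.pow n).X.X) : (X.toM x).card = n := by
  simp [GVar.toM]

lemma GVar.toM_eq_iff (X : GVar B) {n : ℕ} (x x' : Pt (X.pow n).X.X) :
    X.toM x = X.toM x' ↔ ∃ e : Equiv.Perm (Fin n), x ≫ (X.powPerm e).hom = x' := by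
  refine (map_univ_eq_iff _ _).trans (exists_congr fun e => ?_)
  constructor
  · intro h1
    exact X.pow_hom_ext fun i => (X.comp_powPerm_π e i x).trans (congrFun h1 i)
  · rintro rfl
    exact funext fun i => (X.comp_powPerm_π e i x).symm

lemma GVar.exists_toM (X : GVar B) {n : ℕ} (m : Multiset (Pt X.X.X)) (hm : m.card = n) :
    ∃ x : Pt (X.pow n).X.X, X.toM x = m := by
  obtain ⟨f, hf⟩ := exists_map_univ_eq m hm
  obtain ⟨x, hx⟩ := X.exists_powLift f
  exact ⟨x, (congrArg (fun f => Finset.univ.val.map f) (funext hx)).trans hf⟩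
end
end

section
/-! ### Graphs of maps on quotients -/

lemma exists_pt_of_mem_range {W X : Sch k} [LFT W.hom] [LFT X.hom]
    (f : W ⟶ X) (x : Pt X) (h : x.val ∈ Set.range f.left) : ∃ w : Pt W, w ≫ f = x := by
  obtain ⟨p, hp⟩ := h
  obtain ⟨w, hw⟩ := exists_pt_mem (X := W) (s := f.left ⁻¹' {x.val})
    ((isClosed_pt_val x).preimage f.left.continuous).isLocallyClosed ⟨p, hp⟩
  exact ⟨w, Pt.ext_val hw⟩

lemma quasiCompact_of_comp_surjective {X Y Z : Scheme.{u}} (f : X ⟶ Y) (g : Y ⟶ Z)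
    (hf : Function.Surjective f) [QuasiCompact (f ≫ g)] : QuasiCompact g := by
  refine ⟨fun U hU hc => ?_⟩
  have h1 := QuasiCompact.isCompact_preimage (f := f ≫ g) U hU hc
  have h2 : g ⁻¹' U = f '' ((f ≫ g) ⁻¹' U) := by
    have : (f ≫ g) ⁻¹' U = f ⁻¹' (g ⁻¹' U) := rfl
    rw [this, Set.image_preimage_eq _ hf]
  rw [h2]
  exact h1.image f.continuous

variable {G : Sch k} [GrpObj G] [GoodGrp G] {B B' : GSch G} [LFT B.X.hom] [LFT B'.X.hom]

lemma GVar.exists_graph {W : GSch G} [LFT W.X.hom] [IsReduced W.X.left]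
    (Q : GVar B) (T : GVar B') (ψ : W ⟶ Q.X) (φ : W ⟶ T.X) (hψ : UniversallyClosed ψ.hom.left)
    (hs : ∀ y : Pt Q.X.X, ∃ w, w ≫ ψ.hom = y)
    (hh : ∀ w w' : Pt W.X, w ≫ ψ.hom = w' ≫ ψ.hom → w ≫ φ.hom = w' ≫ φ.hom) :
    ∃ (R : GVar B) (r : R.X ⟶ Q.X) (r' : R.X ⟶ T.X), r ≫ Q.str = R.str ∧
      (Function.Bijective fun x : Pt R.X.X => x ≫ r.hom) ∧
      ∀ w : Pt W.X, ∃ x : Pt R.X.X, x ≫ r.hom = w ≫ ψ.hom ∧ x ≫ r'.hom = w ≫ φ.hom := by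
  let P := Q.prod T
  let p : P.X ⟶ Q.X := prodFst Q.X T.X
  let p' : P.X ⟶ T.X := prodSnd Q.X T.X
  let f : W ⟶ P.X := prodLift ψ φ
  have fp (w : Pt W.X) : (w ≫ f.hom) ≫ p.hom = w ≫ ψ.hom := comp_prodLift_fst ψ φ w
  have fp' (w : Pt W.X) : (w ≫ f.hom) ≫ p'.hom = w ≫ φ.hom := comp_prodLift_snd ψ φ w
  have hp : IsSeparated p.hom.left := (inferInstance : IsSeparated (pullback.fst Q.X.X.hom T.X.X.hom))
  have e : f.hom.left ≫ p.hom.left = ψ.hom.left := congrArg (fun t => t.left) (lift_fst ψ.hom φ.hom)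
  have hfu : UniversallyClosed f.hom.left := by
    have : UniversallyClosed (f.hom.left ≫ p.hom.left) := e ▸ hψ
    exact UniversallyClosed.of_comp_of_isSeparated f.hom.left p.hom.left
  have hi : InvLC P.X (Set.range f.hom.left) := InvSet.lc (fun g x hx => by
    obtain ⟨w, rfl⟩ := exists_pt_of_mem_range f.hom x hx
    rw [← GSch.smul_comp]
    exact ⟨(g • w : Pt W.X).val, rfl⟩) f.hom.left.isClosedMap.isClosed_range
  obtain ⟨j, hj⟩ : ∃ j, j = P.subι hi := ⟨_, rfl⟩
  have hjm : ∀ x : Pt (P.sub hi).X.X, ∃ w, w ≫ f.hom = x ≫ j.hom := fun x => by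
    subst hj
    exact exists_pt_of_mem_range f.hom _ (P.subι_mem hi x.val)
  have him : IsImmersion j.hom.left := hj ▸ inferInstance
  have hje : ∀ w : Pt W.X, ∃ x : Pt (P.sub hi).X.X, x ≫ j.hom = w ≫ f.hom :=
    fun w => by
      subst hj
      exact (P.exists_subι_iff hi _).2 ⟨w.val, rfl⟩
  obtain ⟨f', hf'⟩ := exists_lift_pt j.hom f.hom hje
  have hr : Set.range j.hom.left = Set.range f.hom.left := hj ▸ P.range_subι _
  have hfs : Function.Surjective f'.left := fun x => by
    obtain ⟨w, hw⟩ := hr.subset ⟨x, rfl⟩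
    refine ⟨w, j.hom.left.isEmbedding.injective ?_⟩
    exact Eq.trans (congrArg (fun t : W.X ⟶ P.X.X => t.left w) hf') hw
  have hq : QuasiCompact (j ≫ p).hom.left := by
    have e : f'.left ≫ (j ≫ p).hom.left = ψ.hom.left := congrArg (fun t => t.left)
      (assoc'.symm.trans ((hf' =≫ p.hom).trans (lift_fst _ _)) : f' ≫ j.hom ≫ p.hom = ψ.hom)
    have : QuasiCompact (f'.left ≫ (j ≫ p).hom.left) := e ▸ inferInstance
    exact quasiCompact_of_comp_surjective _ _ hfs
  have hq' : QuasiCompact (j ≫ p ≫ Q.str).hom.left :=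
    (inferInstance : QuasiCompact ((j ≫ p).hom.left ≫ Q.str.hom.left))
  refine ⟨(P.sub hi).over (j ≫ p ≫ Q.str) hq', j ≫ p, j ≫ p', rfl,
    ⟨fun x x' hx => ?_, fun y => ?_⟩, fun w => ?_⟩
  · obtain ⟨w, hw⟩ := hjm x
    obtain ⟨w', hw'⟩ := hjm x'
    have h1 : w ≫ ψ.hom = w' ≫ ψ.hom := by
      rw [← fp, ← fp, hw, hw']
      exact assoc'.trans (Eq.trans hx assoc'.symm)
    have h2 : w ≫ f.hom = w' ≫ f.hom :=
      prod_hom_ext ((fp w).trans (h1.trans (fp w').symm)) ((fp' w).trans ((hh _ _ h1).trans (fp' w').symm))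
    subst hj
    exact P.subι_injective hi (hw.symm.trans (h2.trans hw'))
  · obtain ⟨w, rfl⟩ := hs y
    obtain ⟨x, hx⟩ := hje w
    exact ⟨x, (GSch.comp_hom j p x).trans ((hx =≫ p.hom).trans (fp w))⟩
  · obtain ⟨x, hx⟩ := hje w
    exact ⟨x, (GSch.comp_hom j p x).trans ((hx =≫ p.hom).trans (fp w)),
      (GSch.comp_hom j p' x).trans ((hx =≫ p'.hom).trans (fp' w))⟩

lemma K0.mk_eq_sum_of_cover {I : Type*} [Fintype I] (W : I → GSch G)
    [∀ i, LFT (W i).X.hom] [∀ i, IsReduced (W i).X.left]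
    (Q : I → GVar B) (T : GVar B) (ψ : ∀ i, W i ⟶ (Q i).X) (φ : ∀ i, W i ⟶ T.X)
    (hψ : ∀ i, UniversallyClosed (ψ i).hom.left)
    (hs : ∀ i (y : Pt (Q i).X.X), ∃ w, w ≫ (ψ i).hom = y)
    (ht : ∀ y : Pt T.X.X, ∃ i w, w ≫ (φ i).hom = y)
    (hh : ∀ i (w w' : Pt (W i).X), w ≫ (ψ i).hom = w' ≫ (ψ i).hom ↔
      w ≫ (φ i).hom = w' ≫ (φ i).hom)
    (hd : ∀ i j (w : Pt (W i).X) (w' : Pt (W j).X), w ≫ (φ i).hom = w' ≫ (φ j).hom → i = j)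
    (hb : ∀ i, ψ i ≫ (Q i).str = φ i ≫ T.str) : K0.mk T = ∑ i, K0.mk (Q i) := by
  choose R r r' hr hrb hR using fun i =>
    GVar.exists_graph (Q i) T (ψ i) (φ i) (hψ i) (hs i) fun w w' => (hh i w w').1
  have key : ∀ i (x : Pt (R i).X.X), ∃ w, x ≫ (r i).hom = w ≫ (ψ i).hom ∧
      x ≫ (r' i).hom = w ≫ (φ i).hom := fun i x => by
    obtain ⟨w, hw⟩ := hs i (x ≫ (r i).hom)
    obtain ⟨x', h1, h2⟩ := hR i w
    have : x' = x := (hrb i).1 (h1.trans hw)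
    exact ⟨w, this ▸ h1, this ▸ h2⟩
  refine (K0.mk_eq_sum_of_jointBij R T r' (fun i => ?_) ⟨?_, ?_⟩).trans
    (Finset.sum_congr rfl fun i _ => K0.mk_eq_of_bijective (r i) (hr i) (hrb i))
  · rw [← hr]
    refine GSch.ext_of_comp fun x => ?_
    obtain ⟨w, h1, h2⟩ := key i x
    refine (h2 =≫ T.str.hom).trans ((GSch.comp_eq (hb i).symm w).trans ?_)
    exact (GSch.comp_hom _ _ w).trans ((h1.symm =≫ (Q i).str.hom).trans (GSch.comp_hom _ _ x).symm)
  · rintro ⟨i, x⟩ ⟨j, x'⟩ hx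
    obtain ⟨w, h1, h2⟩ := key i x
    obtain ⟨w', h1', h2'⟩ := key j x'
    have e : w ≫ (φ i).hom = w' ≫ (φ j).hom := h2.symm.trans (Eq.trans hx h2')
    obtain rfl := hd _ _ _ _ e
    exact congrArg (Sigma.mk i) ((hrb i).1 (h1.trans (((hh i w w').2 e).trans h1'.symm)))
  · intro y
    obtain ⟨i, w, hw⟩ := ht y
    obtain ⟨x, h1, h2⟩ := hR i w
    exact ⟨⟨i, x⟩, h2.trans hw⟩

lemma K0.mk_eq_of_cover {W : GSch G} [LFT W.X.hom] [IsReduced W.X.left]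
    (Q T : GVar B) (ψ : W ⟶ Q.X) (φ : W ⟶ T.X) (hψ : UniversallyClosed ψ.hom.left)
    (hs : ∀ y : Pt Q.X.X, ∃ w, w ≫ ψ.hom = y) (ht : ∀ y : Pt T.X.X, ∃ w, w ≫ φ.hom = y)
    (hh : ∀ w w' : Pt W.X, w ≫ ψ.hom = w' ≫ ψ.hom ↔ w ≫ φ.hom = w' ≫ φ.hom)
    (hb : ψ ≫ Q.str = φ ≫ T.str) : K0.mk Q = K0.mk T :=
  Eq.symm <| (K0.mk_eq_sum_of_cover (I := Unit) (fun _ => W) (fun _ => Q) T (fun _ => ψ) (fun _ => φ)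
    (fun _ => hψ) (fun _ => hs) (fun y => ⟨(), ht y⟩) (fun _ => hh) (fun _ _ _ _ _ => rfl)
    fun _ => hb).trans (Fintype.sum_unique _)
end

section
/-! ### Quotients and invariant functions on open subsets -/

/-- The restriction of a morphism to open subschemes. -/
def openMap {X Y : Sch k} (f : X ⟶ Y) {U : Y.left.Opens} {V : X.left.Opens}
    (e : V ≤ f.left ⁻¹ᵁ U) : openObj X V ⟶ openObj Y U :=
  Over.homMk (f.left.resLE U V e) (by
    refine assoc'.symm.trans ((Scheme.Hom.resLE_comp_ι f.left e =≫ Y.hom).trans ?_)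
    exact assoc'.trans (V.ι ≫= Over.w f))

lemma openMap_ι {X Y : Sch k} (f : X ⟶ Y) {U : Y.left.Opens} {V : X.left.Opens}
    (e : V ≤ f.left ⁻¹ᵁ U) : openMap f e ≫ openObjι Y U = openObjι X V ≫ f :=
  Over.OverMorphism.ext (Scheme.Hom.resLE_comp_ι f.left e)

/-- Functions on an open subset, as functions on the open subscheme. -/
def openFn (X : Sch k) (U : X.left.Opens) : Γ(X.left, U) ≃ Γ((openObj X U).left, ⊤) where
  toFun a := U.topIso.inv a
  invFun a := U.topIso.hom a
  left_inv a := congrArg (fun t => t.hom a) U.topIso.inv_hom_id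
  right_inv a := congrArg (fun t => t.hom a) U.topIso.hom_inv_id

lemma fnPull_openMap {X Y : Sch k} (f : X ⟶ Y) {U : Y.left.Opens} {V : X.left.Opens}
    (e : V ≤ f.left ⁻¹ᵁ U) (a : Γ(Y.left, U)) :
    fnPull (openMap f e) (openFn Y U a) = openFn X V (f.left.appLE U V e a) := by
  have h := congrArg (fun t => t.hom (U.topIso.inv a)) (Scheme.Hom.resLE_app_top f.left e)
  refine h.trans ?_
  have h2 : U.topIso.hom (U.topIso.inv a) = a := congrArg (fun t => t.hom a) U.topIso.inv_hom_id
  exact congrArg (fun t => V.topIso.inv (f.left.appLE U V e t)) h2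

lemma openMap_comp {X Y Z : Sch k} (f : X ⟶ Y) (g : Y ⟶ Z) {U : Z.left.Opens} {V : Y.left.Opens}
    {W : X.left.Opens} (e : W ≤ f.left ⁻¹ᵁ V) (e' : V ≤ g.left ⁻¹ᵁ U) (e'') :
    openMap f e ≫ openMap g e' = openMap (f ≫ g) e'' :=
  Over.OverMorphism.ext (Scheme.Hom.resLE_comp_resLE _ _ _ _)

lemma openMap_congr {X Y : Sch k} {f g : X ⟶ Y} (h : f = g) {U : Y.left.Opens} {V : X.left.Opens}
    (e : V ≤ f.left ⁻¹ᵁ U) (e') : openMap f e = openMap g e' := by subst h; rfl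

variable {Γ : Type*} {W Q : Sch k} {ρ : Γ → (W ⟶ W)} {q : W ⟶ Q}

lemma le_preimage_of_comp_eq (h : ∀ c, ρ c ≫ q = q) (V : Q.left.Opens) (c : Γ) :
    q.left ⁻¹ᵁ V ≤ (ρ c).left ⁻¹ᵁ (q.left ⁻¹ᵁ V) := by
  have : (ρ c).left ≫ q.left = q.left := congrArg (fun t => t.left) (h c)
  refine le_of_eq ?_
  conv_lhs => rw [← this]
  rfl

lemma existsUnique_app_iff (h : ∀ c, ρ c ≫ q = q) (V : Q.left.Opens) :
    (∀ f : Γ(W.left, q.left ⁻¹ᵁ V), (∀ c (hV : q.left ⁻¹ᵁ V ≤ (ρ c).left ⁻¹ᵁ (q.left ⁻¹ᵁ V)),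
      (ρ c).left.appLE (q.left ⁻¹ᵁ V) (q.left ⁻¹ᵁ V) hV f = f) → ∃! g, q.left.app V g = f) ↔
    ∀ f : Γ((openObj W (q.left ⁻¹ᵁ V)).left, ⊤),
      (∀ c, fnPull (openMap (ρ c) (le_preimage_of_comp_eq h V c)) f = f) →
      ∃! g, fnPull (openMap q (V := q.left ⁻¹ᵁ V) le_rfl) g = f := by
  have h1 : ∀ a, fnPull (openMap q (V := q.left ⁻¹ᵁ V) le_rfl) (openFn Q V a) =
      openFn W _ (q.left.app V a) := fun a => by
    rw [fnPull_openMap, Scheme.Hom.appLE_eq_app]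
  rw [(openFn W (q.left ⁻¹ᵁ V)).symm.forall_congr_left]
  refine forall_congr' fun f => ?_
  refine imp_congr (forall_congr' fun c => ?_) ?_
  · rw [forall_prop_of_true (le_preimage_of_comp_eq h V c)]
    rw [← (openFn W (q.left ⁻¹ᵁ V)).injective.eq_iff, ← fnPull_openMap]
    simp
  · refine (openFn Q V).existsUnique_congr fun g => ?_
    rw [h1]
    exact (openFn W (q.left ⁻¹ᵁ V)).injective.eq_iff.symm

lemma IsGrpQuot.existsUnique_app [Group Γ] [Finite Γ] [LFT W.hom] [IsReduced W.left]
    [LFT Q.hom] [IsReduced Q.left] (h : IsGrpQuot ρ q) (V : Q.left.Opens)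
    (f : Γ(W.left, q.left ⁻¹ᵁ V))
    (hf : ∀ c (hV : q.left ⁻¹ᵁ V ≤ (ρ c).left ⁻¹ᵁ (q.left ⁻¹ᵁ V)),
      (ρ c).left.appLE (q.left ⁻¹ᵁ V) (q.left ⁻¹ᵁ V) hV f = f) : ∃! g, q.left.app V g = f := by
  revert f
  rw [existsUnique_app_iff h.inv]
  intro f hf
  have e := openMap_ι q (U := V) (V := q.left ⁻¹ᵁ V) le_rfl
  have hm : Mono (openObjι W (q.left ⁻¹ᵁ V)) := mono_of_left _
  have hm' : Mono (openObjι Q V) := mono_of_left _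
  have hl : ∀ (x : Pt W) (y : Pt (openObj Q V)), x ≫ q = y ≫ openObjι Q V →
      ∃ x', x' ≫ openObjι W (q.left ⁻¹ᵁ V) = x := fun x y hxy => by
    refine exists_pt_lift _ x ((range_openObjι W _).ge ?_)
    have : Pt.val (x ≫ q) ∈ V := by
      rw [hxy]
      exact (range_openObjι Q V).subset ⟨y.val, rfl⟩
    exact this
  obtain ⟨g, hg⟩ := h.toIsQuot.exists_hom (openObjι W (q.left ⁻¹ᵁ V)) (openObjι Q V) _ e hl (A1.mk f)
    fun x x' hx => by
      have h1 : (x ≫ openObjι W (q.left ⁻¹ᵁ V)) ≫ q = (x' ≫ openObjι W (q.left ⁻¹ᵁ V)) ≫ q := by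
        rw [assoc, assoc, ← e, ← assoc, ← assoc, hx]
      obtain ⟨c, hc⟩ := h.orbit _ _ h1
      have h2 : x ≫ openMap (ρ c) (le_preimage_of_comp_eq h.inv V c) = x' := by
        rw [← cancel_mono (openObjι W (q.left ⁻¹ᵁ V)), ← hc, assoc, openMap_ι, assoc]
      apply A1.ext
      rw [A1.coord_comp, A1.coord_comp, A1.coord_mk, ← h2, fnPull_comp, hf c]
  have hs : ∀ y : Pt (openObj Q V), ∃ x, x ≫ openMap q (V := q.left ⁻¹ᵁ V) le_rfl = y := fun y => by
    obtain ⟨x, hx⟩ := h.surj (y ≫ openObjι Q V)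
    obtain ⟨x', rfl⟩ := hl x y hx
    refine ⟨x', ?_⟩
    rw [← cancel_mono (openObjι Q V), assoc, e, ← hx, assoc]
  refine ⟨A1.coord g, ?_, fun g' hg' => ?_⟩
  · exact (A1.coord_comp _ _).symm.trans ((congrArg A1.coord hg).trans (A1.coord_mk f))
  · refine fnPull_injective_of_surjective _ hs (hg'.trans ?_)
    exact (A1.coord_mk f).symm.trans ((congrArg A1.coord hg).symm.trans (A1.coord_comp _ _))

lemma exists_orbit_of_existsUnique_app [Group Γ] [Finite Γ] [LFT W.hom]
    [LFT Q.hom] (hρ : IsAct ρ) (h : ∀ c, ρ c ≫ q = q) (ha : IsAffineHom q.left)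
    (hf : ∀ (V : Q.left.Opens) (f : Γ(W.left, q.left ⁻¹ᵁ V)),
      (∀ c (hV : q.left ⁻¹ᵁ V ≤ (ρ c).left ⁻¹ᵁ (q.left ⁻¹ᵁ V)),
      (ρ c).left.appLE (q.left ⁻¹ᵁ V) (q.left ⁻¹ᵁ V) hV f = f) → ∃! g, q.left.app V g = f) :
    IsIntegralHom q.left ∧ (∀ y : Pt Q, ∃ x : Pt W, x ≫ q = y) ∧
      ∀ x x' : Pt W, x ≫ q = x' ≫ q → ∃ c, x ≫ ρ c = x' := by
  have key : ∀ V : Q.left.affineOpens, _ := fun V => by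
    have h1 := (existsUnique_app_iff h V.1).1 (hf V.1)
    have a1 : IsAffine (openObj Q V.1).left := V.2
    have a2 : IsAffine (openObj W (q.left ⁻¹ᵁ V.1)).left := V.2.preimage q.left
    have hq : ∀ c, openMap (ρ c) (le_preimage_of_comp_eq h V.1 c) ≫
        openMap q (U := V.1) (V := q.left ⁻¹ᵁ V.1) le_rfl = openMap q le_rfl := fun c => by
      rw [openMap_comp _ _ _ _ (by rw [h c])]
      exact openMap_congr (h c) _ _
    refine affine_quotient (ρ := fun c => openMap (ρ c) (le_preimage_of_comp_eq h V.1 c)) ⟨?_, ?_⟩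
      (openMap q (V := q.left ⁻¹ᵁ V.1) le_rfl) hq ?_ fun f hf => (h1 f hf).exists
    · have hm : Mono (openObjι W (q.left ⁻¹ᵁ V.1)) := mono_of_left _
      rw [← cancel_mono (openObjι W (q.left ⁻¹ᵁ V.1)), openMap_ι, hρ.one]
      exact (comp_id _).trans (id_comp _).symm
    · intro c c'
      exact (openMap_congr (hρ.mul c c') _ (hρ.mul c c' ▸ le_preimage_of_comp_eq h V.1 (c * c'))).trans
        (openMap_comp _ _ _ _ _).symm
    · intro a a' e
      refine (h1 (fnPull (openMap q (V := q.left ⁻¹ᵁ V.1) le_rfl) a') fun c => ?_).unique e rfl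
      rw [← fnPull_comp, hq c]
  have hcov : ∀ y : Q.left, ∃ V : Q.left.affineOpens, y ∈ V.1 := fun y => by
    obtain ⟨U, hU, hp, -⟩ := exists_isAffineOpen_mem_and_subset (x := y) (U := ⊤) trivial
    exact ⟨⟨U, hU⟩, hp⟩
  refine ⟨?_, fun y => ?_, fun x x' hx => ?_⟩
  · have := (HasAffineProperty.iff.1 IsIntegralHom.hasAffineProperty).1
    refine of_cover @IsIntegralHom q.left (fun V : Q.left.affineOpens => (openObjι W (q.left ⁻¹ᵁ V.1)).left)
      (fun V => (openObjι Q V.1).left) (fun V => (openMap q (V := q.left ⁻¹ᵁ V.1) le_rfl).left)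
      (fun V => (congrArg (fun t => t.left) (openMap_ι q (U := V.1) (V := q.left ⁻¹ᵁ V.1) le_rfl)).symm)
      (fun V => ?_) (fun y => ?_) fun V => (key V).1
    · refine (congrArg (q.left ⁻¹ᵁ ·) (Scheme.Opens.opensRange_ι V.1)).trans ?_
      exact (Scheme.Opens.opensRange_ι (q.left ⁻¹ᵁ V.1)).symm
    · obtain ⟨V, hV⟩ := hcov y
      exact ⟨V, (range_openObjι Q V.1).ge hV⟩
  · obtain ⟨V, hV⟩ := hcov y.val
    obtain ⟨y', rfl⟩ := exists_pt_lift (openObjι Q V.1) y ((range_openObjι Q V.1).ge hV)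
    obtain ⟨x, rfl⟩ := (key V).2.1 y'
    refine ⟨x ≫ openObjι W _, ?_⟩
    rw [assoc, assoc, openMap_ι]
  · obtain ⟨V, hV⟩ := hcov (Pt.val (x ≫ q))
    have hm' : Mono (openObjι Q V.1) := mono_of_left _
    have hl : ∀ x : Pt W, Pt.val (x ≫ q) ∈ V.1 → ∃ x', x' ≫ openObjι W (q.left ⁻¹ᵁ V.1) = x :=
      fun x hx => exists_pt_lift _ x ((range_openObjι W _).ge hx)
    obtain ⟨x, rfl⟩ := hl x hV
    obtain ⟨x', rfl⟩ := hl x' (hx ▸ hV)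
    obtain ⟨c, hc⟩ := (key V).2.2 x x' (by
      rw [← cancel_mono (openObjι Q V.1), assoc, assoc, openMap_ι, ← assoc, ← assoc, hx])
    exact ⟨c, by rw [assoc, ← openMap_ι (ρ c) (le_preimage_of_comp_eq h V.1 c),
      ← assoc, hc]⟩
end

section
variable {G : Sch k} [GrpObj G] [GoodGrp G]
variable {B : GSch G} [MonObj B.X] [h : IsGMonoid B]

/-! ### Symmetric powers -/

/-- `q` exhibits `Q` as a quotient of `X ^ n` by the permutations of the factors, on the level of
points. -/
structure GVar.IsSym (n : ℕ) (X Q : GVar B) (q : (X.pow n).X ⟶ Q.X) : Prop where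
  str : q ≫ Q.str = (X.pow n).str
  universallyClosed : UniversallyClosed q.hom.left
  surj : ∀ y : Pt Q.X.X, ∃ x : Pt (X.pow n).X.X, x ≫ q.hom = y
  fib : ∀ x x' : Pt (X.pow n).X.X, x ≫ q.hom = x' ≫ q.hom ↔ X.toM x = X.toM x'

lemma GVar.exists_box (X : GVar B) {n : ℕ} (V : Fin n → X.X.X.left.Opens)
    (hV : ∀ i, IsAffineOpen (V i)) : ∃ O : (X.pow n).X.X.left.Opens, IsAffineOpen O ∧
      ∀ x : Pt (X.pow n).X.X, x.val ∈ O ↔ ∀ i, Pt.val (x ≫ (X.powπ n i).hom) ∈ V i := by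
  induction n with
  | zero => exact ⟨⊤, isAffineOpen_top (Spec (.of k)), fun x => ⟨fun _ i => i.elim0, fun _ => trivial⟩⟩
  | succ n ih =>
    obtain ⟨O, hO, h⟩ := ih (fun i => V i.succ) fun i => hV i.succ
    refine ⟨_, isAffineOpen_inf X.X.X.hom (X.pow n).X.X.hom (hV 0) hO, fun x => ?_⟩
    rw [Fin.forall_fin_succ]
    refine and_congr Iff.rfl ((h (x ≫ snd X.X.X (X.pow n).X.X)).trans (forall_congr' fun i => ?_))
    have e : (x ≫ snd X.X.X (X.pow n).X.X) ≫ (X.powπ n i).hom = x ≫ (X.powπ (n + 1) i.succ).hom :=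
      assoc _ _ _
    exact iff_of_eq (congrArg (fun t : Pt X.X.X => t.val ∈ V i.succ) e)

open scoped Function in
lemma GVar.isNiceFor_pow (X : GVar B) (hX : IsNice X.X) (n : ℕ) :
    IsNiceFor (X.pow n).X fun e : Equiv.Perm (Fin n) => (X.powPerm e).hom := by
  obtain ⟨I, U, hU, hd, hc⟩ := hX
  have hd' : ∀ {i j} {p : X.X.X.left}, p ∈ U i → p ∈ U j → i = j := fun {i j p} hi hj => by
    by_contra hij
    exact Set.disjoint_left.1 (hd i j hij) hi hj
  choose O hO hOm using fun τ : Fin n → I => X.exists_box (fun i => U (τ i)) fun i => (hU (τ i)).1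
  have hτ : ∀ {τ τ'} {x : Pt (X.pow n).X.X}, x.val ∈ O τ → x.val ∈ O τ' → τ = τ' :=
    fun {τ τ' x} h h' => funext fun i => hd' ((hOm τ x).1 h i) ((hOm τ' x).1 h' i)
  let J : Multiset I → Type u := fun m => {τ : Fin n → I // Finset.univ.val.map τ = m}
  have hJ : ∀ m, Finite (J m) := fun m => by
    refine Set.Finite.subset (Set.Finite.pi' (t := fun _ : Fin n => {i | i ∈ m}) fun _ => ?_) ?_
    · classical
      exact (m.toFinset.finite_toSet).subset fun i hi => by simpa using hi
    · rintro τ rfl i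
      exact Multiset.mem_map.2 ⟨i, Finset.mem_univ_val i, rfl⟩
  have hmem : ∀ m (x : Pt (X.pow n).X.X), x.val ∈ (⨆ τ : J m, O τ.1) ↔ ∃ τ : J m, x.val ∈ O τ.1 :=
    fun m x => TopologicalSpace.Opens.mem_iSup
  refine ⟨Multiset I, fun m => ⨆ τ : J m, O τ.1, fun m => ⟨?_, fun g x hx => ?_⟩,
    fun m m' x hx hx' => ?_, fun x => ?_, fun m e x hx => ?_⟩
  · have := hJ m
    refine IsAffineOpen.iSup_of_disjoint (fun τ => hO τ.1) fun τ τ' hne => ?_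
    rw [Function.onFun, disjoint_iff, eq_bot_iff]
    refine subset_of_forall_pt (X := (X.pow n).X.X) (O τ.1 ⊓ O τ'.1).2.isLocallyClosed isClosed_empty
      fun x hx => hne (Subtype.ext (hτ hx.1 hx.2))
  · obtain ⟨τ, hx⟩ := (hmem m x).1 hx
    refine (hmem m _).2 ⟨τ, (hOm _ _).2 fun i => ?_⟩
    have e : (g • x : Pt (X.pow n).X.X) ≫ (X.powπ n i).hom = g • (x ≫ (X.powπ n i).hom) :=
      GSch.smul_comp _ _ _
    rw [e]
    exact (hU (τ.1 i)).2 g _ ((hOm _ _).1 hx i)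
  · obtain ⟨τ, hx⟩ := (hmem m x).1 hx
    obtain ⟨τ', hx'⟩ := (hmem m' x).1 hx'
    rw [← τ.2, ← τ'.2, hτ hx hx']
  · choose τ h using fun i => hc (Pt.val (x ≫ (X.powπ n i).hom))
    exact ⟨_, (hmem _ x).2 ⟨⟨τ, rfl⟩, (hOm _ _).2 h⟩⟩
  · obtain ⟨τ, hx⟩ := (hmem m x).1 hx
    refine (hmem m _).2 ⟨⟨τ.1 ∘ e, ?_⟩, (hOm _ _).2 fun i => ?_⟩
    · exact ((map_univ_eq_iff _ _).2 ⟨e, rfl⟩).symm.trans τ.2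
    · rw [X.comp_powPerm_π]
      exact (hOm _ _).1 hx (e i)

lemma GVar.exists_grpQuot (X : GVar B) (hX : IsNice X.X) (n : ℕ) :
    ∃ (Q : GVar B) (q : (X.pow n).X ⟶ Q.X), q ≫ Q.str = (X.pow n).str ∧ IsIntegralHom q.hom.left ∧
      IsGrpQuot (fun e : Equiv.Perm (Fin n) => (X.powPerm e).hom) q.hom :=
  (X.pow n).exists_quotient (fun e : Equiv.Perm (Fin n) => X.powPerm e) (X.isAct_powPerm n)
    X.powPerm_str (X.isNiceFor_pow hX n)

lemma GVar.toM_eq_of_inv (X : GVar B) {n : ℕ} {T : Sch k} (q : (X.pow n).X.X ⟶ T)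
    (hi : ∀ e : Equiv.Perm (Fin n), (X.powPerm e).hom ≫ q = q)
    (ho : ∀ x x' : Pt (X.pow n).X.X, x ≫ q = x' ≫ q → ∃ e : Equiv.Perm (Fin n),
      x ≫ (X.powPerm e).hom = x') (x x' : Pt (X.pow n).X.X) :
    x ≫ q = x' ≫ q ↔ X.toM x = X.toM x' := by
  rw [X.toM_eq_iff]
  refine ⟨ho x x', ?_⟩
  rintro ⟨e, rfl⟩
  rw [assoc, hi]

lemma GVar.exists_isSym (X : GVar B) (hX : IsNice X.X) (n : ℕ) :
    ∃ (Q : GVar B) (q : (X.pow n).X ⟶ Q.X), GVar.IsSym n X Q q := by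
  obtain ⟨Q, q, hs, -, h⟩ := X.exists_grpQuot hX n
  exact ⟨Q, q, hs, h.universallyClosed, h.surj, X.toM_eq_of_inv _ h.inv h.orbit⟩

/-! ### Comparison with the categorical definition -/

lemma GVar.exists_pow_prod (X : GVar B) (n : ℕ) :
    ∃ (a : (∏ᶜ fun _ : Fin n => X.X.X) ⟶ (X.pow n).X.X)
      (b : (X.pow n).X.X ⟶ ∏ᶜ fun _ : Fin n => X.X.X), a ≫ b = 𝟙 _ ∧ b ≫ a = 𝟙 _ ∧
      (∀ i, a ≫ (X.powπ n i).hom = Pi.π _ i) ∧ ∀ i, b ≫ Pi.π _ i = (X.powπ n i).hom := by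
  obtain ⟨a, ha⟩ := X.exists_powLift fun i => Pi.π (fun _ : Fin n => X.X.X) i
  let b := Pi.lift fun i => (X.powπ n i).hom
  have hb : ∀ i, b ≫ Pi.π _ i = (X.powπ n i).hom := fun i => Pi.lift_π _ i
  refine ⟨a, b, ?_, ?_, ha, hb⟩
  · refine Pi.hom_ext _ _ fun i => ?_
    rw [assoc, hb, ha, id_comp]
  · refine X.pow_hom_ext fun i => ?_
    rw [assoc, ha, hb, id_comp]

lemma powPerm_comp (X : GVar B) {n : ℕ} (e : Equiv.Perm (Fin n))
    {a : (∏ᶜ fun _ : Fin n => X.X.X) ⟶ (X.pow n).X.X}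
    (ha : ∀ i, a ≫ (X.powπ n i).hom = Pi.π _ i) :
    powPerm X.X.X e ≫ a = a ≫ (X.powPerm e).hom :=
  X.pow_hom_ext fun i => by
    rw [assoc, ha, X.comp_powPerm_π, ha]
    exact Pi.lift_π _ _

lemma GVar.comp_powPerm_pi (X : GVar B) {n : ℕ} (e : Equiv.Perm (Fin n))
    {b : (X.pow n).X.X ⟶ ∏ᶜ fun _ : Fin n => X.X.X}
    (hb : ∀ i, b ≫ Pi.π _ i = (X.powπ n i).hom) :
    b ≫ powPerm X.X.X e = (X.powPerm e).hom ≫ b := by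
  refine Pi.hom_ext _ _ fun i => ?_
  have h1 : powPerm X.X.X e ≫ Pi.π _ i = Pi.π _ (e i) := Pi.lift_π _ _
  rw [assoc, assoc, h1, hb, hb]
  exact (X.powLift_π (fun i => X.powπ n (e i)) i).symm

lemma isIso_left_of_inv {X Y : Sch k} {a : X ⟶ Y} {b : Y ⟶ X} (h : a ≫ b = 𝟙 _) (h' : b ≫ a = 𝟙 _) :
    IsIso a.left :=
  ⟨b.left, congrArg (fun t => t.left) h, congrArg (fun t => t.left) h'⟩

lemma GVar.exists_isSymPower (X : GVar B) (hX : IsNice X.X) (n : ℕ) :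
    ∃ (Q : GVar B) (q : (∏ᶜ fun _ : Fin n => X.X.X) ⟶ Q.X.X), IsSymPower n X Q q := by
  obtain ⟨Q, q, hs, hi, hq⟩ := X.exists_grpQuot hX n
  obtain ⟨a, b, hab, hba, ha, hb⟩ := X.exists_pow_prod n
  have ia : IsIso a.left := isIso_left_of_inv hab hba
  have oa : IsOpenImmersion a.left := inferInstance
  have l1 : LFT (∏ᶜ fun _ : Fin n => X.X.X).hom := lft_of_isImmersion a
  have l2 : IsReduced (∏ᶜ fun _ : Fin n => X.X.X).left := isReduced_of_isOpenImmersion a.left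
  have hinv : ∀ e : Equiv.Perm (Fin n), powPerm X.X.X e ≫ a ≫ q.hom = a ≫ q.hom := fun e => by
      rw [← assoc, powPerm_comp X e ha, assoc]
      exact a ≫= hq.inv e
  have hgq : IsGrpQuot (fun e : Equiv.Perm (Fin n) => powPerm X.X.X e) (a ≫ q.hom) :=
    { universallyClosed := by
        have := hq.universallyClosed
        exact (inferInstance : UniversallyClosed (a.left ≫ q.hom.left))
      surj := fun y => by
        obtain ⟨x, hx⟩ := hq.surj y
        refine ⟨x ≫ b, ?_⟩
        rw [assoc, ← assoc b, hba, id_comp, hx]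
      exists_fnQuot := fun y O hy => by
        obtain ⟨D, W', d, w, q', hd, hw, hf, e, hy', hr⟩ := hq.exists_fnQuot y O hy
        have ib : IsIso b.left := isIso_left_of_inv hba hab
        refine ⟨D, W', d, w ≫ b, q', hd, ?_, hf, ?_, hy', hr⟩
        · exact (inferInstance : IsOpenImmersion (w.left ≫ b.left))
        · rw [e, assoc, ← assoc b, hba, id_comp]
      inv := hinv
      orbit := fun x x' hx => by
        obtain ⟨e, he⟩ := hq.orbit (x ≫ a) (x' ≫ a) (by simpa using hx)
        refine ⟨e, ?_⟩
        have h1 := he =≫ b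
        simp only [assoc] at h1
        rw [← X.comp_powPerm_pi e hb, hab, ← assoc a, hab] at h1
        exact (x ≫= id_comp _).symm.trans (h1.trans (comp_id _)) }
  refine ⟨Q, a ≫ q.hom, hinv, ?_, fun V f hf => ?_, fun T g x y hxy => ?_, ?_⟩
  · have : IsAffineHom q.hom.left := inferInstance
    exact (inferInstance : IsAffineHom (a.left ≫ q.hom.left))
  · exact hgq.existsUnique_app V f hf
  · have e : y ≫ a = g • (x ≫ a : T ⟶ (X.pow n).X.X) := X.pow_hom_ext fun i => by
      refine assoc'.trans ((y ≫= ha i).trans ((hxy i).trans ?_))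
      refine Eq.trans ?_ (GSch.smul_comp (X.powπ n i) g _).symm
      exact congrArg (g • ·) ((x ≫= ha i).symm.trans assoc'.symm)
    refine assoc'.symm.trans ((e =≫ q.hom).trans ?_)
    exact (GSch.smul_comp q g _).trans (congrArg (g • ·) assoc')
  · have e : q.hom ≫ Q.str.hom = (X.pow n).str.hom := congrArg Mod.Hom.hom hs
    rw [assoc, e]
    exact (X.pow_str a).trans (Finset.prod_congr rfl fun i _ => ha i =≫ X.str.hom)

lemma IsSymPower.exists_isSym {n : ℕ} {X Q : GVar B} {q : (∏ᶜ fun _ : Fin n => X.X.X) ⟶ Q.X.X}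
    (hq : IsSymPower n X Q q) : ∃ q' : (X.pow n).X ⟶ Q.X, GVar.IsSym n X Q q' := by
  obtain ⟨a, b, hab, hba, ha, hb⟩ := X.exists_pow_prod n
  have ia : IsIso a.left := isIso_left_of_inv hab hba
  have ib : IsIso b.left := isIso_left_of_inv hba hab
  have oa : IsOpenImmersion a.left := inferInstance
  have l1 : LFT (∏ᶜ fun _ : Fin n => X.X.X).hom := lft_of_isImmersion a
  obtain ⟨h1, h2, h3⟩ := exists_orbit_of_existsUnique_app
    (ρ := fun e : Equiv.Perm (Fin n) => powPerm X.X.X e) (q := q)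
    ⟨Pi.hom_ext _ _ fun i => (Pi.lift_π _ i).trans (id_comp _).symm, fun e e' =>
      Pi.hom_ext _ _ fun i => by
        rw [assoc]
        refine (Pi.lift_π _ i).trans (Eq.symm ?_)
        exact (_ ≫= Pi.lift_π _ i).trans (Pi.lift_π _ _)⟩
    hq.perm_comp hq.isAffineHom hq.existsUnique_app
  let q' : (X.pow n).X ⟶ Q.X := GSch.homMk (b ≫ q) fun g x => by
    have := hq.equivariant _ g (x ≫ b) ((g • x : Pt (X.pow n).X.X) ≫ b) fun i => by
      rw [assoc, assoc, hb]
      exact GSch.smul_comp (X.powπ n i) g x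
    exact assoc'.symm.trans (this.trans (congrArg (g • ·) assoc'))
  refine ⟨q', ?_, ?_, fun y => ?_, ?_⟩
  · apply Mod.Hom.ext
    refine assoc'.trans ((b ≫= hq.comp_str).trans ?_)
    have e1 : b ≫ ∏ i, (Pi.π (fun _ : Fin n => X.X.X) i ≫ X.str.hom) =
        ∏ i, b ≫ (Pi.π (fun _ : Fin n => X.X.X) i ≫ X.str.hom) :=
      map_prod (⟨⟨fun f => b ≫ f, MonObj.comp_one _⟩, MonObj.comp_mul _⟩ :
        ((∏ᶜ fun _ : Fin n => X.X.X) ⟶ B.X) →* ((X.pow n).X.X ⟶ B.X)) _ _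
    refine e1.trans (Eq.trans ?_ ((X.pow_str (𝟙 _)).symm.trans (id_comp _)))
    refine Finset.prod_congr rfl fun i _ => ?_
    exact assoc'.symm.trans ((hb i).trans (id_comp _).symm =≫ X.str.hom)
  · exact (inferInstance : UniversallyClosed (b.left ≫ q.left))
  · obtain ⟨x, rfl⟩ := h2 y
    refine ⟨x ≫ a, ?_⟩
    refine assoc'.trans (x ≫= ?_)
    exact assoc'.symm.trans ((hab =≫ q).trans (id_comp _))
  · refine X.toM_eq_of_inv (b ≫ q) (fun e => ?_) fun x x' hx => ?_
    · rw [← assoc, ← X.comp_powPerm_pi e hb, assoc, hq.perm_comp]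
    · obtain ⟨e, he⟩ := h3 (x ≫ b) (x' ≫ b) (by simpa using hx)
      refine ⟨e, ?_⟩
      have h1 := he =≫ a
      simp only [assoc] at h1
      rw [powPerm_comp X e ha, hba, ← assoc b, hba] at h1
      exact (x ≫= id_comp _).symm.trans (h1.trans (comp_id _))
end

section
lemma map_add_map_injective {α β C : Type*} {f : α → C} {g : β → C} (hf : Function.Injective f)
    (hg : Function.Injective g) (h : ∀ a b, f a ≠ g b) {m m' : Multiset α} {l l' : Multiset β}
    (e : m.map f + l.map g = m'.map f + l'.map g) : m = m' ∧ l = l' := by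
  classical
  have key : ∀ (m : Multiset α) (l : Multiset β),
      (m.map f + l.map g).filter (fun c => ∃ a, f a = c) = m.map f := fun m l => by
    rw [Multiset.filter_add, Multiset.filter_eq_self.2, Multiset.filter_eq_nil.2, add_zero]
    · intro c hc ⟨a, ha⟩
      obtain ⟨b, -, rfl⟩ := Multiset.mem_map.1 hc
      exact h a b ha
    · intro c hc
      obtain ⟨a, -, rfl⟩ := Multiset.mem_map.1 hc
      exact ⟨a, rfl⟩
  have h1 : m.map f = m'.map f := (key m l).symm.trans ((congrArg _ e).trans (key m' l'))
  rw [h1] at e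
  exact ⟨Multiset.map_injective hf h1, Multiset.map_injective hg (add_left_cancel e)⟩

lemma exists_map_add_map {α β C : Type*} {f : α → C} {g : β → C}
    (h : ∀ c, (∃ a, f a = c) ∨ ∃ b, g b = c) (n : Multiset C) :
    ∃ (m : Multiset α) (l : Multiset β), m.map f + l.map g = n := by
  induction n using Multiset.induction with
  | empty => exact ⟨0, 0, rfl⟩
  | cons c n ih =>
    obtain ⟨m, l, rfl⟩ := ih
    rcases h c with ⟨a, rfl⟩ | ⟨b, rfl⟩
    · exact ⟨a ::ₘ m, l, by simp⟩
    · exact ⟨m, b ::ₘ l, by simp⟩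

lemma map_univ_addCases {a b : ℕ} {α : Type*} (f : Fin (a + b) → α) :
    Finset.univ.val.map f = Finset.univ.val.map (fun i => f (Fin.castAdd b i)) +
      Finset.univ.val.map (fun i => f (Fin.natAdd a i)) := by
  have h : ∀ {n : ℕ} (f : Fin n → α), Finset.univ.val.map f = ∑ i, {f i} := fun f => by
    rw [Finset.sum_eq_multiset_sum]
    conv_lhs => rw [← Multiset.sum_map_singleton (Multiset.map f Finset.univ.val), Multiset.map_map]
    rfl
  rw [h, h, h, Fin.sum_univ_add]

variable {G : Sch k} [GrpObj G] [GoodGrp G]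

variable {B : GSch G} [MonObj B.X] [h : IsGMonoid B]

lemma GVar.toM_powLift (X : GVar B) {n : ℕ} {W : GSch G} [LFT W.X.hom]
    [IsReduced W.X.left] (f : Fin n → (W ⟶ X.X)) (w : Pt W.X) :
    X.toM (w ≫ (X.powLift f).hom) = Finset.univ.val.map fun i => w ≫ (f i).hom :=
  congrArg (fun f => Finset.univ.val.map f) (funext fun i => X.comp_powLift_π f i w)

lemma GVar.IsSym.mk_eq_of_bijective {n : ℕ} {X X' Q Q' : GVar B} {q : (X.pow n).X ⟶ Q.X}
    {q' : (X'.pow n).X ⟶ Q'.X} (hq : GVar.IsSym n X Q q) (hq' : GVar.IsSym n X' Q' q')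
    (f : X.X ⟶ X'.X) (hf : f ≫ X'.str = X.str)
    (hb : Function.Bijective fun x : Pt X.X.X => x ≫ f.hom) : K0.mk Q = K0.mk Q' := by
  have e : ∀ w : Pt (X.pow n).X.X, X'.toM (w ≫ (X'.powLift fun i => X.powπ n i ≫ f).hom) =
      (X.toM w).map fun x => x ≫ f.hom := fun w => by
    rw [X'.toM_powLift, GVar.toM, Multiset.map_map]
    exact congrArg (fun f => Finset.univ.val.map f) (funext fun i => assoc'.symm)
  have e' : ∀ w : Pt (X.pow n).X.X, w ≫ ((X'.powLift fun i => X.powπ n i ≫ f) ≫ q').hom =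
      (w ≫ (X'.powLift fun i => X.powπ n i ≫ f).hom) ≫ q'.hom := fun w => assoc'.symm
  refine K0.mk_eq_of_cover Q Q' q ((X'.powLift fun i => X.powπ n i ≫ f) ≫ q') hq.universallyClosed
    hq.surj (fun y => ?_) (fun w w' => ?_) ?_
  · obtain ⟨x, rfl⟩ := hq'.surj y
    obtain ⟨m, hm⟩ : ∃ m : Multiset (Pt X.X.X), m.map (fun x => x ≫ f.hom) = X'.toM x := by
      obtain ⟨m, l, hm⟩ := exists_map_add_map (f := fun x : Pt X.X.X => x ≫ f.hom)
        (g := Empty.elim) (fun c => Or.inl (hb.2 c)) (X'.toM x)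
      obtain rfl : l = 0 := Multiset.eq_zero_of_forall_notMem fun b => b.elim
      exact ⟨m, by simpa using hm⟩
    obtain ⟨w, hw⟩ := X.exists_toM (n := n) m (by rw [← X'.card_toM x, ← hm, Multiset.card_map])
    refine ⟨w, (e' w).trans ((hq'.fib _ _).2 ?_)⟩
    rw [e, hw, hm]
  · rw [e', e', hq.fib, hq'.fib, e, e]
    exact (Multiset.map_injective hb.1).eq_iff.symm
  · rw [hq.str]
    refine Eq.trans ?_ (congrArg (_ ≫ ·) hq'.str.symm |>.trans assoc'.symm)
    apply Mod.Hom.ext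
    refine hom_ext_pt fun x => (X.pow_str x).trans ?_
    refine Eq.trans ?_ (assoc x _ _)
    refine Eq.trans ?_ (X'.pow_str _).symm
    refine Finset.prod_congr rfl fun i _ => ?_
    rw [X'.comp_powLift_π]
    exact (GSch.comp_eq hf _).symm.trans (assoc _ _ _ =≫ X'.str.hom)

lemma GVar.IsSym.mk_unique {n : ℕ} {X Q Q' : GVar B} {q : (X.pow n).X ⟶ Q.X}
    {q' : (X.pow n).X ⟶ Q'.X} (hq : GVar.IsSym n X Q q) (hq' : GVar.IsSym n X Q' q') :
    K0.mk Q = K0.mk Q' :=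
  hq.mk_eq_of_bijective hq' (𝟙 _) (id_comp _)
    (bijective_of_eq comp_id)

lemma GVar.exists_concat {X Z U : GVar B} (z : Z.X ⟶ X.X) (v : U.X ⟶ X.X)
    (hz : z ≫ X.str = Z.str) (hv : v ≫ X.str = U.str) {n a b : ℕ} (hn : a + b = n) :
    ∃ f : (prodMod (Z.pow a).X (U.pow b).X) ⟶ (X.pow n).X,
      (∀ w : Pt (prodMod (Z.pow a).X (U.pow b).X).X, X.toM (w ≫ f.hom) =
        (Z.toM (w ≫ fst (Z.pow a).X.X (U.pow b).X.X)).map (· ≫ z.hom) +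
        (U.toM (w ≫ snd (Z.pow a).X.X (U.pow b).X.X)).map (· ≫ v.hom)) ∧
      ∀ w : Pt (prodMod (Z.pow a).X (U.pow b).X).X, w ≫ (f ≫ (X.pow n).str).hom =
        ((w ≫ fst (Z.pow a).X.X (U.pow b).X.X) ≫ (Z.pow a).str.hom) *
        ((w ≫ snd (Z.pow a).X.X (U.pow b).X.X) ≫ (U.pow b).str.hom) := by
  subst hn
  let g : Fin (a + b) → (prodMod (Z.pow a).X (U.pow b).X ⟶ X.X) :=
    Fin.addCases (fun i => prodFst _ _ ≫ Z.powπ a i ≫ z) fun i => prodSnd _ _ ≫ U.powπ b i ≫ v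
  have g1 : ∀ (w : Pt (prodMod (Z.pow a).X (U.pow b).X).X) i, w ≫ (g (Fin.castAdd b i)).hom =
      ((w ≫ fst (Z.pow a).X.X (U.pow b).X.X) ≫ (Z.powπ a i).hom) ≫ z.hom := fun w i => by
    refine (congrArg (fun t => w ≫ Mod.Hom.hom t) (Fin.addCases_left i)).trans ?_
    exact assoc'.symm.trans assoc'.symm
  have g2 : ∀ (w : Pt (prodMod (Z.pow a).X (U.pow b).X).X) i, w ≫ (g (Fin.natAdd a i)).hom =
      ((w ≫ snd (Z.pow a).X.X (U.pow b).X.X) ≫ (U.powπ b i).hom) ≫ v.hom := fun w i => by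
    refine (congrArg (fun t => w ≫ Mod.Hom.hom t) (Fin.addCases_right i)).trans ?_
    exact assoc'.symm.trans assoc'.symm
  refine ⟨X.powLift g, fun w => ?_, fun w => ?_⟩
  · rw [X.toM_powLift, map_univ_addCases, GVar.toM, GVar.toM, Multiset.map_map, Multiset.map_map]
    exact congrArg₂ (fun f g => Finset.univ.val.map f + Finset.univ.val.map g)
      (funext fun i => g1 w i) (funext fun i => g2 w i)
  · refine (assoc w _ _).symm.trans ((X.pow_str _).trans ?_)
    rw [Fin.prod_univ_add, Z.pow_str, U.pow_str]
    refine congrArg₂ (· * ·) (Finset.prod_congr rfl fun i _ => ?_)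
      (Finset.prod_congr rfl fun i _ => ?_)
    · rw [X.comp_powLift_π, g1]
      exact GSch.comp_eq hz _
    · rw [X.comp_powLift_π, g2]
      exact GSch.comp_eq hv _

lemma GVar.IsSym.mk_eq_sum {n : ℕ} {X Z U Q : GVar B} {QZ QU : ℕ → GVar B} {q : (X.pow n).X ⟶ Q.X}
    {qZ : ∀ n, (Z.pow n).X ⟶ (QZ n).X} {qU : ∀ n, (U.pow n).X ⟶ (QU n).X}
    (hq : GVar.IsSym n X Q q) (hqZ : ∀ n, GVar.IsSym n Z (QZ n) (qZ n))
    (hqU : ∀ n, GVar.IsSym n U (QU n) (qU n)) (z : Z.X ⟶ X.X) (v : U.X ⟶ X.X)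
    (hz : z ≫ X.str = Z.str) (hv : v ≫ X.str = U.str) (hd : Decomp z v) :
    K0.mk Q = ∑ p ∈ Finset.HasAntidiagonal.antidiagonal n, K0.mk ((QZ p.1).conv (QU p.2)) := by
  let I := {p : ℕ × ℕ // p ∈ Finset.HasAntidiagonal.antidiagonal n}
  choose f hf hfs using fun p : I =>
    GVar.exists_concat z v hz hv (n := n) (Finset.HasAntidiagonal.mem_antidiagonal.1 p.2)
  refine Eq.trans ?_ (Finset.sum_coe_sort (Finset.HasAntidiagonal.antidiagonal n)
    fun p => K0.mk ((QZ p.1).conv (QU p.2)))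
  let W : I → GSch G := fun p => prodMod (Z.pow p.1.1).X (U.pow p.1.2).X
  let ψ : ∀ p : I, W p ⟶ ((QZ p.1.1).conv (QU p.1.2)).X := fun p => prodMap (qZ p.1.1) (qU p.1.2)
  have e' : ∀ (p : I) (w : Pt (W p).X), w ≫ (f p ≫ q).hom = (w ≫ (f p).hom) ≫ q.hom :=
    fun p w => assoc'.symm
  have hinj : ∀ {p p' : I} {w : Pt (W p).X} {w' : Pt (W p').X},
      w ≫ (f p ≫ q).hom = w' ≫ (f p' ≫ q).hom ↔
      Z.toM (w ≫ fst _ _) = Z.toM (w' ≫ fst _ _) ∧ U.toM (w ≫ snd _ _) = U.toM (w' ≫ snd _ _) := by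
    intro p p' w w'
    rw [e', e', hq.fib, hf, hf]
    refine ⟨fun h => map_add_map_injective (fun x y => hd.inj_left x y)
      (fun x y => hd.inj_right x y) (fun x y => hd.disj x y) h, fun h => ?_⟩
    rw [h.1, h.2]
  refine K0.mk_eq_sum_of_cover W _ Q ψ (fun p => f p ≫ q) (fun p => ?_) (fun p y => ?_)
    (fun y => ?_) (fun p w w' => ?_) (fun p p' w w' h => ?_) fun p => ?_
  · exact tensorHom_left (P := @UniversallyClosed) (hqZ _).universallyClosed
      (hqU _).universallyClosed
  · obtain ⟨x, hx⟩ := (hqZ p.1.1).surj (y ≫ fst (QZ p.1.1).X.X (QU p.1.2).X.X)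
    obtain ⟨x', hx'⟩ := (hqU p.1.2).surj (y ≫ snd (QZ p.1.1).X.X (QU p.1.2).X.X)
    refine ⟨lift x x', prod_hom_ext ?_ ?_⟩
    · refine (comp_prodMap_fst _ _ _).trans (Eq.trans ?_ hx)
      exact lift_fst _ _ =≫ (qZ p.1.1).hom
    · refine (comp_prodMap_snd _ _ _).trans (Eq.trans ?_ hx')
      exact lift_snd _ _ =≫ (qU p.1.2).hom
  · obtain ⟨x, rfl⟩ := hq.surj y
    obtain ⟨m, l, e⟩ := exists_map_add_map (f := fun x : Pt Z.X.X => x ≫ z.hom)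
      (g := fun x : Pt U.X.X => x ≫ v.hom) hd.surj (X.toM x)
    have hc : m.card + l.card = n := by
      rw [← X.card_toM x, ← e, Multiset.card_add, Multiset.card_map, Multiset.card_map]
    obtain ⟨x1, h1⟩ := Z.exists_toM m rfl
    obtain ⟨x2, h2⟩ := U.exists_toM l rfl
    let p : I := ⟨(m.card, l.card), Finset.HasAntidiagonal.mem_antidiagonal.2 hc⟩
    obtain ⟨w, hw⟩ : ∃ w : Pt (W p).X, w = lift x1 x2 := ⟨_, rfl⟩
    refine ⟨p, w, (e' p w).trans ((hq.fib _ _).2 ((hf p w).trans (Eq.trans ?_ e)))⟩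
    subst hw
    refine congrArg₂ (fun m l => Multiset.map _ m + Multiset.map _ l) ?_ ?_
    · exact (congrArg Z.toM (lift_fst x1 x2)).trans h1
    · exact (congrArg U.toM (lift_snd x1 x2)).trans h2
  · rw [hinj, ← (hqZ _).fib, ← (hqU _).fib]
    rw [← comp_prodMap_fst _ (qU p.1.2), ← comp_prodMap_fst _ (qU p.1.2),
      ← comp_prodMap_snd (qZ p.1.1), ← comp_prodMap_snd (qZ p.1.1)]
    exact ⟨fun h => ⟨h =≫ _, h =≫ _⟩, fun h => prod_hom_ext h.1 h.2⟩
  · have h1 := hinj.1 h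
    have h2 := congrArg Multiset.card h1.1
    have h3 := congrArg Multiset.card h1.2
    rw [Z.card_toM, Z.card_toM] at h2
    rw [U.card_toM, U.card_toM] at h3
    exact Subtype.ext (Prod.ext h2 h3)
  · refine GSch.ext_of_comp fun w => ?_
    have h1 : w ≫ ((f p ≫ q) ≫ Q.str).hom = w ≫ (f p ≫ (X.pow n).str).hom :=
      congrArg (fun t => w ≫ Mod.Hom.hom t) (assoc'.trans (f p ≫= hq.str))
    refine Eq.trans ?_ ((hfs p w).symm.trans h1.symm)
    refine (GVar.conv_str _ _ _).trans ?_
    refine congrArg₂ (· * ·) ?_ ?_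
    · refine (comp_prodMap_fst _ _ w =≫ (QZ p.1.1).str.hom).trans ?_
      exact GSch.comp_eq (hqZ _).str _
    · refine (comp_prodMap_snd _ _ w =≫ (QU p.1.2).str.hom).trans ?_
      exact GSch.comp_eq (hqU _).str _
end

section
/-! ### `λ`-rings -/

namespace LambdaRingStr
variable {A A' A'' : Type*} [AddCommGroup A] [AddCommGroup A'] [AddCommGroup A'']

lemma ext {L L' : LambdaRingStr A} (h1 : L.one = L'.one) (h2 : ∀ a b, L.mul a b = L'.mul a b)
    (h3 : ∀ n a, L.σ n a = L'.σ n a) : L = L' := by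
  have h2' : L.mul = L'.mul := by ext a b; exact h2 a b
  have h3' : L.σ = L'.σ := by ext n a; exact h3 n a
  cases L
  cases L'
  congr

lemma σ_neg (L : LambdaRingStr A) (n : ℕ) (a : A) : L.σ (n + 1) (-a) =
    -∑ p ∈ Finset.HasAntidiagonal.antidiagonal n, L.mul (L.σ (p.1 + 1) a) (L.σ p.2 (-a)) := by
  have h := L.σ_add (n + 1) a (-a)
  rw [add_neg_cancel, L.σ_map_zero, Finset.Nat.sum_antidiagonal_succ, L.σ_zero, L.one_mul] at h
  exact eq_neg_of_add_eq_zero_left h.symm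

lemma σ_zero_right (L : LambdaRingStr A) (n : ℕ) (L' : LambdaRingStr A') (f : A →+ A')
    (h : f L.one = L'.one) : f (L.σ n 0) = L'.σ n (f 0) := by
  cases n with
  | zero => rw [L.σ_zero, L'.σ_zero, h]
  | succ n => rw [map_zero, L.σ_map_zero, L'.σ_map_zero, map_zero]

lemma isHom_of_closure {L : LambdaRingStr A} {L' : LambdaRingStr A'} {f : A →+ A'} {s : Set A}
    (hs : AddSubgroup.closure s = ⊤) (h1 : f L.one = L'.one)
    (hm : ∀ a ∈ s, ∀ b ∈ s, f (L.mul a b) = L'.mul (f a) (f b))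
    (hσ : ∀ a ∈ s, ∀ n, f (L.σ n a) = L'.σ n (f a)) : L.IsHom L' f := by
  have hm' : ∀ a b, f (L.mul a b) = L'.mul (f a) (f b) := fun a b => by
    have ha : a ∈ AddSubgroup.closure s := hs ▸ trivial
    have hb : b ∈ AddSubgroup.closure s := hs ▸ trivial
    induction ha using AddSubgroup.closure_induction with
    | mem a ha =>
      induction hb using AddSubgroup.closure_induction with
      | mem b hb => exact hm a ha b hb
      | zero => simp
      | add b b' _ _ h h' => simp [h, h']
      | neg b _ h => simp [h]
    | zero => simp
    | add a a' _ _ h h' => simp [h, h']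
    | neg a _ h => simp [h]
  refine ⟨h1, hm', fun n a => ?_⟩
  have ha : a ∈ AddSubgroup.closure s := hs ▸ trivial
  induction ha using AddSubgroup.closure_induction generalizing n with
  | mem a ha => exact hσ a ha n
  | zero => exact L.σ_zero_right n L' f h1
  | add a b _ _ h h' => rw [map_add, L.σ_add, L'.σ_add, map_sum]; simp only [hm', h, h']
  | neg a _ h =>
    induction n using Nat.strong_induction_on with
    | _ n ih =>
      cases n with
      | zero => rw [L.σ_zero, L'.σ_zero, h1]
      | succ n =>
        rw [map_neg, L.σ_neg, L'.σ_neg, map_neg, map_sum]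
        refine congrArg _ (Finset.sum_congr rfl fun p hp => ?_)
        have := Finset.HasAntidiagonal.mem_antidiagonal.1 hp
        rw [hm', h, ih p.2 (by omega), map_neg]

lemma eq_of_closure {L L' : LambdaRingStr A} {s : Set A}
    (hs : AddSubgroup.closure s = ⊤) (h1 : L.one = L'.one)
    (hm : ∀ a ∈ s, ∀ b ∈ s, L.mul a b = L'.mul a b)
    (hσ : ∀ a ∈ s, ∀ n, L.σ n a = L'.σ n a) : L = L' := by
  have h : L.IsHom L' (AddMonoidHom.id A) := isHom_of_closure hs h1 hm hσ
  exact ext h.map_one h.map_mul h.map_σ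

lemma isLambdaIdeal_of_closure {L : LambdaRingStr A} {I : AddSubgroup A} {s t : Set A}
    (hs : AddSubgroup.closure s = ⊤) (ht : AddSubgroup.closure t = I)
    (hm : ∀ a ∈ s, ∀ b ∈ t, L.mul a b ∈ I) (hσ : ∀ n, 0 < n → ∀ b ∈ t, L.σ n b ∈ I) :
    L.IsLambdaIdeal I := by
  have hm' : ∀ a, ∀ b ∈ I, L.mul a b ∈ I := fun a b hb => by
    have ha : a ∈ AddSubgroup.closure s := hs ▸ trivial
    rw [← ht] at hb
    induction ha using AddSubgroup.closure_induction with
    | mem a ha =>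
      induction hb using AddSubgroup.closure_induction with
      | mem b hb => exact hm a ha b hb
      | zero => rw [map_zero]; exact I.zero_mem
      | add b b' _ _ h h' => rw [map_add]; exact I.add_mem h h'
      | neg b _ h => rw [map_neg]; exact I.neg_mem h
    | zero => rw [map_zero]; exact I.zero_mem
    | add a a' _ _ h h' => rw [map_add]; exact I.add_mem h h'
    | neg a _ h => rw [map_neg]; exact I.neg_mem h
  refine ⟨hm', fun n hn b hb => ?_⟩
  rw [← ht] at hb
  induction hb using AddSubgroup.closure_induction generalizing n with
  | mem b hb => exact hσ n hn b hb
  | zero =>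
    obtain ⟨n, rfl⟩ := Nat.exists_eq_succ_of_ne_zero hn.ne'
    rw [L.σ_map_zero]
    exact I.zero_mem
  | add b b' _ _ h h' =>
    rw [L.σ_add]
    refine I.sum_mem fun p hp => ?_
    have := Finset.HasAntidiagonal.mem_antidiagonal.1 hp
    rcases Nat.eq_zero_or_pos p.1 with h0 | h0
    · exact hm' _ _ (h' p.2 (by omega))
    · rw [L.mul_comm]
      exact hm' _ _ (h p.1 h0)
  | neg b _ h =>
    obtain ⟨n, rfl⟩ := Nat.exists_eq_succ_of_ne_zero hn.ne'
    rw [L.σ_neg]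
    refine I.neg_mem (I.sum_mem fun p _ => ?_)
    rw [L.mul_comm]
    exact hm' _ _ (h _ (Nat.succ_pos _))

lemma existsUnique_of_cover {I : Type*} {A : I → Type*} [∀ i, AddCommGroup (A i)]
    (M : ∀ i, LambdaRingStr (A i)) (f : ∀ i, A i →+ A')
    (hc : ∀ x y z, ∃ i a b c, f i a = x ∧ f i b = y ∧ f i c = z)
    (h1 : ∀ i j, f i (M i).one = f j (M j).one)
    (hm : ∀ i j a b a' b', f i a = f j a' → f i b = f j b' →
      f i ((M i).mul a b) = f j ((M j).mul a' b'))
    (hσ : ∀ n i j a a', f i a = f j a' → f i ((M i).σ n a) = f j ((M j).σ n a')) :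
    ∃! N : LambdaRingStr A', ∀ i, (M i).IsHom N (f i) := by
  choose i a b c ha hb hc' using hc
  obtain ⟨m, hm'⟩ : ∃ m : A' → A' → A', ∀ i a b, m (f i a) (f i b) = f i ((M i).mul a b) :=
    ⟨fun x y => f (i x y 0) ((M _).mul (a x y 0) (b x y 0)),
      fun j a' b' => hm _ _ _ _ _ _ (ha _ _ _) (hb _ _ _)⟩
  obtain ⟨σ, hσ'⟩ : ∃ σ : ℕ → A' → A', ∀ n i a, σ n (f i a) = f i ((M i).σ n a) :=
    ⟨fun n x => f (i x 0 0) ((M _).σ n (a x 0 0)), fun n j a' => hσ _ _ _ _ _ (ha _ _ _)⟩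
  obtain ⟨e, he⟩ : ∃ e : A', ∀ i, e = f i (M i).one := ⟨f (i 0 0 0) (M _).one, fun j => h1 _ _⟩
  have cov : ∀ x y z, ∃ i a b c, x = f i a ∧ y = f i b ∧ z = f i c := fun x y z =>
    ⟨_, _, _, _, (ha x y z).symm, (hb x y z).symm, (hc' x y z).symm⟩
  let N : LambdaRingStr A' :=
    { one := e
      mul := AddMonoidHom.mk' (fun x => AddMonoidHom.mk' (m x) fun y z => by
          obtain ⟨i, a, b, c, rfl, rfl, rfl⟩ := cov x y z
          rw [← map_add, hm', hm', hm', map_add, map_add]) fun x y => by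
        ext z
        obtain ⟨i, a, b, c, rfl, rfl, rfl⟩ := cov x y z
        change m _ _ = m _ _ + m _ _
        rw [← map_add, hm', hm', hm', map_add, AddMonoidHom.add_apply, map_add]
      σ := σ
      mul_comm := fun x y => by
        obtain ⟨i, a, b, -, rfl, rfl, -⟩ := cov x y 0
        exact (hm' i a b).trans ((congrArg _ ((M i).mul_comm a b)).trans (hm' i b a).symm)
      mul_assoc := fun x y z => by
        obtain ⟨i, a, b, c, rfl, rfl, rfl⟩ := cov x y z
        change m (m _ _) _ = m _ (m _ _)
        rw [hm', hm', hm', hm', (M i).mul_assoc]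
      one_mul := fun x => by
        obtain ⟨i, a, -, -, rfl, -, -⟩ := cov x 0 0
        change m e _ = _
        rw [he i, hm', (M i).one_mul]
      σ_zero := fun x => by
        obtain ⟨i, a, -, -, rfl, -, -⟩ := cov x 0 0
        rw [hσ', (M i).σ_zero, he i]
      σ_one := fun x => by
        obtain ⟨i, a, -, -, rfl, -, -⟩ := cov x 0 0
        rw [hσ', (M i).σ_one]
      σ_map_zero := fun n => by
        obtain ⟨i, -⟩ := cov 0 0 0
        rw [← map_zero (f i), hσ', (M i).σ_map_zero]
      σ_add := fun n x y => by
        obtain ⟨i, a, b, -, rfl, rfl, -⟩ := cov x y 0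
        rw [← map_add, hσ', (M i).σ_add, map_sum]
        refine Finset.sum_congr rfl fun p _ => ?_
        rw [hσ', hσ']
        exact (hm' i _ _).symm }
  refine ⟨N, fun i => ⟨(he i).symm, fun a b => (hm' i a b).symm, fun n a => (hσ' n i a).symm⟩,
    fun N' h => ext ?_ (fun x y => ?_) fun n x => ?_⟩
  · obtain ⟨i, -⟩ := cov 0 0 0
    exact (h i).map_one.symm.trans (he i).symm
  · obtain ⟨i, a, b, -, rfl, rfl, -⟩ := cov x y 0
    exact ((h i).map_mul a b).symm.trans (hm' i a b).symm
  · obtain ⟨i, a, -, -, rfl, -, -⟩ := cov x 0 0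
    exact ((h i).map_σ n a).symm.trans (hσ' n i a).symm

lemma IsLambdaIdeal.map_σ_eq {L : LambdaRingStr A} {f : A →+ A'} (h : L.IsLambdaIdeal f.ker) (n : ℕ)
    {a a' : A} (e : f a = f a') : f (L.σ n a) = f (L.σ n a') := by
  obtain ⟨b, rfl⟩ : ∃ b, a = a' + b := ⟨a - a', by abel⟩
  have hb : b ∈ f.ker := by simpa using e
  cases n with
  | zero => rw [L.σ_zero, L.σ_zero]
  | succ n =>
    rw [L.σ_add, Finset.Nat.sum_antidiagonal_succ', L.σ_zero, L.mul_comm, L.one_mul, map_add, map_sum,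
      Finset.sum_eq_zero, add_zero]
    intro p _
    exact h.mul_mem _ _ (h.σ_mem _ (Nat.succ_pos _) b hb)

lemma IsLambdaIdeal.existsUnique_quotient {L : LambdaRingStr A} {f : A →+ A'}
    (h : L.IsLambdaIdeal f.ker) (hf : Function.Surjective f) : ∃! L' : LambdaRingStr A', L.IsHom L' f := by
  obtain ⟨N, hN, hu⟩ := existsUnique_of_cover (I := Unit) (fun _ => L) (fun _ => f)
    (fun x y z => ⟨(), _, _, _, (hf x).choose_spec, (hf y).choose_spec, (hf z).choose_spec⟩)
    (fun _ _ => rfl)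
    (fun _ _ a b a' b' ha hb => by
      have h1 := h.mul_mem a (b - b') (by simpa [sub_eq_zero] using hb)
      have h2 := h.mul_mem b' (a - a') (by simpa [sub_eq_zero] using ha)
      rw [AddMonoidHom.mem_ker, map_sub, map_sub, sub_eq_zero] at h1 h2
      rw [h1, L.mul_comm, h2, L.mul_comm])
    (fun n _ _ a a' e => h.map_σ_eq n e)
  exact ⟨N, hN (), fun N' h => hu N' fun _ => h⟩

lemma IsHom.of_comp {L : LambdaRingStr A} {L' : LambdaRingStr A'} {L'' : LambdaRingStr A''}
    {f : A →+ A'} {g : A' →+ A''} (hf : L.IsHom L' f) (hs : Function.Surjective f)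
    (h : L.IsHom L'' (g.comp f)) : L'.IsHom L'' g where
  map_one := by rw [← hf.map_one]; exact h.map_one
  map_mul a b := by
    obtain ⟨a, rfl⟩ := hs a
    obtain ⟨b, rfl⟩ := hs b
    rw [← hf.map_mul]
    exact h.map_mul a b
  map_σ n a := by
    obtain ⟨a, rfl⟩ := hs a
    rw [← hf.map_σ]
    exact h.map_σ n a

lemma IsHom.comp {L : LambdaRingStr A} {L' : LambdaRingStr A'} {L'' : LambdaRingStr A''}
    {f : A →+ A'} {g : A' →+ A''} (hg : L'.IsHom L'' g) (hf : L.IsHom L' f) :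
    L.IsHom L'' (g.comp f) where
  map_one := (congrArg g hf.map_one).trans hg.map_one
  map_mul a b := (congrArg g (hf.map_mul a b)).trans (hg.map_mul _ _)
  map_σ n a := (congrArg g (hf.map_σ n a)).trans (hg.map_σ _ _)

lemma existsUnique_directLimit {I : Type*} [Preorder I] [Nonempty I] [IsDirectedOrder I]
    [DecidableEq I] {A : I → Type*} [∀ i, AddCommGroup (A i)] (f : ∀ i j, i ≤ j → A i →+ A j)
    [DirectedSystem A fun i j h => f i j h] (M : ∀ i, LambdaRingStr (A i))
    (hM : ∀ i j h, (M i).IsHom (M j) (f i j h)) :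
    ∃! N : LambdaRingStr (AddCommGroup.DirectLimit A f),
      ∀ i, (M i).IsHom N (AddCommGroup.DirectLimit.of A f i) := by
  have push : ∀ {i j} (h : i ≤ j) (a : A i), AddCommGroup.DirectLimit.of A f i a =
      AddCommGroup.DirectLimit.of A f j (f i j h a) :=
    fun h a => (AddCommGroup.DirectLimit.of_f h a).symm
  have exact : ∀ {i j} (a : A i) (b : A j), AddCommGroup.DirectLimit.of A f i a =
      AddCommGroup.DirectLimit.of A f j b → ∃ l, ∃ (hi : i ≤ l) (hj : j ≤ l), ∀ m (hl : l ≤ m),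
        f i m (hi.trans hl) a = f j m (hj.trans hl) b := fun {i j} a b h => by
    obtain ⟨l, hi, hj⟩ := exists_ge_ge i j
    rw [push hi, push hj, ← sub_eq_zero, ← map_sub] at h
    obtain ⟨m, hm, e⟩ := AddCommGroup.DirectLimit.of.zero_exact _ _ h
    rw [map_sub, sub_eq_zero] at e
    refine ⟨m, hi.trans hm, hj.trans hm, fun n hn => ?_⟩
    have hc : ∀ {i j l} (h : i ≤ j) (h' : j ≤ l) (a : A i), f j l h' (f i j h a) =
      f i l (h.trans h') a := fun h h' a => DirectedSystem.map_map' (f := fun i j h => f i j h) h h' a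
    rw [hc, hc] at e
    rw [← hc (hi.trans hm) hn, ← hc (hj.trans hm) hn, e]
  refine existsUnique_of_cover M (AddCommGroup.DirectLimit.of A f) (fun x y z => ?_) (fun i j => ?_)
    (fun i j a b a' b' ha hb => ?_) (fun n i j a a' ha => ?_)
  · induction x using AddCommGroup.DirectLimit.induction_on with | _ i a
    induction y using AddCommGroup.DirectLimit.induction_on with | _ j b
    induction z using AddCommGroup.DirectLimit.induction_on with | _ l c
    obtain ⟨m, hi, hj⟩ := exists_ge_ge i j
    obtain ⟨n, hm, hl⟩ := exists_ge_ge m l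
    exact ⟨n, _, _, _, (push (hi.trans hm) a).symm, (push (hj.trans hm) b).symm, (push hl c).symm⟩
  · obtain ⟨l, hi, hj⟩ := exists_ge_ge i j
    rw [push hi, push hj, (hM i l hi).map_one, (hM j l hj).map_one]
  · obtain ⟨l, hi, hj, h⟩ := exact a a' ha
    obtain ⟨l', hi', hj', h'⟩ := exact b b' hb
    obtain ⟨m, hl, hl'⟩ := exists_ge_ge l l'
    rw [push (hi.trans hl), push (hj.trans hl), (hM _ _ _).map_mul, (hM _ _ _).map_mul, h m hl, h' m hl']
  · obtain ⟨l, hi, hj, h⟩ := exact a a' ha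
    rw [push hi, push hj, (hM _ _ _).map_σ, (hM _ _ _).map_σ, h l le_rfl]
end LambdaRingStr
end

section
variable {G : Sch k} [GrpObj G] [GoodGrp G]

/-! ### The convolution ring -/

omit [GoodGrp G] in
lemma K0.push_mk {B B' : GSch G} (f : B ⟶ B') [IsFT f.hom] (X : GVar B) :
    K0.push f (K0.mk X) = K0.mk (X.push f) := K0.lift_mk _ _ X

omit [GoodGrp G] in
lemma K0.prodRight_mk {B B' : GSch G} [LFT B.X.hom] (X : GVar B) (Y : GVar B') :
    K0.prodRight Y (K0.mk X) = K0.mk (X.prod Y) := K0.lift_mk _ _ X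

lemma Decomp.prod_left (X : GSch G) {Y Z U : GSch G} {z : Z ⟶ Y} {v : U ⟶ Y} (h : Decomp z v) :
    Decomp (prodMap (𝟙 X) z) (prodMap (𝟙 X) v) := by
  have e1 : ∀ {Z : GSch G} (z : Z ⟶ Y) (p : Pt (prodMod X Z).X),
      (p ≫ (prodMap (𝟙 X) z).hom : Pt (prodMod X Y).X) ≫ fst X.X Y.X = p ≫ fst X.X Z.X :=
    fun z p => (comp_prodMap_fst _ _ _).trans (comp_id _)
  have e2 : ∀ {Z : GSch G} (z : Z ⟶ Y) (p : Pt (prodMod X Z).X),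
      (p ≫ (prodMap (𝟙 X) z).hom : Pt (prodMod X Y).X) ≫ snd X.X Y.X = (p ≫ snd X.X Z.X) ≫ z.hom :=
    fun z p => comp_prodMap_snd _ _ _
  have hinj : ∀ {Z : GSch G} (z : Z ⟶ Y), (∀ p q : Pt Z.X, p ≫ z.hom = q ≫ z.hom → p = q) →
      ∀ p q : Pt (prodMod X Z).X, p ≫ (prodMap (𝟙 X) z).hom = q ≫ (prodMap (𝟙 X) z).hom → p = q :=
    fun {Z} z hz p q e => prod_hom_ext
      ((e1 z p).symm.trans ((e =≫ fst X.X Y.X).trans (e1 z q)))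
      (hz _ _ ((e2 z p).symm.trans ((e =≫ snd X.X Y.X).trans (e2 z q))))
  have hsurj : ∀ {Z : GSch G} (z : Z ⟶ Y) (x : Pt (prodMod X Y).X) (p : Pt Z.X),
      p ≫ z.hom = x ≫ snd X.X Y.X → ∃ p, p ≫ (prodMap (𝟙 X) z).hom = x := fun {Z} z x p hp =>
    ⟨lift (x ≫ fst X.X Y.X) p, prod_hom_ext ((e1 z _).trans (lift_fst _ _))
      ((e2 z _).trans ((lift_snd _ _ =≫ z.hom).trans hp))⟩
  refine ⟨hinj z h.inj_left, hinj v h.inj_right, fun p q e => ?_, fun x => ?_⟩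
  · exact h.disj _ _ ((e2 z p).symm.trans ((e =≫ snd X.X Y.X).trans (e2 v q)))
  · rcases h.surj (x ≫ snd X.X Y.X) with ⟨p, hp⟩ | ⟨p, hp⟩
    · exact Or.inl (hsurj z x p hp)
    · exact Or.inr (hsurj v x p hp)

variable {B : GSch G} [MonObj B.X] [h : IsGMonoid B]

lemma GVar.IsCut.mk_conv {Y Z U : GVar B} {z : Z.X ⟶ Y.X} {v : U.X ⟶ Y.X} (h : Y.IsCut Z U z v)
    (X : GVar B) : K0.mk (X.conv Y) = K0.mk (X.conv Z) + K0.mk (X.conv U) := by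
  have key : ∀ {Z : GVar B} (z : Z.X ⟶ Y.X), z ≫ Y.str = Z.str →
      (prodMap (𝟙 X.X) z : (X.conv Z).X ⟶ (X.conv Y).X) ≫ (X.conv Y).str = (X.conv Z).str :=
    fun {Z} z hz => by
      apply Mod.Hom.ext
      refine hom_ext_pt fun p => ?_
      refine assoc'.symm.trans (((X.conv_str Y _).trans ?_).trans (X.conv_str Z p).symm)
      refine congrArg₂ (fun a b => a ≫ X.str.hom * b) ?_ ?_
      · exact (comp_prodMap_fst _ _ _).trans (comp_id _)
      · refine (comp_prodMap_snd (𝟙 X.X) z p =≫ Y.str.hom).trans ?_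
        exact assoc'.trans (_ ≫= congrArg Mod.Hom.hom hz)
  exact K0.mk_eq_add_of_decomp (X := X.conv Y) (Z := X.conv Z) (U := X.conv U) (prodMap (𝟙 X.X) z)
    (prodMap (𝟙 X.X) v) (key z h.closed_comp) (key v h.open_comp) (h.decomp.prod_left X.X)

def K0.convRight (Y : GVar B) : K0 B →+ K0 B := (K0.push (mulHom B)).comp (K0.prodRight Y)

lemma K0.convRight_mk (X Y : GVar B) : K0.convRight Y (K0.mk X) = K0.mk (X.conv Y) :=
  (congrArg (K0.push (mulHom B)) (K0.prodRight_mk X Y)).trans (K0.push_mk (mulHom B) (X.prod Y))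

def K0.convHom : K0 B →+ K0 B →+ K0 B :=
  (K0.lift K0.convRight fun Y Z U z v h => K0.hom_ext fun X => by
    rw [AddMonoidHom.add_apply, K0.convRight_mk, K0.convRight_mk, K0.convRight_mk, h.mk_conv]).flip

lemma K0.convHom_mk (X Y : GVar B) : K0.convHom (K0.mk X) (K0.mk Y) = K0.mk (X.conv Y) := by
  rw [K0.convHom, AddMonoidHom.flip_apply, K0.lift_mk, K0.convRight_mk]

lemma GVar.mk_conv_comm (X Y : GVar B) : K0.mk (X.conv Y) = K0.mk (Y.conv X) := by
  let f : (X.conv Y).X ⟶ (Y.conv X).X := prodLift (prodSnd X.X Y.X) (prodFst X.X Y.X)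
  have e1 : ∀ p : Pt (X.conv Y).X.X, (p ≫ f.hom : Pt (prodMod Y.X X.X).X) ≫ fst Y.X.X X.X.X =
      p ≫ snd X.X.X Y.X.X := fun p => comp_prodLift_fst _ _ p
  have e2 : ∀ p : Pt (X.conv Y).X.X, (p ≫ f.hom : Pt (prodMod Y.X X.X).X) ≫ snd Y.X.X X.X.X =
      p ≫ fst X.X.X Y.X.X := fun p => comp_prodLift_snd _ _ p
  refine K0.mk_eq_of_bijective f ?_ ⟨fun p q e => ?_, fun y => ?_⟩
  · apply Mod.Hom.ext
    refine hom_ext_pt fun p => ?_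
    refine assoc'.symm.trans (((Y.conv_str X _).trans ?_).trans (X.conv_str Y p).symm)
    refine (_root_.mul_comm _ _).trans (congrArg₂ (fun a b => a ≫ X.str.hom * b ≫ Y.str.hom) ?_ ?_)
    · exact e2 p
    · exact e1 p
  · exact prod_hom_ext ((e2 p).symm.trans ((e =≫ snd Y.X.X X.X.X).trans (e2 q)))
      ((e1 p).symm.trans ((e =≫ fst Y.X.X X.X.X).trans (e1 q)))
  · refine ⟨lift (y ≫ snd Y.X.X X.X.X) (y ≫ fst Y.X.X X.X.X), prod_hom_ext ?_ ?_⟩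
    · exact (e1 _).trans (lift_snd _ _)
    · exact (e2 _).trans (lift_fst _ _)

lemma GVar.mk_one_conv (X : GVar B) : K0.mk (GVar.one.conv X) = K0.mk X := by
  refine K0.mk_eq_of_bijective (X := GVar.one.conv X) (prodSnd GVar.one.X X.X) ?_
    ⟨fun p q e => ?_, fun y => ?_⟩
  · apply Mod.Hom.ext
    refine hom_ext_pt fun p => Eq.symm ?_
    refine (GVar.conv_str GVar.one X p).trans ?_
    refine (congrArg (· * _) (GVar.one_str _)).trans ((_root_.one_mul _).trans ?_)
    exact assoc _ _ _
  · exact prod_hom_ext (toUnit_unique (C := Sch k) _ _) e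
  · exact ⟨lift (toUnit (C := Sch k) _) y, lift_snd _ _⟩

lemma GVar.mk_conv_assoc (X Y Z : GVar B) :
    K0.mk ((X.conv Y).conv Z) = K0.mk (X.conv (Y.conv Z)) := by
  let a1 := prodFst (X.conv Y).X Z.X
  let a2 := prodSnd (X.conv Y).X Z.X
  let b1 : (X.conv Y).X ⟶ X.X := prodFst X.X Y.X
  let b2 : (X.conv Y).X ⟶ Y.X := prodSnd X.X Y.X
  let f0 : prodMod (X.conv Y).X Z.X ⟶ (Y.conv Z).X := prodLift (a1 ≫ b2) a2
  let f : ((X.conv Y).conv Z).X ⟶ (X.conv (Y.conv Z)).X := prodLift (a1 ≫ b1) f0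
  have e1 : ∀ p : Pt ((X.conv Y).conv Z).X.X,
      (p ≫ f.hom : Pt (prodMod X.X (Y.conv Z).X).X) ≫ fst X.X.X (Y.conv Z).X.X =
      (p ≫ a1.hom) ≫ b1.hom := fun p => (comp_prodLift_fst _ _ p).trans assoc'.symm
  have e2 : ∀ p : Pt ((X.conv Y).conv Z).X.X,
      (p ≫ f.hom : Pt (prodMod X.X (Y.conv Z).X).X) ≫ snd X.X.X (Y.conv Z).X.X =
      p ≫ f0.hom := fun p => comp_prodLift_snd _ _ p
  have e3 : ∀ p : Pt ((X.conv Y).conv Z).X.X,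
      (p ≫ f0.hom : Pt (prodMod Y.X Z.X).X) ≫ fst Y.X.X Z.X.X = (p ≫ a1.hom) ≫ b2.hom :=
    fun p => (comp_prodLift_fst _ _ p).trans assoc'.symm
  have e4 : ∀ p : Pt ((X.conv Y).conv Z).X.X,
      (p ≫ f0.hom : Pt (prodMod Y.X Z.X).X) ≫ snd Y.X.X Z.X.X = p ≫ a2.hom :=
    fun p => comp_prodLift_snd _ _ p
  refine K0.mk_eq_of_bijective f ?_ ⟨fun p q e => ?_, fun y => ?_⟩
  · apply Mod.Hom.ext
    refine hom_ext_pt fun p => ?_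
    refine assoc'.symm.trans (((X.conv_str (Y.conv Z) _).trans ?_).trans
      ((X.conv Y).conv_str Z p).symm)
    refine Eq.trans ?_ (congrArg (· * _) (X.conv_str Y _).symm)
    refine Eq.trans ?_ (_root_.mul_assoc _ _ _).symm
    refine congrArg₂ (fun a b => a ≫ X.str.hom * b) (e1 p) ?_
    refine (e2 p =≫ (Y.conv Z).str.hom).trans ((Y.conv_str Z _).trans ?_)
    exact congrArg₂ (fun a b => a ≫ Y.str.hom * b ≫ Z.str.hom) (e3 p) (e4 p)
  · have h1 := (e1 p).symm.trans ((e =≫ fst X.X.X (Y.conv Z).X.X).trans (e1 q))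
    have h2 := (e2 p).symm.trans ((e =≫ snd X.X.X (Y.conv Z).X.X).trans (e2 q))
    have h3 := (e3 p).symm.trans ((h2 =≫ fst Y.X.X Z.X.X).trans (e3 q))
    have h4 := (e4 p).symm.trans ((h2 =≫ snd Y.X.X Z.X.X).trans (e4 q))
    exact prod_hom_ext (X := (X.conv Y).X) (prod_hom_ext (X := X.X) (Y := Y.X) h1 h3) h4
  · let y1 : Pt X.X.X := y ≫ fst X.X.X (Y.conv Z).X.X
    let y2 : Pt (Y.conv Z).X.X := y ≫ snd X.X.X (Y.conv Z).X.X
    let p0 : Pt (X.conv Y).X.X := lift y1 (y2 ≫ fst Y.X.X Z.X.X)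
    let p : Pt ((X.conv Y).conv Z).X.X := lift p0 (y2 ≫ snd Y.X.X Z.X.X)
    have hp : p ≫ a1.hom = p0 := lift_fst _ _
    refine ⟨p, prod_hom_ext (X := X.X) (Y := (Y.conv Z).X) ((e1 p).trans ?_) ((e2 p).trans
      (prod_hom_ext (X := Y.X) (Y := Z.X) ((e3 p).trans ?_) ((e4 p).trans ?_)))⟩
    · exact (hp =≫ b1.hom).trans (lift_fst _ _)
    · exact (hp =≫ b2.hom).trans (lift_snd _ _)
    · exact lift_snd _ _

lemma K0.convHom_comm (a b : K0 B) : K0.convHom a b = K0.convHom b a := by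
  have : (K0.convHom : K0 B →+ K0 B →+ K0 B) = K0.convHom.flip := K0.hom_ext fun X =>
    K0.hom_ext fun Y => by
      rw [AddMonoidHom.flip_apply, K0.convHom_mk, K0.convHom_mk, X.mk_conv_comm]
  exact congrArg (fun f : K0 B →+ K0 B →+ K0 B => f a b) this

lemma K0.one_convHom (a : K0 B) : K0.convHom (K0.mk GVar.one) a = a := by
  have : K0.convHom (K0.mk (GVar.one : GVar B)) = AddMonoidHom.id _ := K0.hom_ext fun X =>
    (K0.convHom_mk _ _).trans X.mk_one_conv
  exact congrArg (fun f : K0 B →+ K0 B => f a) this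

lemma K0.convHom_assoc (a b c : K0 B) :
    K0.convHom (K0.convHom a b) c = K0.convHom a (K0.convHom b c) := by
  induction a using K0.induction with
  | zero => simp
  | add a a' h h' => simp [h, h']
  | neg a h => simp [h]
  | mk X =>
    induction b using K0.induction with
    | zero => simp
    | add a a' h h' => simp [h, h']
    | neg a h => simp [h]
    | mk Y =>
      induction c using K0.induction with
      | zero => simp
      | add a a' h h' => simp [h, h']
      | neg a h => simp [h]
      | mk Z => simp only [K0.convHom_mk, GVar.mk_conv_assoc]

variable (B) in
@[reducible] def K0.commRing : CommRing (K0 B) := { (inferInstance : AddCommGroup (K0 B)) with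
    mul := fun a b => K0.convHom a b
    one := K0.mk GVar.one
    left_distrib := fun a b c => map_add _ _ _
    right_distrib := fun a b c => by
      change K0.convHom (a + b) c = _
      rw [map_add]
      rfl
    zero_mul := fun a => by
      change K0.convHom 0 a = 0
      simp
    mul_zero := fun a => map_zero (K0.convHom a)
    mul_assoc := K0.convHom_assoc
    one_mul := K0.one_convHom
    mul_one := fun a => (K0.convHom_comm _ _).trans (K0.one_convHom a)
    mul_comm := K0.convHom_comm }

/-! ### The `λ`-structure -/

lemma GVar.IsSym.mk_zero {X Q : GVar B} {q : (X.pow 0).X ⟶ Q.X} (hq : GVar.IsSym 0 X Q q) :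
    K0.mk Q = K0.mk GVar.one :=
  (K0.mk_eq_of_bijective (X := X.pow 0) q hq.str
    ⟨fun _ _ _ => toUnit_unique (C := Sch k) _ _, hq.surj⟩).symm

lemma GVar.IsSym.mk_one {X Q : GVar B} {q : (X.pow 1).X ⟶ Q.X} (hq : GVar.IsSym 1 X Q q) :
    K0.mk Q = K0.mk X := by
  refine (K0.mk_eq_of_bijective (X := X.pow 1) q hq.str
    ⟨fun x x' e => X.pow_hom_ext fun i => ?_, hq.surj⟩).symm.trans
    ((X.mk_conv_comm GVar.one).trans X.mk_one_conv)
  have h1 := (hq.fib x x').1 e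
  have h2 : ∀ x : Pt (X.pow 1).X.X, X.toM x = {x ≫ (X.powπ 1 0).hom} := fun x => by simp [GVar.toM]
  rw [h2, h2, Multiset.singleton_inj] at h1
  rw [Subsingleton.elim i 0]
  exact h1

variable (B) in
lemma exists_lambda : ∃ L : LambdaRingStr (K0 B), L.one = K0.mk GVar.one ∧
    (∀ X Y : GVar B, L.mul (K0.mk X) (K0.mk Y) = K0.mk (X.conv Y)) ∧
    ∀ (n : ℕ) (X Q : GVar B) (q : (X.pow n).X ⟶ Q.X), IsNice X.X → GVar.IsSym n X Q q →
      L.σ n (K0.mk X) = K0.mk Q := by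
  classical
  let _ := K0.commRing B
  have hex : ∀ X : GVar B, ∃ s : ℕ → K0 B, IsNice X.X →
      ∀ n, ∃ (Q : GVar B) (q : (X.pow n).X ⟶ Q.X), GVar.IsSym n X Q q ∧ s n = K0.mk Q := fun X => by
    by_cases hX : IsNice X.X
    · choose Q q h using X.exists_isSym hX
      exact ⟨fun n => K0.mk (Q n), fun _ n => ⟨Q n, q n, h n, rfl⟩⟩
    · exact ⟨0, fun h => (hX h).elim⟩
  choose s hs using hex
  have hu : ∀ X : GVar B, IsNice X.X → IsUnit (PowerSeries.mk (s X)) := fun X hX => by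
    rw [PowerSeries.isUnit_iff_constantCoeff]
    obtain ⟨Q, q, hq, e⟩ := hs X hX 0
    have : PowerSeries.constantCoeff (PowerSeries.mk (s X)) = 1 := by
      rw [PowerSeries.constantCoeff_mk, e]
      exact hq.mk_zero
    rw [this]
    exact isUnit_one
  let F : GVar B → Additive (PowerSeries (K0 B))ˣ := fun X =>
    if hX : IsNice X.X then Additive.ofMul (hu X hX).unit else 0
  have hF : ∀ X, IsNice X.X → ((F X).toMul : PowerSeries (K0 B)) = PowerSeries.mk (s X) :=
    fun X hX => by simp only [F, dif_pos hX]; rfl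
  have hadd : IsAdditiveOnNice F := fun X Z U z v hX hZ hU hz hv hd => by
    apply Additive.toMul.injective
    apply Units.ext
    rw [toMul_add, Units.val_mul, hF X hX, hF Z hZ, hF U hU]
    ext n
    rw [PowerSeries.coeff_mul, PowerSeries.coeff_mk]
    obtain ⟨Q, q, hq, e⟩ := hs X hX n
    choose QZ qZ hqZ eZ using hs Z hZ
    choose QU qU hqU eU using hs U hU
    rw [e, hq.mk_eq_sum hqZ hqU z v hz hv hd]
    refine Finset.sum_congr rfl fun p _ => ?_
    rw [PowerSeries.coeff_mk, PowerSeries.coeff_mk, eZ, eU]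
    exact (K0.convHom_mk _ _).symm
  obtain ⟨Φ, hΦ⟩ := hadd.exists_hom
  let c : ℕ → K0 B → K0 B := fun n a => PowerSeries.coeff n ((Φ a).toMul : PowerSeries (K0 B))
  have hc : ∀ n X, IsNice X.X → c n (K0.mk X) = s X n := fun n X hX => by
    simp only [c]
    rw [hΦ X hX, hF X hX, PowerSeries.coeff_mk]
  have cadd : ∀ n a b, c n (a + b) =
      ∑ p ∈ Finset.HasAntidiagonal.antidiagonal n, c p.1 a * c p.2 b := fun n a b => by
    simp only [c]
    rw [map_add, toMul_add, Units.val_mul, PowerSeries.coeff_mul]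
  have czero : ∀ n, c (n + 1) 0 = 0 := fun n => by
    simp only [c]
    rw [map_zero]
    exact (PowerSeries.coeff_one _).trans (if_neg (Nat.succ_ne_zero n))
  have c00 : c 0 0 = 1 := by
    simp only [c]
    rw [map_zero]
    exact (PowerSeries.coeff_one _).trans (if_pos rfl)
  have c0 : ∀ a, c 0 a = 1 := fun a => by
    induction a using K0.induction_nice with
    | zero => exact c00
    | mk X hX =>
      obtain ⟨Q, q, hq, e⟩ := hs X hX 0
      rw [hc 0 X hX, e]
      exact hq.mk_zero
    | add a b ha hb => rw [cadd, Finset.Nat.antidiagonal_zero, Finset.sum_singleton, ha, hb]; exact _root_.one_mul _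
    | neg a ha =>
      have := cadd 0 a (-a)
      rw [add_neg_cancel, c00, Finset.Nat.antidiagonal_zero, Finset.sum_singleton, ha] at this
      exact (_root_.one_mul _).symm.trans this.symm
  have c1add : ∀ a b, c 1 (a + b) = c 1 a + c 1 b := fun a b => by
    rw [cadd, Finset.Nat.antidiagonal_succ]
    simp [c0, add_comm]
  have c1 : ∀ a, c 1 a = a := fun a => by
    induction a using K0.induction_nice with
    | zero => exact czero 0
    | mk X hX =>
      obtain ⟨Q, q, hq, e⟩ := hs X hX 1
      rw [hc 1 X hX, e]
      exact hq.mk_one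
    | add a b ha hb => rw [c1add, ha, hb]
    | neg a ha =>
      have := c1add a (-a)
      rw [add_neg_cancel, czero 0, ha] at this
      exact (eq_neg_of_add_eq_zero_right this.symm)
  refine ⟨⟨K0.mk GVar.one, K0.convHom, c, K0.convHom_comm, K0.convHom_assoc, K0.one_convHom,
    c0, c1, czero, cadd⟩, rfl, K0.convHom_mk, fun n X Q q hX hq => ?_⟩
  obtain ⟨Q', q', hq', e⟩ := hs X hX n
  exact (hc n X hX).trans (e.trans (hq'.mk_unique hq))

namespace LambdaRingStr
variable {L : LambdaRingStr (K0 B)}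

lemma closure_nice : AddSubgroup.closure {a : K0 B | ∃ X : GVar B, IsNice X.X ∧ a = K0.mk X} = ⊤ := by
  refine top_unique fun a _ => ?_
  induction a using K0.induction_nice with
  | zero => exact AddSubgroup.zero_mem _
  | mk X hX => exact AddSubgroup.subset_closure ⟨X, hX, rfl⟩
  | add a b ha hb => exact AddSubgroup.add_mem _ (ha trivial) (hb trivial)
  | neg a ha => exact AddSubgroup.neg_mem _ (ha trivial)

variable (B) in
theorem existsUnique_isConvSym : ∃! L : LambdaRingStr (K0 B), L.IsConvSym := by
  obtain ⟨L, h1, hm, hσ⟩ := exists_lambda B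
  have hL : L.IsConvSym := ⟨h1, hm, fun n X Q q hq => by
    obtain ⟨X', f, hX', hf, hb⟩ := X.exists_nice
    obtain ⟨Q', q', hq'⟩ := X'.exists_isSym hX' n
    obtain ⟨q, hq⟩ := hq.exists_isSym
    rw [← K0.mk_eq_of_bijective f hf hb, hσ n X' Q' q' hX' hq']
    exact hq'.mk_eq_of_bijective hq f hf hb⟩
  refine ⟨L, hL, fun L' hL' => eq_of_closure closure_nice (hL'.one_eq.trans h1.symm) ?_ ?_⟩
  · rintro _ ⟨X, -, rfl⟩ _ ⟨Y, -, rfl⟩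
    exact (hL'.mul_mk X Y).trans (hm X Y).symm
  · rintro _ ⟨X, hX, rfl⟩ n
    obtain ⟨Q, q, hq⟩ := X.exists_isSymPower hX n
    exact (hL'.σ_mk n X Q q hq).trans (hL.σ_mk n X Q q hq).symm

lemma IsConvSym.σ_eq (hL : L.IsConvSym) {n : ℕ} {X Q : GVar B} {q : (X.pow n).X ⟶ Q.X}
    (hq : GVar.IsSym n X Q q) : L.σ n (K0.mk X) = K0.mk Q := by
  obtain ⟨X', f, hX', hf, hb⟩ := X.exists_nice
  obtain ⟨Q', q', hq'⟩ := X'.exists_isSymPower hX' n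
  obtain ⟨q'', hq''⟩ := hq'.exists_isSym
  rw [← K0.mk_eq_of_bijective f hf hb, hL.σ_mk n X' Q' q' hq']
  exact hq''.mk_eq_of_bijective hq f hf hb

end LambdaRingStr
end

section
/-! ### Pullback along immersions of the base -/

variable {G : Sch k} [GrpObj G]

variable [GoodGrp G]

lemma GSch.exists_lift {W X Z : GSch G} [LFT W.X.hom] [IsReduced W.X.left]
    (j : Z ⟶ X) [IsImmersion j.hom.left] (f : W ⟶ X)
    (h : ∀ w : Pt W.X, ∃ z : Pt Z.X, z ≫ j.hom = w ≫ f.hom) :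
    ∃ f' : W ⟶ Z, f' ≫ j = f := by
  obtain ⟨f', hf'⟩ := exists_lift_pt j.hom f.hom h
  have := mono_of_left j.hom
  refine ⟨GSch.homMk f' fun g x => ?_, Mod.Hom.ext hf'⟩
  rw [← cancel_mono j.hom, assoc, hf']
  refine (GSch.smul_comp f g x).trans (Eq.trans ?_ (GSch.smul_comp j g _).symm)
  rw [assoc, hf']

variable {B C : GSch G} [LFT B.X.hom] [LFT C.X.hom]

/-- `i : Z ⟶ X` identifies the `k`-points of `Z` with those of `X ×_B C`. -/
structure IsPull (s : C ⟶ B) (X : GVar B) (Z : GVar C) (i : Z.X ⟶ X.X) : Prop where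
  comm : ∀ z : Pt Z.X.X, (z ≫ i.hom) ≫ X.str.hom = (z ≫ Z.str.hom) ≫ s.hom
  inj : ∀ z z' : Pt Z.X.X, z ≫ i.hom = z' ≫ i.hom → z = z'
  surj : ∀ (x : Pt X.X.X) (c : Pt C.X), x ≫ X.str.hom = c ≫ s.hom → ∃ z, z ≫ i.hom = x

lemma GVar.exists_pull (s : C ⟶ B) [IsImmersion s.hom.left] (X : GVar B) :
    ∃ (Z : GVar C) (i : Z.X ⟶ X.X), IsPull s X Z i ∧ IsImmersion i.hom.left ∧
      Set.range i.hom.left = X.str.hom.left ⁻¹' Set.range s.hom.left := by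
  have hs : InvLC X.X (X.str.hom.left ⁻¹' Set.range s.hom.left) :=
    ⟨s.hom.left.isLocallyClosed_range.preimage X.str.hom.left.continuous,
      (invSet_range s).preimage X.str⟩
  have hm := mono_of_left s.hom
  have hex (w : Pt (X.sub hs).X.X) :
      ∃ z : Pt C.X, z ≫ s.hom = w ≫ (X.subι hs ≫ X.str).hom := by
    refine exists_pt_lift s.hom (w ≫ (X.subι hs ≫ X.str).hom) ?_
    rw [GSch.comp_hom]
    exact (X.exists_subι_iff hs _).1 ⟨w, rfl⟩
  obtain ⟨t, ht⟩ := GSch.exists_lift s (X.subι hs ≫ X.str) hex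
  have hq : QuasiCompact t.hom.left := by
    have : QuasiCompact (t.hom.left ≫ s.hom.left) :=
      (congrArg (fun f : (X.sub hs).X ⟶ B => QuasiCompact f.hom.left) ht).mpr
        (X.sub hs).quasiCompact
    exact .of_comp t.hom.left s.hom.left
  refine ⟨(X.sub hs).over t hq, X.subι hs, ⟨fun z => ?_, fun z z' => X.subι_injective hs,
    fun x c h => ?_⟩, (inferInstance : IsImmersion (X.subι hs).hom.left), X.range_subι hs⟩
  · exact (GSch.comp_hom _ _ z).symm.trans (GSch.comp_eq ht z).symm
  · refine (X.exists_subι_iff hs x).2 ?_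
    exact ⟨c.val, congrArg Pt.val h.symm⟩

variable {s : C ⟶ B} {X : GVar B} {Z : GVar C} {i : Z.X ⟶ X.X}

lemma IsPull.exists_lift [IsImmersion s.hom.left] (h : IsPull s X Z i) [IsImmersion i.hom.left]
    {X' : GVar B} {Z' : GVar C} {i' : Z'.X ⟶ X'.X} (h' : IsPull s X' Z' i') (f : X'.X ⟶ X.X)
    (hf : f ≫ X.str = X'.str) : ∃ f' : Z'.X ⟶ Z.X, f' ≫ i = i' ≫ f ∧ f' ≫ Z.str = Z'.str := by
  have e (w : Pt Z'.X.X) : (w ≫ (i' ≫ f).hom) ≫ X.str.hom = (w ≫ Z'.str.hom) ≫ s.hom := by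
    rw [GSch.comp_hom, GSch.comp_eq hf]
    exact h'.comm w
  obtain ⟨f', hf'⟩ := GSch.exists_lift i (i' ≫ f) fun w => h.surj _ _ (e w)
  have hm := mono_of_left s.hom
  refine ⟨f', hf', GSch.ext_of_comp fun w => ?_⟩
  rw [← cancel_mono s.hom]
  refine (h.comm _).symm.trans (Eq.trans ?_ (e w))
  exact GSch.comp_eq hf' w =≫ X.str.hom

/-- The pullback along an immersion of the base. -/
def K0.pull (s : C ⟶ B) [IsImmersion s.hom.left] : K0 B →+ K0 C :=
  K0.lift (fun X => K0.mk (X.exists_pull s).choose) fun X Y U i j hc => by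
    obtain ⟨a, ha, hai, -⟩ := (X.exists_pull s).choose_spec
    obtain ⟨b, hb, -⟩ := (Y.exists_pull s).choose_spec
    obtain ⟨c, hc', -⟩ := (U.exists_pull s).choose_spec
    obtain ⟨f, hf, hf'⟩ := ha.exists_lift hb i hc.closed_comp
    obtain ⟨g, hg, hg'⟩ := ha.exists_lift hc' j hc.open_comp
    have hd := hc.decomp
    have e {p : Pt _} : (p ≫ f.hom) ≫ a.hom = (p ≫ b.hom) ≫ i.hom :=
      (GSch.comp_eq hf p).trans (GSch.comp_hom _ _ p)
    have e' {p : Pt _} : (p ≫ g.hom) ≫ a.hom = (p ≫ c.hom) ≫ j.hom :=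
      (GSch.comp_eq hg p).trans (GSch.comp_hom _ _ p)
    refine K0.mk_eq_add_of_decomp f g hf' hg' ⟨fun p q h => ?_, fun p q h => ?_, fun p q h => ?_,
      fun x => ?_⟩
    · exact hb.inj _ _ (hd.inj_left _ _ (e.symm.trans ((h =≫ a.hom).trans e)))
    · exact hc'.inj _ _ (hd.inj_right _ _ (e'.symm.trans ((h =≫ a.hom).trans e')))
    · exact hd.disj _ _ (e.symm.trans ((h =≫ a.hom).trans e'))
    · rcases hd.surj (x ≫ a.hom) with ⟨p, hp⟩ | ⟨p, hp⟩
      · obtain ⟨z, hz⟩ := hb.surj p (x ≫ (X.exists_pull s).choose.str.hom)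
          ((GSch.comp_eq hc.closed_comp p).symm.trans
            ((hp =≫ X.str.hom).trans (ha.comm x)))
        exact Or.inl ⟨z, ha.inj _ _ (e.trans ((hz =≫ i.hom).trans hp))⟩
      · obtain ⟨z, hz⟩ := hc'.surj p (x ≫ (X.exists_pull s).choose.str.hom)
          ((GSch.comp_eq hc.open_comp p).symm.trans
            ((hp =≫ X.str.hom).trans (ha.comm x)))
        exact Or.inr ⟨z, ha.inj _ _ (e'.trans ((hz =≫ j.hom).trans hp))⟩

lemma IsPull.mk_eq [IsImmersion s.hom.left] (h : IsPull s X Z i) :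
    K0.pull s (K0.mk X) = K0.mk Z := by
  obtain ⟨a, ha, hai, -⟩ := (X.exists_pull s).choose_spec
  obtain ⟨f, hf, hf'⟩ := ha.exists_lift h (𝟙 X.X) (id_comp _)
  have e (p : Pt Z.X.X) : (p ≫ f.hom) ≫ a.hom = p ≫ i.hom :=
    (GSch.comp_eq hf p).trans (congrArg (fun t : Z.X ⟶ X.X => p ≫ t.hom) (comp_id i))
  refine (K0.lift_mk _ _ X).trans (K0.mk_eq_of_bijective f hf' ⟨fun p q hpq => ?_, fun x => ?_⟩).symm
  · exact h.inj _ _ ((e p).symm.trans ((hpq =≫ a.hom).trans (e q)))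
  · obtain ⟨z, hz⟩ := h.surj (x ≫ a.hom) _ (ha.comm x)
    exact ⟨z, ha.inj _ _ ((e z).trans hz)⟩

lemma IsPull.res {H : Sch k} [GrpObj H] [GoodGrp H] (φ : H ⟶ G) [IsMonHom φ]
    [LFT ((Mod.comap φ).obj B).X.hom]
    [LFT ((Mod.comap φ).obj C).X.hom] (h : IsPull s X Z i) :
    IsPull ((Mod.comap φ).map s) (X.res φ) (Z.res φ)
      ((Mod.comap φ).map i) := ⟨h.comm, h.inj, h.surj⟩

lemma IsPull.trans [IsImmersion s.hom.left] {D : GSch G} [LFT D.X.hom] (h : IsPull s X Z i) {t : D ⟶ C}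
    {W : GVar D} {j : W.X ⟶ Z.X} (h' : IsPull t Z W j) : IsPull (t ≫ s) X W (j ≫ i) where
  comm z := by rw [GSch.comp_hom, h.comm, h'.comm, GSch.comp_hom]
  inj z z' e := by
    rw [GSch.comp_hom, GSch.comp_hom] at e
    exact h'.inj _ _ (h.inj _ _ e)
  surj x c e := by
    rw [GSch.comp_hom] at e
    obtain ⟨z, hz⟩ := h.surj x _ e
    have hm := mono_of_left s.hom
    obtain ⟨w, hw⟩ := h'.surj z c (by rw [← cancel_mono s.hom, ← h.comm, hz, e])
    exact ⟨w, (GSch.comp_hom _ _ w).trans ((hw =≫ i.hom).trans hz)⟩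
end

section
/-! ### Points of diagonalizable groups -/

section Diag
variable {M : Type} [AddCommGroup M] {T : Sch k}

lemma Diag.hom_ext {f g : T ⟶ Diag k M} (h : ∀ m, chi m f = chi m g) : f = g := by
  have : IsAffine (Diag k M).left := inferInstanceAs (IsAffine (Spec (.of (AddMonoidAlgebra k M))))
  apply Over.OverMorphism.ext
  apply ext_of_isAffine
  have e : (fnPull f).comp (Diag.fn (k := k) (M := M)) = (fnPull g).comp (Diag.fn (k := k) (M := M)) := by
    apply AddMonoidAlgebra.ringHom_ext
    · intro a
      rw [RingHom.comp_apply, RingHom.comp_apply, Diag.fn_single, map_mul, map_mul, fnPull_fnC,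
        fnPull_fnC]
      exact congrArg (· * _) (h 0)
    · intro m
      rw [RingHom.comp_apply, RingHom.comp_apply, Diag.fn_single, map_mul, map_mul, fnPull_fnC,
        fnPull_fnC]
      exact congrArg (· * _) (h m)
  ext a
  obtain ⟨b, rfl⟩ := (Scheme.ΓSpecIso (.of (AddMonoidAlgebra k M))).symm.commRingCatIsoToRingEquiv.surjective a
  exact congrArg (fun t => t b) e

lemma toSpecΓ_fnC : T.left.toSpecΓ ≫ Spec.map (CommRingCat.ofHom (fnC T)) = T.hom := by
  have h := Scheme.toSpecΓ_naturality T.hom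
  have h2 : (CommRingCat.ofHom (fnC T)) = (Scheme.ΓSpecIso (.of k)).inv ≫ T.hom.appTop := rfl
  rw [h2, Spec.map_comp, ← assoc, ← h, assoc]
  exact (T.hom ≫= toSpecΓ_SpecMap_ΓSpecIso_inv (.of k)).trans (comp_id _)

lemma Diag.exists_hom (f : Multiplicative M →* Γ(T.left, ⊤)) :
    ∃ g : T ⟶ Diag k M, ∀ m, chi m g = f (.ofAdd m) := by
  let F : AddMonoidAlgebra k M →+* Γ(T.left, ⊤) :=
    AddMonoidAlgebra.liftNCRingHom (fnC T) f fun _ _ => Commute.all _ _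
  have hF : F.comp (algebraMap k (AddMonoidAlgebra k M)) = fnC T := by
    ext a
    rw [RingHom.comp_apply, AddMonoidAlgebra.coe_algebraMap]
    exact (AddMonoidAlgebra.liftNCRingHom_single _ _ _ _ _).trans (by simp)
  refine ⟨Over.homMk (T.left.toSpecΓ ≫ Spec.map (CommRingCat.ofHom F)) ?_, fun m => ?_⟩
  · refine assoc'.trans (Eq.trans ?_ toSpecΓ_fnC)
    refine _ ≫= (Spec.map_comp _ _).symm.trans (congrArg (fun t => Spec.map (CommRingCat.ofHom t)) hF)
  · refine (Diag.appTop_SpecMap T.left.toSpecΓ (CommRingCat.ofHom F) (.single m 1)).trans ?_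
    rw [Scheme.toSpecΓ_appTop]
    refine (congrArg (fun t => t.hom (F (.single m 1)))
      (Scheme.ΓSpecIso Γ(T.left, ⊤)).inv_hom_id).trans ?_
    have h := AddMonoidAlgebra.liftNCRingHom_single (fnC T) f (fun _ _ => Commute.all _ _) m 1
    rw [map_one, _root_.one_mul] at h
    exact h

lemma Diag.chi_zero (g : T ⟶ Diag k M) : chi 0 g = 1 := by
  rw [← zero_nsmul (0 : M), chi_nsmul, pow_zero]

lemma Diag.chi_add (m n : M) (g : T ⟶ Diag k M) : chi (m + n) g = chi m g * chi n g := by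
  have h : (AddMonoidAlgebra.single (m + n) 1 : AddMonoidAlgebra k M) =
    AddMonoidAlgebra.single m 1 * AddMonoidAlgebra.single n 1 := by
      simp [AddMonoidAlgebra.single_mul_single]
  exact (congrArg (fnPull g) ((congrArg Diag.fn h).trans (map_mul Diag.fn _ _))).trans
    (map_mul (fnPull g) _ _)

lemma Diag.isUnit_chi (m : M) (g : T ⟶ Diag k M) : IsUnit (chi m g) := by
  refine IsUnit.of_mul_eq_one (chi m g⁻¹) ?_
  rw [← chi_mul, mul_inv_cancel, chi_one]
end Diag

section
variable {T : Sch k}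

lemma Gm.hom_ext {f g : T ⟶ Gm k} (h : Diag.chi 1 f = Diag.chi 1 g) : f = g := by
  have hn (n : ℕ) : Diag.chi (n : ℤ) f = Diag.chi (n : ℤ) g := by
    rw [← nsmul_one, Diag.chi_nsmul, Diag.chi_nsmul, h]
  have h0 (m : ℤ) (f : T ⟶ Gm k) : Diag.chi (-m) f * Diag.chi m f = 1 := by
    rw [← Diag.chi_add, neg_add_cancel, Diag.chi_zero]
  refine Diag.hom_ext fun m => ?_
  obtain ⟨n, rfl | rfl⟩ := m.eq_nat_or_neg
  · exact hn n
  · refine (Diag.isUnit_chi (n : ℤ) f).mul_right_cancel ?_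
    rw [h0, hn, h0]

lemma Gm.exists_hom {a : Γ(T.left, ⊤)} (ha : IsUnit a) : ∃ g : T ⟶ Gm k, Diag.chi 1 g = a := by
  obtain ⟨u, rfl⟩ := ha
  obtain ⟨g, hg⟩ := Diag.exists_hom (T := T) ((Units.coeHom _).comp (zpowersHom _ u))
  exact ⟨g, (hg 1).trans (by simp)⟩

lemma Mu.hom_ext {d : ℕ} [NeZero d] {f g : T ⟶ Mu k d} (h : Diag.chi 1 f = Diag.chi 1 g) :
    f = g := by
  refine Diag.hom_ext fun m => ?_
  rw [← ZMod.natCast_zmod_val m, ← nsmul_one, Diag.chi_nsmul, Diag.chi_nsmul, h]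

lemma chi_muToGm {d : ℕ} (c : T ⟶ Mu k d) : Diag.chi 1 (c ≫ muToGm k d) = Diag.chi 1 c := by
  rw [Diag.chi_map]
  simp

lemma muToGm_injective {d : ℕ} [NeZero d] {c c' : T ⟶ Mu k d}
    (h : c ≫ muToGm k d = c' ≫ muToGm k d) : c = c' :=
  Mu.hom_ext (by rw [← chi_muToGm, h, chi_muToGm])

lemma comp_muToGm_pow {d : ℕ} (c : T ⟶ Mu k d) : (c ≫ muToGm k d) ^ d = 1 := by
  apply Gm.hom_ext
  rw [Diag.chi_pow, chi_muToGm, ← Diag.chi_nsmul, Diag.chi_one, nsmul_one, ZMod.natCast_self,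
    Diag.chi_zero]

lemma exists_comp_muToGm {d : ℕ} (x : T ⟶ Gm k) (h : x ^ d = 1) :
    ∃ c : T ⟶ Mu k d, c ≫ muToGm k d = x := by
  obtain ⟨u, hu⟩ := Diag.isUnit_chi 1 x
  have hd : u ^ d = 1 := by
    ext
    rw [Units.val_pow_eq_pow_val, hu, ← Diag.chi_pow, h, Diag.chi_one, Units.val_one]
  let F := ZMod.lift d ⟨zmultiplesHom (Additive Γ(T.left, ⊤)ˣ) (.ofMul u), by
    simpa using congrArg Additive.ofMul hd⟩
  obtain ⟨c, hc⟩ := Diag.exists_hom (T := T) ((Units.coeHom _).comp F.toMultiplicativeLeft)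
  refine ⟨c, Gm.hom_ext ?_⟩
  have h1 : F 1 = .ofMul u := by
    have := ZMod.lift_coe d ⟨zmultiplesHom (Additive Γ(T.left, ⊤)ˣ) (.ofMul u), by
      simpa using congrArg Additive.ofMul hd⟩ 1
    rw [Int.cast_one] at this
    exact this.trans (one_zsmul _)
  rw [chi_muToGm, hc, ← hu]
  exact congrArg (fun t : Additive Γ(T.left, ⊤)ˣ => (t.toMul : Γ(T.left, ⊤))) h1
end

instance (d : ℕ) [NeZero d] : Finite (Pt (Mu k d)) := by
  have hf : Set.Finite {a : PtRing k | a ^ d = 1} := by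
    classical
    exact (Polynomial.nthRoots d (1 : PtRing k)).toFinset.finite_toSet.subset fun a ha =>
      Multiset.mem_toFinset.2 ((Polynomial.mem_nthRoots (NeZero.pos d)).2 ha)
  have := hf.to_subtype
  have h1 (c : Pt (Mu k d)) : Diag.chi 1 c ^ d = 1 := by
    rw [← chi_muToGm, ← Diag.chi_pow, comp_muToGm_pow, Diag.chi_one]
  exact Finite.of_injective (fun c : Pt (Mu k d) => (⟨_, h1 c⟩ : {a : PtRing k | a ^ d = 1}))
    fun c c' h => Mu.hom_ext (congrArg Subtype.val h)

lemma exists_pow_eq (d : ℕ) [NeZero d] (x : Pt (Gm k)) : ∃ y : Pt (Gm k), y ^ d = x := by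
  obtain ⟨a, ha⟩ := (fnC_unit_bijective k).2 (Diag.chi 1 x)
  obtain ⟨b, rfl⟩ := IsAlgClosed.exists_pow_nat_eq a (NeZero.pos d)
  have hb : IsUnit (fnC (𝟙_ (Sch k)) b) := by
    have h := Diag.isUnit_chi 1 x
    rw [← ha, map_pow] at h
    exact (isUnit_pow_iff (NeZero.ne d)).1 h
  obtain ⟨y, hy⟩ := Gm.exists_hom hb
  exact ⟨y, Gm.hom_ext (by rw [Diag.chi_pow, hy, ← map_pow, ha])⟩

/-! ### Sections and the complement of the zero section -/

lemma isUnit_of_basicOpen_eq_top {X : Scheme.{u}} {a : Γ(X, ⊤)} (h : X.basicOpen a = ⊤) :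
    IsUnit a := by
  have key : ∀ (U : X.Opens) (_ : U = ⊤) (hU : U ≤ ⊤),
      IsUnit (X.presheaf.map (homOfLE hU).op a) → IsUnit a := by
    rintro _ rfl hU h
    have e : (homOfLE hU).op = 𝟙 _ := rfl
    rw [e, X.presheaf.map_id] at h
    exact h
  exact key _ h _ (X.toRingedSpace.isUnit_res_basicOpen a)

lemma Gm.exists_lift {T : Sch k} (f : T ⟶ A1 k) (h : IsUnit (A1.coord f)) :
    ∃ g : T ⟶ Gm k, g ≫ A1.mk (Diag.chi 1 (𝟙 (Gm k))) = f := by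
  obtain ⟨g, hg⟩ := Gm.exists_hom h
  exact ⟨g, A1.ext ((coord_gm g).trans hg)⟩

instance isOpenImmersion_gmToA1 : IsOpenImmersion (A1.mk (Diag.chi 1 (𝟙 (Gm k)))).left := by
  let U := (A1 k).left.basicOpen (A1.coord (𝟙 (A1 k)))
  let g := A1.mk (Diag.chi 1 (𝟙 (Gm k)))
  have hU : IsUnit (A1.coord (openObjι (A1 k) U)) := by
    refine isUnit_of_basicOpen_eq_top ?_
    have := A1.coord_comp (openObjι (A1 k) U) (𝟙 _)
    rw [comp_id] at this
    rw [this, ← preimage_basicOpen_fnPull]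
    ext x
    exact iff_of_true ((range_openObjι (A1 k) U).subset ⟨x, rfl⟩) trivial
  obtain ⟨e, he⟩ := Gm.exists_lift (openObjι (A1 k) U) hU
  have hr : Set.range g.left ⊆ Set.range (openObjι (A1 k) U).left := by
    rw [range_openObjι]
    rintro _ ⟨x, rfl⟩
    have h1 : g.left ⁻¹ᵁ U = ⊤ := by
      rw [preimage_basicOpen_fnPull, ← A1.coord_comp, comp_id]
      refine Scheme.basicOpen_of_isUnit _ ?_
      rw [A1.coord_mk]
      exact Diag.isUnit_chi _ _
    exact (congrArg (x ∈ ·) h1).mpr trivial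
  let f := IsOpenImmersion.lift (openObjι (A1 k) U).left g.left hr
  have hf : f ≫ (openObjι (A1 k) U).left = g.left := IsOpenImmersion.lift_fac _ _ _
  let f' : Gm k ⟶ openObj (A1 k) U := Over.homMk f (by
    rw [← Over.w (openObjι (A1 k) U), ← assoc, hf, Over.w])
  have hf' : f' ≫ openObjι (A1 k) U = g := Over.OverMorphism.ext hf
  have h1 : f' ≫ e = 𝟙 _ := by
    apply Gm.hom_ext
    rw [← coord_gm, assoc, he, hf', A1.coord_mk]
  have hm := mono_of_left (openObjι (A1 k) U)
  have h2 : e ≫ f' = 𝟙 _ := by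
    rw [← cancel_mono (openObjι (A1 k) U), assoc, hf', id_comp]
    exact he
  have : IsIso f' := ⟨e, h1, h2⟩
  have : IsIso f'.left := inferInstanceAs (IsIso ((Over.forget _).map f'))
  rw [← hf]
  exact (inferInstance : IsOpenImmersion (f'.left ≫ (openObjι (A1 k) U).left))

instance (S : Sch k) (d : ℕ) : IsOpenImmersion (glToA1 S d).hom.left :=
  tensorHom_left (P := @IsOpenImmersion) (inferInstance : IsOpenImmersion (𝟙 S.left))
    (isOpenImmersion_gmToA1 (k := k))

lemma isClosedImmersion_section {S Y : Sch k} [IsSeparated Y.hom] (y : S ⟶ Y) :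
    IsClosedImmersion (lift (𝟙 S) y).left := by
  have h1 : (lift (𝟙 S) y).left ≫ (fst S Y).left = 𝟙 _ := congrArg Over.Hom.left (lift_fst (𝟙 S) y)
  have : IsSeparated (fst S Y).left := (inferInstance : IsSeparated (pullback.fst S.hom Y.hom))
  have : IsClosedImmersion ((lift (𝟙 S) y).left ≫ (fst S Y).left) := by rw [h1]; infer_instance
  exact .of_comp _ (fst S Y).left
end

section
/-! ### The decomposition along the zero section -/

instance (d : ℕ) : LFT (GmW (k := k) d).X.hom := inferInstanceAs (LFT (Gm k).hom)

lemma zeroSec_fst (S : Sch k) (d : ℕ) {T : Sch k} (x : T ⟶ S) :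
    (x ≫ zeroSec S d) ≫ fst S (A1 k) = x :=
  assoc'.trans ((x ≫= lift_fst _ _).trans (comp_id x))

lemma zeroSec_snd (S : Sch k) (d : ℕ) {T : Sch k} (x : T ⟶ S) :
    A1.coord ((x ≫ zeroSec S d) ≫ snd S (A1 k)) = 0 := by
  refine (congrArg A1.coord (assoc'.trans (x ≫= lift_snd (𝟙 S) (A1.mk 0)))).trans ?_
  rw [A1.coord_comp, A1.coord_mk, map_zero]

lemma A1S_hom_ext {S : Sch k} {d : ℕ} {T : Sch k} {x y : T ⟶ (A1S S d).X}
    (h : x ≫ fst S (A1 k) = y ≫ fst S (A1 k))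
    (h' : A1.coord (x ≫ snd S (A1 k)) = A1.coord (y ≫ snd S (A1 k))) : x = y :=
  CartesianMonoidalCategory.hom_ext (X := S) (Y := A1 k) _ _ h (A1.ext h')

lemma A1S_smul_fst {S : Sch k} {d : ℕ} {T : Sch k} (g : T ⟶ Gm k) (x : T ⟶ (A1S S d).X) :
    (g • x) ≫ fst S (A1 k) = x ≫ fst S (A1 k) :=
  (prodMod_smul_fst g x).trans (trivMod_smul _ _)

lemma A1S_smul_snd {S : Sch k} {d : ℕ} {T : Sch k} (g : T ⟶ Gm k) (x : T ⟶ (A1S S d).X) :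
    A1.coord ((g • x) ≫ snd S (A1 k)) = Diag.chi 1 g ^ d * A1.coord (x ≫ snd S (A1 k)) :=
  (congrArg A1.coord (prodMod_smul_snd g x)).trans (A1w_smul _ _)

def zeroHom (S : Sch k) (d : ℕ) : trivMod S ⟶ A1S S d :=
  letI : IsModHom (Gm k) (show (triv(Gm k) S).X ⟶ (A1S S d).X from zeroSec S d) :=
    isModHom_of_points _ (by
    intro T g x
    refine (trivMod_smul g x =≫ zeroSec S d).trans (A1S_hom_ext ?_ ?_)
    · exact (A1S_smul_fst _ _).symm
    · refine (zeroSec_snd S d x).trans (Eq.trans ?_ (A1S_smul_snd g _).symm)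
      exact (mul_zero _).symm.trans (congrArg (_ * ·) (zeroSec_snd S d x).symm))
  ⟨zeroSec S d⟩

lemma glToA1_fst {S : Sch k} {d : ℕ} {T : Sch k} (x : T ⟶ (GlS S d).X) :
    (x ≫ (glToA1 S d).hom) ≫ fst S (A1 k) = x ≫ fst S (Gm k) := by
  refine assoc'.trans ((x ≫= tensorHom_fst _ _).trans ?_)
  exact x ≫= comp_id _

lemma glToA1_snd {S : Sch k} {d : ℕ} {T : Sch k} (x : T ⟶ (GlS S d).X) :
    A1.coord ((x ≫ (glToA1 S d).hom) ≫ snd S (A1 k)) = Diag.chi 1 (x ≫ snd S (Gm k)) := by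
  refine (congrArg A1.coord (assoc'.trans ((x ≫= tensorHom_snd _ _).trans assoc'.symm))).trans (coord_gm _)

variable (S : Sch k) (d : ℕ)

instance isClosedImmersion_zeroHom : IsClosedImmersion (zeroHom S d).hom.left :=
  isClosedImmersion_section (Y := A1 k) (A1.mk 0)

instance : IsFT (zeroHom S d).hom where
  locallyOfFiniteType := (inferInstance : LFT (zeroHom S d).hom.left)
  quasiCompact := (inferInstance : QuasiCompact (zeroHom S d).hom.left)

lemma exists_glToA1_iff (x : Pt (A1S S d).X) :
    (∃ y : Pt (GlS S d).X, y ≫ (glToA1 S d).hom = x) ↔ A1.coord (x ≫ snd S (A1 k)) ≠ 0 := by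
  constructor
  · rintro ⟨y, rfl⟩
    rw [glToA1_snd]
    exact (Diag.isUnit_chi _ _).ne_zero
  · intro h
    have hu : IsUnit (A1.coord (x ≫ snd S (A1 k))) := by
      obtain ⟨a, ha⟩ := (fnC_unit_bijective k).2 (A1.coord (x ≫ snd S (A1 k)))
      rw [← ha] at h ⊢
      exact (IsUnit.mk0 a fun h0 => h (by rw [h0, map_zero])).map _
    obtain ⟨g, hg⟩ := Gm.exists_hom hu
    exact ⟨lift (x ≫ fst S (A1 k)) g, A1S_hom_ext ((glToA1_fst _).trans (lift_fst _ _))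
      ((glToA1_snd _).trans ((congrArg (Diag.chi 1) (lift_snd _ _)).trans hg))⟩

lemma exists_zeroHom_iff (x : Pt (A1S S d).X) :
    (∃ y : Pt S, y ≫ (zeroHom S d).hom = x) ↔ A1.coord (x ≫ snd S (A1 k)) = 0 := by
  constructor
  · rintro ⟨y, rfl⟩
    exact zeroSec_snd S d y
  · exact fun h => ⟨x ≫ fst S (A1 k), A1S_hom_ext (zeroSec_fst S d _)
      ((zeroSec_snd S d _).trans h.symm)⟩

lemma IsPull.mk_eq_add {G : Sch k} [GrpObj G] [GoodGrp G] {B C D : GSch G}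
    [LFT B.X.hom] [LFT C.X.hom] [LFT D.X.hom]
    {s : C ⟶ B} {t : D ⟶ B} [IsFT s.hom] [IsFT t.hom] {X : GVar B} {Z : GVar C} {U : GVar D}
    {i : Z.X ⟶ X.X} {j : U.X ⟶ X.X} (hi : IsPull s X Z i) (hj : IsPull t X U j)
    (hd : ∀ b : Pt B.X, (∃ c : Pt C.X, c ≫ s.hom = b) ↔ ¬ ∃ c : Pt D.X, c ≫ t.hom = b) :
    K0.mk X = K0.mk (Z.push s) + K0.mk (U.push t) := by
  refine K0.mk_eq_add_of_decomp (Z := Z.push s) (U := U.push t) i j (GSch.ext_of_comp fun p => ?_)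
    (GSch.ext_of_comp fun p => ?_) ⟨hi.inj, hj.inj, fun p q h => ?_, fun x => ?_⟩
  · exact (hi.comm p).trans (GSch.comp_hom _ _ _).symm
  · exact (hj.comm p).trans (GSch.comp_hom _ _ _).symm
  · refine (hd (p ≫ i.hom ≫ X.str.hom)).1 ⟨_, ((hi.comm p).symm.trans assoc')⟩ ⟨q ≫ U.str.hom, ?_⟩
    exact (hj.comm q).symm.trans ((h.symm =≫ X.str.hom).trans assoc')
  · by_cases h : ∃ c : Pt D.X, c ≫ t.hom = x ≫ X.str.hom
    · obtain ⟨c, hc⟩ := h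
      exact Or.inr (hj.surj x c hc.symm)
    · obtain ⟨c, hc⟩ := (hd _).2 h
      exact Or.inl (hi.surj x c hc.symm)

variable [LFT S.hom]

lemma eq_push_add_inclGl (a : K0 (A1S S d)) : a = K0.push (zeroHom S d) (K0.pull (zeroHom S d) a) +
    inclGl S d (K0.pull (glToA1 S d) a) := by
  have h : AddMonoidHom.id _ = (K0.push (zeroHom S d)).comp (K0.pull (zeroHom S d)) +
      (inclGl S d).comp (K0.pull (glToA1 S d)) := K0.hom_ext fun X => by
    obtain ⟨Z, i, hi, -⟩ := X.exists_pull (zeroHom S d)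
    obtain ⟨V, j, hj, -⟩ := X.exists_pull (glToA1 S d)
    rw [AddMonoidHom.add_apply, AddMonoidHom.comp_apply, AddMonoidHom.comp_apply, hi.mk_eq,
      hj.mk_eq, K0.push_mk]
    refine (hi.mk_eq_add hj fun b => ?_).trans (congrArg (_ + ·) (K0.push_mk _ V).symm)
    exact (exists_zeroHom_iff S d b).trans (Iff.trans not_not.symm (exists_glToA1_iff S d b).not.symm)
  exact congrArg (fun t => t a) h

variable {S} in
abbrev GVar.line (Y : GVar (triv(Gm k) S)) (d : ℕ) : GVar (A1S S d) := Y.prod (a1Var d)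

variable {S d} in
lemma prod_a1Var_fst (Y : GVar (triv(Gm k) S)) {T : Sch k} (x : T ⟶ (Y.line d).X.X) :
    (x ≫ (Y.line d).str.hom) ≫ fst S (A1 k) = (x ≫ fst Y.X.X (A1 k)) ≫ Y.str.hom :=
  comp_prodMap_fst Y.str (𝟙 (A1w d)) x

variable {S d} in
lemma prod_a1Var_snd (Y : GVar (triv(Gm k) S)) {T : Sch k} (x : T ⟶ (Y.line d).X.X) :
    (x ≫ (Y.line d).str.hom) ≫ snd S (A1 k) = x ≫ snd Y.X.X (A1 k) :=
  (comp_prodMap_snd Y.str (𝟙 (A1w d)) x).trans (comp_id _)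

lemma exists_isPull_zeroHom (Y : GVar (triv(Gm k) S)) :
    ∃ i : Y.X ⟶ (Y.line d).X, IsPull (zeroHom S d) (Y.line d) Y i ∧
      (∀ y : Pt Y.X.X, (y ≫ i.hom) ≫ fst Y.X.X (A1 k) = y) := by
  have h0 (y : Pt Y.X.X) : A1.coord (y ≫ (A1.mk 0 : Y.X.X ⟶ A1 k)) = 0 := by
    rw [A1.coord_comp, A1.coord_mk, map_zero]
  let c : Y.X ⟶ A1w d := GSch.homMk (A1.mk 0 : Y.X.X ⟶ A1 k) fun g x => A1.ext (by
    refine (h0 _).trans (Eq.trans ?_ (A1w_smul g _).symm)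
    exact (mul_zero _).symm.trans (congrArg (_ * ·) (h0 x).symm))
  let i : Y.X ⟶ prodMod Y.X (A1w d) := prodLift (𝟙 Y.X) c
  have h1 (y : Pt Y.X.X) : (y ≫ i.hom) ≫ fst Y.X.X (A1 k) = y :=
    (comp_prodLift_fst (𝟙 Y.X) c y).trans (comp_id y)
  have h2 (y : Pt Y.X.X) : A1.coord ((y ≫ i.hom) ≫ snd Y.X.X (A1 k)) = 0 :=
    (congrArg A1.coord (comp_prodLift_snd (𝟙 Y.X) c y)).trans (h0 y)
  refine ⟨i, ⟨fun z => A1S_hom_ext ?_ ?_, fun z z' h => ?_, fun x c h => ?_⟩, h1⟩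
  · exact (prod_a1Var_fst Y _).trans ((h1 z =≫ Y.str.hom).trans (zeroSec_fst S d _).symm)
  · exact (congrArg A1.coord (prod_a1Var_snd Y _)).trans ((h2 z).trans (zeroSec_snd S d _).symm)
  · exact (h1 z).symm.trans ((h =≫ fst Y.X.X (A1 k)).trans (h1 z'))
  · refine ⟨x ≫ fst Y.X.X (A1 k), prod_hom_ext (X := Y.X) (Y := A1w d) (h1 _) (A1.ext ?_)⟩
    refine (h2 _).trans (Eq.trans ?_ (congrArg A1.coord (prod_a1Var_snd Y x)))
    exact (zeroSec_snd S d c).symm.trans (congrArg (fun t => A1.coord (t ≫ snd S (A1 k))) h.symm)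

lemma pull_zeroHom_pullA1 (a : K0 (triv(Gm k) S)) :
    K0.pull (zeroHom S d) (pullA1 S d a) = a := by
  have h : (K0.pull (zeroHom S d)).comp (pullA1 S d) = AddMonoidHom.id _ := K0.hom_ext fun Y => by
    obtain ⟨i, hi, -⟩ := exists_isPull_zeroHom S d Y
    exact (congrArg _ (K0.prodRight_mk Y (a1Var d))).trans hi.mk_eq
  exact congrArg (fun t => t a) h

lemma pull_glToA1_inclGl (a : K0 (GlS S d)) : K0.pull (glToA1 S d) (inclGl S d a) = a := by
  have h : (K0.pull (glToA1 S d)).comp (inclGl S d) = AddMonoidHom.id _ := K0.hom_ext fun W => by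
    have hm := mono_of_left (glToA1 S d).hom
    have hi : IsPull (glToA1 S d) (W.push (glToA1 S d)) W (𝟙 W.X) := by
      have e (z : Pt W.X.X) : z ≫ Mod.Hom.hom (𝟙 W.X) = z := comp_id z
      exact ⟨fun z => (e z =≫ (W.str ≫ glToA1 S d).hom).trans (GSch.comp_hom _ _ z),
        fun z z' h => (e z).symm.trans (h.trans (e z')), fun x _ _ => ⟨x, e x⟩⟩
    exact (congrArg _ (K0.push_mk (glToA1 S d) W)).trans hi.mk_eq
  exact congrArg (fun t => t a) h

lemma pull_zeroHom_inclGl (a : K0 (GlS S d)) : K0.pull (zeroHom S d) (inclGl S d a) = 0 := by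
  have h : (K0.pull (zeroHom S d)).comp (inclGl S d) = 0 := K0.hom_ext fun W => by
    obtain ⟨Z, i, hi, -⟩ := (W.push (glToA1 S d)).exists_pull (zeroHom S d)
    refine (congrArg _ (K0.push_mk (glToA1 S d) W)).trans (hi.mk_eq.trans ?_)
    have : IsEmpty Z.X.X.left := by
      by_contra hne
      obtain ⟨z, -⟩ := exists_pt_mem (X := Z.X.X) isOpen_univ.isLocallyClosed
        (@Set.univ_nonempty _ (not_isEmpty_iff.1 hne))
      have h := hi.comm z
      refine (exists_glToA1_iff S d _).1 ⟨(z ≫ i.hom) ≫ W.str.hom, (Eq.trans ?_ h)⟩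
        (zeroSec_snd S d (z ≫ Z.str.hom))
      exact (GSch.comp_hom W.str (glToA1 S d) _).symm
    exact K0.mk_of_isEmpty Z
  exact congrArg (fun t => t a) h

/-- The projection to the motives supported on the complement of the zero section. -/
def prGl : K0 (A1S S d) →+ K0 (GlS S d) := K0.pull (glToA1 S d) -
  (K0.pull (glToA1 S d)).comp ((pullA1 S d).comp (K0.pull (zeroHom S d)))

lemma prGl_apply (a : K0 (A1S S d)) : prGl S d a = K0.pull (glToA1 S d) a -
    K0.pull (glToA1 S d) (pullA1 S d (K0.pull (zeroHom S d) a)) := rfl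

lemma prGl_pullA1 (a : K0 (triv(Gm k) S)) : prGl S d (pullA1 S d a) = 0 := by
  rw [prGl_apply, pull_zeroHom_pullA1, sub_self]

lemma prGl_inclGl (a : K0 (GlS S d)) : prGl S d (inclGl S d a) = a := by
  rw [prGl_apply, pull_zeroHom_inclGl, map_zero, map_zero, sub_zero, pull_glToA1_inclGl]

lemma eq_pullA1_add_inclGl (a : K0 (A1S S d)) :
    a = pullA1 S d (K0.pull (zeroHom S d) a) + inclGl S d (prGl S d a) := by
  have h := eq_push_add_inclGl S d (pullA1 S d (K0.pull (zeroHom S d) a))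
  rw [pull_zeroHom_pullA1] at h
  rw [h, prGl_apply, map_sub]
  conv_lhs => rw [eq_push_add_inclGl S d a]
  abel

lemma pullA1_injective : Function.Injective (pullA1 S d) :=
  Function.LeftInverse.injective (pull_zeroHom_pullA1 S d)

lemma inclGl_injective : Function.Injective (inclGl S d) :=
  Function.LeftInverse.injective (prGl_inclGl S d)

lemma ker_prGl : (prGl S d).ker = (pullA1 S d).range := by
  ext a
  refine ⟨fun h => ⟨K0.pull (zeroHom S d) a, ?_⟩, ?_⟩
  · have e := eq_pullA1_add_inclGl S d a
    rw [AddMonoidHom.mem_ker.1 h, map_zero, add_zero] at e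
    exact e.symm
  · rintro ⟨b, rfl⟩
    exact prGl_pullA1 S d b

lemma isCompl_pullA1_inclGl : IsCompl (pullA1 S d).range (inclGl S d).range := by
  refine ⟨?_, codisjoint_iff_le_sup.2 fun a _ => ?_⟩
  · rw [AddSubgroup.disjoint_def]
    rintro _ ⟨a, rfl⟩ ⟨b, hb⟩
    have h := congrArg (prGl S d) hb
    rw [prGl_inclGl, prGl_pullA1] at h
    rw [← hb, h, map_zero]
  · rw [eq_pullA1_add_inclGl S d a]
    exact AddSubgroup.add_mem_sup ⟨_, rfl⟩ ⟨_, rfl⟩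
end

section
/-! ### The image of the pullback is a `λ`-ideal -/

def fstHom (S : Sch k) (d : ℕ) : A1S S d ⟶ trivMod S :=
  letI : IsModHom (Gm k) (show (A1S S d).X ⟶ (triv(Gm k) S).X from fst S (A1 k)) :=
    isModHom_of_points _ fun _ g x => prodMod_smul_fst g x
  ⟨fst S (A1 k)⟩

def sndHom (S : Sch k) (d : ℕ) : A1S S d ⟶ A1w d :=
  letI : IsModHom (Gm k) (show (A1S S d).X ⟶ (A1w (k := k) d).X from snd S (A1 k)) :=
    isModHom_of_points _ fun _ g x => prodMod_smul_snd g x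
  ⟨snd S (A1 k)⟩

instance (S : Sch k) (d : ℕ) : IsFT (fstHom S d).hom where
  locallyOfFiniteType := (inferInstance : LFT (pullback.fst S.hom (A1 k).hom))
  quasiCompact := (inferInstance : QuasiCompact (pullback.fst S.hom (A1 k).hom))

lemma A1w_exists_add_smul {d : ℕ} {W : GSch (Gm k)} [LFT W.X.hom]
    [IsReduced W.X.left] (a b : W ⟶ A1w d) (c : k) : ∃ f : W ⟶ A1w d, ∀ p : Pt W.X,
      A1.coord (p ≫ f.hom) = A1.coord (p ≫ a.hom) + fnC _ c * A1.coord (p ≫ b.hom) := by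
  let f : W.X ⟶ A1 k := A1.mk (A1.coord (show W.X ⟶ A1 k from a.hom) +
    fnC _ c * A1.coord (show W.X ⟶ A1 k from b.hom))
  have hf (p : Pt W.X) : A1.coord (p ≫ f) =
      A1.coord (p ≫ a.hom) + fnC _ c * A1.coord (p ≫ b.hom) := by
    rw [A1.coord_comp, A1.coord_mk, map_add, map_mul, fnPull_fnC, ← A1.coord_comp, ← A1.coord_comp]
  have hs (a : W ⟶ A1w d) (g : Pt (Gm k)) (x : Pt W.X) :
      A1.coord ((g • x) ≫ a.hom) = Diag.chi 1 g ^ d * A1.coord (x ≫ a.hom) :=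
    (congrArg A1.coord (GSch.smul_comp a g x)).trans (A1w_smul _ _)
  refine ⟨GSch.homMk (Y := A1w d) f fun g x => A1.ext ?_, hf⟩
  refine (hf _).trans (Eq.trans ?_ (A1w_smul _ _).symm)
  refine Eq.trans ?_ (congrArg (_ * ·) (hf x).symm)
  rw [hs, hs]
  ring

variable {S : Sch k} [LFT S.hom] {d : ℕ}

section
variable (Y : GVar (triv(Gm k) S))

lemma prod_a1Var_hom_ext {T : Sch k} {x x' : T ⟶ (Y.line d).X.X}
    (h : x ≫ fst Y.X.X (A1 k) = x' ≫ fst Y.X.X (A1 k))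
    (h' : A1.coord (x ≫ snd Y.X.X (A1 k)) = A1.coord (x' ≫ snd Y.X.X (A1 k))) : x = x' :=
  CartesianMonoidalCategory.hom_ext (X := Y.X.X) (Y := A1 k) _ _ h (A1.ext h')

lemma isNice_prod_a1Var (hY : IsNice Y.X) : IsNice (Y.line d).X := by
  obtain ⟨I, U, hU, hd, hc⟩ := hY
  let p : (Y.line d).X ⟶ Y.X := prodFst Y.X (a1Var d).X
  have : IsAffineHom p.hom.left := 
    MorphismProperty.of_isPullback (P := @IsAffineHom) (IsPullback.of_hasPullback Y.X.X.hom (A1 k).hom).flip inferInstance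
  exact ⟨I, fun i => p.hom.left ⁻¹ᵁ U i, fun i => ⟨(hU i).1.preimage _, (hU i).2.preimage p⟩,
    fun i j h => (hd i j h).preimage p.hom.left, fun x => hc (p.hom.left x)⟩

end

variable [MonObj S] [IsCommMonObj S] [QuasiCompact μ[S].left]

lemma A1S_mul_fst {T : Sch k} (x y : T ⟶ (A1S S d).X) :
    (x * y) ≫ fst S (A1 k) = (x ≫ fst S (A1 k)) * (y ≫ fst S (A1 k)) :=
  prodMod_mul_fst (triv(Gm k) S) (A1w d) x y

lemma A1S_mul_snd {T : Sch k} (x y : T ⟶ (A1S S d).X) : A1.coord ((x * y) ≫ snd S (A1 k)) =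
    A1.coord (x ≫ snd S (A1 k)) + A1.coord (y ≫ snd S (A1 k)) :=
  (congrArg A1.coord (prodMod_mul_snd (triv(Gm k) S) (A1w d) x y)).trans (A1.coord_add _ _)

lemma A1S_prod_fst {T : Sch k} {n : ℕ} (x : Fin n → (T ⟶ (A1S S d).X)) :
    (∏ i, x i) ≫ fst S (A1 k) = ∏ i, x i ≫ fst S (A1 k) :=
  map_prod (⟨⟨fun y : T ⟶ (A1S S d).X => y ≫ fst S (A1 k),
    prodMod_one_fst (triv(Gm k) S) (A1w d) T⟩, A1S_mul_fst⟩ :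
    (T ⟶ (A1S S d).X) →* (T ⟶ S)) x _

lemma A1S_prod_snd {T : Sch k} {n : ℕ} (x : Fin n → (T ⟶ (A1S S d).X)) :
    A1.coord ((∏ i, x i) ≫ snd S (A1 k)) = ∑ i, A1.coord (x i ≫ snd S (A1 k)) :=
  map_prod (⟨⟨fun y : T ⟶ (A1S S d).X => Multiplicative.ofAdd (A1.coord (y ≫ snd S (A1 k))),
    congrArg (fun t => Multiplicative.ofAdd (A1.coord t))
      (prodMod_one_snd (triv(Gm k) S) (A1w d) T) |>.trans
      (congrArg Multiplicative.ofAdd A1.coord_zero)⟩,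
    fun x y => congrArg Multiplicative.ofAdd (A1S_mul_snd x y)⟩ :
    (T ⟶ (A1S S d).X) →* Multiplicative Γ(T.left, ⊤)) x _

lemma mk_conv_prod_a1Var (X : GVar (A1S S d)) (Y : GVar (triv(Gm k) S)) :
    K0.mk (X.conv (Y.line d)) =
      pullA1 S d (K0.mk ((X.push (fstHom S d)).conv Y)) := by
  let E := Y.line d
  let V := (X.push (fstHom S d)).conv Y
  let pX : (X.conv E).X ⟶ X.X := prodFst X.X E.X
  let pE : (X.conv E).X ⟶ E.X := prodSnd X.X E.X
  let pY : E.X ⟶ Y.X := prodFst Y.X (a1Var d).X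
  let v : (X.conv E).X ⟶ V.X := prodLift pX (pE ≫ pY)
  let f : (X.conv E).X ⟶ (V.line d).X := prodLift v ((X.conv E).str ≫ sndHom S d)
  have ef (p : Pt (X.conv E).X.X) : (p ≫ f.hom) ≫ fst V.X.X (A1 k) = p ≫ v.hom :=
    comp_prodLift_fst _ _ p
  have es (p : Pt (X.conv E).X.X) : A1.coord ((p ≫ f.hom) ≫ snd V.X.X (A1 k)) =
      A1.coord (((p ≫ pX.hom) ≫ X.str.hom) ≫ snd S (A1 k)) +
      A1.coord ((p ≫ pE.hom) ≫ snd Y.X.X (A1 k)) := by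
    refine (congrArg A1.coord ((comp_prodLift_snd _ _ p).trans ((GSch.comp_hom _ _ p).trans
      (X.conv_str E p =≫ snd S (A1 k))))).trans ((A1S_mul_snd _ _).trans ?_)
    exact congrArg (_ + ·) (congrArg A1.coord (prod_a1Var_snd Y _))
  have evX (p : Pt (X.conv E).X.X) : (p ≫ v.hom : Pt (prodMod X.X Y.X).X) ≫ fst X.X.X Y.X.X =
      p ≫ pX.hom := comp_prodLift_fst _ _ p
  have evY (p : Pt (X.conv E).X.X) : (p ≫ v.hom : Pt (prodMod X.X Y.X).X) ≫ snd X.X.X Y.X.X =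
      (p ≫ pE.hom) ≫ fst Y.X.X (A1 k) := (comp_prodLift_snd _ _ p).trans assoc'.symm
  refine Eq.trans ?_ (K0.prodRight_mk V (a1Var d)).symm
  refine K0.mk_eq_of_bijective f (GSch.ext_of_comp fun p => A1S_hom_ext ?_ ?_)
    ⟨fun p q e => ?_, fun y => ?_⟩
  · refine (prod_a1Var_fst V _).trans ((ef p =≫ V.str.hom).trans ?_)
    refine ((X.push (fstHom S d)).conv_str Y _).trans (Eq.trans ?_
      (X.conv_str E p =≫ fst S (A1 k)).symm)
    refine Eq.trans ?_ (A1S_mul_fst (S := S) (d := d) _ _).symm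
    refine congrArg₂ (· * ·) ?_ ?_
    · exact (evX p =≫ (X.push (fstHom S d)).str.hom).trans (GSch.comp_hom _ _ _)
    · exact (evY p =≫ Y.str.hom).trans (prod_a1Var_fst Y _).symm
  · refine (congrArg A1.coord ((prod_a1Var_snd V _).trans ?_))
    exact (comp_prodLift_snd _ _ p).trans (GSch.comp_hom _ _ p)
  · have e1 : p ≫ v.hom = q ≫ v.hom := (ef p).symm.trans ((e =≫ fst V.X.X (A1 k)).trans (ef q))
    have e2 : p ≫ pX.hom = q ≫ pX.hom := (evX p).symm.trans ((e1 =≫ fst X.X.X Y.X.X).trans (evX q))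
    refine prod_hom_ext e2 (prod_a1Var_hom_ext Y ?_ ?_)
    · exact (evY p).symm.trans ((e1 =≫ snd X.X.X Y.X.X).trans (evY q))
    · have := (es p).symm.trans ((congrArg (fun t => A1.coord (t ≫ snd V.X.X (A1 k))) e).trans (es q))
      rw [e2] at this
      exact add_left_cancel this
  · let x : Pt X.X.X := (y ≫ fst V.X.X (A1 k)) ≫ fst X.X.X Y.X.X
    let w : Pt E.X.X := lift ((y ≫ fst V.X.X (A1 k)) ≫ snd X.X.X Y.X.X)
      (A1.mk (A1.coord (y ≫ snd V.X.X (A1 k)) - A1.coord ((x ≫ X.str.hom) ≫ snd S (A1 k))))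
    let p : Pt (X.conv E).X.X := lift x w
    have hx : p ≫ pX.hom = x := lift_fst _ _
    have hw : p ≫ pE.hom = w := lift_snd _ _
    refine ⟨p, prod_a1Var_hom_ext V ((ef p).trans (prod_hom_ext (X := X.X) (Y := Y.X) ?_ ?_))
      ((es p).trans ?_)⟩
    · exact (evX p).trans hx
    · exact (evY p).trans ((hw =≫ fst Y.X.X (A1 k)).trans (lift_fst _ _))
    · rw [hx, hw]
      refine (congrArg (_ + ·) ((congrArg A1.coord (lift_snd _ _)).trans (A1.coord_mk _))).trans ?_
      exact add_sub_cancel _ _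
end

section
/-! ### Symmetric powers of `Y × 𝔸¹` -/

variable {S : Sch k} [LFT S.hom] {d : ℕ} [MonObj S] [IsCommMonObj S] [QuasiCompact μ[S].left]

section
variable (Y : GVar (triv(Gm k) S)) (d)

/-- The translation of `Y × 𝔸¹` along the affine line. -/
def translate (t : PtRing k) (e : Pt (Y.line d).X.X) : Pt (Y.line d).X.X :=
  lift (e ≫ fst Y.X.X (A1 k)) (A1.mk (A1.coord (e ≫ snd Y.X.X (A1 k)) + t))

lemma translate_fst (t : PtRing k) (e : Pt (Y.line d).X.X) :
    translate d Y t e ≫ fst Y.X.X (A1 k) = e ≫ fst Y.X.X (A1 k) := lift_fst _ _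

lemma translate_snd (t : PtRing k) (e : Pt (Y.line d).X.X) :
    A1.coord (translate d Y t e ≫ snd Y.X.X (A1 k)) = A1.coord (e ≫ snd Y.X.X (A1 k)) + t :=
  (congrArg A1.coord (lift_snd _ _)).trans (A1.coord_mk _)

lemma translate_injective (t : PtRing k) : Function.Injective (translate d Y t) := fun e e' h =>
  prod_a1Var_hom_ext Y ((translate_fst d Y t e).symm.trans
    ((h =≫ fst Y.X.X (A1 k)).trans (translate_fst d Y t e')))
    (add_right_cancel ((translate_snd d Y t e).symm.trans
    ((congrArg (fun x => A1.coord (x ≫ snd Y.X.X (A1 k))) h).trans (translate_snd d Y t e'))))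

lemma translate_neg_translate (t : PtRing k) (e : Pt (Y.line d).X.X) :
    translate d Y (-t) (translate d Y t e) = e :=
  prod_a1Var_hom_ext Y ((translate_fst ..).trans (translate_fst ..))
    ((translate_snd ..).trans ((congrArg (· + -t) (translate_snd ..)).trans
      (add_neg_cancel_right _ _)))

lemma pow_str_fst {n : ℕ} (w : Pt ((Y.line d).pow n).X.X) :
    (w ≫ ((Y.line d).pow n).str.hom) ≫ fst S (A1 k) =
      ∏ i, ((w ≫ ((Y.line d).powπ n i).hom) ≫ fst Y.X.X (A1 k)) ≫ Y.str.hom :=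
  (GVar.pow_str _ w =≫ fst S (A1 k)).trans ((A1S_prod_fst (S := S) (d := d) _).trans
    (Finset.prod_congr rfl fun _ _ => prod_a1Var_fst Y _))

lemma pow_str_snd {n : ℕ} (w : Pt ((Y.line d).pow n).X.X) :
    A1.coord ((w ≫ ((Y.line d).pow n).str.hom) ≫ snd S (A1 k)) =
      ∑ i, A1.coord ((w ≫ ((Y.line d).powπ n i).hom) ≫ snd Y.X.X (A1 k)) :=
  (congrArg (fun t => A1.coord (t ≫ snd S (A1 k))) (GVar.pow_str _ w)).trans
    ((A1S_prod_snd (S := S) (d := d) _).trans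
    (Finset.sum_congr rfl fun _ _ => congrArg A1.coord (prod_a1Var_snd Y _)))

lemma toM_of_translate {n : ℕ} (w w' : Pt ((Y.line d).pow n).X.X) (t : PtRing k)
    (h : ∀ i, w' ≫ ((Y.line d).powπ n i).hom =
      translate d Y t (w ≫ ((Y.line d).powπ n i).hom)) :
    (Y.line d).toM w' = ((Y.line d).toM w).map (translate d Y t) :=
  (congrArg (fun f => Finset.univ.val.map f) (funext h)).trans (Multiset.map_map (translate d Y t)
    (fun i => w ≫ ((Y.line d).powπ n i).hom) Finset.univ.val).symm

lemma exists_center {n : ℕ} : ∃ f : ((Y.line d).pow n).X ⟶ ((Y.line d).pow n).X,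
    ∀ w i, (w ≫ f.hom) ≫ ((Y.line d).powπ n i).hom = translate d Y (-(fnC _ (n : k)⁻¹ *
      A1.coord ((w ≫ ((Y.line d).pow n).str.hom) ≫ snd S (A1 k))))
        (w ≫ ((Y.line d).powπ n i).hom) := by
  let E := Y.line d
  let p1 : E.X ⟶ Y.X := prodFst Y.X (a1Var d).X
  let p2 : E.X ⟶ A1w d := prodSnd Y.X (a1Var d).X
  choose f hf using fun i : Fin n => A1w_exists_add_smul (E.powπ n i ≫ p2)
    ((E.pow n).str ≫ sndHom S d) (-(n : k)⁻¹)
  let g (i : Fin n) : (E.pow n).X ⟶ E.X := prodLift (E.powπ n i ≫ p1) (f i)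
  refine ⟨E.powLift g, fun w i => (E.comp_powLift_π g i w).trans (prod_a1Var_hom_ext Y ?_ ?_)⟩
  · refine (comp_prodLift_fst _ _ w).trans (Eq.trans ?_ (translate_fst ..).symm)
    exact GSch.comp_hom _ _ w
  · refine (congrArg A1.coord (comp_prodLift_snd (X := Y.X) (E.powπ n i ≫ p1) (f i) w)).trans
      ((hf i w).trans (Eq.trans ?_ (translate_snd ..).symm))
    rw [map_neg, neg_mul]
    refine congrArg₂ (fun a b => A1.coord a + -(_ * A1.coord b)) ?_ ?_
    · exact GSch.comp_hom _ _ w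
    · exact GSch.comp_hom _ _ w

end

lemma natCast_mul_fnC_inv {n : ℕ} (hn : 0 < n) (t : PtRing k) :
    (n : PtRing k) * (fnC _ (n : k)⁻¹ * t) = t := by
  rw [← map_natCast (fnC (𝟙_ (Sch k))), ← _root_.mul_assoc, ← map_mul,
    mul_inv_cancel₀ (Nat.cast_ne_zero.2 hn.ne'), map_one, _root_.one_mul]

lemma GVar.IsSym.exists_mk_eq_pullA1 {n : ℕ} (hn : 0 < n) {Y : GVar (triv(Gm k) S)}
    {Q : GVar (A1S S d)} {q : ((Y.line d).pow n).X ⟶ Q.X}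
    (hq : GVar.IsSym n (Y.line d) Q q) : ∃ a, K0.mk Q = pullA1 S d a := by
  let E := Y.line d
  obtain ⟨Q0, i, hi, him, -⟩ := Q.exists_pull (zeroHom S d)
  obtain ⟨c, hc⟩ := exists_center d Y (n := n)
  let m (w : Pt (E.pow n).X.X) : PtRing k := A1.coord ((w ≫ (E.pow n).str.hom) ≫ snd S (A1 k))
  have hqs (w : Pt (E.pow n).X.X) : (w ≫ q.hom) ≫ Q.str.hom = w ≫ (E.pow n).str.hom :=
    GSch.comp_eq hq.str w
  have hm (w w' : Pt (E.pow n).X.X) (t : PtRing k)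
      (h : ∀ i, w' ≫ (E.powπ n i).hom = translate d Y t (w ≫ (E.powπ n i).hom)) :
      m w' = m w + n * t := by
    refine (pow_str_snd d Y w').trans (Eq.trans ?_ (congrArg (· + _) (pow_str_snd d Y w).symm))
    refine (Finset.sum_congr rfl fun i _ => (congrArg (fun t => A1.coord (t ≫ snd Y.X.X (A1 k)))
      (h i)).trans (translate_snd d Y t _)).trans ?_
    rw [Finset.sum_add_distrib]
    simp
    rfl
  have hcm (w : Pt (E.pow n).X.X) : m (w ≫ c.hom) = 0 := by
    rw [hm w (w ≫ c.hom) _ (hc w), mul_neg, natCast_mul_fnC_inv hn, add_neg_cancel]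
  have hct (w : Pt (E.pow n).X.X) :
      E.toM (w ≫ c.hom) = (E.toM w).map (translate d Y (-(fnC _ (n : k)⁻¹ * m w))) :=
    toM_of_translate d Y w (w ≫ c.hom) _ (hc w)
  obtain ⟨f, hf⟩ := GSch.exists_lift i (c ≫ q) fun w => by
    obtain ⟨b, hb⟩ := (exists_zeroHom_iff S d _).2 (hcm w)
    refine hi.surj _ b (Eq.trans ?_ hb.symm)
    exact (GSch.comp_hom c q w =≫ Q.str.hom).trans (hqs _)
  have hf' (w : Pt (E.pow n).X.X) : (w ≫ f.hom) ≫ i.hom = (w ≫ c.hom) ≫ q.hom :=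
    (GSch.comp_eq hf w).trans (GSch.comp_hom _ _ w)
  let φ : (E.pow n).X ⟶ (Q0.line d).X := prodLift f ((E.pow n).str ≫ sndHom S d)
  have hφ1 (w : Pt (E.pow n).X.X) : (w ≫ φ.hom) ≫ fst Q0.X.X (A1 k) = w ≫ f.hom :=
    comp_prodLift_fst _ _ w
  have hφ2 (w : Pt (E.pow n).X.X) : (w ≫ φ.hom) ≫ snd Q0.X.X (A1 k) =
      (w ≫ (E.pow n).str.hom) ≫ snd S (A1 k) :=
    (comp_prodLift_snd f ((E.pow n).str ≫ sndHom S d) w).trans (GSch.comp_hom _ _ w)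
  have hφ (w w' : Pt (E.pow n).X.X) : w ≫ φ.hom = w' ≫ φ.hom ↔
      E.toM (w ≫ c.hom) = E.toM (w' ≫ c.hom) ∧ m w = m w' := by
    rw [← hq.fib]
    refine ⟨fun h => ⟨?_, ?_⟩, fun h => prod_a1Var_hom_ext Q0 ?_ ?_⟩
    · rw [← hf', ← hf', ← hφ1, ← hφ1]
      exact congrArg (fun t => (t ≫ fst Q0.X.X (A1 k)) ≫ i.hom) h
    · exact (congrArg A1.coord (hφ2 w)).symm.trans
        ((congrArg (fun t => A1.coord (t ≫ snd Q0.X.X (A1 k))) h).trans (congrArg A1.coord (hφ2 w')))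
    · refine (hφ1 w).trans ((hi.inj _ _ ?_).trans (hφ1 w').symm)
      rw [hf', hf', h.1]
    · exact (congrArg A1.coord (hφ2 w)).trans (h.2.trans (congrArg A1.coord (hφ2 w')).symm)
  refine ⟨K0.mk Q0, Eq.trans ?_ (K0.prodRight_mk Q0 (a1Var d)).symm⟩
  refine K0.mk_eq_of_cover Q (Q0.line d) q φ hq.universallyClosed hq.surj (fun y => ?_)
    (fun w w' => ?_) (GSch.hom_ext_pt fun w => ?_)
  · let t := A1.coord (y ≫ snd Q0.X.X (A1 k))
    obtain ⟨w0, hw0⟩ := hq.surj ((y ≫ fst Q0.X.X (A1 k)) ≫ i.hom)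
    have hm0 : m w0 = 0 := by
      change A1.coord ((w0 ≫ (E.pow n).str.hom) ≫ snd S (A1 k)) = 0
      rw [← hqs, hw0, hi.comm]
      exact zeroSec_snd S d _
    obtain ⟨w, hw⟩ := E.exists_powLift fun i =>
      translate d Y (fnC _ (n : k)⁻¹ * t) (w0 ≫ (E.powπ n i).hom)
    have hmw : m w = t := by rw [hm w0 w _ hw, hm0, natCast_mul_fnC_inv hn, zero_add]
    refine ⟨w, prod_a1Var_hom_ext Q0 ((hφ1 w).trans (hi.inj _ _ ?_))
      ((congrArg A1.coord (hφ2 w)).trans hmw)⟩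
    rw [hf', ← hw0, hq.fib, hct, toM_of_translate d Y w0 w _ hw, Multiset.map_map, hmw]
    exact (Multiset.map_congr rfl fun e _ => translate_neg_translate d Y _ e).trans
      (Multiset.map_id _)
  · rw [hφ, hct, hct]
    refine ⟨fun h => ?_, fun h => ?_⟩
    · have e : m w = m w' := by
        change A1.coord ((w ≫ (E.pow n).str.hom) ≫ snd S (A1 k)) =
          A1.coord ((w' ≫ (E.pow n).str.hom) ≫ snd S (A1 k))
        rw [← hqs, h, hqs]
      exact ⟨by rw [e, (hq.fib w w').1 h], e⟩
    · rw [h.2] at h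
      exact (hq.fib w w').2 (Multiset.map_injective (translate_injective d Y _) h.1)
  · refine (GSch.comp_hom _ _ w).trans ((hqs w).trans (Eq.trans ?_ (GSch.comp_hom _ _ w).symm))
    refine A1S_hom_ext ?_ ?_
    · refine (pow_str_fst d Y w).trans (Eq.trans ?_ ((prod_a1Var_fst Q0 _).trans
        (hφ1 w =≫ Q0.str.hom)).symm)
      refine Eq.trans ?_ (zeroSec_fst S d ((w ≫ f.hom) ≫ Q0.str.hom))
      refine Eq.trans ?_ (((hi.comm _).symm.trans
        ((hf' w =≫ Q.str.hom).trans (hqs _))).symm =≫ fst S (A1 k))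
      refine Eq.trans ?_ (pow_str_fst d Y (w ≫ c.hom)).symm
      refine Finset.prod_congr rfl fun i _ => ?_ =≫ Y.str.hom
      exact ((hc w i =≫ fst Y.X.X (A1 k)).trans (translate_fst ..)).symm
    · exact congrArg A1.coord ((prod_a1Var_snd Q0 _).trans (hφ2 w)).symm

lemma isLambdaIdeal_pullA1 {L : LambdaRingStr (K0 (A1S S d))} (hL : L.IsConvSym) :
    L.IsLambdaIdeal (pullA1 S d).range := by
  refine LambdaRingStr.isLambdaIdeal_of_closure (LambdaRingStr.closure_nice (B := A1S S d))
    (t := pullA1 S d '' {a | ∃ Y : GVar (triv(Gm k) S), IsNice Y.X ∧ a = K0.mk Y}) ?_ ?_ ?_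
  · rw [← AddMonoidHom.map_closure, LambdaRingStr.closure_nice, AddMonoidHom.range_eq_map]
  · rintro _ ⟨X, -, rfl⟩ _ ⟨_, ⟨Y, -, rfl⟩, rfl⟩
    refine ⟨K0.mk ((X.push (fstHom S d)).conv Y), ?_⟩
    refine (mk_conv_prod_a1Var X Y).symm.trans (Eq.trans (hL.mul_mk _ _).symm ?_)
    exact congrArg _ (K0.prodRight_mk Y (a1Var d)).symm
  · rintro n hn _ ⟨_, ⟨Y, hY, rfl⟩, rfl⟩
    obtain ⟨Q, q, hq⟩ := GVar.exists_isSym (Y.line d) (isNice_prod_a1Var Y hY) n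
    obtain ⟨a, ha⟩ := hq.exists_mk_eq_pullA1 hn
    refine ⟨a, ha.symm.trans ((hL.σ_eq hq).symm.trans ?_)⟩
    exact congrArg _ (K0.prodRight_mk Y (a1Var d)).symm
end

section
/-! ### The variety that is induced from a variety with an action of the roots of unity -/

/-- A morphism of schemes as an equivariant morphism for the trivial actions. -/
def trivMap (G : Sch k) [GrpObj G] {X Y : Sch k} (f : X ⟶ Y) : triv(G) X ⟶ trivMod Y :=
  letI : IsModHom G (show (triv(G) X).X ⟶ (triv(G) Y).X from f) :=
    isModHom_of_points _ fun _ g x =>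
      (trivMod_smul g x =≫ f).trans (trivMod_smul g _).symm
  ⟨f⟩

lemma GlS_hom_ext {S : Sch k} {d : ℕ} {T : Sch k} {x y : T ⟶ (GlS S d).X}
    (h : x ≫ fst S (Gm k) = y ≫ fst S (Gm k)) (h' : x ≫ snd S (Gm k) = y ≫ snd S (Gm k)) : x = y :=
  CartesianMonoidalCategory.hom_ext (X := S) (Y := Gm k) _ _ h h'

lemma GlS_smul_fst {S : Sch k} {d : ℕ} {T : Sch k} (g : T ⟶ Gm k) (x : T ⟶ (GlS S d).X) :
    (g • x) ≫ fst S (Gm k) = x ≫ fst S (Gm k) :=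
  (prodMod_smul_fst g x).trans (trivMod_smul _ _)

lemma GlS_smul_snd {S : Sch k} {d : ℕ} {T : Sch k} (g : T ⟶ Gm k) (x : T ⟶ (GlS S d).X) :
    (g • x) ≫ snd S (Gm k) = g ^ d * (x ≫ snd S (Gm k)) :=
  (prodMod_smul_snd g x).trans (GmW_smul _ _)

lemma unitSec_fst (S : Sch k) (d : ℕ) {T : Sch k} (x : T ⟶ S) :
    (x ≫ unitSec S d) ≫ fst S (Gm k) = x :=
  assoc'.trans ((x ≫= lift_fst _ _).trans (comp_id x))

lemma unitSec_snd (S : Sch k) (d : ℕ) {T : Sch k} (x : T ⟶ S) :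
    (x ≫ unitSec S d) ≫ snd S (Gm k) = 1 :=
  assoc'.trans ((x ≫= lift_snd _ _).trans (comp_one x))

def unitHom (S : Sch k) (d : ℕ) :
    triv(Mu k d) S ⟶ (Mod.comap (muToGm k d)).obj (GlS S d) :=
  letI : IsModHom (Mu k d) (show (triv(Mu k d) S).X ⟶
      ((Mod.comap (muToGm k d)).obj (GlS S d)).X from unitSec S d) :=
    isModHom_of_points _ (by
    intro T g x
    refine (trivMod_smul g x =≫ unitSec S d).trans (Eq.trans (GlS_hom_ext ?_ ?_)
      (comap_smul (muToGm k d) (GlS S d) g (x ≫ unitSec S d)).symm)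
    · exact (GlS_smul_fst _ _).symm
    · refine (unitSec_snd S d x).trans (Eq.trans ?_ (GlS_smul_snd _ _).symm)
      exact ((congrArg (· * _) (comp_muToGm_pow g)).trans
        ((_root_.one_mul _).trans (unitSec_snd S d x))).symm)
  ⟨unitSec S d⟩

instance : IsAffineHom (Gm k).hom := inferInstanceAs (IsAffineHom (Spec.map _))
instance isAffine_gm : IsAffine (Gm k).left := inferInstanceAs (IsAffine (Spec _))

variable (k) in
/-- The `d`-th power map of `𝔾ₘ` as an equivariant morphism. -/
def gmPowHom (d : ℕ) : GmW (k := k) 1 ⟶ GmW d :=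
  letI : IsModHom (Gm k) (show (GmW (k := k) 1).X ⟶ (GmW (k := k) d).X from (𝟙 (Gm k)) ^ d) :=
    isModHom_of_points _ fun T g x => by
      have e (y : T ⟶ Gm k) : y ≫ (𝟙 (Gm k)) ^ d = y ^ d := by rw [MonObj.comp_pow, comp_id]
      refine (e _).trans (Eq.trans ?_ (GmW_smul g _).symm)
      refine (congrArg (fun y : T ⟶ Gm k => y ^ d) (GmW_smul g x)).trans ((mul_pow _ _ _).trans ?_)
      exact congrArg₂ (· * ·) (by rw [pow_one]) (e x).symm
  ⟨(𝟙 (Gm k)) ^ d⟩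

variable (k) in
/-- The group `𝔾ₘ`, as a variety over `𝔾ₘ` by the `d`-th power map. -/
def gmVar (d : ℕ) : GVar (GmW (k := k) d) where
  X := GmW 1
  str := gmPowHom k d
  isReduced := (inferInstance : IsReduced (Gm k).left)
  isSeparated := (inferInstance : IsSeparated (Gm k).hom)
  locallyOfFiniteType := lft_left _ (inferInstance : LFT (Gm k).hom)
  quasiCompact := by
    have : QuasiCompact (((𝟙 (Gm k)) ^ d : Gm k ⟶ Gm k).left ≫ (Gm k).hom) := by
      rw [Over.w]
      infer_instance
    exact (.of_comp ((𝟙 (Gm k)) ^ d : Gm k ⟶ Gm k).left (Gm k).hom :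
      QuasiCompact ((𝟙 (Gm k)) ^ d : Gm k ⟶ Gm k).left)
  isGood p := ⟨⊤, trivial, isAffineOpen_top (Gm k).left, fun _ _ _ _ => by simp⟩

lemma comp_mul_const (a y : Pt (Gm k)) : y ≫ (𝟙 (Gm k) * (toUnit (Gm k) ≫ a)) = y * a := by
  rw [comp_mul, comp_id, comp_toUnit_assoc]
  exact congrArg (_ * ·) ((toUnit_unique _ (𝟙 _) =≫ a).trans (id_comp a))

/-- The translation by a point, for the action of `𝔾ₘ` on itself. -/
def gmTranslate (a : Pt (Gm k)) : GmW (k := k) 1 ⟶ GmW 1 :=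
  have : IsReduced (GmW (k := k) 1).X.left := inferInstanceAs (IsReduced (Gm k).left)
  GSch.homMk (show (GmW (k := k) 1).X ⟶ (GmW 1).X from 𝟙 (Gm k) * (toUnit (Gm k) ≫ a)) fun g x => by
      refine (comp_mul_const a _).trans (Eq.trans ?_ (GmW_smul g _).symm)
      refine (congrArg (fun y : Pt (Gm k) => y * a) (GmW_smul g x)).trans
        ((_root_.mul_assoc _ _ _).trans ?_)
      exact congrArg (_ * ·) (comp_mul_const a x).symm

lemma comp_gmTranslate (a x : Pt (Gm k)) :
    (show Pt (GmW (k := k) 1).X from x) ≫ (gmTranslate a).hom = (x * a : Pt (Gm k)) :=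
  comp_mul_const a x

variable {S : Sch k} [LFT S.hom] {d : ℕ}

/-- A variety over `S`, with the trivial action. -/
def GVar.triv {H : Sch k} [GrpObj H] (G : Sch k) [GrpObj G] (Z : GVar (triv(H) S)) :
    GVar (triv(G) S) where
  X := trivMod Z.X.X
  str := trivMap G Z.str.hom
  isReduced := Z.isReduced
  isSeparated := Z.isSeparated
  locallyOfFiniteType := Z.locallyOfFiniteType
  quasiCompact := Z.quasiCompact
  isGood := isGood_trivMod G _

variable (Z : GVar (triv(Mu k d) S))

/-- The product `Z × 𝔾ₘ`, over `S × 𝔾ₘ` by the `d`-th power map on the second factor. -/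
def indVar : GVar (GlS S d) := (Z.triv (Gm k)).prod (gmVar k d)

variable {Z}

lemma indVar_hom_ext {T : Sch k} {x y : T ⟶ (indVar Z).X.X}
    (h : x ≫ fst Z.X.X (Gm k) = y ≫ fst Z.X.X (Gm k))
    (h' : x ≫ snd Z.X.X (Gm k) = y ≫ snd Z.X.X (Gm k)) : x = y :=
  CartesianMonoidalCategory.hom_ext (X := Z.X.X) (Y := Gm k) _ _ h h'

lemma indVar_str_fst {T : Sch k} (x : T ⟶ (indVar Z).X.X) :
    (x ≫ (indVar Z).str.hom) ≫ fst S (Gm k) = (x ≫ fst Z.X.X (Gm k)) ≫ Z.str.hom :=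
  comp_prodMap_fst (Z.triv (Gm k)).str (gmPowHom k d) x

lemma indVar_str_snd {T : Sch k} (x : T ⟶ (indVar Z).X.X) :
    (x ≫ (indVar Z).str.hom) ≫ snd S (Gm k) = (x ≫ snd Z.X.X (Gm k)) ^ d :=
  (comp_prodMap_snd (Z.triv (Gm k)).str (gmPowHom k d) x).trans
    ((MonObj.comp_pow (𝟙 (Gm k)) d (x ≫ snd Z.X.X (Gm k))).trans
      (congrArg (· ^ d) (comp_id _)))

lemma indVar_smul_fst {T : Sch k} (g : T ⟶ Gm k) (x : T ⟶ (indVar Z).X.X) :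
    (g • x) ≫ fst Z.X.X (Gm k) = x ≫ fst Z.X.X (Gm k) :=
  (prodMod_smul_fst g x).trans (trivMod_smul _ _)

lemma indVar_smul_snd {T : Sch k} (g : T ⟶ Gm k) (x : T ⟶ (indVar Z).X.X) :
    (g • x) ≫ snd Z.X.X (Gm k) = g * (x ≫ snd Z.X.X (Gm k)) :=
  (prodMod_smul_snd g x).trans ((GmW_smul _ _).trans (congrArg (· * _) (pow_one g)))

variable (Z) in
/-- The action of the roots of unity on `Z × 𝔾ₘ`. -/
def indAct (c : Pt (Mu k d)) : (indVar Z).X ⟶ (indVar Z).X :=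
  prodMap (trivMap (Gm k) (Z.X.act c)) (gmTranslate (c ≫ muToGm k d)⁻¹)

lemma indAct_fst (c : Pt (Mu k d)) (x : Pt (indVar Z).X.X) :
    (x ≫ (indAct Z c).hom) ≫ fst Z.X.X (Gm k) = c • (x ≫ fst Z.X.X (Gm k)) :=
  (comp_prodMap_fst (trivMap (Gm k) (Z.X.act c)) (gmTranslate (c ≫ muToGm k d)⁻¹) x).trans
    (Z.X.comp_act c _)

lemma indAct_snd (c : Pt (Mu k d)) (x : Pt (indVar Z).X.X) :
    (x ≫ (indAct Z c).hom) ≫ snd Z.X.X (Gm k) =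
      (x ≫ snd Z.X.X (Gm k)) * (c ≫ muToGm k d)⁻¹ :=
  (comp_prodMap_snd (trivMap (Gm k) (Z.X.act c)) (gmTranslate (c ≫ muToGm k d)⁻¹) x).trans
    (comp_gmTranslate _ _)

variable (Z) in
lemma indAct_str (c : Pt (Mu k d)) : indAct Z c ≫ (indVar Z).str = (indVar Z).str := by
  refine GSch.ext_of_comp fun p => GlS_hom_ext ?_ ?_
  · refine (indVar_str_fst _).trans (Eq.trans ?_ (indVar_str_fst p).symm)
    refine (indAct_fst c p =≫ Z.str.hom).trans ((GSch.smul_comp Z.str c _).trans ?_)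
    exact trivMod_smul _ _
  · refine (indVar_str_snd _).trans (Eq.trans ?_ (indVar_str_snd p).symm)
    rw [indAct_snd, mul_pow, inv_pow, comp_muToGm_pow, inv_one, _root_.mul_one]

variable (Z) in
lemma isAct_indAct : IsAct fun c => (indAct Z c).hom where
  one := hom_ext_pt fun p => indVar_hom_ext
    ((indAct_fst 1 p).trans ((one_smul _ _).trans ((comp_id p).symm =≫ _)))
    ((indAct_snd 1 p).trans (by
      rw [one_comp, inv_one, _root_.mul_one]
      exact (comp_id p).symm =≫ snd Z.X.X (Gm k)))
  mul a b := hom_ext_pt fun p => by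
    refine Eq.trans ?_ (assoc p (indAct Z a).hom (indAct Z b).hom)
    refine indVar_hom_ext ((indAct_fst _ p).trans (Eq.trans ?_ (indAct_fst _ _).symm))
      ((indAct_snd _ p).trans (Eq.trans ?_ (indAct_snd _ _).symm))
    · rw [indAct_fst, smul_smul, _root_.mul_comm]
    · rw [indAct_snd, mul_comp, mul_inv, _root_.mul_assoc]

lemma isNiceFor_indVar (hZ : IsNice Z.X) : IsNiceFor (indVar Z).X fun c => (indAct Z c).hom := by
  obtain ⟨I, U, hU, hd, hc⟩ := hZ
  let p : (indVar Z).X.X ⟶ Z.X.X := fst Z.X.X (Gm k)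
  have : IsAffineHom p.left := MorphismProperty.of_isPullback (P := @IsAffineHom)
    (IsPullback.of_hasPullback Z.X.X.hom (Gm k).hom).flip inferInstance
  refine ⟨I, fun i => p.left ⁻¹ᵁ U i, fun i => ⟨(hU i).1.preimage _, fun g x hx => ?_⟩,
    fun i j x hi hj => ?_, fun x => hc _, fun i c x hx => ?_⟩
  · exact (congrArg (fun t => Pt.val t ∈ U i) (indVar_smul_fst g x)).mpr hx
  · by_contra h
    exact Set.disjoint_left.1 (hd i j h) hi hj
  · exact (congrArg (fun t => Pt.val t ∈ U i) (indAct_fst c x)).mpr ((hU i).2 c _ hx)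
end

section
/-! ### The fibre over the unit section -/

variable {S : Sch k} [LFT S.hom] {d : ℕ} [NeZero d]

/-- `q` exhibits `Q` as the quotient of `Z × 𝔾ₘ` by the roots of unity, on the level of points. -/
structure IsInd (Z : GVar (triv(Mu k d) S)) (Q : GVar (GlS S d))
    (q : (indVar Z).X ⟶ Q.X) : Prop where
  str : q ≫ Q.str = (indVar Z).str
  universallyClosed : UniversallyClosed q.hom.left
  surj : ∀ y : Pt Q.X.X, ∃ x : Pt (indVar Z).X.X, x ≫ q.hom = y
  fib : ∀ x x' : Pt (indVar Z).X.X, x ≫ q.hom = x' ≫ q.hom ↔ ∃ c, x ≫ (indAct Z c).hom = x'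

lemma exists_isInd (Z : GVar (triv(Mu k d) S)) (hZ : IsNice Z.X) : ∃ Q q, IsInd Z Q q := by
  obtain ⟨Q, q, hs, -, h⟩ := (indVar Z).exists_quotient (indAct Z) (isAct_indAct Z) (indAct_str Z)
    (isNiceFor_indVar hZ)
  refine ⟨Q, q, hs, h.universallyClosed, h.surj, fun x x' => ⟨h.orbit x x', ?_⟩⟩
  rintro ⟨c, rfl⟩
  exact (x ≫= (h.inv c).symm).trans assoc'.symm

section
variable {X Z U : GVar (triv(Mu k d) S)} (z : Z.X ⟶ X.X)

def indMap : (indVar Z).X ⟶ (indVar X).X := prodMap (trivMap (Gm k) z.hom) (𝟙 (GmW 1))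

lemma indMap_fst (w : Pt (indVar Z).X.X) :
    (w ≫ (indMap z).hom) ≫ fst X.X.X (Gm k) = (w ≫ fst Z.X.X (Gm k)) ≫ z.hom :=
  comp_prodMap_fst (trivMap (Gm k) z.hom) (𝟙 (GmW 1)) w

lemma indMap_snd (w : Pt (indVar Z).X.X) :
    (w ≫ (indMap z).hom) ≫ snd X.X.X (Gm k) = w ≫ snd Z.X.X (Gm k) :=
  (comp_prodMap_snd (trivMap (Gm k) z.hom) (𝟙 (GmW 1)) w).trans (comp_id _)

lemma indMap_indAct (c : Pt (Mu k d)) (w : Pt (indVar Z).X.X) :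
    (w ≫ (indMap z).hom) ≫ (indAct X c).hom = (w ≫ (indAct Z c).hom) ≫ (indMap z).hom := by
  refine indVar_hom_ext ?_ ?_
  · rw [indAct_fst, indMap_fst, indMap_fst, indAct_fst]
    exact (GSch.smul_comp z c _).symm
  · rw [indAct_snd, indMap_snd, indMap_snd, indAct_snd]

variable {z} {Q Q' Q'' : GVar (GlS S d)} {q : (indVar X).X ⟶ Q.X} {q' : (indVar Z).X ⟶ Q'.X}
  {q'' : (indVar U).X ⟶ Q''.X}

lemma IsInd.map_eq_iff (h : IsInd X Q q) (w : Pt (indVar Z).X.X) (w' : Pt (indVar X).X.X) :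
    w ≫ (indMap z ≫ q).hom = w' ≫ q.hom ↔ ∃ c, (w ≫ (indAct Z c).hom) ≫ (indMap z).hom = w' := by
  rw [GSch.comp_hom, h.fib]
  exact exists_congr fun c => by rw [indMap_indAct]

lemma IsInd.eq_iff (h : IsInd X Q q) (h' : IsInd Z Q' q')
    (hz : ∀ p q : Pt Z.X.X, p ≫ z.hom = q ≫ z.hom → p = q) (w w' : Pt (indVar Z).X.X) :
    w ≫ q'.hom = w' ≫ q'.hom ↔ w ≫ (indMap z ≫ q).hom = w' ≫ (indMap z ≫ q).hom := by
  rw [GSch.comp_hom _ _ w', h.map_eq_iff, h'.fib]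
  refine exists_congr fun c => ⟨fun e => by rw [e], fun e => indVar_hom_ext (hz _ _ ?_) ?_⟩
  · exact (indMap_fst z _).symm.trans ((e =≫ fst X.X.X (Gm k)).trans (indMap_fst z _))
  · exact (indMap_snd z _).symm.trans ((e =≫ snd X.X.X (Gm k)).trans (indMap_snd z _))

lemma IsInd.str_eq (h : IsInd X Q q) (h' : IsInd Z Q' q') (hz : z ≫ X.str = Z.str) :
    q' ≫ Q'.str = (indMap z ≫ q) ≫ Q.str := by
  refine h'.str.trans (GSch.ext_of_comp fun w => ?_).symm
  refine (GSch.comp_hom _ _ w =≫ Q.str.hom).trans ((GSch.comp_eq h.str _).trans ?_)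
  refine GlS_hom_ext ?_ ?_
  · refine (indVar_str_fst _).trans (Eq.trans ?_ (indVar_str_fst w).symm)
    exact (indMap_fst z w =≫ X.str.hom).trans (GSch.comp_eq hz _)
  · exact (indVar_str_snd _).trans ((congrArg (· ^ d) (indMap_snd z w)).trans (indVar_str_snd w).symm)

lemma exists_indMap_eq (q : (indVar X).X ⟶ Q.X) {x : Pt (indVar X).X.X} {p : Pt Z.X.X}
    (hp : p ≫ z.hom = x ≫ fst X.X.X (Gm k)) : ∃ w, w ≫ (indMap z ≫ q).hom = x ≫ q.hom := by
  let w : Pt (indVar Z).X.X := lift p (x ≫ snd X.X.X (Gm k))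
  refine ⟨w, (GSch.comp_hom _ _ w).trans (indVar_hom_ext ?_ ?_ =≫ q.hom)⟩
  · exact (indMap_fst z w).trans ((lift_fst _ _ =≫ z.hom).trans hp)
  · exact (indMap_snd z w).trans (lift_snd _ _)

lemma IsInd.mk_eq_add (h : IsInd X Q q) (h' : IsInd Z Q' q') (h'' : IsInd U Q'' q'')
    {v : U.X ⟶ X.X} (hz : z ≫ X.str = Z.str) (hv : v ≫ X.str = U.str) (hd : Decomp z v) :
    K0.mk Q = K0.mk Q' + K0.mk Q'' := by
  have hne (w : Pt (indVar Z).X.X) (w' : Pt (indVar U).X.X) :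
      w ≫ (indMap z ≫ q).hom ≠ w' ≫ (indMap v ≫ q).hom := fun e => by
    rw [GSch.comp_hom _ _ w', h.map_eq_iff] at e
    obtain ⟨c, hc⟩ := e
    exact hd.disj _ _ ((indMap_fst z _).symm.trans
      ((hc =≫ fst X.X.X (Gm k)).trans (indMap_fst v w')))
  refine (K0.mk_eq_sum_of_cover (I := Bool) (fun b => (indVar (cond b Z U)).X)
    (fun b => cond b Q' Q'') Q (fun b => match b with | true => q' | false => q'')
    (fun b => match b with | true => indMap z ≫ q | false => indMap v ≫ q) ?_ ?_ ?_ ?_ ?_ ?_).trans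
    (Fintype.sum_bool _)
  · rintro (_ | _)
    exacts [h''.universallyClosed, h'.universallyClosed]
  · rintro (_ | _)
    exacts [h''.surj, h'.surj]
  · intro y
    obtain ⟨x, rfl⟩ := h.surj y
    rcases hd.surj (x ≫ fst X.X.X (Gm k)) with ⟨p, hp⟩ | ⟨p, hp⟩
    exacts [⟨true, exists_indMap_eq q hp⟩, ⟨false, exists_indMap_eq q hp⟩]
  · rintro (_ | _) w w'
    exacts [h.eq_iff h'' hd.inj_right w w', h.eq_iff h' hd.inj_left w w']
  · rintro (_ | _) (_ | _) w w' e
    exacts [rfl, (hne _ _ e.symm).elim, (hne _ _ e).elim, rfl]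
  · rintro (_ | _)
    exacts [h.str_eq h'' hv, h.str_eq h' hz]
end

instance {H G : Sch k} [GrpObj G] [GrpObj H] (φ : H ⟶ G) [IsMonHom φ] (B : GSch G)
    [h : LFT B.X.hom] :
    LFT ((Mod.comap φ).obj B).X.hom := h

instance {H : Sch k} [GrpObj H] (S : Sch k) [h : LFT S.hom] : LFT (triv(H) S).X.hom := h

open Classical in
lemma exists_ind_hom : ∃ Φ : KMu S d →+ K0 (GlS S d),
    ∀ (Z : GVar (triv(Mu k d) S)), IsNice Z.X → ∃ Q q, IsInd Z Q q ∧ Φ (K0.mk Z) = K0.mk Q := by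
  let F (Z : GVar (triv(Mu k d) S)) : K0 (GlS S d) :=
    if h : IsNice Z.X then K0.mk (exists_isInd Z h).choose else 0
  have hF (Z : GVar (triv(Mu k d) S)) (h : IsNice Z.X) :
      F Z = K0.mk (exists_isInd Z h).choose := dif_pos h
  have : IsAdditiveOnNice F := fun X Z U z v hX hZ hU hz hv hd => by
    rw [hF X hX, hF Z hZ, hF U hU]
    exact (exists_isInd X hX).choose_spec.choose_spec.mk_eq_add
      (exists_isInd Z hZ).choose_spec.choose_spec (exists_isInd U hU).choose_spec.choose_spec hz hv hd
  obtain ⟨Φ, hΦ⟩ := this.exists_hom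
  exact ⟨Φ, fun Z hZ => ⟨_, _, (exists_isInd Z hZ).choose_spec.choose_spec,
    (hΦ Z hZ).trans (hF Z hZ)⟩⟩

lemma K0.res_mk {H G : Sch k} [GrpObj G] [GrpObj H] (φ : H ⟶ G) [IsMonHom φ] {B : GSch G}
    [LFT B.X.hom] (X : GVar B) : K0.res φ B (K0.mk X) = K0.mk (X.res φ) :=
  K0.lift_mk _ _ X

instance isClosedImmersion_unitHom (S : Sch k) (d : ℕ) : IsClosedImmersion (unitHom S d).hom.left :=
  isClosedImmersion_section (1 : S ⟶ Gm k)

variable (S d) in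
def unitFibre : K0 (GlS S d) →+ KMu S d := (K0.pull (unitHom S d)).comp (K0.res (muToGm k d) _)

lemma unitFibre_mk {X : GVar (GlS S d)} {Z : GVar (triv(Mu k d) S)}
    {i : Z.X ⟶ (X.res (muToGm k d)).X} (h : IsPull (unitHom S d) (X.res (muToGm k d)) Z i) :
    unitFibre S d (K0.mk X) = K0.mk Z :=
  (congrArg (K0.pull (unitHom S d)) (K0.res_mk (muToGm k d) X)).trans h.mk_eq

protected lemma IsInd.unitFibre_mk {Z : GVar (triv(Mu k d) S)} {Q : GVar (GlS S d)}
    {q : (indVar Z).X ⟶ Q.X} (h : IsInd Z Q q) : unitFibre S d (K0.mk Q) = K0.mk Z := by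
  let j : Z.X.X ⟶ (indVar Z).X.X := lift (𝟙 Z.X.X) (1 : Z.X.X ⟶ Gm k)
  have j1 (z : Pt Z.X.X) : (z ≫ j) ≫ fst Z.X.X (Gm k) = z :=
    assoc'.trans ((z ≫= lift_fst _ _).trans (comp_id z))
  have j2 (z : Pt Z.X.X) : (z ≫ j) ≫ snd Z.X.X (Gm k) = 1 :=
    assoc'.trans ((z ≫= lift_snd _ _).trans (comp_one z))
  have hstr (x : Pt (indVar Z).X.X) : (x ≫ q.hom) ≫ Q.str.hom = x ≫ (indVar Z).str.hom :=
    GSch.comp_eq h.str x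
  let i : Z.X ⟶ (Q.res (muToGm k d)).X := GSch.homMk (j ≫ q.hom : Z.X.X ⟶ Q.X.X) fun c z => by
      refine (assoc (c • z) j q.hom).symm.trans (Eq.trans ?_ ((comap_smul (muToGm k d) Q.X c
        ((z ≫ j) ≫ q.hom)).symm.trans (congrArg (fun t : Pt (Q.res (muToGm k d)).X.X => c • t)
          (assoc z j q.hom))))
      refine Eq.trans ?_ (GSch.smul_comp q _ _)
      refine ((h.fib _ _).2 ⟨c, indVar_hom_ext ?_ ?_⟩).symm
      · rw [indAct_fst, indVar_smul_fst, j1, j1]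
      · rw [indAct_snd, indVar_smul_snd, j2, j2, _root_.mul_one, mul_inv_cancel]
  have hi (z : Pt Z.X.X) : z ≫ i.hom = (z ≫ j) ≫ q.hom := (assoc z j q.hom).symm
  refine unitFibre_mk (i := i) ⟨fun z => ?_, fun z z' e => ?_, fun x u e => ?_⟩
  · refine (hi z =≫ Q.str.hom).trans ((hstr _).trans (GlS_hom_ext ?_ ?_))
    · exact (indVar_str_fst _).trans ((j1 z =≫ Z.str.hom).trans (unitSec_fst S d _).symm)
    · refine (indVar_str_snd _).trans (Eq.trans ?_ (unitSec_snd S d _).symm)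
      rw [j2, one_pow]
  · obtain ⟨c, hc⟩ := (h.fib _ _).1 ((hi z).symm.trans (e.trans (hi z')))
    have h1 := (indAct_snd c (z ≫ j)).symm.trans ((hc =≫ snd Z.X.X (Gm k)).trans (j2 z'))
    have h2 := (indAct_fst c (z ≫ j)).symm.trans ((hc =≫ fst Z.X.X (Gm k)).trans (j1 z'))
    rw [j2, _root_.one_mul, inv_eq_one] at h1
    rw [j1] at h2
    have : c = 1 := muToGm_injective (h1.trans (one_comp _).symm)
    rw [← h2, this, one_smul]
  · obtain ⟨w, rfl⟩ := h.surj x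
    have e2 : (w ≫ snd Z.X.X (Gm k)) ^ d = 1 := by
      refine (indVar_str_snd w).symm.trans (Eq.trans ?_ (unitSec_snd S d u))
      exact (hstr w).symm.trans e =≫ snd S (Gm k)
    obtain ⟨c, hc⟩ := exists_comp_muToGm _ e2
    refine ⟨c • (w ≫ fst Z.X.X (Gm k)), (hi _).trans ((h.fib _ _).2 ⟨c, ?_⟩).symm⟩
    refine indVar_hom_ext ((indAct_fst c w).trans (j1 _).symm) ((indAct_snd c w).trans ?_)
    rw [j2, hc, mul_inv_cancel]

lemma IsInd.mk_eq {X : GVar (GlS S d)} {Z : GVar (triv(Mu k d) S)}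
    {i : Z.X ⟶ (X.res (muToGm k d)).X} (hi : IsPull (unitHom S d) (X.res (muToGm k d)) Z i)
    {Q : GVar (GlS S d)} {q : (indVar Z).X ⟶ Q.X} (h : IsInd Z Q q) : K0.mk Q = K0.mk X := by
  let i' : Z.X.X ⟶ X.X.X := i.hom
  have hi' (c : Pt (Mu k d)) (z : Pt Z.X.X) : (c • z) ≫ i' = (c ≫ muToGm k d) • (z ≫ i') :=
    (GSch.smul_comp i c z).trans (comap_smul (muToGm k d) X.X c (z ≫ i'))
  have hc (z : Pt Z.X.X) : (z ≫ i') ≫ X.str.hom = (z ≫ Z.str.hom) ≫ unitSec S d := hi.comm z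
  let f0 : (indVar Z).X.X ⟶ X.X.X :=
    (snd Z.X.X (Gm k)) • ((show Z.X.X ⊗ Gm k ⟶ Z.X.X from fst Z.X.X (Gm k)) ≫ i')
  have hf0 (w : Pt (indVar Z).X.X) :
      w ≫ f0 = (w ≫ snd Z.X.X (Gm k)) • ((w ≫ fst Z.X.X (Gm k)) ≫ i') :=
    (ModObj.comp_smul _ _ _).trans (congrArg (_ • ·) assoc'.symm)
  let f : (indVar Z).X ⟶ X.X := GSch.homMk f0 fun g w => by
    rw [hf0, hf0, indVar_smul_fst, indVar_smul_snd, smul_smul]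
  have hf (w : Pt (indVar Z).X.X) :
      w ≫ f.hom = (w ≫ snd Z.X.X (Gm k)) • ((w ≫ fst Z.X.X (Gm k)) ≫ i') := hf0 w
  have hfs (w : Pt (indVar Z).X.X) : (w ≫ f.hom) ≫ X.str.hom = w ≫ (indVar Z).str.hom := by
    rw [hf, GSch.smul_comp, hc]
    refine GlS_hom_ext ?_ ?_
    · exact (GlS_smul_fst _ _).trans ((unitSec_fst S d _).trans (indVar_str_fst w).symm)
    · refine (GlS_smul_snd _ _).trans ((congrArg (_ * ·) (unitSec_snd S d _)).trans ?_)
      exact (_root_.mul_one _).trans (indVar_str_snd w).symm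
  refine K0.mk_eq_of_cover Q X q f h.universallyClosed h.surj (fun y => ?_) (fun w w' => ?_)
    (h.str.trans (GSch.ext_of_comp hfs).symm)
  · obtain ⟨g, hg⟩ := exists_pow_eq d ((y ≫ X.str.hom) ≫ snd S (Gm k))
    obtain ⟨z, hz⟩ := hi.surj (g⁻¹ • y) ((y ≫ X.str.hom) ≫ fst S (Gm k)) (by
      refine (GSch.smul_comp X.str g⁻¹ y).trans (GlS_hom_ext ?_ ?_)
      · exact (GlS_smul_fst _ _).trans (unitSec_fst S d _).symm
      · refine (GlS_smul_snd _ _).trans (Eq.trans ?_ (unitSec_snd S d _).symm)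
        rw [← hg, inv_pow, inv_mul_cancel])
    let w : Pt (indVar Z).X.X := lift z g
    refine ⟨w, (hf w).trans ?_⟩
    have h1 : w ≫ fst Z.X.X (Gm k) = z := lift_fst _ _
    have h2 : w ≫ snd Z.X.X (Gm k) = g := lift_snd _ _
    rw [h1, h2]
    exact (congrArg (fun t : Pt X.X.X => g • t) hz).trans (smul_inv_smul g y)
  · rw [h.fib]
    refine ⟨?_, fun e => ?_⟩
    · rintro ⟨c, rfl⟩
      rw [hf, hf, indAct_fst, indAct_snd, hi', smul_smul, inv_mul_cancel_right]
    · have e2 : (w ≫ snd Z.X.X (Gm k)) ^ d = (w' ≫ snd Z.X.X (Gm k)) ^ d := by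
        rw [← indVar_str_snd, ← indVar_str_snd, ← hfs, e, hfs]
      obtain ⟨c, hc⟩ := exists_comp_muToGm ((w' ≫ snd Z.X.X (Gm k))⁻¹ * (w ≫ snd Z.X.X (Gm k)))
        (by rw [mul_pow, inv_pow, e2, inv_mul_cancel])
      refine ⟨c, indVar_hom_ext ((indAct_fst c w).trans (hi.inj _ _ ?_)) ?_⟩
      · refine (hi' c _).trans ?_
        rw [hc, mul_smul, ← hf, e, hf, inv_smul_smul]
        rfl
      · rw [indAct_snd, hc, mul_inv_rev, inv_inv, mul_inv_cancel_left]

lemma unitFibre_bijective : Function.Bijective (unitFibre S d) := by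
  obtain ⟨Φ, hΦ⟩ := exists_ind_hom (S := S) (d := d)
  refine Function.bijective_iff_has_inverse.2 ⟨Φ, fun a => ?_, fun a => ?_⟩
  · have : Φ.comp (unitFibre S d) = AddMonoidHom.id _ := K0.hom_ext fun X => by
      obtain ⟨Z, i, hi, -⟩ := (X.res (muToGm k d)).exists_pull (unitHom S d)
      obtain ⟨Y, f, hY, hf, hb⟩ := Z.exists_nice
      have hi' : IsPull (unitHom S d) (X.res (muToGm k d)) Y (f ≫ i) := by
        refine ⟨fun y => ?_, fun y y' e => ?_, fun x u e => ?_⟩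
        · rw [GSch.comp_hom, hi.comm, GSch.comp_eq hf]
        · rw [GSch.comp_hom, GSch.comp_hom] at e
          exact hb.1 (hi.inj _ _ e)
        · obtain ⟨z, hz⟩ := hi.surj x u e
          obtain ⟨y, rfl⟩ := hb.2 z
          exact ⟨y, (GSch.comp_hom _ _ y).trans hz⟩
      obtain ⟨Q, q, hq, e⟩ := hΦ Y hY
      exact (congrArg Φ (unitFibre_mk hi')).trans (e.trans (hq.mk_eq hi'))
    exact congrArg (fun t => t a) this
  · induction a using K0.induction_nice with
    | zero => rw [map_zero, map_zero]
    | mk Z hZ =>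
      obtain ⟨Q, q, hq, e⟩ := hΦ Z hZ
      rw [e, hq.unitFibre_mk]
    | add a b ha hb => rw [map_add, map_add, ha, hb]
    | neg a ha => rw [map_neg, map_neg, ha]
end

section
/-! ### Changing the action -/

section
variable {H G : Sch k} [GrpObj G] [GoodGrp G]
  [GrpObj H] [GoodGrp H] (φ : H ⟶ G) [IsMonHom φ] {B : GSch G} [MonObj B.X] [IsGMonoid B]
  {B' : GSch H} [MonObj B'.X] [IsGMonoid B'] (t : (Mod.comap φ).obj B ⟶ B') [IsFT t.hom]

/-- A variety over `B`, as a variety over `B'` with another group. -/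
abbrev GVar.trans (X : GVar B) : GVar B' := (X.res φ).push t

lemma K0.trans_mk (X : GVar B) : K0.push t (K0.res φ B (K0.mk X)) = K0.mk (X.trans φ t) :=
  (congrArg _ (K0.res_mk φ X)).trans (K0.push_mk t _)

omit [GoodGrp G] [GoodGrp H] in
lemma IsNice.comap {X : GSch G} (h : IsNice X) : IsNice ((Mod.comap φ).obj X) := by
  obtain ⟨I, U, hU, hd, hc⟩ := h
  exact ⟨I, U, fun i => ⟨(hU i).1, fun g x hx => (congrArg (fun y : Pt X.X => y.val ∈ (U i : Set _))
    (comap_smul φ X g x)).mpr ((hU i).2 (g ≫ φ) x hx)⟩, hd, hc⟩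

variable {t} (h1 : (1 : Pt B.X) ≫ t.hom = (1 : Pt B'.X))
  (hm : ∀ p q : Pt B.X, (p * q) ≫ t.hom = ((p ≫ t.hom) * (q ≫ t.hom) : Pt B'.X))

include h1 in
lemma GVar.mk_one_trans : K0.mk ((GVar.one (B := B)).trans φ t) = K0.mk GVar.one := by
  have e (x : Pt (𝟙_ (Sch k))) : x ≫ (trivRes φ (𝟙_ (Sch k))).hom = x := comp_id x
  refine K0.mk_eq_of_bijective (trivRes φ (𝟙_ (Sch k))) (GSch.ext_of_comp fun x => ?_)
    (bijective_of_eq e)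
  refine (GVar.one_str (B := B') _).trans (h1.symm.trans ?_)
  refine ((GVar.one_str (B := B) x).symm =≫ t.hom).trans assoc'

include hm in
lemma GVar.mk_conv_trans (X Y : GVar B) :
    K0.mk ((X.conv Y).trans φ t) = K0.mk ((X.trans φ t).conv (Y.trans φ t)) := by
  have e (x : Pt (X.X.X ⊗ Y.X.X)) : x ≫ (comapProd φ X.X Y.X).hom = x := comp_id x
  refine K0.mk_eq_of_bijective (comapProd φ X.X Y.X) (GSch.ext_of_comp fun x => ?_)
    (bijective_of_eq e)
  refine (GVar.conv_str (X.trans φ t) (Y.trans φ t) _).trans ?_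
  refine Eq.trans ?_ ((hm _ _).symm.trans (((GVar.conv_str X Y x).symm =≫ t.hom).trans assoc'))
  refine congrArg₂ (fun a b : Pt B'.X => a * b) ?_ ?_
  · refine Eq.trans ?_ (assoc (x ≫ fst X.X.X Y.X.X) X.str.hom t.hom).symm
    exact congrArg (fun y : Pt (X.X.X ⊗ Y.X.X) => (y ≫ fst X.X.X Y.X.X) ≫ X.str.hom ≫ t.hom) (e x)
  · refine Eq.trans ?_ (assoc (x ≫ snd X.X.X Y.X.X) Y.str.hom t.hom).symm
    exact congrArg (fun y : Pt (X.X.X ⊗ Y.X.X) => (y ≫ snd X.X.X Y.X.X) ≫ Y.str.hom ≫ t.hom) (e x)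

variable (t) in
/-- The comparison of the powers of a variety for two groups. -/
def GVar.powTrans (X : GVar B) (n : ℕ) : ((X.pow n).res φ).X ⟶ ((X.trans φ t).pow n).X :=
  (X.trans φ t).powLift fun i => (Mod.comap φ).map (X.powπ n i)

lemma GVar.powTrans_π (X : GVar B) {n : ℕ} (w : Pt ((X.pow n).res φ).X.X) (i : Fin n) :
    (w ≫ (X.powTrans φ t n).hom) ≫ ((X.trans φ t).powπ n i).hom =
      w ≫ ((Mod.comap φ).map (X.powπ n i)).hom :=
  GVar.comp_powLift_π (W := ((X.pow n).res φ).X) (X.trans φ t)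
    (fun i => (Mod.comap φ).map (X.powπ n i)) i w

lemma GVar.toM_powTrans (X : GVar B) {n : ℕ} (w : Pt ((X.pow n).res φ).X.X) :
    (X.trans φ t).toM (w ≫ (X.powTrans φ t n).hom) = X.toM (show Pt (X.pow n).X.X from w) :=
  congrArg (fun f : Fin n → Pt X.X.X => Finset.univ.val.map f) (funext (X.powTrans_π φ w))

include h1 hm in
lemma GVar.IsSym.mk_trans {n : ℕ} {X Q : GVar B} {q : (X.pow n).X ⟶ Q.X} (hq : GVar.IsSym n X Q q)
    {R : GVar B'} {r : ((X.trans φ t).pow n).X ⟶ R.X} (hr : GVar.IsSym n (X.trans φ t) R r) :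
    K0.mk (Q.trans φ t) = K0.mk R := by
  let τ : Pt B.X →* Pt B'.X := { toFun := fun p => p ≫ t.hom, map_one' := h1, map_mul' := hm }
  refine K0.mk_eq_of_cover (W := ((X.pow n).res φ).X) (Q.trans φ t) R
    ((Mod.comap φ).map q) (X.powTrans φ t n ≫ r)
    hq.universallyClosed hq.surj (fun y => ?_) (fun w w' => ?_) (GSch.ext_of_comp fun w => ?_).symm
  · obtain ⟨x, rfl⟩ := hr.surj y
    obtain ⟨w, hw⟩ := X.exists_powLift fun i => x ≫ ((X.trans φ t).powπ n i).hom
    refine ⟨w, (GSch.comp_hom (X.powTrans φ t n) r w).trans (?_ =≫ r.hom)⟩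
    exact (X.trans φ t).pow_hom_ext fun i => (X.powTrans_π φ w i).trans (hw i)
  · rw [GSch.comp_hom (X.powTrans φ t n) r w, GSch.comp_hom (X.powTrans φ t n) r w', hr.fib]
    refine (hq.fib w w').trans (Eq.congr ?_ ?_)
    exacts [(X.toM_powTrans φ w).symm, (X.toM_powTrans φ w').symm]
  · refine (GSch.comp_hom (X.powTrans φ t n) r w =≫ R.str.hom).trans ((GSch.comp_eq hr.str _).trans ?_)
    refine (GVar.pow_str (X.trans φ t) _).trans ?_
    refine Eq.trans ?_ (((X.pow_str w).symm.trans
      (GSch.comp_eq hq.str w).symm =≫ t.hom).trans assoc')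
    refine Eq.trans ?_ (map_prod τ _ _).symm
    refine Finset.prod_congr rfl fun i _ => ?_
    refine Eq.trans ?_ (assoc (w ≫ (X.powπ n i).hom) X.str.hom t.hom).symm
    exact congrArg (fun y : Pt X.X.X => y ≫ X.str.hom ≫ t.hom) (X.powTrans_π φ w i)

include h1 hm in
lemma isHom_trans {L : LambdaRingStr (K0 B)} {L' : LambdaRingStr (K0 B')} (hL : L.IsConvSym)
    (hL' : L'.IsConvSym) : L.IsHom L' ((K0.push t).comp (K0.res φ B)) := by
  refine LambdaRingStr.isHom_of_closure LambdaRingStr.closure_nice ?_ ?_ ?_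
  · rw [hL.one_eq, hL'.one_eq]
    exact (K0.trans_mk φ t _).trans (GVar.mk_one_trans φ h1)
  · rintro _ ⟨X, -, rfl⟩ _ ⟨Y, -, rfl⟩
    rw [hL.mul_mk]
    refine (K0.trans_mk φ t _).trans ((GVar.mk_conv_trans φ hm X Y).trans ?_)
    exact (hL'.mul_mk _ _).symm.trans
      (congrArg₂ (L'.mul · ·) (K0.trans_mk φ t X).symm (K0.trans_mk φ t Y).symm)
  · rintro _ ⟨X, hX, rfl⟩ n
    obtain ⟨Q, q, hq⟩ := X.exists_isSym hX n
    obtain ⟨R, r, hr⟩ := (X.trans φ t).exists_isSym (hX.comap φ) n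
    rw [hL.σ_eq hq]
    exact (K0.trans_mk φ t Q).trans ((hq.mk_trans φ h1 hm hr).trans
      ((hL'.σ_eq hr).symm.trans (congrArg (L'.σ n) (K0.trans_mk φ t X).symm)))
end
end

section
/-! ### Fibres over sections -/

section
variable {G H : Sch k} [GrpObj G] [GrpObj H] [GoodGrp G]
  [GoodGrp H] {φ : H ⟶ G} [IsMonHom φ] {B : GSch G} [LFT B.X.hom]
  {S : Sch k} [LFT S.hom] {X : GVar B} {Z : GVar (triv(H) S)}
  {s : triv(H) S ⟶ (Mod.comap φ).obj B}

lemma IsFiber.exists_isPull (h : IsFiber φ s.hom X Z) : ∃ i, IsPull s (X.res φ) Z i := by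
  obtain ⟨i, hi, hc, hr⟩ := h
  have hm := mono_of_left i.hom
  refine ⟨i, fun z => ?_, fun z z' e => (cancel_mono i.hom).1 e, fun x u e => ?_⟩
  · exact (assoc z i.hom X.str.hom).trans ((z ≫= hc).trans (assoc z Z.str.hom s.hom).symm)
  · refine exists_pt_of_mem_range i.hom x (hr.symm.subset ⟨u.val, ?_⟩)
    exact (congrArg Pt.val e).symm

variable (X s) in
lemma exists_isFiber [IsClosedImmersion s.hom.left] :
    ∃ Z : GVar (triv(H) S), IsFiber φ s.hom X Z := by
  obtain ⟨Z, i, hi, him, hr⟩ := (X.res φ).exists_pull s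
  refine ⟨Z, i, isClosedImmersion_of_isImmersion _ ?_, hom_ext_pt fun z => ?_, hr⟩
  · rw [hr]
    exact s.hom.left.isClosedEmbedding.isClosed_range.preimage X.str.hom.left.continuous
  · exact (assoc z i.hom X.str.hom).symm.trans ((hi.comm z).trans assoc')

variable (φ) in
/-- A section that is invariant under `G`, as a morphism that is equivariant under `H`. -/
def secRes (s : triv(G) S ⟶ B) : triv(H) S ⟶ (Mod.comap φ).obj B :=
  letI : IsModHom H (show (triv(H) S).X ⟶ ((Mod.comap φ).obj B).X from s.hom) :=
    isModHom_of_points _ fun T h x => (trivMod_smul h x =≫ s.hom).trans (by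
      refine Eq.trans ?_ (comap_smul φ B h (x ≫ s.hom)).symm
      exact ((trivMod_smul (h ≫ φ) x).symm =≫ s.hom).trans (GSch.smul_comp s (h ≫ φ) x))
  ⟨s.hom⟩

variable (φ) in
/-- A variety over `S` with another group. -/
abbrev GVar.resTriv (Y : GVar (triv(G) S)) : GVar (triv(H) S) := (Y.res φ).push (trivRes φ S)

variable (φ) in
lemma K0.resTriv_mk (Y : GVar (triv(G) S)) :
    K0.resTriv φ S (K0.mk Y) = K0.mk (Y.resTriv φ) :=
  (congrArg _ (K0.res_mk φ Y)).trans (K0.push_mk _ _)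

variable (φ) in
lemma GVar.comp_resTriv_str (Y : GVar (triv(G) S)) (y : Pt Y.X.X) :
    y ≫ (Y.resTriv φ).str.hom = y ≫ Y.str.hom :=
  y ≫= comp_id Y.str.hom

lemma IsPull.triv {s : triv(G) S ⟶ B} {W : GVar (triv(G) S)} {j : W.X ⟶ X.X}
    (h : IsPull s X W j) : IsPull (secRes φ s) (X.res φ) (W.resTriv φ)
      ((Mod.comap φ).map j) :=
  ⟨fun z => (h.comm z).trans ((W.comp_resTriv_str φ z).symm =≫ s.hom), h.inj, h.surj⟩

lemma K0.resTriv_pull {s : triv(G) S ⟶ B} [IsImmersion s.hom.left]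
    [hs : IsImmersion (secRes φ s).hom.left] {i : Z.X ⟶ (X.res φ).X}
    (hi : IsPull (secRes φ s) (X.res φ) Z i) : K0.resTriv φ S (K0.pull s (K0.mk X)) = K0.mk Z := by
  obtain ⟨W, j, hj, -⟩ := X.exists_pull s
  exact (congrArg _ hj.mk_eq).trans ((K0.resTriv_mk φ W).trans (hj.triv.mk_eq.symm.trans hi.mk_eq))
end

section
variable (S : Sch k) [LFT S.hom] (d : ℕ) [NeZero d]

def oneSecHom : triv(Mu k d) S ⟶ (Mod.comap (muToGm k d)).obj (A1S S d) :=
  unitHom S d ≫ (Mod.comap (muToGm k d)).map (glToA1 S d)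

lemma oneSecHom_hom : (oneSecHom S d).hom = oneSec S d := by
  refine A1S_hom_ext ((glToA1_fst (unitSec S d)).trans ?_) ((glToA1_snd (unitSec S d)).trans ?_)
  · exact (lift_fst _ _).trans (lift_fst _ _).symm
  · refine (congrArg _ (lift_snd _ _)).trans ((Diag.chi_one 1).trans ?_)
    exact ((congrArg A1.coord (lift_snd _ _)).trans (A1.coord_mk _)).symm

lemma oneSecHom_fst {T : Sch k} (x : T ⟶ S) : (x ≫ (oneSecHom S d).hom) ≫ fst S (A1 k) = x :=
  (congrArg (fun t => (x ≫ t) ≫ fst S (A1 k)) (oneSecHom_hom S d)).trans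
    (assoc'.trans ((x ≫= lift_fst _ _).trans (comp_id x)))

lemma oneSecHom_snd {T : Sch k} (x : T ⟶ S) :
    A1.coord ((x ≫ (oneSecHom S d).hom) ≫ snd S (A1 k)) = 1 := by
  refine (congrArg (fun t => A1.coord ((x ≫ t) ≫ snd S (A1 k))) (oneSecHom_hom S d)).trans ?_
  refine (congrArg A1.coord (assoc'.trans (x ≫= lift_snd _ _))).trans ?_
  rw [A1.coord_comp, A1.coord_mk, map_one]

instance isClosedImmersion_oneSecHom : IsClosedImmersion (oneSecHom S d).hom.left := by
  rw [oneSecHom_hom]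
  exact isClosedImmersion_section (Y := A1 k) (A1.mk 1)

abbrev zeroRes : triv(Mu k d) S ⟶ (Mod.comap (muToGm k d)).obj (A1S S d) := secRes _ (zeroHom S d)

instance : IsClosedImmersion (zeroRes S d).hom.left :=
  isClosedImmersion_zeroHom S d

variable {S d}
lemma unitFibre_pull_mk {X : GVar (A1S S d)} {Z : GVar (triv(Mu k d) S)}
    {i : Z.X ⟶ (X.res (muToGm k d)).X} (h : IsPull (oneSecHom S d) (X.res (muToGm k d)) Z i) :
    unitFibre S d (K0.pull (glToA1 S d) (K0.mk X)) = K0.mk Z := by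
  obtain ⟨U, j, hj, -⟩ := X.exists_pull (glToA1 S d)
  obtain ⟨W, l, hl, -⟩ := (U.res (muToGm k d)).exists_pull (unitHom S d)
  have : IsImmersion ((Mod.comap (muToGm k d)).map (glToA1 S d)).hom.left :=
    (inferInstance : IsImmersion (glToA1 S d).hom.left)
  exact (congrArg _ hj.mk_eq).trans ((unitFibre_mk hl).trans
    (((hj.res (muToGm k d)).trans hl).mk_eq.symm.trans h.mk_eq))

lemma exists_isPull_oneSecHom (Y : GVar (triv(Gm k) S)) :
    ∃ i, IsPull (oneSecHom S d) ((Y.line d).res (muToGm k d))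
      (Y.resTriv (muToGm k d)) i := by
  let j : Y.X.X ⟶ Y.X.X ⊗ A1 k := lift (𝟙 Y.X.X) (A1.mk 1)
  have h1 (y : Pt Y.X.X) : (y ≫ j) ≫ fst Y.X.X (A1 k) = y :=
    assoc'.trans ((y ≫= lift_fst _ _).trans (comp_id y))
  have h2 (y : Pt Y.X.X) : A1.coord ((y ≫ j) ≫ snd Y.X.X (A1 k)) = 1 := by
    rw [assoc, lift_snd, A1.coord_comp, A1.coord_mk, map_one]
  let i : (Y.res (muToGm k d)).X ⟶ ((Y.line d).res (muToGm k d)).X :=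
    GSch.homMk (show Y.X.X ⟶ Y.X.X ⊗ A1 k from j) fun c y => by
      refine Eq.trans ?_ (comap_smul (muToGm k d) (prodMod Y.X (A1w d)) c (y ≫ j)).symm
      refine (congrArg (fun t : Pt Y.X.X => t ≫ j) (comap_smul (muToGm k d) Y.X c y)).trans ?_
      refine prod_hom_ext (X := Y.X) (Y := A1w d) ?_ (A1.ext ?_)
      · refine (h1 _).trans (Eq.trans ?_ (prodMod_smul_fst (X := Y.X) (Y := A1w d) _ (y ≫ j)).symm)
        exact congrArg (fun t : Pt Y.X.X => (c ≫ muToGm k d) • t) (h1 y).symm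
      · refine (h2 _).trans (Eq.trans ?_ (congrArg A1.coord
          (prodMod_smul_snd (X := Y.X) (Y := A1w d) _ (y ≫ j)).symm))
        refine Eq.trans ?_ (A1w_smul (c ≫ muToGm k d) ((y ≫ j) ≫ snd Y.X.X (A1 k))).symm
        refine Eq.trans ?_ (congrArg (_ * ·) (h2 y).symm)
        rw [← Diag.chi_pow, comp_muToGm_pow, Diag.chi_one, _root_.mul_one]
  refine ⟨i, fun z => A1S_hom_ext ?_ ?_, fun z z' h => ?_, fun x c h => ?_⟩
  · refine (prod_a1Var_fst Y (z ≫ j)).trans ((h1 z =≫ Y.str.hom).trans ?_)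
    exact (Y.comp_resTriv_str (muToGm k d) z).symm.trans (oneSecHom_fst S d _).symm
  · exact (congrArg A1.coord (prod_a1Var_snd Y (z ≫ j))).trans ((h2 z).trans (oneSecHom_snd S d _).symm)
  · exact (h1 z).symm.trans ((congrArg (fun t : Pt (Y.X.X ⊗ A1 k) => t ≫ fst Y.X.X (A1 k)) h).trans (h1 z'))
  · refine ⟨(show Pt (Y.X.X ⊗ A1 k) from x) ≫ fst Y.X.X (A1 k),
      prod_hom_ext (X := Y.X) (Y := A1w d) (h1 _) (A1.ext ?_)⟩
    refine (h2 _).trans (Eq.trans ?_ (congrArg A1.coord (prod_a1Var_snd Y x)))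
    exact (oneSecHom_snd S d c).symm.trans
      (congrArg (fun t : Pt (A1S S d).X => A1.coord (t ≫ snd S (A1 k))) h.symm)

lemma unitFibre_pull_pullA1 (a : K0 (triv(Gm k) S)) :
    unitFibre S d (K0.pull (glToA1 S d) (pullA1 S d a)) = K0.resTriv (muToGm k d) S a := by
  have h : ((unitFibre S d).comp (K0.pull (glToA1 S d))).comp (pullA1 S d) =
      K0.resTriv (muToGm k d) S := K0.hom_ext fun Y => by
    obtain ⟨i, hi⟩ := exists_isPull_oneSecHom (d := d) Y
    exact (congrArg ((unitFibre S d).comp (K0.pull (glToA1 S d))) (K0.prodRight_mk Y (a1Var d))).trans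
      ((unitFibre_pull_mk hi).trans (K0.resTriv_mk _ Y).symm)
  exact congrArg (fun t => t a) h

lemma IsPull.unitFibre_prGl {X : GVar (A1S S d)} {Z₀ Z₁ : GVar (triv(Mu k d) S)}
    {i₀ : Z₀.X ⟶ (X.res (muToGm k d)).X} {i₁ : Z₁.X ⟶ (X.res (muToGm k d)).X}
    (h₀ : IsPull (zeroRes S d) (X.res (muToGm k d)) Z₀ i₀)
    (h₁ : IsPull (oneSecHom S d) (X.res (muToGm k d)) Z₁ i₁) :
    -unitFibre S d (prGl S d (K0.mk X)) = K0.mk Z₀ - K0.mk Z₁ := by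
  rw [prGl_apply, map_sub, unitFibre_pull_pullA1, unitFibre_pull_mk h₁, neg_sub]
  exact congrArg (· - _) (K0.resTriv_pull (s := zeroHom S d) h₀)

lemma unitFibre_prGl {X : GVar (A1S S d)} {Z₀ Z₁ : GVar (triv(Mu k d) S)}
    (h₀ : IsFiber (muToGm k d) (zeroSec S d) X Z₀) (h₁ : IsFiber (muToGm k d) (oneSec S d) X Z₁) :
    -unitFibre S d (prGl S d (K0.mk X)) = K0.mk Z₀ - K0.mk Z₁ := by
  rw [← oneSecHom_hom] at h₁
  obtain ⟨i, hi⟩ := h₁.exists_isPull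
  obtain ⟨j, hj⟩ := IsFiber.exists_isPull (s := zeroRes S d) h₀
  exact hj.unitFibre_prGl hi

lemma unitFibre_mk_of_isFiber {X : GVar (GlS S d)} {Z : GVar (triv(Mu k d) S)}
    (h : IsFiber (muToGm k d) (unitSec S d) X Z) : unitFibre S d (K0.mk X) = K0.mk Z := by
  obtain ⟨i, hi⟩ := IsFiber.exists_isPull (s := unitHom S d) h
  exact unitFibre_mk hi
end
end

section
/-! ### Compatibility for `d ∣ d'` -/

section
variable {G G' H H' : Sch k} [GrpObj G] [GrpObj G']
  [GrpObj H] [GrpObj H'] [GoodGrp G] [GoodGrp G'] [GoodGrp H] [GoodGrp H'] {φ : H ⟶ G} [IsMonHom φ]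
  {φ' : H' ⟶ G'} [IsMonHom φ'] {ψ : G' ⟶ G} [IsMonHom ψ] {ψ' : H' ⟶ H} [IsMonHom ψ']
  {S : Sch k} [LFT S.hom]

lemma IsPull.exists_trans {B : GSch G} {B' : GSch G'} [LFT B.X.hom]
    [LFT B'.X.hom] {t : (Mod.comap ψ).obj B ⟶ B'} [IsFT t.hom]
    {s : triv(H) S ⟶ (Mod.comap φ).obj B}
    {s' : triv(H') S ⟶ (Mod.comap φ').obj B'}
    {X : GVar B} {Z : GVar (triv(H) S)} {i : Z.X ⟶ (X.res φ).X}
    (hs : ∀ (b : Pt B.X) (u : Pt S), b ≫ t.hom = u ≫ s'.hom ↔ b = u ≫ s.hom)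
    (hφ : ∀ c : Pt H', (c ≫ ψ') ≫ φ = (c ≫ φ') ≫ ψ) (h : IsPull s (X.res φ) Z i) :
    ∃ i', IsPull s' (((X.res ψ).push t).res φ') (Z.resTriv ψ') i' := by
  let i' : (Z.res ψ').X ⟶ (((X.res ψ).push t).res φ').X :=
    GSch.homMk (show Z.X.X ⟶ X.X.X from i.hom) fun c z => by
      refine (comap_smul ψ' Z.X c z =≫ i.hom).trans ((GSch.smul_comp i _ _).trans ?_)
      refine (comap_smul φ X.X (c ≫ ψ') (z ≫ i.hom)).trans (Eq.trans ?_
        ((comap_smul φ' ((X.res ψ).push t).X c (z ≫ i.hom)).trans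
          (comap_smul ψ X.X (c ≫ φ') (z ≫ i.hom))).symm)
      exact congrArg (fun g : Pt G => g • (show Pt X.X.X from z ≫ i.hom)) (hφ c)
  have ht (x : Pt X.X.X) : x ≫ ((X.res ψ).push t).str.hom = (x ≫ X.str.hom) ≫ t.hom := assoc'.symm
  refine ⟨i', fun z => ?_, h.inj, fun x u e => h.surj x u ((hs _ _).1 ((ht x).symm.trans e))⟩
  refine (ht (z ≫ i.hom)).trans (((hs _ _).2 (h.comm z)).trans ?_)
  exact (Z.comp_resTriv_str ψ' z).symm =≫ s'.hom

lemma K0.resTriv_eq (χ : H' ⟶ G) [IsMonHom χ] (hφ : ∀ c : Pt H', (c ≫ ψ') ≫ φ = c ≫ χ)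
    (a : K0 (triv(G) S)) :
    K0.resTriv ψ' S (K0.resTriv φ S a) = K0.resTriv χ S a := by
  have h : (K0.resTriv ψ' S).comp (K0.resTriv φ S) = K0.resTriv χ S := K0.hom_ext fun Y => by
    refine (congrArg (K0.resTriv ψ' S) (K0.resTriv_mk φ Y)).trans ((K0.resTriv_mk ψ' _).trans
      (Eq.trans ?_ (K0.resTriv_mk χ Y).symm))
    let f : (((Y.resTriv φ).res ψ').push (trivRes ψ' S)).X ⟶
        (Y.resTriv χ).X := GSch.homMk (𝟙 Y.X.X) fun c y => by
      refine (comp_id (X := 𝟙_ (Sch k)) (Y := Y.X.X) _).trans (Eq.trans ?_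
        (congrArg (fun t : Pt (Y.res χ).X.X => c • t)
          (comp_id (X := 𝟙_ (Sch k)) (Y := Y.X.X) y)).symm)
      refine ((comap_smul ψ' (Y.res φ).X c y).trans (comap_smul φ Y.X (c ≫ ψ') y)).trans
        (Eq.trans ?_ (comap_smul χ Y.X c y).symm)
      exact congrArg (fun g : Pt G => g • (show Pt Y.X.X from y)) (hφ c)
    have e (y : Pt Y.X.X) : y ≫ f.hom = y := comp_id y
    refine K0.mk_eq_of_bijective f (GSch.ext_of_comp fun y => ?_)
      (bijective_of_eq e)
    refine ((e y =≫ (Y.resTriv χ).str.hom).trans (Y.comp_resTriv_str χ y)).trans ?_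
    exact (Y.comp_resTriv_str φ y).symm.trans
      ((Y.resTriv φ).comp_resTriv_str ψ' y).symm
  exact congrArg (fun t => t a) h

lemma K0.resTriv_id (χ : G ⟶ G) [IsMonHom χ] (hφ : ∀ c : Pt G, c ≫ χ = c)
    (a : K0 (triv(G) S)) : K0.resTriv χ S a = a := by
  have h : K0.resTriv χ S = AddMonoidHom.id _ := K0.hom_ext fun Y => by
    refine (K0.resTriv_mk χ Y).trans ?_
    let f : (Y.resTriv χ).X ⟶ Y.X := GSch.homMk (𝟙 Y.X.X) fun c y => by
      refine (comp_id (X := 𝟙_ (Sch k)) (Y := Y.X.X) _).trans (Eq.trans ?_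
        (congrArg (fun t : Pt Y.X.X => c • t)
          (comp_id (X := 𝟙_ (Sch k)) (Y := Y.X.X) y)).symm)
      exact (comap_smul χ Y.X c y).trans
        (congrArg (fun g : Pt G => g • (show Pt Y.X.X from y)) (hφ c))
    have e (y : Pt Y.X.X) : y ≫ f.hom = y := comp_id y
    refine K0.mk_eq_of_bijective f (GSch.ext_of_comp fun y => ?_)
      (bijective_of_eq e)
    exact (e y =≫ Y.str.hom).trans (Y.comp_resTriv_str χ y).symm
  exact congrArg (fun t => t a) h
end

section

lemma chi_gmPow {T : Sch k} (m : ℕ) (g : T ⟶ Gm k) :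
    Diag.chi 1 (g ≫ gmPow k m) = Diag.chi 1 g ^ m :=
  (Diag.chi_map _ _ g).trans ((congrArg (Diag.chi · g) rfl).trans (Diag.chi_nsmul 1 m g))

lemma chi_muPow {T : Sch k} {d d' : ℕ} (h : d ∣ d') (c : T ⟶ Mu k d') :
    Diag.chi 1 (c ≫ muPow k h) = Diag.chi 1 c ^ (d' / d) := by
  refine (Diag.chi_map _ _ c).trans (Eq.trans ?_ (Diag.chi_nsmul 1 (d' / d) c))
  congr 1
  have := ZMod.lift_coe d (⟨(d' / d) • Int.castAddHom (ZMod d'), by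
    have : ((d' / d * d : ℕ) : ZMod d') = 0 := by rw [Nat.div_mul_cancel h]; simp
    simpa using this⟩ : {f : ℤ →+ ZMod d' // f d = 0}) 1
  simpa [zmodMul] using this

lemma comp_muPow_muToGm {T : Sch k} {d d' : ℕ} (h : d ∣ d') (c : T ⟶ Mu k d') :
    (c ≫ muPow k h) ≫ muToGm k d = (c ≫ muToGm k d') ≫ gmPow k (d' / d) :=
  Gm.hom_ext (by rw [chi_muToGm, chi_muPow, chi_gmPow, chi_muToGm])

lemma comp_muPow_muPow {T : Sch k} {d d' d'' : ℕ} [NeZero d] (h : d ∣ d') (h' : d' ∣ d'')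
    (c : T ⟶ Mu k d'') : (c ≫ muPow k h') ≫ muPow k h = c ≫ muPow k (h.trans h') :=
  Mu.hom_ext (by rw [chi_muPow, chi_muPow, chi_muPow, ← pow_mul]; congr 1
                 obtain ⟨a, rfl⟩ := h
                 obtain ⟨b, rfl⟩ := h'
                 rw [Nat.mul_div_cancel_left a (NeZero.pos d), Nat.mul_assoc d,
                   Nat.mul_div_cancel_left _ (NeZero.pos d), ← Nat.mul_assoc]
                 rcases Nat.eq_zero_or_pos a with rfl | ha
                 · simp
                 · rw [Nat.mul_div_cancel_left b (Nat.mul_pos (NeZero.pos d) ha), Nat.mul_comm])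

lemma comp_muPow_self {T : Sch k} {d : ℕ} [NeZero d] (c : T ⟶ Mu k d) :
    c ≫ muPow k (dvd_refl d) = c :=
  Mu.hom_ext (by rw [chi_muPow, Nat.div_self (NeZero.pos d), pow_one])

variable (S : Sch k) {d d' : ℕ} (h : d ∣ d')

lemma comp_a1Res {T : Sch k} (x : T ⟶ S ⊗ A1 k) : x ≫ (a1Res S h).hom = x := by
  have : (a1Res S h).hom = 𝟙 (S ⊗ A1 k) :=
    (id_comp (X := S ⊗ A1 k) (𝟙 S ⊗ₘ 𝟙 (A1 k))).trans (id_tensorHom_id S (A1 k))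
  exact (x ≫= this).trans (comp_id x)

variable [LFT S.hom]

variable {S} in
lemma a1Res_fst {T : Sch k} (x : T ⟶ (A1S S d).X) :
    (x ≫ (a1Res S h).hom) ≫ fst S (A1 k) = x ≫ fst S (A1 k) :=
  congrArg (fun t : T ⟶ S ⊗ A1 k => t ≫ fst S (A1 k)) (comp_a1Res S h x)

variable {S} in
lemma a1Res_snd {T : Sch k} (x : T ⟶ (A1S S d).X) :
    A1.coord ((x ≫ (a1Res S h).hom) ≫ snd S (A1 k)) = A1.coord (x ≫ snd S (A1 k)) :=
  congrArg (fun t : T ⟶ S ⊗ A1 k => A1.coord (t ≫ snd S (A1 k))) (comp_a1Res S h x)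

variable {S} in
lemma comp_a1Res_eq_iff {b x : Pt (A1S S d).X} {x' : Pt (A1S S d').X}
    (hf : x ≫ fst S (A1 k) = x' ≫ fst S (A1 k))
    (hs : A1.coord (x ≫ snd S (A1 k)) = A1.coord (x' ≫ snd S (A1 k))) :
    b ≫ (a1Res S h).hom = x' ↔ b = x := by
  constructor
  · rintro rfl
    exact A1S_hom_ext ((a1Res_fst h b).symm.trans hf.symm) ((a1Res_snd h b).symm.trans hs.symm)
  · rintro rfl
    exact A1S_hom_ext ((a1Res_fst h b).trans hf) ((a1Res_snd h b).trans hs)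

variable {S} in
lemma mul_comp_a1Res [MonObj S] [IsCommMonObj S] [QuasiCompact μ[S].left] (p q : Pt (A1S S d).X) :
    (p * q) ≫ (a1Res S h).hom =
      ((p ≫ (a1Res S h).hom) * (q ≫ (a1Res S h).hom) : Pt (A1S S d').X) := by
  refine A1S_hom_ext (S := S) (d := d') ((a1Res_fst h (p * q)).trans ((A1S_mul_fst p q).trans
    (Eq.trans ?_ (A1S_mul_fst (S := S) (d := d') _ _).symm))) ((a1Res_snd h (p * q)).trans
    ((A1S_mul_snd p q).trans (Eq.trans ?_ (A1S_mul_snd (S := S) (d := d') _ _).symm)))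
  · rw [a1Res_fst, a1Res_fst]
  · rw [a1Res_snd, a1Res_snd]

variable {S} in
lemma one_comp_a1Res [MonObj S] [IsCommMonObj S] [QuasiCompact μ[S].left] :
    (1 : Pt (A1S S d).X) ≫ (a1Res S h).hom = (1 : Pt (A1S S d').X) :=
  have e (d : ℕ) : A1.coord ((1 : Pt (A1S S d).X) ≫ snd S (A1 k)) = 0 := (congrArg A1.coord
    (prodMod_one_snd (triv(Gm k) S) (A1w d) _)).trans A1.coord_zero
  A1S_hom_ext (S := S) (d := d')
    ((a1Res_fst h _).trans ((prodMod_one_fst (triv(Gm k) S) (A1w d) _).trans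
      (prodMod_one_fst (triv(Gm k) S) (A1w d') _).symm))
    ((a1Res_snd h _).trans ((e d).trans (e d').symm))

lemma isHom_transA1 [MonObj S] [IsCommMonObj S] [QuasiCompact μ[S].left]
    {L : LambdaRingStr (K0 (A1S S d))} {L' : LambdaRingStr (K0 (A1S S d'))}
    (hL : L.IsConvSym) (hL' : L'.IsConvSym) : L.IsHom L' (transA1 S h) := by
  have h0 : IsGMonoid (A1S S d') := inferInstance
  have h1 := isHom_trans (B := A1S S d) (B' := A1S S d') (gmPow k (d' / d)) (t := a1Res S h)
    (one_comp_a1Res h) (mul_comp_a1Res h) hL hL'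
  exact h1

lemma transA1_mk (X : GVar (A1S S d)) :
    transA1 S h (K0.mk X) = K0.mk ((X.res (gmPow k (d' / d))).push (a1Res S h)) := by
  have e1 := K0.res_mk (gmPow k (d' / d)) X
  have e2 := K0.push_mk (a1Res S h) (X.res (gmPow k (d' / d)))
  rw [transA1, AddMonoidHom.comp_apply, e1, e2]

lemma transA1_pullA1 (a : K0 (triv(Gm k) S)) :
    transA1 S h (pullA1 S d a) = pullA1 S d' (K0.resTriv (gmPow k (d' / d)) S a) := by
  let ψ := gmPow k (d' / d)
  have : (transA1 S h).comp (pullA1 S d) = (pullA1 S d').comp (K0.resTriv ψ S) := K0.hom_ext fun Y => by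
    refine (congrArg (transA1 S h) (K0.prodRight_mk Y (a1Var d))).trans ((transA1_mk S h _).trans
      (Eq.trans ?_ ((congrArg (pullA1 S d') (K0.resTriv_mk ψ Y)).trans
        (K0.prodRight_mk _ (a1Var d'))).symm))
    let f : (Mod.comap ψ).obj (prodMod Y.X (A1w d)) ⟶
        prodMod ((Mod.comap ψ).obj Y.X) (A1w d') :=
      comapProd ψ Y.X (A1w d) ≫ prodMap (𝟙 _) (a1wRes h)
    have hf : f.hom = 𝟙 (Y.X.X ⊗ A1 k) :=
      (id_comp (X := Y.X.X ⊗ A1 k) (𝟙 Y.X.X ⊗ₘ 𝟙 (A1 k))).trans (id_tensorHom_id _ _)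
    have e (y : Pt (Y.X.X ⊗ A1 k)) : y ≫ f.hom = y := (y ≫= hf).trans (comp_id y)
    let Y' := Y.resTriv ψ
    refine K0.mk_eq_of_bijective f (GSch.ext_of_comp fun y => ?_)
      (bijective_of_eq e)
    refine Eq.trans ?_ (assoc y (Y.line d).str.hom (a1Res S h).hom)
    refine A1S_hom_ext (S := S) (d := d') ((prod_a1Var_fst Y' _).trans ?_)
      ((congrArg A1.coord (prod_a1Var_snd Y' _)).trans ?_)
    · refine ((e y =≫ fst Y.X.X (A1 k)) =≫ Y'.str.hom).trans ((Y.comp_resTriv_str ψ _).trans ?_)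
      exact (prod_a1Var_fst Y y).symm.trans (a1Res_fst h _).symm
    · exact (congrArg A1.coord ((e y =≫ snd Y.X.X (A1 k)).trans (prod_a1Var_snd Y y).symm)).trans
        (a1Res_snd h _).symm
  exact congrArg (fun t => t a) this

lemma secZero_fst (d : ℕ) [NeZero d] (u : Pt S) :
    (u ≫ (zeroRes S d).hom) ≫ fst S (A1 k) = u := zeroSec_fst S d u

lemma secZero_snd (d : ℕ) [NeZero d] (u : Pt S) :
    A1.coord ((u ≫ (zeroRes S d).hom) ≫ snd S (A1 k)) = 0 := zeroSec_snd S d u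

section
variable [NeZero d] [NeZero d'] {X : GVar (A1S S d)} {Z : GVar (triv(Mu k d) S)}
  {i : Z.X ⟶ (X.res (muToGm k d)).X}

lemma IsPull.exists_zero_trans
    (h₀ : IsPull (zeroRes S d) (X.res (muToGm k d)) Z i) :
    ∃ i', IsPull (zeroRes S d')
      (((X.res (gmPow k (d' / d))).push (a1Res S h)).res (muToGm k d'))
      (Z.resTriv (muPow k h)) i' :=
  IsPull.exists_trans (t := a1Res S h) (s' := zeroRes S d')
      (fun _ u => comp_a1Res_eq_iff h ((secZero_fst S d u).trans (secZero_fst S d' u).symm)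
        ((secZero_snd S d u).trans (secZero_snd S d' u).symm)) (comp_muPow_muToGm h) h₀

lemma IsPull.exists_one_trans (h₁ : IsPull (oneSecHom S d) (X.res (muToGm k d)) Z i) :
    ∃ i', IsPull (oneSecHom S d')
      (((X.res (gmPow k (d' / d))).push (a1Res S h)).res (muToGm k d'))
      (Z.resTriv (muPow k h)) i' :=
  IsPull.exists_trans (t := a1Res S h) (s' := oneSecHom S d')
      (fun _ u => comp_a1Res_eq_iff h ((oneSecHom_fst S d u).trans (oneSecHom_fst S d' u).symm)
        ((oneSecHom_snd S d u).trans (oneSecHom_snd S d' u).symm)) (comp_muPow_muToGm h) h₁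
end

lemma unitFibre_prGl_transA1 [NeZero d] [NeZero d'] (a : K0 (A1S S d)) :
    -unitFibre S d' (prGl S d' (transA1 S h a)) = transMu S h (-unitFibre S d (prGl S d a)) := by
  have : ((unitFibre S d').comp (prGl S d')).comp (transA1 S h) =
      (transMu S h).comp ((unitFibre S d).comp (prGl S d)) := K0.hom_ext fun X => by
    obtain ⟨Z₀, i₀, h₀, -⟩ := (X.res (muToGm k d)).exists_pull (zeroRes S d)
    obtain ⟨Z₁, i₁, h₁, -⟩ := (X.res (muToGm k d)).exists_pull (oneSecHom S d)
    obtain ⟨i₀', h₀'⟩ := h₀.exists_zero_trans S h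
    obtain ⟨i₁', h₁'⟩ := h₁.exists_one_trans S h
    refine neg_injective ((congrArg (fun t => -unitFibre S d' (prGl S d' t)) (transA1_mk S h X)).trans
      ((h₀'.unitFibre_prGl h₁').trans (Eq.trans ?_ ((map_neg (transMu S h) _).symm.trans
        (congrArg (transMu S h) (h₀.unitFibre_prGl h₁))).symm)))
    exact ((map_sub (transMu S h) _ _).trans
      (congrArg₂ (· - ·) (K0.resTriv_mk _ Z₀) (K0.resTriv_mk _ Z₁))).symm
  exact (congrArg (fun t => -t a) this).trans (map_neg (transMu S h) _).symm
end
end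

section
/-! ### The direct limit -/

instance (d : DivPos) : NeZero (d : ℕ) := ⟨d.2.ne'⟩

instance : Nonempty DivPos := ⟨⟨1, one_pos⟩⟩

instance : IsDirectedOrder DivPos :=
  ⟨fun a b => ⟨⟨a * b, Nat.mul_pos a.2 b.2⟩, dvd_mul_right (a : ℕ) b, dvd_mul_left (b : ℕ) a⟩⟩

variable (S : Sch k) [LFT S.hom]

instance : DirectedSystem (fun d : DivPos => KMu S d) fun _ _ h => transMu S h where
  map_self _ a := K0.resTriv_id _ comp_muPow_self a
  map_map _ _ _ h h' a := K0.resTriv_eq (φ := muPow k h) (ψ' := muPow k h') _ (comp_muPow_muPow h h') a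

lemma unitFibre_unique (d : ℕ) [NeZero d] {ψ : K0 (GlS S d) →+ KMu S d}
    (hψ : ∀ X Z, IsFiber (muToGm k d) (unitSec S d) X Z → ψ (K0.mk X) = K0.mk Z) :
    ψ = unitFibre S d := K0.hom_ext fun X => by
  obtain ⟨Z, hZ⟩ := exists_isFiber X (unitHom S d)
  exact (hψ X Z hZ).trans (unitFibre_mk_of_isFiber hZ).symm
end

end
end EquivariantMotives

open EquivariantMotives
theorem mainTheorem6 {k : Type*} [Field k] [IsAlgClosed k] [CharZero k]
    (S : Over (Spec (.of k))) [MonObj S] [IsCommMonObj S] [LFT S.hom]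
    [QuasiCompact μ[S].left] :
    ∃ L : ∀ d : ℕ, LambdaRingStr (K0 (A1S S d)),
      -- the `λ`-ring structure on the equivariant motives over `S × 𝔸¹`
      (∀ d, (L d).IsConvSym ∧ ∀ L' : LambdaRingStr (K0 (A1S S d)), L'.IsConvSym → L' = L d) ∧
      -- the image of the pullback is a `λ`-ideal, isomorphic to the motives over `S`
      (∀ d, Function.Injective (pullA1 S d) ∧ (L d).IsLambdaIdeal (pullA1 S d).range) ∧
      -- the motives supported on `S × 𝔾ₘ` are a complement
      (∀ d, Function.Injective (inclGl S d) ∧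
        IsCompl (pullA1 S d).range (inclGl S d).range) ∧
      -- the projection to the complement, and the quotient `λ`-ring structure on it
      ∃ (pr : ∀ d : ℕ, K0 (A1S S d) →+ K0 (GlS S d)) (P : ∀ d : ℕ, LambdaRingStr (K0 (GlS S d))),
      (∀ d, (∀ a, pr d (pullA1 S d a) = 0) ∧ (∀ a, pr d (inclGl S d a) = a) ∧
        (L d).IsHom (P d) (pr d) ∧
        ∀ P' : LambdaRingStr (K0 (GlS S d)), (L d).IsHom P' (pr d) → P' = P d) ∧
      -- the identification of the complement by taking fibres over the unit section
      ∃ φ : ∀ d : DivPos, K0 (GlS S d) ≃+ KMu S d,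
      (∀ d : DivPos,
        (∀ X Z, IsFiber (muToGm k d) (unitSec S d) X Z → φ d (K0.mk X) = K0.mk Z) ∧
        ∀ ψ : K0 (GlS S d) ≃+ KMu S d,
          (∀ X Z, IsFiber (muToGm k d) (unitSec S d) X Z → ψ (K0.mk X) = K0.mk Z) → ψ = φ d) ∧
      -- the resulting quotient map, with the sign convention, and the new `λ`-ring structures
      ∃ (ρ : ∀ d : DivPos, K0 (A1S S d) →+ KMu S d) (M : ∀ d : DivPos, LambdaRingStr (KMu S d)),
      (∀ d a, ρ d a = -φ d (pr d a)) ∧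
      (∀ (d : DivPos) X Z₀ Z₁, IsFiber (muToGm k d) (zeroSec S d) X Z₀ →
        IsFiber (muToGm k d) (oneSec S d) X Z₁ → ρ d (K0.mk X) = K0.mk Z₀ - K0.mk Z₁) ∧
      (∀ d, Function.Surjective (ρ d) ∧ (ρ d).ker = (pullA1 S d).range ∧
        (L d).IsHom (M d) (ρ d) ∧
        ∀ M' : LambdaRingStr (KMu S d), (L d).IsHom M' (ρ d) → M' = M d) ∧
      -- compatibility for `d ∣ d'`
      (∀ (d d' : ℕ) (h : d ∣ d'), (L d).IsHom (L d') (transA1 S h) ∧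
        ∀ a, transA1 S h (pullA1 S d a) = pullA1 S d' (K0.resTriv (gmPow k (d' / d)) S a)) ∧
      (∀ (d d' : DivPos) (h : (d : ℕ) ∣ d'), (M d).IsHom (M d') (transMu S h) ∧
        ∀ a, ρ d' (transA1 S h a) = transMu S h (ρ d a)) ∧
      -- the `λ`-ring structure on the direct limit
      ∃! N : LambdaRingStr (KMuHat S), ∀ d, (M d).IsHom N (KMuHat.of S d) := by
  choose L hL hLu using fun d : ℕ => LambdaRingStr.existsUnique_isConvSym (A1S S d)
  have hI (d : ℕ) : (L d).IsLambdaIdeal (pullA1 S d).range := isLambdaIdeal_pullA1 (hL d)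
  have hps (d : ℕ) : Function.Surjective (prGl S d) := fun a => ⟨_, prGl_inclGl S d a⟩
  have hpk (d : ℕ) : (L d).IsLambdaIdeal (prGl S d).ker := by
    rw [ker_prGl]
    exact hI d
  choose P hP hPu using fun d => (hpk d).existsUnique_quotient (hps d)
  let φ (d : DivPos) : K0 (GlS S d) ≃+ KMu S d := AddEquiv.ofBijective (unitFibre S d) unitFibre_bijective
  let ρ (d : DivPos) : K0 (A1S S d) →+ KMu S d := -((unitFibre S d).comp (prGl S d))
  have hρs (d : DivPos) : Function.Surjective (ρ d) := fun a => by
    obtain ⟨b, hb⟩ := (φ d).surjective (-a)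
    obtain ⟨c, rfl⟩ := hps d b
    exact ⟨c, neg_eq_iff_eq_neg.2 hb⟩
  have hρk (d : DivPos) : (ρ d).ker = (pullA1 S d).range := by
    rw [← ker_prGl]
    ext a
    exact neg_eq_zero.trans ((φ d).map_eq_zero_iff (x := prGl S d a))
  choose M hM hMu using fun d : DivPos =>
    ((hρk d).symm ▸ hI d : (L d).IsLambdaIdeal (ρ d).ker).existsUnique_quotient (hρs d)
  have ht {d d' : DivPos} (h : (d : ℕ) ∣ d') (a) : ρ d' (transA1 S h a) = transMu S h (ρ d a) :=
    unitFibre_prGl_transA1 S h a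
  have htM (d d' : DivPos) (h : (d : ℕ) ∣ d') : (M d).IsHom (M d') (transMu S h) := by
    refine (hM d).of_comp (hρs d) ?_
    have e : (transMu S h).comp (ρ d) = (ρ d').comp (transA1 S h) :=
      AddMonoidHom.ext fun a => (ht h a).symm
    rw [e]
    exact (hM d').comp (isHom_transA1 S h (hL d) (hL d'))
  refine ⟨L, fun d => ⟨hL d, hLu d⟩, fun d => ⟨pullA1_injective S d, hI d⟩,
    fun d => ⟨inclGl_injective S d, isCompl_pullA1_inclGl S d⟩, fun d => prGl S d, P,
    fun d => ⟨prGl_pullA1 S d, prGl_inclGl S d, hP d, hPu d⟩, φ,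
    fun d => ⟨fun X Z h => unitFibre_mk_of_isFiber h, fun ψ hψ => ?_⟩, ρ, M, fun d a => rfl,
    fun d X Z₀ Z₁ h₀ h₁ => unitFibre_prGl h₀ h₁, fun d => ⟨hρs d, hρk d, hM d, hMu d⟩,
    fun d d' h => ⟨isHom_transA1 S h (hL d) (hL d'), transA1_pullA1 S h⟩,
    fun d d' h => ⟨htM d d' h, ht h⟩, LambdaRingStr.existsUnique_directLimit _ M htM⟩
  have e := unitFibre_unique S d (ψ := ψ.toAddMonoidHom) hψ
  exact AddEquiv.ext fun a => congrArg (fun t => t a) e
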